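/- Let $n\ge 1$, $m\in\{0,\dots,n+1\}$, $\hbar>0$. Work in Viète coordinates $q=(q_1,\dots,q_n)\in\mathbb R^n$ with conjugate momenta $p$, and put $q_0=1$, $q_k=0$ for $k<0$ or $k>n$. Let $L$ be the matrix with first column $(-q_1,\dots,-q_n)^T$, ones on the superdiagonal and zeros elsewhere; $G_0^{ij}=q_{i+j-n-1}$; $G=L^mG_0$ (a contravariant metric on $Q=\{q:\det G(q)\ne0\}$, with $g=G^{-1}$ and $|g|=|\det g|$); $A_r=K_rG$ with $K_r=\sum_{k=0}^{r-1}q_kL^{r-1-k}$; $V^{(\alpha)}=L^\alpha(0,\dots,0,-1)^T$ for $\alpha\ge 0$; $(P_r^{(\gamma)})^j=-\sum_{s=0}^{r-1}q_sV_j^{(r+\gamma-s-1)}$ for $\gamma=0,\dots,n+1$. Let $J_1=0$ and, for $2\le r\le n$, $$J_r=\sum_{k=n+2-m-r}^{n-m}(n+1-m-k)\,q_{m+r-n-2+k}\,\partial_k\quad (r\le n-m+1),\qquad J_r=-\sum_{k=n+2-m}^{2n+2-m-r}(n+1-m-k)\,q_{m+r-n-2+k}\,\partial_k\quad (r\ge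 n-m+2).$$ For real functions $d_0,\dots,d_{n+1}$ of $t=(t_1,\dots,t_n)$ let $$h_r^B=\tfrac12p^TA_rp+\sum_jJ_r^jp_j+\sum_{\gamma=0}^{n+1}d_\gamma(t)\sum_j(P_r^{(\gamma)})^jp_j,\qquad r=1,\dots,n.$$ With $\kappa_1=\lfloor (n+3-m)/2\rfloor$, $\kappa_2=\lfloor m/2\rfloor$ and real functions $\zeta_{r,j}$ of $t$ put $$H_r^B=h_r^B\ \ (r\le\kappa_1\text{ or }r\ge n-\kappa_2+1),\qquad H^B_r=\sum_{j=1}^r\zeta_{r,j}h^B_j\ \ (\kappa_1<r\le n-m+1),\qquad H^B_r=\sum_{j=r}^n\zeta_{r,j}h^B_j\ \ (\max(\kappa_1+1,\,n-m+2)\le r\le n-\kappa_2).$$ Here all functions are smooth, $\zeta_{r,r}=1$, $\zeta_{r,j}$ depends only on $t_1,\dots,t_{r-1}$ if $j\le r\le n-m+1$, and only on $t_{r+1},\dots,t_n$ if $n-m+2\le r\le j$. The functions $\zeta_{r,j},d_\gamma$ are chosen so that the classical Frobenius condition $$\frac{\partial H_r^B}{\partial t_s}-\frac{\partial H_s^B}{\partial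 t_r}+\{H_r^B,H_s^B\}=f_{rs}(t),\qquad r,s=1,\dots,n,$$ holds for some functions $f_{rs}$ of $t$ alone, where $\{f,g\}=\sum_i(\partial_{q_i}f\,\partial_{p_i}g-\partial_{p_i}f\,\partial_{q_i}g)$. Let the hat denote minimal quantization, i.e. the real-linear map with $\widehat{\tfrac12C^{kj}p_kp_j}=-\tfrac12\hbar^2|g|^{-1/2}\partial_k|g|^{1/2}C^{kj}\partial_j$ and $\widehat{X^jp_j}=-\tfrac12i\hbar\,(|g|^{-1/2}\partial_j|g|^{1/2}X^j+X^j\partial_j)$. Let $\widehat h_r^B=\widehat E_r+\widehat W_r+\sum_\gamma d_\gamma(t)\widehat M_r^{(\gamma)}$, with $E_r=\tfrac12p^TA_rp$, $W_r=\sum_jJ_r^jp_j$, $M_r^{(\gamma)}=\sum_j(P_r^{(\gamma)})^jp_j$, and let $\widehat H_r^B$ be the combination of the $\widehat h_j^B$ with the same coefficients as above. **Theorem.** (i) Such functions exist, with $n+2$ free parameters: there are functions $\zeta_{r,j}$ on $\mathbb R^n$ with the properties listed above such that for every $b\in\mathbb R^{n+2}$ there are smooth $d_\gamma$ on $\mathbb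 R^n$ with $d_\gamma(0)=b_\gamma$ ($\gamma=0,\dots,n+1$) for which the $H_r^B$ satisfy the classical Frobenius condition for all $t\in\mathbb R^n$, $q\in Q$, $p\in\mathbb R^n$. (ii) For every open set $U\subseteq\mathbb R^n$ of times and every such choice of functions $\zeta_{r,j},d_\gamma$ on $U$ satisfying the classical Frobenius condition for all $t\in U$, $q\in Q$, $p\in\mathbb R^n$, the operators $\widehat H_r^B$ satisfy the quantum Frobenius condition $$i\hbar\frac{\partial\widehat H_r^B}{\partial t_s}-i\hbar\frac{\partial\widehat H_s^B}{\partial t_r}+[\widehat H_r^B,\widehat H_s^B]=0,\qquad r,s=1,\dots,n,\ t\in U,$$ as differential operators on the smooth complex functions on $Q$. -/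

import Mathlib

open scoped ContDiff

noncomputable section

namespace QuasiStackel

/-- Partial derivative `∂f/∂x_k` of a function on `ℝⁿ`. -/
def pderiv {n : ℕ} {F : Type*} [NormedAddCommGroup F] [NormedSpace ℝ F]
    (k : Fin n) (f : (Fin n → ℝ) → F) (x : Fin n → ℝ) : F :=
  fderiv ℝ f x (Pi.single k 1)

/-! Geometric objects in the Viète coordinates `q = (q_1, …, q_n)`.  An element `i : Fin n`
stands for the index `i + 1 ∈ {1, …, n}` of the mathematical text. -/

/-- The number `q_k` for an arbitrary integer `k`: `q_0 = 1`, and `q_k = 0` for `k < 0` and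
for `k > n`. -/
def coord {n : ℕ} (q : Fin n → ℝ) (k : ℤ) : ℝ :=
  if k = 0 then 1
  else if h : 1 ≤ k ∧ k ≤ n then q ⟨(k - 1).toNat, by omega⟩
  else 0

/-- The special conformal Killing tensor `L`: first column `(-q_1, …, -q_n)`, ones on the
superdiagonal. -/
def tensorL {n : ℕ} (q : Fin n → ℝ) : Matrix (Fin n) (Fin n) ℝ :=
  Matrix.of fun i j =>
    (if (j : ℕ) = 0 then -q i else 0) + (if (j : ℕ) = (i : ℕ) + 1 then 1 else 0)

/-- The contravariant metric `G_0`, with `G_0^{ij} = q_{i+j-n-1}`. -/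
def metricG0 {n : ℕ} (q : Fin n → ℝ) : Matrix (Fin n) (Fin n) ℝ :=
  Matrix.of fun i j => coord q ((i : ℤ) + (j : ℤ) + 1 - (n : ℤ))

/-- The contravariant metric `G = L^m G_0`. -/
def metricG {n : ℕ} (m : ℕ) (q : Fin n → ℝ) : Matrix (Fin n) (Fin n) ℝ :=
  tensorL q ^ m * metricG0 q

/-- The configuration space: the points at which the metric is nonsingular
(`q_n ≠ 0` if `m > 0`, all of `ℝⁿ` if `m = 0`). -/
def configSpace (n m : ℕ) : Set (Fin n → ℝ) :=
  {q | (metricG m q).det ≠ 0}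

/-- The density `|g|^{1/2}`, where `g = G⁻¹` is the covariant metric. -/
def density {n : ℕ} (m : ℕ) (q : Fin n → ℝ) : ℝ :=
  Real.sqrt |((metricG m q)⁻¹).det|

/-- The Killing tensors `K_r = ∑_{k=0}^{r-1} q_k L^{r-1-k}` (so `K_1 = Id`). -/
def tensorK {n : ℕ} (r : Fin n) (q : Fin n → ℝ) : Matrix (Fin n) (Fin n) ℝ :=
  ∑ k ∈ Finset.range ((r : ℕ) + 1), coord q (k : ℤ) • tensorL q ^ ((r : ℕ) - k)

/-- The `(2,0)`-tensors `A_r = K_r G`. -/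
def tensorA {n : ℕ} (m : ℕ) (r : Fin n) (q : Fin n → ℝ) : Matrix (Fin n) (Fin n) ℝ :=
  tensorK r q * metricG m q

/-- The basic separable scalar potentials `V^{(α)}`, `α ≥ 0`:
`V^{(0)} = (0, …, 0, -1)` and `V_r^{(α+1)} = V_{r+1}^{(α)} - q_r V_1^{(α)}`, that is
`V^{(α)} = L^α V^{(0)}`.  Equivalently, `-∑_r V_r^{(α)} x^{n-r}` is the remainder of `x^α`
modulo `x^n + ∑_r q_r x^{n-r} = ∏_i (x - λ_i)`. -/
def potentialV {n : ℕ} (α : ℕ) (q : Fin n → ℝ) : Fin n → ℝ :=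
  (tensorL q ^ α).mulVec (fun i => if (i : ℕ) + 1 = n then -1 else 0)

/-- The basic separable vector potentials
`(P_r^{(γ)})^j = -∑_{s=0}^{r-1} q_s V_j^{(r+γ-s-1)}`. -/
def potentialP {n : ℕ} (r : Fin n) (γ : ℕ) (q : Fin n → ℝ) (j : Fin n) : ℝ :=
  -∑ s ∈ Finset.range ((r : ℕ) + 1), coord q (s : ℤ) * potentialV ((r : ℕ) + γ - s) q j

/-- The component `J_r^k` (indices counted from `1`) of the vector fields `J_r`:
`J_1 = 0`; for `2 ≤ r ≤ n-m+1`,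
`J_r = ∑_{k=n+2-m-r}^{n-m} (n+1-m-k) q_{m+r-n-2+k} ∂_k`; for `r ≥ 2`, `n-m+2 ≤ r ≤ n`,
`J_r = -∑_{k=n+2-m}^{2n+2-m-r} (n+1-m-k) q_{m+r-n-2+k} ∂_k`. -/
def killingJAux {n : ℕ} (m : ℤ) (r k : ℤ) (q : Fin n → ℝ) : ℝ :=
  if r = 1 then 0
  else if r ≤ n - m + 1 then
    if n + 2 - m - r ≤ k ∧ k ≤ n - m then
      ((n + 1 - m - k : ℤ) : ℝ) * coord q (m + r - n - 2 + k) else 0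
  else
    if n + 2 - m ≤ k ∧ k ≤ 2 * n + 2 - m - r then
      -(((n + 1 - m - k : ℤ) : ℝ) * coord q (m + r - n - 2 + k)) else 0

/-- The vector field `J_r`, with its components indexed by `Fin n`. -/
def killingJ {n : ℕ} (m : ℕ) (r : Fin n) (q : Fin n → ℝ) (k : Fin n) : ℝ :=
  killingJAux (m : ℤ) ((r : ℤ) + 1) ((k : ℤ) + 1) q

/-! Classical Hamiltonians on the phase space with coordinates `(q, p)`. -/

/-- The magnetic quasi-Stäckel Hamiltonian
`h_r^B = ½ pᵀ A_r p + ∑_j J_r^j p_j + ∑_{γ=0}^{n+1} d_γ(t) ∑_j (P_r^{(γ)})^j p_j`. -/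
def hB {n : ℕ} (m : ℕ) (d : Fin (n + 2) → (Fin n → ℝ) → ℝ) (r : Fin n)
    (t q p : Fin n → ℝ) : ℝ :=
  (1 / 2) * ∑ i, ∑ j, tensorA m r q i j * p i * p j
    + ∑ j, killingJ m r q j * p j
    + ∑ γ : Fin (n + 2), d γ t * ∑ j, potentialP r (γ : ℕ) q j * p j

/-- The number `κ₁ = [(n+3-m)/2]`. -/
def kappa1 (n m : ℕ) : ℕ := (n + 3 - m) / 2

/-- The number `κ₂ = [m/2]`. -/
def kappa2 (m : ℕ) : ℕ := m / 2

/-- The coefficient of `h_j` in `H_r`:  `H_r = h_r` if `r ≤ κ₁` or `r ≥ n-κ₂+1`,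
`H_r = ∑_{j=1}^r ζ_{r,j} h_j` if `κ₁+1 ≤ r ≤ n-m+1`, and
`H_r = ∑_{j=r}^n ζ_{r,j} h_j` if `n-m+2 ≤ r ≤ n-κ₂`. -/
def mix {n : ℕ} (m : ℕ) (ζ : Fin n → Fin n → (Fin n → ℝ) → ℝ) (r j : Fin n)
    (t : Fin n → ℝ) : ℝ :=
  if (r : ℕ) + 1 ≤ kappa1 n m ∨ n - kappa2 m < (r : ℕ) + 1 then
    if j = r then 1 else 0
  else if (r : ℕ) + 1 ≤ n + 1 - m then
    if j ≤ r then ζ r j t else 0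
  else
    if r ≤ j then ζ r j t else 0

/-- The classical Hamiltonians `H_r^B`. -/
def HB {n : ℕ} (m : ℕ) (ζ : Fin n → Fin n → (Fin n → ℝ) → ℝ)
    (d : Fin (n + 2) → (Fin n → ℝ) → ℝ) (r : Fin n) (t q p : Fin n → ℝ) : ℝ :=
  ∑ j, mix m ζ r j t * hB m d j t q p

/-- The canonical Poisson bracket
`{f, g} = ∑_i (∂f/∂q_i ∂g/∂p_i - ∂f/∂p_i ∂g/∂q_i)`. -/
def poisson {n : ℕ} (f g : (Fin n → ℝ) → (Fin n → ℝ) → ℝ) (q p : Fin n → ℝ) : ℝ :=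
  ∑ i, (pderiv i (fun x => f x p) q * pderiv i (fun y => g q y) p
      - pderiv i (fun y => f q y) p * pderiv i (fun x => g x p) q)

/-- `f` depends, on the set `U`, only on the variables `t_k` with `k ∈ S`. -/
def DependsOnlyOn {n : ℕ} (f : (Fin n → ℝ) → ℝ) (S : Set (Fin n)) (U : Set (Fin n → ℝ)) :
    Prop :=
  ∀ t ∈ U, ∀ t' ∈ U, (∀ k ∈ S, t k = t' k) → f t = f t'

/-- The conditions on the functions `ζ_{r,j}` : they are smooth, `ζ_{r,r} = 1`, and
`ζ_{r,j}` depends only on `t_1, …, t_{r-1}` if `j ≤ r ≤ n-m+1`, and only on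
`t_{r+1}, …, t_n` if `n-m+2 ≤ r ≤ j`. -/
structure AdmissibleZeta {n : ℕ} (m : ℕ) (U : Set (Fin n → ℝ))
    (ζ : Fin n → Fin n → (Fin n → ℝ) → ℝ) : Prop where
  smooth : ∀ r j, ContDiffOn ℝ ∞ (ζ r j) U
  diag : ∀ r, ∀ t ∈ U, ζ r r t = 1
  lower : ∀ r j : Fin n, (r : ℕ) + 1 ≤ n + 1 - m → j ≤ r →
    DependsOnlyOn (ζ r j) {k | k < r} U
  upper : ∀ r j : Fin n, n + 1 - m < (r : ℕ) + 1 → r ≤ j →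
    DependsOnlyOn (ζ r j) {k | r < k} U

/-- The classical Frobenius condition for the Hamiltonians `H_r^B`, for times in `U`:
`∂H_r/∂t_s - ∂H_s/∂t_r + {H_r, H_s} = f_{rs}(t)`. -/
def ClassicalFrobenius {n : ℕ} (m : ℕ) (U : Set (Fin n → ℝ))
    (ζ : Fin n → Fin n → (Fin n → ℝ) → ℝ) (d : Fin (n + 2) → (Fin n → ℝ) → ℝ) : Prop :=
  ∀ r s : Fin n, ∃ f : (Fin n → ℝ) → ℝ, ∀ t ∈ U, ∀ q ∈ configSpace n m, ∀ p : Fin n → ℝ,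
    pderiv s (fun τ => HB m ζ d r τ q p) t - pderiv r (fun τ => HB m ζ d s τ q p) t
      + poisson (HB m ζ d r t) (HB m ζ d s t) q p = f t

/-! Minimal quantization: differential operators acting on complex functions on the
configuration space. -/

/-- Minimal quantization of `½ C^{kj} p_k p_j`:
`-½ ħ² |g|^{-1/2} ∂_k |g|^{1/2} C^{kj} ∂_j`. -/
def quantQuad {n : ℕ} (m : ℕ) (ħ : ℝ) (C : (Fin n → ℝ) → Matrix (Fin n) (Fin n) ℝ)
    (ψ : (Fin n → ℝ) → ℂ) (q : Fin n → ℝ) : ℂ :=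
  -(1 / 2) * (ħ : ℂ) ^ 2 * ((density m q : ℝ) : ℂ)⁻¹ *
    ∑ k, pderiv k (fun x => ∑ j, ((density m x * C x k j : ℝ) : ℂ) * pderiv j ψ x) q

/-- Minimal quantization of `X^j p_j`:
`-½ i ħ (|g|^{-1/2} ∂_j |g|^{1/2} X^j + X^j ∂_j)`. -/
def quantLin {n : ℕ} (m : ℕ) (ħ : ℝ) (X : (Fin n → ℝ) → Fin n → ℝ)
    (ψ : (Fin n → ℝ) → ℂ) (q : Fin n → ℝ) : ℂ :=
  -(1 / 2) * Complex.I * (ħ : ℂ) *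
    (((density m q : ℝ) : ℂ)⁻¹ *
        ∑ j, pderiv j (fun x => ((density m x * X x j : ℝ) : ℂ) * ψ x) q
      + ∑ j, ((X q j : ℝ) : ℂ) * pderiv j ψ q)

/-- The operator `ĥ_r^B = Ê_r + Ŵ_r + ∑_{γ=0}^{n+1} d_γ(t) M̂_r^{(γ)}`. -/
def quantHB {n : ℕ} (m : ℕ) (ħ : ℝ) (d : Fin (n + 2) → (Fin n → ℝ) → ℝ) (r : Fin n)
    (t : Fin n → ℝ) (ψ : (Fin n → ℝ) → ℂ) (q : Fin n → ℝ) : ℂ :=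
  quantQuad m ħ (tensorA m r) ψ q + quantLin m ħ (killingJ m r) ψ q
    + ∑ γ : Fin (n + 2), ((d γ t : ℝ) : ℂ) * quantLin m ħ (potentialP r (γ : ℕ)) ψ q

/-- The operator `Ĥ_r^B`, the combination of the `ĥ_j^B` with the same coefficients as in the
classical case. -/
def QuantHB {n : ℕ} (m : ℕ) (ħ : ℝ) (ζ : Fin n → Fin n → (Fin n → ℝ) → ℝ)
    (d : Fin (n + 2) → (Fin n → ℝ) → ℝ) (r : Fin n)
    (t : Fin n → ℝ) (ψ : (Fin n → ℝ) → ℂ) (q : Fin n → ℝ) : ℂ :=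
  ∑ j, ((mix m ζ r j t : ℝ) : ℂ) * quantHB m ħ d j t ψ q

/-- The quantum Frobenius condition for the operators `Ĥ_r^B`, for times in `U`:
`iħ ∂Ĥ_r/∂t_s - iħ ∂Ĥ_s/∂t_r + [Ĥ_r, Ĥ_s] = 0` as differential operators on the smooth
functions on the configuration space. -/
def QuantumFrobenius {n : ℕ} (m : ℕ) (ħ : ℝ) (U : Set (Fin n → ℝ))
    (ζ : Fin n → Fin n → (Fin n → ℝ) → ℝ) (d : Fin (n + 2) → (Fin n → ℝ) → ℝ) : Prop :=
  ∀ r s : Fin n, ∀ t ∈ U, ∀ ψ : (Fin n → ℝ) → ℂ, ContDiffOn ℝ ∞ ψ (configSpace n m) →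
    ∀ q ∈ configSpace n m,
      Complex.I * (ħ : ℂ) * pderiv s (fun τ => QuantHB m ħ ζ d r τ ψ q) t
        - Complex.I * (ħ : ℂ) * pderiv r (fun τ => QuantHB m ħ ζ d s τ ψ q) t
        + (QuantHB m ħ ζ d r t (QuantHB m ħ ζ d s t ψ) q
          - QuantHB m ħ ζ d s t (QuantHB m ħ ζ d r t ψ) q) = 0

end QuasiStackel

end

open scoped ContDiff

set_option linter.unusedSectionVars false

noncomputable section

namespace QuasiStackel

/-! Let `a = X^n + q_1 X^(n-1) + … + q_n`, let `res F` be the sum of the residues of `F/a`, and put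
`β_s = ∑_{k<s} q_k X^(s-1-k)`. In the coordinates `F ↦ res (β_i F)` of `ℝ[X]/a` the matrix `L` is
multiplication by `X` and `K_r` is multiplication by `β_r`. Hence `A_r` and `P_r^(γ)` have the
components `res (β_k β_r β_j X^m)` and `res (β_j β_r X^γ)`. With `b = ∑ p_k β_k` this gives `E_r = ½
res (β_r X^m b²)` and `M_r^(γ) = res (β_r X^γ b)`, and brackets become residue calculus. Two rules
suffice: the total residue of a derivative vanishes, and a derivation `δ` of the coefficients
satisfies `δ (res_a F) = res_a (δF) - res_{a²} (F δa)`.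

Quantum part. The classical condition is polynomial in `p`, so its terms of degree two and one give
identities between tensors and vector fields (`eq_zero_of_cubic`). The commutator of two minimally
quantized Hamiltonians is governed by the same Lie derivatives and brackets, up to two obstructions
(`quantOp_commutator`): the Laplace operators `Δ_r` must commute, and the scalar `Δ_r (div Y_s) -
Δ_s (div Y_r)` must vanish. The first holds because `Δ_r` is the residue of `β_r` times a polynomial
built from commuting operators (`lap_comm`). For the second, the fields `J_r` are divergence free
(`weightedDiv_killC`), and `div P_s^(γ)` is `res (β_s F)` where `F` has constant coefficients or is
a multiple of `X⁻¹` modulo `a` (`lap_weightedDiv_potential_symm`). The commutator is then `-iħ`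
times the quantized time derivative term of the classical condition.

Classical part. For constant parameters, `{h_r, h_s}` is a structure constant times `h_{r+s+m-n-2}`
plus magnetic terms in which `X^γ` is replaced by a multiple of another power of `X`
(`ham_polyH_polyH`). These data form a Lie algebra with a faithful representation `N` on the `n+2`
magnetic parameters (`lieRep_bracket`, `lieRep_injective`). The combinations `∑ Z_r^j h_j` with
parameters `D` satisfy the Frobenius condition with zero right-hand side as soon as `∂_r D = N(Z_r)
D` and `Z` has zero curvature (`classicalFrobenius_of_flat`). A product of one-parameter
exponentials applied to `b` solves both equations. The order of the factors (`exists_flow_list`)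
makes `Z` triangular, and brackets whose index leaves the range `1, …, n` vanish, which leaves the
extreme Hamiltonians unmodified. -/

open Polynomial

/-! ### Residues of fractions with monic denominator, computed through remainders -/

section Residue

variable {R : Type*} [CommRing R]

/-- The derivation of `R[X]` that applies a derivation of `R` to the coefficients. -/
def coeffD (δ : Derivation ℤ R R) : Derivation ℤ R[X] R[X] :=
  Derivation.mk'
    (AddMonoidHom.toIntLinearMap
      { toFun := fun F => F.sum fun i x => monomial i (δ x)
        map_zero' := by simp
        map_add' := fun F G => by rw [Polynomial.sum_add_index] <;> simp })
    (fun F G => by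
      have key : ∀ H : R[X], ∀ i, (H.sum fun i x => monomial i (δ x)).coeff i = δ (H.coeff i) := by
        intro H i
        by_cases h : H.coeff i = 0 <;>
          simp [Polynomial.sum_def, coeff_monomial, h]
      ext i
      simp only [AddMonoidHom.coe_toIntLinearMap, AddMonoidHom.coe_mk, ZeroHom.coe_mk, key, smul_eq_mul, coeff_add]
      rw [mul_comm G, coeff_mul, coeff_mul, coeff_mul, map_sum, ← Finset.sum_add_distrib]
      refine Finset.sum_congr rfl fun x _ => ?_
      rw [key, key, δ.leibniz, smul_eq_mul, smul_eq_mul]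
      ring)

@[simp] theorem coeff_coeffD (δ : Derivation ℤ R R) (F : R[X]) (i : ℕ) :
    (coeffD δ F).coeff i = δ (F.coeff i) := by
  by_cases h : F.coeff i = 0 <;>
    simp [coeffD, Polynomial.sum_def, coeff_monomial, h]

@[simp] theorem coeffD_C (δ : Derivation ℤ R R) (x : R) : coeffD δ (C x) = C (δ x) := by
  ext i; simp only [coeff_coeffD, coeff_C]; split_ifs <;> simp

@[simp] theorem coeffD_X (δ : Derivation ℤ R R) : coeffD δ (X : R[X]) = 0 := by
  ext i; simp only [coeff_coeffD, coeff_X]; split_ifs <;> simp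

theorem coeffD_X_pow (δ : Derivation ℤ R R) (k : ℕ) : coeffD δ (X ^ k : R[X]) = 0 := by
  rw [Derivation.leibniz_pow]; simp

theorem coeffD_mul (δ : Derivation ℤ R R) (F G : R[X]) :
    coeffD δ (F * G) = F * coeffD δ G + coeffD δ F * G := by
  rw [Derivation.leibniz, smul_eq_mul, smul_eq_mul, mul_comm G]

theorem coeffD_X_pow_mul (δ : Derivation ℤ R R) (k : ℕ) (F : R[X]) :
    coeffD δ (X ^ k * F) = X ^ k * coeffD δ F := by
  rw [coeffD_mul, coeffD_X_pow]; simp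

theorem degree_coeffD_lt (δ : Derivation ℤ R R) {F : R[X]} {N : ℕ} (h : F.degree < N) :
    (coeffD δ F).degree < N := by
  rw [degree_lt_iff_coeff_zero] at h ⊢
  intro m hm; rw [coeff_coeffD, h m hm, map_zero]

/-- `res a F` is the sum of the residues of `F / a` at the roots of the monic polynomial `a`,
computed as the coefficient of `X ^ (deg a - 1)` in the remainder of `F` modulo `a`. -/
def res (a : R[X]) : R[X] →ₗ[R] R :=
  (lcoeff R (a.natDegree - 1)).comp (modByMonicHom a)

theorem res_apply (a F : R[X]) : res a F = (F %ₘ a).coeff (a.natDegree - 1) := rfl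

theorem res_C_mul (a F : R[X]) (x : R) : res a (C x * F) = x * res a F := by
  rw [← smul_eq_C_mul, map_smul, smul_eq_mul]

theorem res_self_mul {a : R[X]} (ha : a.Monic) (F : R[X]) : res a (a * F) = 0 := by
  rw [res_apply, self_mul_modByMonic ha, coeff_zero]

theorem res_congr {a : R[X]} (ha : a.Monic) {F G : R[X]} (h : a ∣ F - G) : res a F = res a G := by
  obtain ⟨H, hH⟩ := h
  rw [← sub_eq_zero, ← map_sub, hH, res_self_mul ha]

variable [Nontrivial R]

theorem res_of_degree_lt {a : R[X]} (ha : a.Monic) {F : R[X]} (h : F.degree < a.degree) :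
    res a F = F.coeff (a.natDegree - 1) := by
  rw [res_apply, (modByMonic_eq_self_iff ha).2 h]

/-- The product `a * (F %ₘ a)` already has degree below `2 deg a`. This is the algebraic form of
cancelling one factor in `aF/a²`. -/
theorem self_mul_modByMonic_sq {a : R[X]} (ha : a.Monic) (F : R[X]) :
    (a * F) %ₘ (a ^ 2) = a * (F %ₘ a) := by
  have h1 := modByMonic_add_div F a
  refine (div_modByMonic_unique (F /ₘ a) (a * (F %ₘ a)) (ha.pow 2) ⟨?_, ?_⟩).2
  · linear_combination a * h1
  · rw [pow_two, ha.degree_mul, mul_comm a, ha.degree_mul]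
    have := degree_modByMonic_lt F ha
    rcases eq_or_ne (F %ₘ a) 0 with h0 | h0
    · rw [h0, degree_zero, WithBot.bot_add]
      exact bot_lt_iff_ne_bot.2 (by simp [degree_eq_bot, ha.ne_zero])
    · rw [degree_eq_natDegree h0, degree_eq_natDegree ha.ne_zero] at *
      norm_cast at *; omega

theorem res_sq_self_mul {a : R[X]} (ha : a.Monic) (h1 : 0 < a.natDegree) (F : R[X]) :
    res (a ^ 2) (a * F) = res a F := by
  rw [res_apply, res_apply, self_mul_modByMonic_sq ha, ha.natDegree_pow]
  have h2 : 2 * a.natDegree - 1 = a.natDegree + (a.natDegree - 1) := by omega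
  have hd : (F %ₘ a).natDegree ≤ a.natDegree - 1 := by
    have := natDegree_modByMonic_lt F ha (by rintro rfl; simp at h1)
    omega
  rw [h2, coeff_mul_add_eq_of_natDegree_le le_rfl hd, coeff_natDegree, ha.leadingCoeff, one_mul]

/-- A fraction `F/a²` that decays like `x⁻²` at infinity has no residue there, so its finite
residues add up to zero. The terms that drop out of the residue identities below do so for this
reason. -/
theorem res_sq_of_natDegree_le {a : R[X]} (ha : a.Monic) (h1 : 0 < a.natDegree) {F : R[X]}
    (h : F.natDegree + 2 ≤ 2 * a.natDegree) : res (a ^ 2) F = 0 := by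
  rw [res_of_degree_lt (ha.pow 2), ha.natDegree_pow, coeff_eq_zero_of_natDegree_lt (by omega)]
  refine lt_of_le_of_lt degree_le_natDegree ?_
  rw [degree_eq_natDegree (ha.pow 2).ne_zero, ha.natDegree_pow]
  exact_mod_cast (by omega : F.natDegree < 2 * a.natDegree)

theorem natDegree_modByMonic_succ_le {a : R[X]} (ha : a.Monic) (h1 : 0 < a.natDegree) (F : R[X]) :
    (F %ₘ a).natDegree + 1 ≤ a.natDegree :=
  natDegree_modByMonic_lt F ha (by rintro rfl; simp at h1)

/-- Integration by parts. -/
theorem res_sq_parts {a : R[X]} (ha : a.Monic) (h1 : 0 < a.natDegree) (F : R[X]) :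
    res (a ^ 2) (a * derivative F) = res (a ^ 2) (derivative a * F) := by
  have hF := modByMonic_add_div F a
  have hd := natDegree_modByMonic_succ_le ha h1 F
  set F0 := F %ₘ a
  set Q := F /ₘ a
  rw [← sub_eq_zero, ← map_sub, ← hF]
  -- The quotient part of `F` contributes the multiple `a² Q'`. For the remainder both terms,
  -- divided by `a²`, decay like `x⁻²`.
  have e : a * derivative (F0 + a * Q) - derivative a * (F0 + a * Q)
      = a ^ 2 * derivative Q + (a * derivative F0 - derivative a * F0) := by
    simp only [derivative_add, derivative_mul]; ring
  rw [e, map_add, res_self_mul (ha.pow 2), zero_add, map_sub]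
  have e1 : res (a ^ 2) (a * derivative F0) = 0 := by
    by_cases h0 : F0.natDegree = 0
    · rw [derivative_of_natDegree_zero h0]; simp
    · apply res_sq_of_natDegree_le ha h1
      have := natDegree_derivative_lt h0
      have := natDegree_mul_le (p := a) (q := derivative F0)
      omega
  have e2 : res (a ^ 2) (derivative a * F0) = 0 := by
    apply res_sq_of_natDegree_le ha h1
    have := natDegree_derivative_lt (p := a) (by omega)
    have := natDegree_mul_le (p := derivative a) (q := F0)
    omega
  rw [e1, e2, sub_zero]

/-- The change of the residue under a derivation of the coefficients. -/
theorem derivation_res (δ : Derivation ℤ R R) {a : R[X]} (ha : a.Monic) (h1 : 0 < a.natDegree)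
    (F : R[X]) : δ (res a F) = res a (coeffD δ F) - res (a ^ 2) (F * coeffD δ a) := by
  have hF := modByMonic_add_div F a
  have hd := natDegree_modByMonic_succ_le ha h1 F
  have hlt := degree_modByMonic_lt F ha
  have hn : a.degree = a.natDegree := degree_eq_natDegree ha.ne_zero
  -- Since `a` is monic, `δ` kills its leading coefficient.
  have hda : (coeffD δ a).natDegree + 1 ≤ a.natDegree := by
    have : (coeffD δ a).degree < a.natDegree := by
      rw [degree_lt_iff_coeff_zero]
      intro m hm
      rw [coeff_coeffD]
      rcases hm.eq_or_lt with rfl | hm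
      · rw [coeff_natDegree, ha.leadingCoeff, δ.map_one_eq_zero]
      · rw [coeff_eq_zero_of_natDegree_lt hm, map_zero]
    rcases eq_or_ne (coeffD δ a) 0 with h0 | h0
    · rw [h0, natDegree_zero]; omega
    · rw [degree_eq_natDegree h0] at this; exact_mod_cast this
  set F0 := F %ₘ a with hF0
  set Q := F /ₘ a
  have e1 : coeffD δ F = coeffD δ F0 + coeffD δ a * Q + a * coeffD δ Q := by
    rw [← hF, map_add, coeffD_mul]; ring
  -- The product `F0 δa` decays too fast to have a residue over `a²`. What survives is the term `δa
  -- Q` of `e1`, the effect of the moving poles.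
  have e2 : res (a ^ 2) (F * coeffD δ a) = res a (coeffD δ a * Q) := by
    rw [← hF, add_mul, map_add, res_sq_of_natDegree_le ha h1, zero_add, mul_assoc,
      res_sq_self_mul ha h1, mul_comm]
    have := natDegree_mul_le (p := F0) (q := coeffD δ a)
    omega
  rw [e2, e1, map_add, map_add, res_self_mul ha, add_zero, add_sub_cancel_right,
    res_of_degree_lt ha (F := coeffD δ F0), coeff_coeffD, res_apply]
  · rw [hn] at hlt ⊢
    exact degree_coeffD_lt δ hlt

/-- The residue identity behind the Poisson algebra of the geodesic and magnetic parts. -/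
theorem res_quotient_identity {a : R[X]} (ha : a.Monic) (h1 : 0 < a.natDegree)
    (P Q S T : R[X]) (h : P * Q = S * T) :
    res a (P * derivative (Q /ₘ a) - S * derivative (T /ₘ a)
      + T * derivative (S /ₘ a) - Q * derivative (P /ₘ a))
      = res (a ^ 2) (P * derivative Q - S * derivative T) := by
  -- Integration by parts moves everything that is not symmetric in `P` and `Q` into simple poles.
  -- The rest is the residue of `a' U` over `a²`, where `a U = P Q - (P %ₘ a)(Q %ₘ a)`.
  have half : ∀ P Q : R[X], res (a ^ 2) (P * derivative Q) - res a (P * derivative (Q /ₘ a))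
      + res a (Q * derivative (P /ₘ a))
      = res (a ^ 2) (derivative a * (a * (P /ₘ a) * (Q /ₘ a) + (P /ₘ a) * (Q %ₘ a)
        + (P %ₘ a) * (Q /ₘ a))) := by
    intro P Q
    have hP := modByMonic_add_div P a
    have hQ := modByMonic_add_div Q a
    have dP := natDegree_modByMonic_succ_le ha h1 P
    have dQ := natDegree_modByMonic_succ_le ha h1 Q
    set P1 := P /ₘ a
    set Q1 := Q /ₘ a
    set P0 := P %ₘ a
    set Q0 := Q %ₘ a
    have e0 : res (a ^ 2) (P0 * derivative Q0) = 0 := by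
      apply res_sq_of_natDegree_le ha h1
      have := natDegree_derivative_le Q0
      have := natDegree_mul_le (p := P0) (q := derivative Q0)
      omega
    have e1 : res a (P * derivative Q1) = res (a ^ 2) (a * (P0 * derivative Q1)) := by
      rw [res_sq_self_mul ha h1]
      apply res_congr ha
      exact ⟨P1 * derivative Q1, by rw [← hP]; ring⟩
    have e2 : res a (Q * derivative P1) = res (a ^ 2) (a * (Q0 * derivative P1)) := by
      rw [res_sq_self_mul ha h1]
      apply res_congr ha
      exact ⟨Q1 * derivative P1, by rw [← hQ]; ring⟩
    have e3 := res_sq_parts ha h1 (P1 * Q0)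
    have e4 : res (a ^ 2) (a ^ 2 * (P1 * derivative Q1)) = 0 := res_self_mul (ha.pow 2) _
    have e5 : P * derivative Q = a ^ 2 * (P1 * derivative Q1)
        + P0 * derivative Q0 + (a * (P0 * derivative Q1)) + a * (P1 * derivative Q0)
        + derivative a * (a * P1 * Q1 + P0 * Q1) := by
      rw [← hP, ← hQ]; simp only [derivative_add, derivative_mul]; ring
    have e6 : derivative a * (a * P1 * Q1 + P1 * Q0 + P0 * Q1)
      = derivative a * (a * P1 * Q1 + P0 * Q1) + derivative a * (P1 * Q0) := by ring
    have e7 : a * derivative (P1 * Q0) = a * (P1 * derivative Q0) + a * (Q0 * derivative P1) := by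
      simp only [derivative_mul]; ring
    rw [e7, map_add] at e3
    rw [e1, e2, e5, e6]
    simp only [map_add]
    rw [e0, e4]
    linear_combination e3
  have hPQ := half P Q
  have hST := half S T
  set U := a * (P /ₘ a) * (Q /ₘ a) + (P /ₘ a) * (Q %ₘ a) + (P %ₘ a) * (Q /ₘ a) with hU
  set V := a * (S /ₘ a) * (T /ₘ a) + (S /ₘ a) * (T %ₘ a) + (S %ₘ a) * (T /ₘ a) with hV
  -- As `P Q = S T`, the difference `a (U - V)` involves only products of remainders, so `U - V` has
  -- degree at most `deg a - 2` and `a' (U - V)` has no residue over `a²`.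
  have hUV : res (a ^ 2) (derivative a * (U - V)) = 0 := by
    have e : a * (U - V) = (S %ₘ a) * (T %ₘ a) - (P %ₘ a) * (Q %ₘ a) := by
      have hP := modByMonic_add_div P a
      have hQ := modByMonic_add_div Q a
      have hS := modByMonic_add_div S a
      have hT := modByMonic_add_div T a
      have : (P %ₘ a + a * (P /ₘ a)) * (Q %ₘ a + a * (Q /ₘ a))
        = (S %ₘ a + a * (S /ₘ a)) * (T %ₘ a + a * (T /ₘ a)) := by rw [hP, hQ, hS, hT, h]
      rw [hU, hV]; linear_combination this
    rcases eq_or_ne (U - V) 0 with h0 | h0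
    · rw [h0]; simp
    · have d1 : (a * (U - V)).natDegree = a.natDegree + (U - V).natDegree :=
        ha.natDegree_mul' h0
      have dP := natDegree_modByMonic_succ_le ha h1 P
      have dQ := natDegree_modByMonic_succ_le ha h1 Q
      have dS := natDegree_modByMonic_succ_le ha h1 S
      have dT := natDegree_modByMonic_succ_le ha h1 T
      have d2 := natDegree_sub_le ((S %ₘ a) * (T %ₘ a)) ((P %ₘ a) * (Q %ₘ a))
      rw [← e, d1] at d2
      have d3 := natDegree_mul_le (p := S %ₘ a) (q := T %ₘ a)
      have d4 := natDegree_mul_le (p := P %ₘ a) (q := Q %ₘ a)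
      have d5 := natDegree_derivative_lt (p := a) (by omega)
      have d6 := natDegree_mul_le (p := derivative a) (q := U - V)
      apply res_sq_of_natDegree_le ha h1
      have d7 : a.natDegree + (U - V).natDegree + 2 ≤ 2 * a.natDegree := by
        rcases le_max_iff.1 d2 with d | d <;> omega
      omega
  rw [mul_sub, map_sub] at hUV
  simp only [map_sub, map_add]
  linear_combination hST - hPQ - hUV

/-- `res_quotient_identity` in the form used for pairs of Hamiltonians. -/
theorem res_quotient_identity' {a : R[X]} (ha : a.Monic) (h1 : 0 < a.natDegree)
    (F G f g : R[X]) :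
    res a (G * (g * derivative ((F * f) /ₘ a) - f * derivative ((F * g) /ₘ a)))
      + res a (F * (g * derivative ((G * f) /ₘ a) - f * derivative ((G * g) /ₘ a)))
      = res (a ^ 2) (F * G * (g * derivative f - f * derivative g)) := by
  -- With this choice the terms containing `F'` cancel in `P Q' - S T'`, leaving `F G` times the
  -- Wronskian of `f` and `g`.
  have := res_quotient_identity ha h1 (G * g) (F * f) (G * f) (F * g) (by ring)
  rw [← map_add]
  convert this using 2
  · ring
  · simp only [derivative_mul]; ring

end Residue

/-! ### The Horner polynomials `β_s` and their duality with the powers of `X` -/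

section Beta

variable {R : Type*} [CommRing R]

/-- A sequence of Viète coordinates: `c 0 = 1` and `c k = 0` outside `{0, …, n}`. -/
structure IsCoord (n : ℕ) (c : ℤ → R) : Prop where
  zero : c 0 = 1
  neg : ∀ k < 0, c k = 0
  big : ∀ k : ℤ, (n : ℤ) < k → c k = 0

/-- The polynomials `∑_{k < s} c_k X^{s-1-k}`. -/
def beta (c : ℤ → R) : ℕ → R[X]
  | 0 => 0
  | s + 1 => X * beta c s + C (c s)

@[simp] theorem beta_zero (c : ℤ → R) : beta c 0 = 0 := rfl

theorem beta_succ (c : ℤ → R) (s : ℕ) : beta c (s + 1) = X * beta c s + C (c s) := rfl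

variable {n : ℕ} {c : ℤ → R}

theorem coeff_beta (hc : IsCoord n c) (s N : ℕ) : (beta c s).coeff N = c (s - 1 - N) := by
  induction s generalizing N with
  | zero => simp [hc.neg (-1 - N) (by omega)]
  | succ s ih =>
    rw [beta_succ]
    cases N with
    | zero => simp
    | succ N =>
      simp only [coeff_add, coeff_X_mul, ih, coeff_C_succ, add_zero]
      congr 1; push_cast; ring

theorem beta_one (hc : IsCoord n c) : beta c 1 = 1 := by simp [beta_succ, hc.zero]

theorem degree_beta_lt (hc : IsCoord n c) (s : ℕ) : (beta c s).degree < s := by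
  rw [degree_lt_iff_coeff_zero]
  intro N hN
  rw [coeff_beta hc, hc.neg]; omega

theorem natDegree_beta_le (hc : IsCoord n c) (s : ℕ) : (beta c (s + 1)).natDegree ≤ s := by
  rw [natDegree_le_iff_coeff_eq_zero]
  intro N hN
  rw [coeff_beta hc, hc.neg]; push_cast; omega

theorem beta_monic (hc : IsCoord n c) (s : ℕ) : (beta c (s + 1)).Monic := by
  apply monic_of_natDegree_le_of_coeff_eq_one s (natDegree_beta_le hc s)
  rw [coeff_beta hc]; push_cast; ring_nf; exact hc.zero

theorem natDegree_beta [Nontrivial R] (hc : IsCoord n c) (s : ℕ) :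
    (beta c (s + 1)).natDegree = s := by
  refine natDegree_eq_of_le_of_coeff_ne_zero (natDegree_beta_le hc s) ?_
  rw [coeff_beta hc]; push_cast; ring_nf; rw [hc.zero]; exact one_ne_zero

/-- Beyond index `n + 1` no new coefficients enter, so these polynomials are multiples of the
characteristic polynomial and disappear under `res`. This is why the kinetic and magnetic terms of
index above `n` vanish. -/
theorem beta_big (hc : IsCoord n c) (j : ℕ) : beta c (n + 1 + j) = X ^ j * beta c (n + 1) := by
  induction j with
  | zero => simp
  | succ j ih =>
    rw [← add_assoc, beta_succ, ih, hc.big _ (by push_cast; omega), pow_succ']; simp [mul_assoc]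

theorem map_beta {S : Type*} [CommRing S] (f : R →+* S) (s : ℕ) :
    (beta c s).map f = beta (fun k => f (c k)) s := by
  induction s with
  | zero => simp
  | succ s ih => simp [beta_succ, ih]

theorem beta_eq_sum (hc : IsCoord n c) {k N : ℕ} (h : k ≤ N) :
    beta c k = ∑ i ∈ Finset.range N, C (c (k - 1 - i)) * X ^ i := by
  ext j
  simp only [finsetSum_coeff, coeff_C_mul, coeff_X_pow, mul_ite, mul_one, mul_zero,
    Finset.sum_ite_eq, Finset.mem_range, coeff_beta hc]
  split_ifs with hj
  · rfl
  · rw [hc.neg]; omega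

section Div

variable {a : R[X]}

theorem add_divByMonic' [Nontrivial R] (ha : a.Monic) (F G : R[X]) :
    (F + G) /ₘ a = F /ₘ a + G /ₘ a := by
  refine (div_modByMonic_unique _ (F %ₘ a + G %ₘ a) ha ⟨?_, ?_⟩).1
  · linear_combination modByMonic_add_div F a + modByMonic_add_div G a
  · exact lt_of_le_of_lt (degree_add_le _ _)
      (max_lt (degree_modByMonic_lt _ ha) (degree_modByMonic_lt _ ha))

theorem C_mul_divByMonic' [Nontrivial R] (ha : a.Monic) (x : R) (F : R[X]) :
    (C x * F) /ₘ a = C x * (F /ₘ a) := by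
  refine (div_modByMonic_unique _ (C x * (F %ₘ a)) ha ⟨?_, ?_⟩).1
  · linear_combination C x * modByMonic_add_div F a
  · rw [← smul_eq_C_mul]
    exact lt_of_le_of_lt (degree_smul_le _ _) (degree_modByMonic_lt _ ha)

theorem sub_divByMonic' [Nontrivial R] (ha : a.Monic) (F G : R[X]) :
    (F - G) /ₘ a = F /ₘ a - G /ₘ a := by
  have := add_divByMonic' ha (F - G) G
  rw [sub_add_cancel] at this
  rw [this]; ring

theorem sum_divByMonic' [Nontrivial R] {ι : Type*} (ha : a.Monic) (s : Finset ι) (f : ι → R[X]) :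
    (∑ i ∈ s, f i) /ₘ a = ∑ i ∈ s, f i /ₘ a := by
  classical
  induction s using Finset.induction_on with
  | empty => simp
  | insert i s hi ih => rw [Finset.sum_insert hi, Finset.sum_insert hi, add_divByMonic' ha, ih]

/-- Multiplication of the remainder by `X` can overflow only in degree `deg a`, and the overflow is
the top coefficient `res a F`. The inductions on remainders and quotients rest on this step. -/
theorem X_mul_mod_div [Nontrivial R] (ha : a.Monic) (h1 : 0 < a.natDegree) (F : R[X]) :
    (X * F) /ₘ a = X * (F /ₘ a) + C (res a F) ∧
    (X * F) %ₘ a = X * (F %ₘ a) - C (res a F) * a := by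
  refine div_modByMonic_unique _ _ ha ⟨?_, ?_⟩
  · linear_combination X * modByMonic_add_div F a
  · have hd := natDegree_modByMonic_succ_le ha h1 F
    rw [degree_eq_natDegree ha.ne_zero, degree_lt_iff_coeff_zero]
    intro N hN
    rcases hN.eq_or_lt with rfl | hN
    · obtain ⟨k, hk⟩ : ∃ k, a.natDegree = k + 1 := ⟨a.natDegree - 1, by omega⟩
      have e := ha.coeff_natDegree
      rw [res_apply, coeff_sub, coeff_C_mul, e]
      rw [hk, coeff_X_mul]
      simp
    · obtain ⟨k, rfl⟩ : ∃ k, N = k + 1 := ⟨N - 1, by omega⟩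
      rw [coeff_sub, coeff_X_mul, coeff_C_mul, coeff_eq_zero_of_natDegree_lt hN,
        coeff_eq_zero_of_natDegree_lt (by omega : (F %ₘ a).natDegree < k)]
      simp

end Div

variable [Nontrivial R]

theorem degree_charpoly (hc : IsCoord n c) : (beta c (n + 1)).degree = n := by
  rw [degree_eq_natDegree (beta_monic hc n).ne_zero, natDegree_beta hc]

theorem charpoly_natDegree_pos (hc : IsCoord n c) (hn : 0 < n) :
    0 < (beta c (n + 1)).natDegree := by rwa [natDegree_beta hc]

/-- The remainder modulo the characteristic polynomial in terms of residues. -/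
theorem coeff_mod_eq_res (hc : IsCoord n c) (k : ℕ) (hk : k < n) (F : R[X]) :
    (F %ₘ beta c (n + 1)).coeff (n - 1 - k) = res (beta c (n + 1)) (beta c (k + 1) * F) := by
  have ha := beta_monic hc n
  have hn := natDegree_beta hc n
  induction k generalizing F with
  | zero => rw [res_apply, zero_add, beta_one hc, one_mul, hn, Nat.sub_zero]
  | succ k ih =>
    -- Reducing `X F` subtracts `res F` times `a`; the coefficient of `a` involved is `c_{k+1}`, the
    -- same that enters in `β_{k+2} = X β_{k+1} + c_{k+1}`.
    have h := ih (by omega) (X * F)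
    rw [(X_mul_mod_div ha (by omega) F).2, coeff_sub, coeff_C_mul, coeff_beta hc] at h
    have e : n - 1 - k = (n - 1 - (k + 1)) + 1 := by omega
    rw [e, coeff_X_mul] at h
    have e2 : (((n + 1 : ℕ) : ℤ) - 1 - ((n - 1 - (k + 1) + 1 : ℕ) : ℤ)) = ((k + 1 : ℕ) : ℤ) := by
      omega
    rw [e2] at h
    rw [beta_succ c (k + 1), add_mul, map_add, res_C_mul, mul_comm X, mul_assoc, ← h]
    ring

/-- The dual expansion of the remainder. -/
theorem mod_eq_sum_res_X_pow (hc : IsCoord n c) (F : R[X]) :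
    F %ₘ beta c (n + 1) =
      ∑ i ∈ Finset.range n, C (res (beta c (n + 1)) (X ^ i * F)) * beta c (n - i) := by
  have ha := beta_monic hc n
  ext N
  simp only [finsetSum_coeff, coeff_C_mul]
  by_cases hN : N < n
  · obtain ⟨k, hk, rfl⟩ : ∃ k, k < n ∧ N = n - 1 - k := ⟨n - 1 - N, by omega, by omega⟩
    rw [coeff_mod_eq_res hc k hk, beta_eq_sum hc (Nat.succ_le_of_lt hk), Finset.sum_mul, map_sum]
    refine Finset.sum_congr rfl fun i hi => ?_
    rw [Finset.mem_range] at hi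
    rw [mul_assoc, res_C_mul, mul_comm, coeff_beta hc]
    congr 2; omega
  · have h := degree_modByMonic_lt F ha
    rw [degree_charpoly hc, degree_lt_iff_coeff_zero] at h
    rw [h N (by omega)]
    symm
    refine Finset.sum_eq_zero fun i hi => ?_
    rw [Finset.mem_range] at hi
    rw [coeff_beta hc, hc.neg, mul_zero]
    omega

end Beta

/-! ### Sums of residues against the `β_k` as quotients by the characteristic polynomial -/

section Quotients

variable {R : Type*} [CommRing R] [Nontrivial R] {n : ℕ} {c : ℤ → R} {a : R[X]}

theorem X_pow_succ_mul_div (ha : a.Monic) (h1 : 0 < a.natDegree) (b : R[X]) (j : ℕ) :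
    (b * X ^ (j + 1)) /ₘ a = X * ((b * X ^ j) /ₘ a) + C (res a (b * X ^ j)) := by
  rw [← (X_mul_mod_div ha h1 _).1]; congr 1; ring

/-- Both sides obey the same Horner recursion, in which raising `s` uses the hypothesis for `m + 1`.
In the applications the residues of `b X^j` are momenta, and the closed form replaces sums over them
by quotients. -/
theorem sum_res_mul_beta (ha : a.Monic) (h1 : 0 < a.natDegree) (b : R[X]) (s m : ℕ) :
    ∑ k ∈ Finset.range s, C (res a (b * X ^ (m + s - 1 - k))) * beta c k
      = (b * X ^ m * beta c s) /ₘ a - beta c s * ((b * X ^ m) /ₘ a) := by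
  induction s generalizing m with
  | zero => simp
  | succ s ih =>
    rw [Finset.sum_range_succ]
    have e : ∀ k ∈ Finset.range s, C (res a (b * X ^ (m + (s + 1) - 1 - k))) * beta c k
        = C (res a (b * X ^ ((m + 1) + s - 1 - k))) * beta c k := by
      intro k _; congr 5; omega
    rw [Finset.sum_congr rfl e, ih (m + 1)]
    have e2 : m + (s + 1) - 1 - s = m := by omega
    have e3 : b * X ^ m * beta c (s + 1)
        = b * X ^ (m + 1) * beta c s + C (c s) * (b * X ^ m) := by rw [beta_succ]; ring
    rw [e2, e3, add_divByMonic' ha, C_mul_divByMonic' ha, X_pow_succ_mul_div ha h1, beta_succ]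
    ring

/-- The weights `s-1-k` are those with which `J_s` moves the momenta. In the induction, lowering all
weights by one splits off an unweighted sum of the preceding type. -/
theorem sum_nsmul_res_mul_beta (ha : a.Monic) (h1 : 0 < a.natDegree) (b : R[X]) (s m : ℕ) :
    ∑ k ∈ Finset.range s, ((s - 1 - k : ℕ) : R[X]) * (C (res a (b * X ^ (m + s - 2 - k))) * beta c k)
      = (b * X ^ m * derivative (beta c s)) /ₘ a - derivative ((b * X ^ m * beta c s) /ₘ a)
        + beta c s * derivative ((b * X ^ m) /ₘ a) := by
  induction s generalizing m with
  | zero => simp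
  | succ s ih =>
    have e : ∑ k ∈ Finset.range (s + 1), ((s + 1 - 1 - k : ℕ) : R[X])
          * (C (res a (b * X ^ (m + (s + 1) - 2 - k))) * beta c k)
        = ∑ k ∈ Finset.range s, ((s - 1 - k : ℕ) : R[X])
          * (C (res a (b * X ^ ((m + 1) + s - 2 - k))) * beta c k)
        + ∑ k ∈ Finset.range s, C (res a (b * X ^ (m + s - 1 - k))) * beta c k := by
      rw [Finset.sum_range_succ, ← Finset.sum_add_distrib]
      simp only [Nat.add_sub_cancel, Nat.sub_self, Nat.cast_zero, zero_mul, add_zero]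
      refine Finset.sum_congr rfl fun k hk => ?_
      rw [Finset.mem_range] at hk
      obtain ⟨j, rfl⟩ : ∃ j, s = k + 1 + j := ⟨s - k - 1, by omega⟩
      have e1 : k + 1 + j - k = j + 1 := by omega
      have e2 : k + 1 + j - 1 - k = j := by omega
      have e3 : m + (k + 1 + j + 1) - 2 - k = m + j := by omega
      have e4 : m + 1 + (k + 1 + j) - 2 - k = m + j := by omega
      have e5 : m + (k + 1 + j) - 1 - k = m + j := by omega
      rw [e1, e2, e3, e4, e5]; push_cast; ring
    rw [e, ih (m + 1), sum_res_mul_beta ha h1]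
    have e3 : b * X ^ m * beta c (s + 1)
        = b * X ^ (m + 1) * beta c s + C (c s) * (b * X ^ m) := by rw [beta_succ]; ring
    have e4 : b * X ^ m * derivative (beta c (s + 1))
        = b * X ^ (m + 1) * derivative (beta c s) + b * X ^ m * beta c s := by
      rw [beta_succ]; simp; ring
    rw [e4, e3, add_divByMonic' ha, add_divByMonic' ha, C_mul_divByMonic' ha,
      X_pow_succ_mul_div ha h1, beta_succ]
    simp
    ring

/-- Quotients in terms of shifted coefficients. -/
theorem sum_mul_shift_eq_div (hc : IsCoord n c) (p J : ℤ → R) (γ : ℕ → R[X])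
    (h0 : γ 0 = 0) (hs : ∀ k, γ (k + 1) = X * γ k + C (J k)) :
    ∑ k ∈ Finset.range (n + 1), C (p k) * γ k
      = ((∑ k ∈ Finset.range (n + 1), C (p k) * beta c k) * γ (n + 1)) /ₘ beta c (n + 1) := by
  have ha := beta_monic hc n
  have hγ : ∀ k, (γ k).degree < k := by
    intro k
    induction k with
    | zero => simp [h0]
    | succ k ih =>
      rw [degree_lt_iff_coeff_zero] at ih ⊢
      intro N hN
      obtain ⟨N, rfl⟩ : ∃ M, N = M + 1 := ⟨N - 1, by omega⟩
      rw [hs, coeff_add, coeff_X_mul, coeff_C_succ, ih N (by omega), add_zero]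
  -- For `k + j = n` this bound says that `β_k γ_{n+1} - a γ_k` has degree below `n`, that is, `γ_k`
  -- is the quotient of `β_k γ_{n+1}` by `a`.
  have key : ∀ k j : ℕ,
      (beta c k * γ (k + 1 + j) - beta c (k + 1 + j) * γ k).degree < (k + j : ℕ) := by
    intro k j
    induction j with
    | zero =>
      have e : beta c k * γ (k + 1 + 0) - beta c (k + 1 + 0) * γ k
          = C (J k) * beta c k - C (c k) * γ k := by
        rw [add_zero, hs, beta_succ]; ring
      rw [e, add_zero]
      refine lt_of_le_of_lt (degree_sub_le _ _) (max_lt ?_ ?_)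
      · rw [← smul_eq_C_mul]; exact lt_of_le_of_lt (degree_smul_le _ _) (degree_beta_lt hc k)
      · rw [← smul_eq_C_mul]; exact lt_of_le_of_lt (degree_smul_le _ _) (hγ k)
    | succ j ih =>
      have e : beta c k * γ (k + 1 + (j + 1)) - beta c (k + 1 + (j + 1)) * γ k
          = X * (beta c k * γ (k + 1 + j) - beta c (k + 1 + j) * γ k)
            + (C (J (k + 1 + j : ℕ)) * beta c k - C (c (k + 1 + j : ℕ)) * γ k) := by
        rw [← add_assoc (k + 1) j 1, hs, beta_succ]; ring
      have hb := degree_beta_lt hc k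
      have hg := hγ k
      rw [degree_lt_iff_coeff_zero] at ih hb hg ⊢
      intro N hN
      obtain ⟨N, rfl⟩ : ∃ M, N = M + 1 := ⟨N - 1, by omega⟩
      rw [e, coeff_add, coeff_X_mul, ih N (by omega), coeff_sub, coeff_C_mul, coeff_C_mul,
        hb (N + 1) (by omega), hg (N + 1) (by omega)]
      simp
  rw [Finset.sum_mul, sum_divByMonic' ha]
  refine Finset.sum_congr rfl fun k hk => ?_
  rw [mul_assoc, C_mul_divByMonic' ha]
  congr 1
  refine ((div_modByMonic_unique (γ k) _ ha ⟨add_comm _ _ |>.trans (add_sub_cancel _ _), ?_⟩).1).symm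
  rw [Finset.mem_range] at hk
  obtain ⟨j, hj⟩ : ∃ j, n = k + j := ⟨n - k, by omega⟩
  have := key k j
  rw [degree_charpoly hc]
  rwa [show k + 1 + j = n + 1 by omega, show k + j = n by omega] at this

end Quotients

/-! ### The vector fields `J_s`, their commutators and generating polynomials -/

section KillingFlow

variable {R : Type*} [CommRing R] {n m : ℕ} {c : ℤ → R}

/-- The indices `s` for which the vector field `J_s` is of the first of the two kinds. -/
abbrev lowIdx (n m s : ℕ) : Prop := s = 1 ∨ s + m ≤ n + 1

/-- The components of the vector fields `J_s`. -/
def killC (n m s : ℕ) (c : ℤ → R) (k : ℤ) : R :=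
  if lowIdx n m s then ((max (n + 1 - m - k) 0 : ℤ) : R) * c (k - (n + 2 - m - s))
  else ((max (k - (n + 1 - m)) 0 : ℤ) : R) * c (k - (n + 2 - m - s))

/-- The structure constants of the Lie algebra of geodesic Hamiltonians. -/
def structC (n m r s : ℕ) : ℤ :=
  if lowIdx n m r then (if lowIdx n m s then s - r else 0)
  else (if lowIdx n m s then 0 else r - s)

/-- The polynomials `F_s` with `X J_s = X F_s' - m F_s`. -/
def polyF (n m s : ℕ) (c : ℤ → R) : R[X] :=
  if lowIdx n m s then X ^ m * beta c s
  else X ^ m * beta c s - X ^ (m + s - 1 - n) * beta c (n + 1)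

theorem coeff_polyF (hc : IsCoord n c) (s N : ℕ) :
    (polyF n m s c).coeff N = if lowIdx n m s then (if m ≤ N then c (m + s - 1 - N) else 0)
      else (if m ≤ N then 0 else - c (m + s - 1 - N)) := by
  unfold polyF
  have e1 : (X ^ m * beta c s).coeff N = if m ≤ N then c (m + s - 1 - N) else 0 := by
    rw [coeff_X_pow_mul']
    split_ifs with h
    · rw [coeff_beta hc]; congr 1; omega
    · rfl
  by_cases hl : lowIdx n m s
  · rw [if_pos hl, if_pos hl, e1]
  · rw [if_neg hl, if_neg hl, coeff_sub, e1, coeff_X_pow_mul']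
    unfold lowIdx at hl
    by_cases hN : m ≤ N
    · rw [if_pos hN, if_pos hN]
      split_ifs with h
      · rw [coeff_beta hc, sub_eq_zero]; congr 1; omega
      · rw [hc.big]; · simp
        omega
    · rw [if_neg hN, if_neg hN]
      split_ifs with h
      · rw [coeff_beta hc, zero_sub]; congr 2; omega
      · rw [hc.big]; · simp
        omega

/-- The weights in `killC` are cut off by `max` instead of by ranges of summation. Outside the
ranges either the weight or the coordinate vanishes, so that one formula serves all integer indices.
-/
theorem killC_zero (hc : IsCoord n c) (hm : m ≤ n + 1) (s : ℕ) (k : ℤ) (hk : k ≤ 0) :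
    killC n m s c k = 0 := by
  unfold killC
  split_ifs with h
  · rcases eq_or_ne (k - (n + 2 - m - s) : ℤ) 0 with h0 | h0
    · have : max (n + 1 - m - k : ℤ) 0 = 0 := by unfold lowIdx at h; omega
      rw [this]; simp
    · rw [hc.neg, mul_zero]
      unfold lowIdx at h; omega
  · have : max (k - (n + 1 - m) : ℤ) 0 = 0 := by omega
    rw [this]; simp

theorem killC_big (hc : IsCoord n c) (s : ℕ) (k : ℤ) (hk : n < k) :
    killC n m s c k = 0 := by
  unfold killC
  split_ifs with h
  · have : max (n + 1 - m - k : ℤ) 0 = 0 := by omega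
    rw [this]; simp
  · rw [hc.big, mul_zero]
    unfold lowIdx at h; omega

/-- A derivation that acts on the coordinates as the vector field `J_s`. -/
def FlowsAlong (n m s : ℕ) (c : ℤ → R) (δ : Derivation ℤ R R) : Prop :=
  ∀ k : ℤ, δ (c k) = killC n m s c k

theorem Derivation.map_intCast_mul (δ : Derivation ℤ R R) (z : ℤ) (x : R) :
    δ ((z : R) * x) = z * δ x := by
  rw [δ.leibniz, δ.map_intCast]; simp

/-- Iterated action: the commutators of the vector fields `J_s`. -/
theorem flow_killC_sub (hc : IsCoord n c) (hm : m ≤ n + 1) {r s : ℕ} (hr : 1 ≤ r) (hs : 1 ≤ s)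
    {δr δs : Derivation ℤ R R} (hδr : FlowsAlong n m r c δr) (hδs : FlowsAlong n m s c δs) (k : ℤ) :
    δs (killC n m r c k) - δr (killC n m s c k)
      = structC n m r s * killC n m (r + s + m - (n + 2)) c k := by
  -- On the diagonal the two derivations may differ, but they agree on the coordinates.
  rcases eq_or_ne r s with rfl | hrs
  · have h0 : structC n m r r = 0 := by unfold structC; split_ifs <;> simp
    have h1 : δs (killC n m r c k) = δr (killC n m r c k) := by
      unfold killC
      split_ifs <;> rw [Derivation.map_intCast_mul, Derivation.map_intCast_mul, hδr, hδs]
    rw [h0, h1]; simp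
  have key : δs (killC n m r c k) - δr (killC n m s c k)
      = (if lowIdx n m r then ((max (n + 1 - m - k) 0 : ℤ) : R)
          else ((max (k - (n + 1 - m)) 0 : ℤ) : R)) * killC n m s c (k - (n + 2 - m - r))
       - (if lowIdx n m s then ((max (n + 1 - m - k) 0 : ℤ) : R)
          else ((max (k - (n + 1 - m)) 0 : ℤ) : R)) * killC n m r c (k - (n + 2 - m - s)) := by
    rw [killC.eq_1 n m r, killC.eq_1 n m s]
    split_ifs <;>
      rw [Derivation.map_intCast_mul, Derivation.map_intCast_mul, hδr, hδs]
  rw [key]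
  -- For fields of the same kind the coordinate factors coincide and the weights differ by a
  -- multiple of `s - r`: with `ν = n+1-m-k`, the first kind gives `ν(ν+n+2-m-r) - ν(ν+n+2-m-s) =
  -- (s-r)ν`. For fields of different kinds every term contains a weight that is cut off to zero.
  have hc1 : (k - (n + 2 - m - s) - (n + 2 - m - r) : ℤ)
    = k - (n + 2 - m - r) - (n + 2 - m - s) := by ring
  by_cases hlr : lowIdx n m r <;> by_cases hls : lowIdx n m s
  · have hl : lowIdx n m (r + s + m - (n + 2)) := by unfold lowIdx at *; omega
    simp only [killC, structC, if_pos hlr, if_pos hls, if_pos hl, hc1]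
    rcases le_or_gt (n + 1 - m - k : ℤ) 0 with hν | hν
    · rw [max_eq_right hν]; simp
    · rw [max_eq_left hν.le, max_eq_left (by unfold lowIdx at *; omega),
        max_eq_left (by unfold lowIdx at *; omega)]
      -- If `r + s + m < n + 2`, the natural subtraction yields the index `0`, and the coordinates
      -- on both sides have negative index.
      by_cases h : n + 2 ≤ r + s + m
      · have e : (k - (n + 2 - m - (r + s + m - (n + 2) : ℕ)) : ℤ)
            = k - (n + 2 - m - r) - (n + 2 - m - s) := by omega
        rw [e]; push_cast; ring
      · rw [hc.neg, hc.neg (k - (n + 2 - m - (r + s + m - (n + 2) : ℕ)))]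
        · simp
        · omega
        · omega
  · simp only [killC, structC, if_pos hlr, if_neg hls]
    rcases le_or_gt (n + 1 - m - k : ℤ) 0 with hν | hν
    · rw [max_eq_right hν, max_eq_right (a := (n + 1 - m - (k - (n + 2 - m - s)) : ℤ))
        (by unfold lowIdx at *; omega)]; simp
    · rw [max_eq_right (a := (k - (n + 1 - m) : ℤ)) (by omega),
        max_eq_right (a := ((k - (n + 2 - m - r)) - (n + 1 - m) : ℤ))
        (by unfold lowIdx at *; omega)]; simp
  · simp only [killC, structC, if_neg hlr, if_pos hls]
    rcases le_or_gt (n + 1 - m - k : ℤ) 0 with hν | hν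
    · rw [max_eq_right hν, max_eq_right (a := (n + 1 - m - (k - (n + 2 - m - r)) : ℤ))
        (by unfold lowIdx at *; omega)]; simp
    · rw [max_eq_right (a := (k - (n + 1 - m) : ℤ)) (by omega),
        max_eq_right (a := ((k - (n + 2 - m - s)) - (n + 1 - m) : ℤ))
        (by unfold lowIdx at *; omega)]; simp
  · have hl : ¬ lowIdx n m (r + s + m - (n + 2)) := by unfold lowIdx at *; omega
    simp only [killC, structC, if_neg hlr, if_neg hls, if_neg hl, hc1]
    rcases le_or_gt (k - (n + 1 - m) : ℤ) 0 with hν | hν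
    · rw [max_eq_right hν]; simp
    · rw [max_eq_left hν.le, max_eq_left (by unfold lowIdx at *; omega),
        max_eq_left (by unfold lowIdx at *; omega)]
      have e : (k - (n + 2 - m - (r + s + m - (n + 2) : ℕ)) : ℤ)
          = k - (n + 2 - m - r) - (n + 2 - m - s) := by unfold lowIdx at *; omega
      rw [e]; push_cast; ring

/-- The coefficients of `F_s` are shifted coordinates, cut off at the power `X^m`, so the
computation for the commutator of `J_r` and `J_s` can be repeated in each degree. Through this
relation the brackets of the kinetic and magnetic terms close. -/
theorem coeffD_polyF_sub (hc : IsCoord n c) (hm : m ≤ n + 1) {r s : ℕ} (hr : 1 ≤ r) (hs : 1 ≤ s)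
    {δr δs : Derivation ℤ R R} (hδr : FlowsAlong n m r c δr) (hδs : FlowsAlong n m s c δs) :
    coeffD δs (polyF n m r c) - coeffD δr (polyF n m s c)
      = (structC n m r s : R[X]) * polyF n m (r + s + m - (n + 2)) c := by
  have hF : ∀ (δ : Derivation ℤ R R) (s r N : ℕ), FlowsAlong n m s c δ →
      (coeffD δ (polyF n m r c)).coeff N = if lowIdx n m r then
        (if m ≤ N then killC n m s c (m + r - 1 - N) else 0)
      else (if m ≤ N then 0 else - killC n m s c (m + r - 1 - N)) := by
    intro δ s r N hδ
    rw [coeff_coeffD, coeff_polyF hc]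
    split_ifs <;> simp [hδ _]
  ext N
  rw [coeff_sub, hF δs s r N hδs, hF δr r s N hδr, ← C_eq_intCast, coeff_C_mul, coeff_polyF hc]
  rcases eq_or_ne r s with rfl | hrs
  · have h0 : structC n m r r = 0 := by unfold structC; split_ifs <;> simp
    rw [h0]; simp
  have hc1 : (m + s - 1 - N - (n + 2 - m - r) : ℤ) = m + r - 1 - N - (n + 2 - m - s) := by ring
  by_cases hlr : lowIdx n m r <;> by_cases hls : lowIdx n m s
  · have hl : lowIdx n m (r + s + m - (n + 2)) := by unfold lowIdx at *; omega
    simp only [killC, structC, if_pos hlr, if_pos hls, if_pos hl, hc1]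
    by_cases hN : m ≤ N
    · simp only [if_pos hN]
      rw [max_eq_left (by unfold lowIdx at *; omega), max_eq_left (by unfold lowIdx at *; omega)]
      by_cases h : n + 2 ≤ r + s + m
      · have e : (m + (r + s + m - (n + 2) : ℕ) - 1 - N : ℤ)
            = m + r - 1 - N - (n + 2 - m - s) := by omega
        rw [e]; push_cast; ring
      · rw [hc.neg, hc.neg (m + (r + s + m - (n + 2) : ℕ) - 1 - N)]
        · simp
        · omega
        · omega
    · simp [hN]
  · simp only [killC, structC, if_pos hlr, if_neg hls]
    by_cases hN : m ≤ N
    · rw [max_eq_right (by unfold lowIdx at *; omega)]; simp [hN]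
    · rw [max_eq_right (a := (n + 1 - m - (m + s - 1 - N) : ℤ)) (by unfold lowIdx at *; omega)]
      simp [hN]
  · simp only [killC, structC, if_neg hlr, if_pos hls]
    by_cases hN : m ≤ N
    · rw [max_eq_right (a := ((m + s - 1 - N) - (n + 1 - m) : ℤ)) (by unfold lowIdx at *; omega)]
      simp [hN]
    · rw [max_eq_right (by unfold lowIdx at *; omega)]; simp [hN]
  · have hl : ¬ lowIdx n m (r + s + m - (n + 2)) := by unfold lowIdx at *; omega
    simp only [killC, structC, if_neg hlr, if_neg hls, if_neg hl, hc1]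
    by_cases hN : m ≤ N
    · simp [hN]
    · simp only [if_neg hN]
      rw [max_eq_left (by unfold lowIdx at *; omega), max_eq_left (by unfold lowIdx at *; omega)]
      have e : (m + (r + s + m - (n + 2) : ℕ) - 1 - N : ℤ)
          = m + r - 1 - N - (n + 2 - m - s) := by unfold lowIdx at *; omega
      rw [e]; push_cast; ring

/-- The generating polynomial of the components of `J_s`. -/
def polyJ (n m s : ℕ) (c : ℤ → R) : R[X] :=
  ∑ k ∈ Finset.range n, C (killC n m s c (k + 1)) * X ^ (n - 1 - k)

theorem coeff_polyJ (hc : IsCoord n c) (hm : m ≤ n + 1) (s : ℕ) (N : ℕ) :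
    (polyJ n m s c).coeff N = killC n m s c (n - N) := by
  unfold polyJ
  simp only [finsetSum_coeff, coeff_C_mul, coeff_X_pow, mul_ite, mul_one, mul_zero]
  by_cases hN : N < n
  · rw [Finset.sum_eq_single (n - 1 - N)]
    · rw [if_pos (by omega)]; congr 1; omega
    · intro k hk hk'
      rw [Finset.mem_range] at hk
      rw [if_neg (by omega)]
    · intro h; rw [Finset.mem_range] at h; omega
  · rw [Finset.sum_eq_zero, killC_zero hc hm s _ (by omega)]
    intro k hk
    rw [Finset.mem_range] at hk
    rw [if_neg (by omega)]

/-- Formally `J_s = X^m (X^(-m) F_s)'`: the weight of a coordinate in `J_s` is its exponent in `F_s`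
minus `m`. The factor `X` avoids negative powers. -/
theorem X_mul_polyJ (hc : IsCoord n c) (hm : m ≤ n + 1) (s : ℕ) :
    X * polyJ n m s c = X * derivative (polyF n m s c) - (m : R[X]) * polyF n m s c := by
  have e : ∀ N, ((m : R[X]) * polyF n m s c).coeff N = m * (polyF n m s c).coeff N := by
    intro N; rw [← C_eq_natCast, coeff_C_mul]
  ext N
  cases N with
  | zero =>
    rw [coeff_sub, coeff_X_mul_zero, coeff_X_mul_zero, e, coeff_polyF hc]
    rcases Nat.eq_zero_or_pos m with rfl | h
    · simp
    · rw [if_neg (by omega : ¬ m ≤ 0)]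
      by_cases hl : lowIdx n m s
      · simp [hl]
      · rw [if_neg hl, if_neg (by omega), hc.big]
        · simp
        · unfold lowIdx at hl; push_cast; omega
  | succ N =>
    rw [coeff_sub, coeff_X_mul, coeff_X_mul, e, coeff_derivative, coeff_polyJ hc hm, coeff_polyF hc,
      killC]
    have e1 : (n - N - (n + 2 - m - s) : ℤ) = m + s - 1 - (N + 1 : ℕ) := by push_cast; ring
    rw [e1]
    by_cases hl : lowIdx n m s
    · simp only [if_pos hl]
      by_cases hN : m ≤ N + 1
      · rw [if_pos hN, max_eq_left (by omega)]; push_cast; ring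
      · rw [if_neg hN, max_eq_right (by omega)]; simp
    · simp only [if_neg hl]
      by_cases hN : m ≤ N + 1
      · rw [if_pos hN, max_eq_right (by omega)]; simp
      · rw [if_neg hN, max_eq_left (by omega)]; push_cast; ring

end KillingFlow

/-! ### The flow of `J_s` on the characteristic polynomial and on `b` -/

section Flow

variable {R : Type*} [CommRing R] {n m : ℕ} {c p : ℤ → R}

/-- The polynomial `b = ∑ p_k β_k`, which takes the values `-μ_i` at the roots `λ_i`. -/
def polyB (n : ℕ) (c p : ℤ → R) : R[X] := ∑ k ∈ Finset.range (n + 1), C (p k) * beta c k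

/-- A derivation acts on the momenta as the Hamiltonian flow of `∑ J_s^k p_k`. -/
def FlowsAlongDual (n m s : ℕ) (p : ℤ → R) (δ : Derivation ℤ R R) : Prop :=
  ∀ k : ℤ, 1 ≤ k → k ≤ n → δ (p k) =
    -(if lowIdx n m s then ((max (s - 1 - k) 0 : ℤ) : R) else ((max (k - (s - 1)) 0 : ℤ) : R))
      * p (k + (n + 2 - m - s))

/-- The polynomials `Z_s` with `F_s = X^m β_s - Z_s a`. -/
def polyZ (R : Type*) [CommRing R] (n m s : ℕ) : R[X] :=
  if lowIdx n m s then 0 else X ^ (m + s - 1 - n)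

/-- The polynomials `Y_s` with `J_s = X^m β_s' - Z_s a' - Y_s a`. -/
def polyY (R : Type*) [CommRing R] (n m s : ℕ) : R[X] :=
  if lowIdx n m s then 0 else ((s : R[X]) - 1 - (n : R[X])) * X ^ (m + s - 2 - n)

theorem polyF_eq (n m s : ℕ) (c : ℤ → R) :
    polyF n m s c = X ^ m * beta c s - polyZ R n m s * beta c (n + 1) := by
  unfold polyF polyZ; split_ifs <;> simp

theorem coeffD_polyZ (δ : Derivation ℤ R R) (s : ℕ) : coeffD δ (polyZ R n m s) = 0 := by
  unfold polyZ; split_ifs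
  · simp
  · exact coeffD_X_pow _ _

theorem X_mul_derivative_X_pow (k : ℕ) : (X : R[X]) * derivative (X ^ k) = (k : R[X]) * X ^ k := by
  cases k with
  | zero => simp
  | succ k => rw [derivative_X_pow]; simp [pow_succ]; ring

/-- This is the Leibniz rule for `F_s = X^m β_s - Z_s a`, after cancelling the regular element `X`.
It exhibits the part of `J_s` that is visible modulo `a`. -/
theorem polyJ_eq (hc : IsCoord n c) (hm : m ≤ n + 1) (s : ℕ) :
    polyJ n m s c = X ^ m * derivative (beta c s) - polyZ R n m s * derivative (beta c (n + 1))
      - polyY R n m s * beta c (n + 1) := by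
  apply (monic_X (R := R)).isRegular.left
  change X * _ = X * _
  rw [X_mul_polyJ hc hm, polyF_eq]
  have h1 := X_mul_derivative_X_pow (R := R) m
  simp only [derivative_sub, derivative_mul]
  unfold polyZ polyY
  split_ifs with hl
  · simp only [derivative_zero]; linear_combination beta c s * h1
  · unfold lowIdx at hl
    have h2 := X_mul_derivative_X_pow (R := R) (m + s - 1 - n)
    obtain ⟨k, hk⟩ : ∃ k, m + s = n + 2 + k := ⟨m + s - (n + 2), by omega⟩
    have e1 : m + s - 1 - n = k + 1 := by omega
    have e2 : m + s - 2 - n = k := by omega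
    have hk' : (m : R[X]) + (s : R[X]) = (n : R[X]) + 2 + (k : R[X]) := by exact_mod_cast congrArg (Nat.cast (R := R[X])) hk
    rw [e1] at h2
    rw [e1, e2]
    push_cast at h2
    linear_combination beta c s * h1 - beta c (n + 1) * h2
      + X ^ (k + 1) * beta c (n + 1) * hk'

theorem coeffD_beta_succ (δ : Derivation ℤ R R) (k : ℕ) :
    coeffD δ (beta c (k + 1)) = X * coeffD δ (beta c k) + C (δ (c k)) := by
  rw [beta_succ, map_add, coeffD_mul, coeffD_X, coeffD_C]; ring

theorem coeffD_charpoly (hc : IsCoord n c) (hm : m ≤ n + 1) {s : ℕ} {δ : Derivation ℤ R R}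
    (hδ : FlowsAlong n m s c δ) : coeffD δ (beta c (n + 1)) = polyJ n m s c := by
  ext N
  rw [coeff_coeffD, coeff_beta hc, hδ, coeff_polyJ hc hm]
  congr 1; push_cast; ring

variable [Nontrivial R]

theorem degree_polyB_lt (hc : IsCoord n c) : (polyB n c p).degree < n ∨ n = 0 := by
  rcases Nat.eq_zero_or_pos n with h | h
  · exact Or.inr h
  left
  rw [degree_lt_iff_coeff_zero]
  intro N hN
  unfold polyB
  rw [finsetSum_coeff]
  refine Finset.sum_eq_zero fun k hk => ?_
  rw [Finset.mem_range] at hk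
  rw [coeff_C_mul, coeff_beta hc, hc.neg, mul_zero]
  omega

/-- The momenta are the moments of `b`, because the `β_{k+1}` and the `X^(n-1-k)` are dual bases for
the residue pairing. -/
theorem res_polyB_mul_X_pow (hc : IsCoord n c) {j : ℕ} (hj : j < n) :
    res (beta c (n + 1)) (polyB n c p * X ^ j) = p (n - j) := by
  have ha := beta_monic hc n
  unfold polyB
  rw [Finset.sum_mul, map_sum, Finset.sum_range_succ']
  simp only [beta_zero, mul_zero, zero_mul, map_zero, add_zero]
  have e : ∀ k ∈ Finset.range n, res (beta c (n + 1)) (C (p (k + 1 : ℕ)) * beta c (k + 1) * X ^ j)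
      = if k = n - 1 - j then p (n - j) else 0 := by
    intro k hk
    rw [Finset.mem_range] at hk
    rw [mul_assoc, res_C_mul, ← coeff_mod_eq_res hc k hk, (modByMonic_eq_self_iff ha).2, coeff_X_pow]
    · by_cases h : k = n - 1 - j
      · rw [if_pos h, if_pos (by omega), mul_one]; congr 1; omega
      · rw [if_neg h, if_neg (by omega), mul_zero]
    · rw [degree_charpoly hc, degree_X_pow]; exact_mod_cast hj
  rw [Finset.sum_congr rfl e, Finset.sum_ite_eq', if_pos (by rw [Finset.mem_range]; omega)]

/-- The flow of the vector field `J_s` on the polynomial `b`. -/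
theorem flow_polyB (hc : IsCoord n c) (hn : 0 < n) (hm : m ≤ n + 1) {s : ℕ} (h1 : 1 ≤ s)
    (hs : s ≤ n) {δ : Derivation ℤ R R} (hδ : FlowsAlong n m s c δ)
    (hδp : FlowsAlongDual n m s p δ) :
    beta c (n + 1) ∣ coeffD δ (polyB n c p)
      - (derivative ((polyB n c p * polyF n m s c) /ₘ beta c (n + 1))
        - beta c s * derivative ((polyB n c p * X ^ m) /ₘ beta c (n + 1))) := by
  have ha := beta_monic hc n
  have hn' := charpoly_natDegree_pos hc hn
  -- The contribution `∑ p_k δβ_k` of the moving coordinates is the quotient of `b J_s` by `a`.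
  have h2 := sum_mul_shift_eq_div hc p (fun k => δ (c k)) (fun k => coeffD δ (beta c k))
    (by simp) (fun k => coeffD_beta_succ δ k)
  have hres : ∀ j, j < n → res (beta c (n + 1)) (polyB n c p * X ^ j) = p (n - j) :=
    fun j hj => res_polyB_mul_X_pow hc hj
  change _ = (polyB n c p * coeffD δ (beta c (n + 1))) /ₘ beta c (n + 1) at h2
  rw [coeffD_charpoly hc hm hδ] at h2
  have h3 : coeffD δ (polyB n c p) = ∑ k ∈ Finset.range (n + 1), C (δ (p k)) * beta c k
      + (polyB n c p * polyJ n m s c) /ₘ beta c (n + 1) := by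
    rw [← h2, ← Finset.sum_add_distrib]
    conv_lhs => rw [polyB]
    rw [map_sum]
    refine Finset.sum_congr rfl fun k _ => ?_
    rw [coeffD_mul, coeffD_C]; ring
  have hA := sum_nsmul_res_mul_beta (c := c) ha hn' (polyB n c p) s m
  -- Natural subtraction makes the weight zero from `k = s - 1` on, so the range can be enlarged.
  have hsub : ∑ k ∈ Finset.range s, ((s - 1 - k : ℕ) : R[X])
        * (C (res (beta c (n + 1)) (polyB n c p * X ^ (m + s - 2 - k))) * beta c k)
      = ∑ k ∈ Finset.range (n + 1), ((s - 1 - k : ℕ) : R[X])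
        * (C (res (beta c (n + 1)) (polyB n c p * X ^ (m + s - 2 - k))) * beta c k) := by
    refine Finset.sum_subset (fun k hk => ?_) (fun k _ hk => ?_)
    · rw [Finset.mem_range] at *; omega
    · rw [Finset.mem_range] at hk
      rw [show s - 1 - k = 0 by omega]; simp
  rw [hsub] at hA
  have hcast : ∀ (z : ℤ) (x : R), C ((z : R) * x) = (z : R[X]) * C x := by intro z x; simp
  rw [h3, polyJ_eq hc hm, polyF_eq]
  by_cases hl : lowIdx n m s
  · have e : ∑ k ∈ Finset.range (n + 1), C (δ (p k)) * beta c k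
        = - ∑ k ∈ Finset.range (n + 1), ((s - 1 - k : ℕ) : R[X])
        * (C (res (beta c (n + 1)) (polyB n c p * X ^ (m + s - 2 - k))) * beta c k) := by
      rw [← Finset.sum_neg_distrib]
      refine Finset.sum_congr rfl fun k hk => ?_
      rw [Finset.mem_range] at hk
      rcases Nat.eq_zero_or_pos k with rfl | hk0
      · simp
      rw [hδp k (by omega) (by omega), if_pos hl, neg_mul, C_neg, hcast]
      rcases le_or_gt s (k + 1) with h | h
      · rw [max_eq_right (by omega), show s - 1 - k = 0 by omega]; simp
      · rw [max_eq_left (by omega), hres _ (by unfold lowIdx at hl; omega)]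
        have e1 : ((s : ℤ) - 1 - k) = ((s - 1 - k : ℕ) : ℤ) := by omega
        have e2 : (n - (m + s - 2 - k : ℕ) : ℤ) = k + (n + 2 - m - s) := by omega
        rw [e1, e2]; push_cast; ring
    rw [e, hA]
    unfold polyZ polyY
    simp only [if_pos hl, zero_mul, sub_zero, mul_assoc]
    convert dvd_zero _ using 1
    ring
  · have hl' := hl
    unfold lowIdx at hl'
    obtain ⟨κ, hκ⟩ : ∃ κ, m + s = n + 2 + κ := ⟨m + s - (n + 2), by omega⟩
    -- For the second kind the weight is rewritten as `-max(k-s+1, 0) = (n-k) - (n+1-s) - max(s-1-k,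
    -- 0)`. The first two parts are sums of the previous type with `n + 1` in place of `s`.
    have hA' := sum_nsmul_res_mul_beta (c := c) ha hn' (polyB n c p) (n + 1) (κ + 1)
    have hB' := sum_res_mul_beta (c := c) ha hn' (polyB n c p) (n + 1) κ
    have e : ∑ k ∈ Finset.range (n + 1), C (δ (p k)) * beta c k
        = ∑ k ∈ Finset.range (n + 1), ((n + 1 - 1 - k : ℕ) : R[X])
            * (C (res (beta c (n + 1)) (polyB n c p * X ^ (κ + 1 + (n + 1) - 2 - k))) * beta c k)
          - ((n : R[X]) + 1 - (s : R[X])) * ∑ k ∈ Finset.range (n + 1),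
              C (res (beta c (n + 1)) (polyB n c p * X ^ (κ + (n + 1) - 1 - k))) * beta c k
          - ∑ k ∈ Finset.range (n + 1), ((s - 1 - k : ℕ) : R[X])
        * (C (res (beta c (n + 1)) (polyB n c p * X ^ (m + s - 2 - k))) * beta c k) := by
      rw [Finset.mul_sum, ← Finset.sum_sub_distrib, ← Finset.sum_sub_distrib]
      refine Finset.sum_congr rfl fun k hk => ?_
      rw [Finset.mem_range] at hk
      rcases Nat.eq_zero_or_pos k with rfl | hk0
      · simp
      have i1 : κ + 1 + (n + 1) - 2 - k = m + s - 2 - k := by omega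
      have i2 : κ + (n + 1) - 1 - k = m + s - 2 - k := by omega
      rw [i1, i2, hδp k (by omega) (by omega), if_neg hl, neg_mul, C_neg, hcast]
      rcases le_or_gt s k with h | h
      · rw [max_eq_left (by omega), hres _ (by omega), show s - 1 - k = 0 by omega]
        have e2 : (n - (m + s - 2 - k : ℕ) : ℤ) = k + (n + 2 - m - s) := by omega
        have e3 : ((n + 1 - 1 - k : ℕ) : R[X]) = (n : R[X]) - (k : R[X]) := by
          rw [Nat.add_sub_cancel, Nat.cast_sub (by omega)]
        rw [e2, e3]; push_cast; ring
      · rw [max_eq_right (by omega)]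
        have e3 : ((n + 1 - 1 - k : ℕ) : R[X]) = (n : R[X]) - (k : R[X]) := by
          rw [Nat.add_sub_cancel, Nat.cast_sub (by omega)]
        have e4 : ((s - 1 - k : ℕ) : R[X]) = (s : R[X]) - 1 - (k : R[X]) := by
          rw [Nat.sub_sub, Nat.cast_sub (by omega)]; push_cast; ring
        rw [e3, e4]; push_cast; ring
    rw [e, hA, hA', hB']
    unfold polyZ polyY
    simp only [if_neg hl]
    have i1 : m + s - 1 - n = κ + 1 := by omega
    have i2 : m + s - 2 - n = κ := by omega
    rw [i1, i2]
    have q1 : polyB n c p * X ^ (κ + 1) * beta c (n + 1) /ₘ beta c (n + 1)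
        = polyB n c p * X ^ (κ + 1) := by
      rw [mul_comm]; exact mul_divByMonic_cancel_left _ ha
    have q2 : polyB n c p * X ^ κ * beta c (n + 1) /ₘ beta c (n + 1)
        = polyB n c p * X ^ κ := by
      rw [mul_comm]; exact mul_divByMonic_cancel_left _ ha
    have q3 : polyB n c p * (X ^ m * derivative (beta c s)
          - X ^ (κ + 1) * derivative (beta c (n + 1))
          - ((s : R[X]) - 1 - (n : R[X])) * X ^ κ * beta c (n + 1)) /ₘ beta c (n + 1)
        = (polyB n c p * X ^ m * derivative (beta c s)) /ₘ beta c (n + 1)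
          - (polyB n c p * X ^ (κ + 1) * derivative (beta c (n + 1))) /ₘ beta c (n + 1)
          - ((s : R[X]) - 1 - (n : R[X])) * (polyB n c p * X ^ κ) := by
      have : polyB n c p * (X ^ m * derivative (beta c s)
          - X ^ (κ + 1) * derivative (beta c (n + 1))
          - ((s : R[X]) - 1 - (n : R[X])) * X ^ κ * beta c (n + 1))
        = polyB n c p * X ^ m * derivative (beta c s)
          - polyB n c p * X ^ (κ + 1) * derivative (beta c (n + 1))
          - C ((s : R) - 1 - (n : R)) * (polyB n c p * X ^ κ * beta c (n + 1)) := by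
        simp; ring
      rw [this, sub_divByMonic' ha, sub_divByMonic' ha, C_mul_divByMonic' ha, q2]
      simp
    have q4 : polyB n c p * (X ^ m * beta c s - X ^ (κ + 1) * beta c (n + 1)) /ₘ beta c (n + 1)
        = (polyB n c p * X ^ m * beta c s) /ₘ beta c (n + 1) - polyB n c p * X ^ (κ + 1) := by
      rw [mul_sub, sub_divByMonic' ha, ← mul_assoc, ← mul_assoc, q1]
    rw [q1, q2, q3, q4]
    -- The witness collects the terms of `hA'` and `hB'` that carry the factor `β_{n+1} = a`.
    refine ⟨derivative ((polyB n c p * X ^ (κ + 1)) /ₘ beta c (n + 1))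
      + ((n : R[X]) + 1 - (s : R[X])) * ((polyB n c p * X ^ κ) /ₘ beta c (n + 1)), ?_⟩
    simp only [derivative_sub]
    ring

end Flow

/-! ### Brackets of kinetic and magnetic terms with the Killing Hamiltonians -/

section Brackets

variable {R : Type*} [CommRing R] [Nontrivial R] {n m : ℕ} {c p : ℤ → R}

/-- The brackets of the geodesic Hamiltonians with the Killing vector fields. -/
theorem flow_geodesic_sub (hc : IsCoord n c) (hn : 0 < n) (hm : m ≤ n + 1) {r s : ℕ}
    (hr : 1 ≤ r) (hr' : r ≤ n) (hs : 1 ≤ s) (hs' : s ≤ n) {δr δs : Derivation ℤ R R}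
    (hδr : FlowsAlong n m r c δr) (hδrp : FlowsAlongDual n m r p δr)
    (hδs : FlowsAlong n m s c δs) (hδsp : FlowsAlongDual n m s p δs) :
    δs (res (beta c (n + 1)) (beta c r * (X ^ m * polyB n c p ^ 2)))
      - δr (res (beta c (n + 1)) (beta c s * (X ^ m * polyB n c p ^ 2)))
      = structC n m r s * res (beta c (n + 1))
          (beta c (r + s + m - (n + 2)) * (X ^ m * polyB n c p ^ 2)) := by
  have ha := beta_monic hc n
  have hn' := charpoly_natDegree_pos hc hn
  have hJr := coeffD_charpoly hc hm hδr
  have hJs := coeffD_charpoly hc hm hδs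
  have hbr := flow_polyB (p := p) hc hn hm hr hr' hδr hδrp
  have hbs := flow_polyB (p := p) hc hn hm hs hs' hδs hδsp
  have hcomb := coeffD_polyF_sub hc hm hr hs hδr hδs
  set b := polyB n c p
  set a := beta c (n + 1)
  -- Modulo `a`, `X^m β_s` may be replaced by `F_s`, for which the antisymmetrized flow is known.
  have hF : ∀ s, res a (beta c s * (X ^ m * b ^ 2)) = res a (b ^ 2 * polyF n m s c) := by
    intro s
    apply res_congr ha
    exact ⟨polyZ R n m s * b ^ 2, by rw [polyF_eq]; ring⟩
  rw [hF, hF, hF, derivation_res δs ha hn', derivation_res δr ha hn', hJr, hJs]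
  -- The terms `-m F` in `X J = X F' - m F` cancel by antisymmetry, so a Wronskian remains.
  have hJ : polyF n m r c * polyJ n m s c - polyF n m s c * polyJ n m r c
      = polyF n m r c * derivative (polyF n m s c) - polyF n m s c * derivative (polyF n m r c) := by
    apply (monic_X (R := R)).isRegular.left
    change X * _ = X * _
    linear_combination polyF n m r c * X_mul_polyJ hc hm s - polyF n m s c * X_mul_polyJ hc hm r
  have hkey := res_quotient_identity' ha hn' b b (polyF n m s c) (polyF n m r c)
  have e1 : res a (coeffD δs (b ^ 2 * polyF n m r c)) - res a (coeffD δr (b ^ 2 * polyF n m s c))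
      = res a (2 * (b * (polyF n m r c * derivative ((b * polyF n m s c) /ₘ a)
          - polyF n m s c * derivative ((b * polyF n m r c) /ₘ a)))
        + b ^ 2 * ((structC n m r s : R[X]) * polyF n m (r + s + m - (n + 2)) c)) := by
    rw [← map_sub]
    apply res_congr ha
    obtain ⟨u, hu⟩ := hbr
    obtain ⟨v, hv⟩ := hbs
    have hu' := eq_add_of_sub_eq hu
    have hv' := eq_add_of_sub_eq hv
    rw [← hcomb]
    simp only [coeffD_mul, pow_two]
    rw [hu', hv']
    have f1 : polyF n m r c * beta c s - polyF n m s c * beta c r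
        = a * (polyZ R n m s * beta c r - polyZ R n m r * beta c s) := by
      rw [polyF_eq, polyF_eq]; ring
    refine ⟨2 * b * (polyF n m r c * v - polyF n m s c * u)
      - 2 * b * derivative (b * X ^ m /ₘ a)
        * (polyZ R n m s * beta c r - polyZ R n m r * beta c s), ?_⟩
    linear_combination - 2 * b * derivative (b * X ^ m /ₘ a) * f1
  have e2 : res (a ^ 2) (b ^ 2 * polyF n m r c * polyJ n m s c)
      - res (a ^ 2) (b ^ 2 * polyF n m s c * polyJ n m r c)
      = res (a ^ 2) (b * b * (polyF n m r c * derivative (polyF n m s c)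
        - polyF n m s c * derivative (polyF n m r c))) := by
    rw [← map_sub, ← hJ]; congr 1; ring
  have e3 : ∀ G : R[X], res a (2 * G) = 2 * res a G := by
    intro G; rw [two_mul, map_add, two_mul]
  rw [map_add, e3] at e1
  have e4 : res a (b ^ 2 * ((structC n m r s : R[X]) * polyF n m (r + s + m - (n + 2)) c))
      = structC n m r s * res a (b ^ 2 * polyF n m (r + s + m - (n + 2)) c) := by
    rw [← res_C_mul]; congr 1; simp; ring
  rw [e4] at e1
  -- For `F = G = b` the identity `hkey` matches the simple poles, which carry a factor two from
  -- `b²`, with the double pole. Only the structure constant term is left.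
  linear_combination e1 - e2 + hkey

/-- The action of the index `s` on the coefficients of magnetic terms. -/
def polyD (n m s : ℕ) (c : ℤ → R) (d : R[X]) : R[X] :=
  X ^ m * derivative ((d * beta c s) /ₘ beta c (n + 1)) - polyZ R n m s * derivative d
    - polyY R n m s * d

/-- The brackets of the magnetic terms with the Killing vector fields. -/
theorem flow_magnetic_sub (hc : IsCoord n c) (hn : 0 < n) (hm : m ≤ n + 1)
    (hX : ∀ G : R[X], beta c (n + 1) ∣ X ^ m * G → beta c (n + 1) ∣ G) {r s : ℕ}
    (hr : 1 ≤ r) (hr' : r ≤ n) (hs : 1 ≤ s) (hs' : s ≤ n) {δr δs : Derivation ℤ R R}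
    (hδr : FlowsAlong n m r c δr) (hδrp : FlowsAlongDual n m r p δr)
    (hδs : FlowsAlong n m s c δs) (hδsp : FlowsAlongDual n m s p δs)
    (d : R[X]) (hdr : coeffD δr d = 0) (hds : coeffD δs d = 0) :
    δs (res (beta c (n + 1)) (beta c r * (d * polyB n c p)))
      - δr (res (beta c (n + 1)) (beta c s * (d * polyB n c p)))
      = structC n m r s * res (beta c (n + 1)) (beta c (r + s + m - (n + 2)) * (d * polyB n c p))
        + res (beta c (n + 1)) (beta c s * (polyD n m r c d * polyB n c p))
        - res (beta c (n + 1)) (beta c r * (polyD n m s c d * polyB n c p)) := by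
  have ha := beta_monic hc n
  have hn' := charpoly_natDegree_pos hc hn
  have hJr := coeffD_charpoly hc hm hδr
  have hJs := coeffD_charpoly hc hm hδs
  have hbr := flow_polyB (p := p) hc hn hm hr hr' hδr hδrp
  have hbs := flow_polyB (p := p) hc hn hm hs hs' hδs hδsp
  have hcomb := coeffD_polyF_sub hc hm hr hs hδr hδs
  have hjr := polyJ_eq hc hm r
  have hjs := polyJ_eq hc hm s
  unfold polyD
  set b := polyB n c p
  set a := beta c (n + 1) with hadef
  set l := r + s + m - (n + 2)
  set Zr := polyZ R n m r with hZr
  set Zs := polyZ R n m s with hZs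
  set Yr := polyY R n m r
  set Ys := polyY R n m s
  -- the combination of the flows of `β_r` and `β_s`
  have hcomb2 : a ∣ coeffD δs (beta c r) - coeffD δr (beta c s) + Zs * derivative (beta c r)
      - Zr * derivative (beta c s) - (structC n m r s : R[X]) * beta c l := by
    -- The relation between the `F_s` carries a factor `X^m`, which can be cancelled since `X` is
    -- regular modulo `a`.
    apply hX
    rw [polyF_eq, polyF_eq, polyF_eq, map_sub, map_sub, coeffD_X_pow_mul, coeffD_X_pow_mul,
      coeffD_mul, coeffD_mul, coeffD_polyZ, coeffD_polyZ, ← hadef, hJr, hJs, hjr, hjs, ← hZr,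
      ← hZs] at hcomb
    refine ⟨- (structC n m r s : R[X]) * polyZ R n m l + Zs * Yr - Zr * Ys, ?_⟩
    linear_combination hcomb
  -- The quotients of `b X^m β` on the left come from the flow of `b`; those of `d β` are the ones
  -- in `polyD`. The identity thus trades a motion of `b` for a motion of `d`.
  have hkey := res_quotient_identity' ha hn' (b * X ^ m) d (beta c s) (beta c r)
  rw [derivation_res δs ha hn', derivation_res δr ha hn', hJr, hJs]
  -- The term `Z a'` of `J` creates a double pole, which integration by parts turns into a simple
  -- one.
  have hps := res_sq_parts ha hn' (d * b * beta c r * Zs)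
  have hpr := res_sq_parts ha hn' (d * b * beta c s * Zr)
  rw [res_sq_self_mul ha hn'] at hps hpr
  -- quotients of `b F_s`
  have hq : ∀ s, (b * polyF n m s c) /ₘ a = (b * X ^ m * beta c s) /ₘ a - b * polyZ R n m s := by
    intro s
    rw [polyF_eq, mul_sub, sub_divByMonic' ha, ← mul_assoc, ← mul_assoc b (polyZ R n m s),
      mul_comm _ (beta c (n + 1)), mul_divByMonic_cancel_left _ ha]
  rw [hq] at hbr hbs
  -- the double pole terms
  have e2 : res (a ^ 2) (beta c r * (d * b) * polyJ n m s c)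
      - res (a ^ 2) (beta c s * (d * b) * polyJ n m r c)
      = res (a ^ 2) (b * X ^ m * d * (beta c r * derivative (beta c s)
          - beta c s * derivative (beta c r)))
        - res a (derivative (d * b * beta c r * Zs)) + res a (derivative (d * b * beta c s * Zr))
        - res a (d * b * beta c r * Ys) + res a (d * b * beta c s * Yr) := by
    rw [hps, hpr, ← res_sq_self_mul ha hn' (d * b * beta c r * Ys),
      ← res_sq_self_mul ha hn' (d * b * beta c s * Yr), hjr, hjs]
    simp only [← map_sub, ← map_add]
    congr 1
    ring
  have e1 : res a (coeffD δs (beta c r * (d * b))) - res a (coeffD δr (beta c s * (d * b)))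
      = res a (d * (beta c r * derivative ((b * X ^ m * beta c s) /ₘ a)
          - beta c s * derivative ((b * X ^ m * beta c r) /ₘ a))
        - d * (beta c r * derivative (b * Zs) - beta c s * derivative (b * Zr))
        + d * b * ((structC n m r s : R[X]) * beta c l - Zs * derivative (beta c r)
          + Zr * derivative (beta c s))) := by
    rw [← map_sub]
    apply res_congr ha
    obtain ⟨u, hu⟩ := hbr
    obtain ⟨v, hv⟩ := hbs
    obtain ⟨w, hw⟩ := hcomb2
    have hu' := eq_add_of_sub_eq hu
    have hv' := eq_add_of_sub_eq hv
    simp only [coeffD_mul]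
    rw [hu', hv', hdr, hds]
    refine ⟨d * (beta c r * v - beta c s * u) + d * b * w, ?_⟩
    simp only [derivative_sub]
    linear_combination d * b * hw
  have e5 : res a (d * b * ((structC n m r s : R[X]) * beta c l))
      = structC n m r s * res a (beta c l * (d * b)) := by
    rw [← res_C_mul]; congr 1; simp; ring
  rw [← e5]
  have e6 : ∀ A B C D E F : R, A - B - (C - D) = (A - C) - (B - D) := by intros; ring
  rw [sub_sub_sub_comm, e1, e2]
  have hk2 := hkey
  rw [← hk2]
  simp only [← map_sub, ← map_add]
  congr 1
  simp only [derivative_mul]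
  ring

end Brackets

/-! ### Poisson brackets as derivations and the involution of Stäckel Hamiltonians -/

section Commuting

variable {R : Type*} [CommRing R] {n : ℕ}

/-- The derivation `{·, g}`. -/
def ham (dq dp : Fin n → Derivation ℤ R R) (g : R) : Derivation ℤ R R :=
  ∑ i, (dp i g • dq i - dq i g • dp i)

theorem ham_apply (dq dp : Fin n → Derivation ℤ R R) (f g : R) :
    ham dq dp g f = ∑ i, (dq i f * dp i g - dp i f * dq i g) := by
  unfold ham
  rw [← Derivation.coeFnAddMonoidHom_apply, map_sum, Finset.sum_apply]
  refine Finset.sum_congr rfl fun i _ => ?_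
  simp [mul_comm]

theorem ham_symm (dq dp : Fin n → Derivation ℤ R R) (f g : R) :
    ham dq dp g f = - ham dq dp f g := by
  rw [ham_apply, ham_apply, ← Finset.sum_neg_distrib]
  exact Finset.sum_congr rfl fun i _ => by ring

/-- Derivations `∂/∂q_i`, `∂/∂p_i` of a ring that contains the canonical coordinates. -/
structure IsCanonical (c p : ℤ → R) (dq dp : Fin n → Derivation ℤ R R) : Prop where
  qc : ∀ i k, dq i (c k) = if k = (i : ℤ) + 1 then 1 else 0
  pc : ∀ i k, dp i (c k) = 0
  qp : ∀ i k, dq i (p k) = 0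
  pp : ∀ i k, dp i (p k) = if k = (i : ℤ) + 1 then 1 else 0

variable {c p : ℤ → R} {dq dp : Fin n → Derivation ℤ R R}

theorem ham_coord (h : IsCanonical c p dq dp) (g : R) (k : ℕ) :
    ham dq dp g (c k) = if hk : 1 ≤ k ∧ k ≤ n then dp ⟨k - 1, by omega⟩ g else 0 := by
  rw [ham_apply]
  simp only [h.qc, h.pc, zero_mul, sub_zero]
  split_ifs with hk
  · rw [Finset.sum_eq_single ⟨k - 1, by omega⟩]
    · rw [if_pos (by simp only; omega), one_mul]
    · intro i _ hi
      rw [if_neg, zero_mul]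
      intro h'; apply hi; ext; simp only; omega
    · simp
  · refine Finset.sum_eq_zero fun i _ => ?_
    rw [if_neg (by have := i.2; omega), zero_mul]

theorem ham_momentum (h : IsCanonical c p dq dp) (g : R) (k : ℕ) :
    ham dq dp g (p k) = if hk : 1 ≤ k ∧ k ≤ n then - dq ⟨k - 1, by omega⟩ g else 0 := by
  rw [ham_apply]
  simp only [h.qp, h.pp, zero_mul, zero_sub]
  split_ifs with hk
  · rw [Finset.sum_eq_single ⟨k - 1, by omega⟩]
    · rw [if_pos (by simp only; omega), one_mul]
    · intro i _ hi
      rw [if_neg]; · simp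
      intro h'; apply hi; ext; simp only; omega
    · simp
  · refine Finset.sum_eq_zero fun i _ => ?_
    rw [if_neg (by have := i.2; omega)]; simp

end Commuting

section Commuting

variable {R : Type*} [CommRing R] {n : ℕ} {c p : ℤ → R} {dq dp : Fin n → Derivation ℤ R R}

theorem coeff_polyB (hc : IsCoord n c) (i : ℕ) :
    (polyB n c p).coeff i = ∑ k ∈ Finset.range (n + 1), p k * c (k - 1 - i) := by
  unfold polyB
  rw [finsetSum_coeff]
  exact Finset.sum_congr rfl fun k _ => by rw [coeff_C_mul, coeff_beta hc]

theorem coeffD_dp_beta (h : IsCanonical c p dq dp) (l : Fin n) (s : ℕ) :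
    coeffD (dp l) (beta c s) = 0 := by
  induction s with
  | zero => simp
  | succ s ih => rw [coeffD_beta_succ, ih, h.pc]; simp

theorem coeffD_dp_polyB (h : IsCanonical c p dq dp) (l : Fin n) :
    coeffD (dp l) (polyB n c p) = beta c (l + 1) := by
  unfold polyB
  rw [map_sum, Finset.sum_eq_single (l + 1 : ℕ)]
  · rw [coeffD_mul, coeffD_C, coeffD_dp_beta h, h.pp, if_pos (by push_cast; rfl)]; simp
  · intro k _ hk
    rw [coeffD_mul, coeffD_C, coeffD_dp_beta h, h.pp, if_neg (by intro h'; apply hk; omega)]; simp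
  · intro hl; rw [Finset.mem_range] at hl; have := l.2; omega

theorem dq_coeff_polyB (h : IsCanonical c p dq dp) (hc : IsCoord n c)
    (hp : ∀ k : ℤ, (n : ℤ) < k → p k = 0) (l : Fin n) (j : ℕ) :
    dq l ((polyB n c p).coeff j) = p (l + 2 + j) := by
  rw [coeff_polyB hc, map_sum]
  have e : ∀ k ∈ Finset.range (n + 1), dq l (p k * c (k - 1 - j))
      = if k = (l : ℕ) + 2 + j then p (l + 2 + j) else 0 := by
    intro k _
    rw [Derivation.leibniz, h.qc, h.qp]
    by_cases hk : k = (l : ℕ) + 2 + j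
    · rw [if_pos hk, if_pos (by rw [hk]; push_cast; ring), hk]; push_cast; simp
    · rw [if_neg hk, if_neg (by omega)]; simp
  rw [Finset.sum_congr rfl e, Finset.sum_ite_eq']
  split_ifs with hl
  · rfl
  · rw [hp]; rw [Finset.mem_range] at hl; omega

/-- After reindexing, the sum depends on `i` and `j` only through `i + j`; the terms lost at either
end vanish. This symmetry makes the coefficients of `b` commute. -/
theorem sum_shift_symm (hc : IsCoord n c) (hp : ∀ k : ℤ, (n : ℤ) < k → p k = 0) (i j : ℕ) :
    ∑ l ∈ Finset.range n, p (l + 2 + j) * c (l - i)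
      = ∑ u ∈ Finset.range n, p (u + i + j + 2) * c u := by
  rcases le_or_gt n i with h | h
  · rw [Finset.sum_eq_zero, Finset.sum_eq_zero]
    · intro u _; rw [hp _ (by omega), zero_mul]
    · intro l hl; rw [Finset.mem_range] at hl; rw [hc.neg _ (by omega), mul_zero]
  · obtain ⟨t, rfl⟩ : ∃ t, n = i + t := ⟨n - i, by omega⟩
    rw [Finset.sum_range_add]
    rw [add_comm i t, Finset.sum_range_add (fun u : ℕ => p (u + i + j + 2) * c u) t i]
    rw [Finset.sum_eq_zero (s := Finset.range i), zero_add]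
    · rw [Finset.sum_eq_zero (s := Finset.range i), add_zero]
      · refine Finset.sum_congr rfl fun u _ => ?_
        congr 2 <;> push_cast <;> ring
      · intro u _; rw [hp, zero_mul]; push_cast; omega
    · intro l hl; rw [Finset.mem_range] at hl; rw [hc.neg _ (by omega), mul_zero]

theorem ham_coeff_polyB_coeff_polyB (h : IsCanonical c p dq dp) (hc : IsCoord n c)
    (hp : ∀ k : ℤ, (n : ℤ) < k → p k = 0) (i j : ℕ) :
    ham dq dp ((polyB n c p).coeff i) ((polyB n c p).coeff j) = 0 := by
  have e : ∀ (l : Fin n) (i : ℕ), dp l ((polyB n c p).coeff i) = c (l - i) := by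
    intro l i
    rw [← coeff_coeffD, coeffD_dp_polyB h, coeff_beta hc]; congr 1; push_cast; ring
  rw [ham_apply]
  simp only [e, dq_coeff_polyB h hc hp]
  rw [Finset.sum_sub_distrib, sub_eq_zero]
  have e1 := Fin.sum_univ_eq_sum_range (fun l : ℕ => p (l + 2 + j) * c (l - i)) n
  have e2 := Fin.sum_univ_eq_sum_range (fun l : ℕ => p (l + 2 + i) * c (l - j)) n
  have e3 : ∑ x : Fin n, c (x - j) * p (x + 2 + i) = ∑ x : Fin n, p (x + 2 + i) * c (x - j) :=
    Finset.sum_congr rfl fun _ _ => mul_comm _ _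
  rw [e1, sum_shift_symm hc hp, e3, e2, sum_shift_symm hc hp]
  refine Finset.sum_congr rfl fun u _ => ?_
  congr 2; ring

/-- The coefficients of `a` are coordinates and `b` is linear in the momenta. Together with the
vanishing brackets among the coefficients of `b`, this determines the flow of `b` under every
Stäckel Hamiltonian. -/
theorem coeffD_ham_coeff_polyB_charpoly (h : IsCanonical c p dq dp) (hc : IsCoord n c)
    {i : ℕ} (hi : i < n) :
    coeffD (ham dq dp ((polyB n c p).coeff i)) (beta c (n + 1)) = beta c (n - i) := by
  ext N
  rw [coeff_coeffD, coeff_beta hc, coeff_beta hc]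
  rcases lt_or_ge N n with hN | hN
  · have e : (((n + 1 : ℕ) : ℤ) - 1 - N) = ((n - N : ℕ) : ℤ) := by omega
    rw [e, ham_coord h, dif_pos (by omega), ← coeff_coeffD, coeffD_dp_polyB h, coeff_beta hc]
    congr 1; simp only; omega
  · rw [hc.neg ((n - i : ℕ) - 1 - N) (by omega)]
    rcases hN.eq_or_lt with rfl | hN
    · rw [show (((n + 1 : ℕ) : ℤ) - 1 - n) = 0 by push_cast; ring, hc.zero]
      exact Derivation.map_one_eq_zero _
    · rw [hc.neg _ (by push_cast; omega), map_zero]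

variable [Nontrivial R]

/-- The Stäckel Hamiltonians generated by `α(X) b(X)² + 2 β(X) b(X)` are in involution. -/
theorem ham_stackel_stackel (h : IsCanonical c p dq dp) (hc : IsCoord n c) (hn : 0 < n)
    (hp : ∀ k : ℤ, (n : ℤ) < k → p k = 0) (α β : R[X])
    (hαq : ∀ i, coeffD (dq i) α = 0) (hαp : ∀ i, coeffD (dp i) α = 0)
    (hβq : ∀ i, coeffD (dq i) β = 0) (hβp : ∀ i, coeffD (dp i) β = 0)
    {r s : ℕ} (hr : r < n) (hs : s < n) :
    ham dq dp (res (beta c (n + 1)) (beta c (s + 1)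
        * (α * polyB n c p ^ 2 + 2 * (β * polyB n c p))))
      (res (beta c (n + 1)) (beta c (r + 1)
        * (α * polyB n c p ^ 2 + 2 * (β * polyB n c p)))) = 0 := by
  have ha := beta_monic hc n
  have hn' := charpoly_natDegree_pos hc hn
  have hconst : ∀ g, coeffD (ham dq dp g) α = 0 ∧ coeffD (ham dq dp g) β = 0 := by
    intro g
    constructor <;>
    · ext N
      rw [coeff_coeffD, ham_apply, coeff_zero]
      refine Finset.sum_eq_zero fun i _ => ?_
      simp only [← coeff_coeffD]
      simp [hαq, hαp, hβq, hβp]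
  have hbb : ∀ i, coeffD (ham dq dp ((polyB n c p).coeff i)) (polyB n c p) = 0 := by
    intro i; ext j
    rw [coeff_coeffD, ham_coeff_polyB_coeff_polyB h hc hp, coeff_zero]
  have hab : ∀ i, i < n → coeffD (ham dq dp ((polyB n c p).coeff i)) (beta c (n + 1))
      = beta c (n - i) := fun i hi => coeffD_ham_coeff_polyB_charpoly h hc hi
  have hdpb := coeffD_dp_polyB h
  have hdpa := fun l => coeffD_dp_beta h l (n + 1)
  have hdpβ := fun l s => coeffD_dp_beta h l s
  have hbdeg : (polyB n c p).degree < n := (degree_polyB_lt hc).resolve_right (by omega)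
  have hadeg := degree_charpoly hc
  set b := polyB n c p with hbdef
  set a := beta c (n + 1) with hadef
  set S := α * b ^ 2 + 2 * (β * b) with hS
  set Sb := 2 * α * b + 2 * β with hSb
  -- The coefficients of the remainder `E` are the Hamiltonians. The proof differentiates `E + a Q =
  -- S` along a flow; `Sb` is the derivative of `S` with respect to `b`.
  set E := S %ₘ a with hE
  set Q := S /ₘ a with hQ
  have hSE : E + a * Q = S := modByMonic_add_div S a
  have hcoe : ∀ k, k < n → res a (beta c (k + 1) * S) = E.coeff (n - 1 - k) :=
    fun k hk => (coeff_mod_eq_res hc k hk S).symm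
  have hEdeg : E.degree < n := by rw [← hadeg]; exact degree_modByMonic_lt _ ha
  have hEδ : ∀ (δ : Derivation ℤ R R) (k : ℕ), k < n →
      δ (E.coeff (n - 1 - k)) = res a (beta c (k + 1) * coeffD δ E) := by
    intro δ k hk
    rw [← coeff_mod_eq_res hc k hk, (modByMonic_eq_self_iff ha).2, coeff_coeffD]
    rw [hadeg]; exact degree_coeffD_lt δ hEdeg
  have hSδ : ∀ g, coeffD (ham dq dp g) S = Sb * coeffD (ham dq dp g) b := by
    intro g
    have h2 : coeffD (ham dq dp g) (2 : R[X]) = 0 := Derivation.map_natCast _ 2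
    rw [hS, map_add]
    simp only [coeffD_mul, pow_two, (hconst g).1, (hconst g).2, h2]
    ring
  -- the flow of the Hamiltonian on `b`
  have flowb : ∀ s, s < n → coeffD (ham dq dp (res a (beta c (s + 1) * S))) b
      = (beta c (s + 1) * Q) %ₘ a := by
    intro s hs
    ext i
    rw [coeff_coeffD]
    rcases lt_or_ge i n with hi | hi
    · rw [ham_symm, hcoe s hs, hEδ _ s hs]
      have e1 : coeffD (ham dq dp (b.coeff i)) E
          = - (beta c (n - i) * Q) - a * coeffD (ham dq dp (b.coeff i)) Q := by
        have := congrArg (coeffD (ham dq dp (b.coeff i))) hSE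
        rw [map_add, coeffD_mul, hab i hi, hSδ, hbb, mul_zero] at this
        linear_combination this
      obtain ⟨k, hk, hk'⟩ : ∃ k, k < n ∧ i = n - 1 - k := ⟨n - 1 - i, by omega, by omega⟩
      have e2 := coeff_mod_eq_res hc k hk (beta c (s + 1) * Q)
      rw [← hk'] at e2
      rw [e1, e2, show n - i = k + 1 by omega, ← map_neg]
      apply res_congr ha
      exact ⟨beta c (s + 1) * coeffD (ham dq dp (b.coeff i)) Q, by ring⟩
    · have e1 : b.coeff i = 0 := (degree_lt_iff_coeff_zero _ _).1 hbdeg i hi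
      have e2 := degree_modByMonic_lt (beta c (s + 1) * Q) ha
      rw [hadeg] at e2
      rw [e1, map_zero, (degree_lt_iff_coeff_zero _ _).1 e2 i hi]
  -- the flow of the Hamiltonian on `a`
  have flowa : ∀ s, s < n → coeffD (ham dq dp (res a (beta c (s + 1) * S))) a
      = (beta c (s + 1) * Sb) %ₘ a := by
    intro s hs
    have hdeg := degree_modByMonic_lt (beta c (s + 1) * Sb) ha
    rw [hadeg] at hdeg
    ext N
    rw [coeff_coeffD, hadef, coeff_beta hc, ← hadef]
    rcases lt_or_ge N n with hN | hN
    · obtain ⟨k, hk, rfl⟩ : ∃ k, k < n ∧ N = n - 1 - k := ⟨n - 1 - N, by omega, by omega⟩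
      have e : (((n + 1 : ℕ) : ℤ) - 1 - (n - 1 - k : ℕ)) = ((k + 1 : ℕ) : ℤ) := by omega
      rw [e, ham_coord h, dif_pos (by omega), derivation_res _ ha hn', hdpa, mul_zero, map_zero,
        sub_zero, hadef, coeff_mod_eq_res hc k hk, ← hadef]
      congr 1
      have h2 : ∀ l, coeffD (dp l) (2 : R[X]) = 0 := fun l => Derivation.map_natCast _ 2
      rw [hS, coeffD_mul, hdpβ, map_add]
      simp only [coeffD_mul, pow_two, hαp, hβp, h2, hdpb, Nat.add_sub_cancel]
      rw [hSb]; ring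
    · rw [(degree_lt_iff_coeff_zero _ _).1 hdeg N hN]
      rcases hN.eq_or_lt with rfl | hN
      · rw [show (((n + 1 : ℕ) : ℤ) - 1 - n) = 0 by push_cast; ring, hc.zero]
        exact Derivation.map_one_eq_zero _
      · rw [hc.neg _ (by push_cast; omega), map_zero]
  rw [hcoe r hr, hEδ _ r hr]
  have e := congrArg (coeffD (ham dq dp (res a (beta c (s + 1) * S)))) hSE
  rw [map_add, coeffD_mul, hSδ, flowa s hs, flowb s hs] at e
  -- Modulo `a` both reductions may be omitted, and the two products become `β_{s+1} Sb Q` with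
  -- opposite signs.
  have e3 : coeffD (ham dq dp (res a (beta c (s + 1) * S))) E
      = Sb * ((beta c (s + 1) * Q) %ₘ a) - ((beta c (s + 1) * Sb) %ₘ a) * Q
        - a * coeffD (ham dq dp (res a (beta c (s + 1) * S))) Q := by linear_combination e
  rw [e3, ← map_zero (res a)]
  apply res_congr ha
  obtain ⟨u, hu⟩ := dvd_modByMonic_sub (beta c (s + 1) * Q) a
  obtain ⟨v, hv⟩ := dvd_modByMonic_sub (beta c (s + 1) * Sb) a
  refine ⟨beta c (r + 1) * (Sb * u - Q * v
    - coeffD (ham dq dp (res a (beta c (s + 1) * S))) Q), ?_⟩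
  linear_combination beta c (r + 1) * (Sb * hu - Q * hv)

end Commuting

/-! ### Operators acting on the coefficients of polynomials -/

section CoeffMap

variable {R : Type*} [CommRing R]

/-- Application of an additive map to the coefficients of a polynomial. -/
def coeffMap (f : R →ₗ[ℤ] R) : R[X] →+ R[X] where
  toFun F := F.sum fun i x => monomial i (f x)
  map_zero' := by simp
  map_add' F G := by rw [Polynomial.sum_add_index] <;> simp

@[simp] theorem coeff_coeffMap (f : R →ₗ[ℤ] R) (F : R[X]) (i : ℕ) :
    (coeffMap f F).coeff i = f (F.coeff i) := by
  by_cases h : F.coeff i = 0 <;>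
    simp [coeffMap, Polynomial.sum_def, coeff_monomial, h]

theorem coeffMap_C_mul_X_pow (f : R →ₗ[ℤ] R) (x : R) (i : ℕ) :
    coeffMap f (C x * X ^ i) = C (f x) * X ^ i := by
  ext j
  simp only [coeff_coeffMap, coeff_C_mul, coeff_X_pow]
  split_ifs <;> simp

/-- Each `t < n` is a sum `i + l` in `t + 1` ways, and `g` vanishes from `n - 1` on. The shifted
form of the result matches the exponents `m + l - 1` of the first-order terms in the Laplace
operators. -/
theorem sum_range_sum_range_add {M : Type*} [AddCommMonoid M] {n : ℕ} (g : ℕ → M)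
    (hg : ∀ t, n ≤ t + 1 → g t = 0) :
    ∑ i ∈ Finset.range n, ∑ l ∈ Finset.range n, g (i + l)
      = ∑ l ∈ Finset.range n, l • g (l - 1) := by
  have e : ∀ i ∈ Finset.range n, ∑ l ∈ Finset.range n, g (i + l)
      = ∑ t ∈ Finset.range n, if i ≤ t then g t else 0 := by
    intro i hi
    rw [Finset.mem_range] at hi
    have := Finset.sum_Ico_eq_sum_range g i (i + n)
    rw [Nat.add_sub_cancel_left] at this
    rw [← this, ← Finset.sum_filter]
    symm
    apply Finset.sum_subset
    · intro t; simp only [Finset.mem_filter, Finset.mem_range, Finset.mem_Ico]; omega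
    · intro t; simp only [Finset.mem_filter, Finset.mem_range, Finset.mem_Ico]
      intro h h'; exact hg t (by omega)
  rw [Finset.sum_congr rfl e, Finset.sum_comm]
  have e2 : ∀ t ∈ Finset.range n, (∑ i ∈ Finset.range n, if i ≤ t then g t else 0)
      = (t + 1) • g t := by
    intro t ht
    rw [Finset.mem_range] at ht
    rw [← Finset.sum_filter, Finset.sum_const]
    congr 1
    have : (Finset.range n).filter (· ≤ t) = Finset.range (t + 1) := by ext; simp; omega
    rw [this, Finset.card_range]
  rw [Finset.sum_congr rfl e2]
  cases n with
  | zero => rfl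
  | succ n =>
    rw [Finset.sum_range_succ, hg n le_rfl, smul_zero, add_zero, Finset.sum_range_succ' _ n]
    simp

end CoeffMap

/-! ### The commuting frame and the separated Laplace operators -/

section Frame

variable {R : Type*} [CommRing R] {n : ℕ} {c : ℤ → R} {D : Fin n → Derivation ℤ R R}

/-- Commuting derivations `∂/∂c_1, …, ∂/∂c_n`. -/
structure IsPartials (c : ℤ → R) (D : Fin n → Derivation ℤ R R) : Prop where
  comm : ∀ i j x, D i (D j x) = D j (D i x)
  coord : ∀ (i : Fin n) (k : ℤ), D i (c k) = if k = i + 1 then 1 else 0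

/-- The derivations `𝔟_i = ∑_k c_{k-i} ∂_k`. -/
def frame (c : ℤ → R) (D : Fin n → Derivation ℤ R R) (i : ℕ) : Derivation ℤ R R :=
  ∑ k : Fin n, c (k - i) • D k

theorem frame_apply (i : ℕ) (x : R) : frame c D i x = ∑ k : Fin n, c (k - i) * D k x := by
  unfold frame
  rw [← Derivation.coeFnAddMonoidHom_apply, map_sum, Finset.sum_apply]
  rfl

/-- The bound on `j` is needed: beyond `n` the left side is zero while `c_{j-1-i}` need not be. The
symbols of the frame fields are the coefficients of `b`. -/
theorem frame_coord (hc : IsCoord n c) (hD : IsPartials c D) (i : ℕ) {j : ℤ} (hj : j ≤ n) :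
    frame c D i (c j) = c (j - 1 - i) := by
  rw [frame_apply]
  simp only [hD.coord]
  rcases lt_or_ge 0 j with h | h
  · rw [Finset.sum_eq_single (⟨(j - 1).toNat, by omega⟩ : Fin n)]
    · rw [if_pos (by simp only; omega), mul_one]; congr 1; simp only; omega
    · intro k _ hk
      rw [if_neg, mul_zero]
      intro h'; apply hk; ext; simp only; omega
    · simp
  · rw [hc.neg _ (by omega)]
    refine Finset.sum_eq_zero fun k _ => ?_
    rw [if_neg (by omega), mul_zero]

/-- The first-order terms of the composition depend only on `i + j` and the second-order terms are
symmetric. This is the operator counterpart of `ham_coeff_polyB_coeff_polyB`. -/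
theorem frame_comm (hc : IsCoord n c) (hD : IsPartials c D) (i j : ℕ) (x : R) :
    frame c D i (frame c D j x) = frame c D j (frame c D i x) := by
  have key : ∀ i j, frame c D i (frame c D j x) = ∑ k : Fin n, c (k - 1 - i - j) * D k x
      + ∑ k : Fin n, ∑ l : Fin n, c (k - i) * c (l - j) * D k (D l x) := by
    intro i j
    rw [frame_apply j, map_sum]
    simp only [Derivation.leibniz, smul_eq_mul]
    rw [Finset.sum_add_distrib, add_comm]
    congr 1
    · refine Finset.sum_congr rfl fun k _ => ?_
      rw [frame_coord hc hD i (by omega), mul_comm]; congr 2; ring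
    · rw [Finset.sum_comm]
      refine Finset.sum_congr rfl fun k _ => ?_
      rw [frame_apply, Finset.mul_sum]
      exact Finset.sum_congr rfl fun l _ => by ring
  rw [key, key, Finset.sum_comm (s := Finset.univ) (t := Finset.univ)
    (f := fun k l : Fin n => c (k - i) * c (l - j) * D k (D l x))]
  congr 1
  · exact Finset.sum_congr rfl fun k _ => by congr 2; ring
  · refine Finset.sum_congr rfl fun k _ => Finset.sum_congr rfl fun l _ => ?_
    rw [hD.comm]; ring

theorem coeffD_frame_beta (hc : IsCoord n c) (hD : IsPartials c D) (i : ℕ) {s : ℕ}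
    (hs : s ≤ n + 1) : coeffD (frame c D i) (beta c s) = beta c (s - 1 - i) := by
  ext N
  rw [coeff_coeffD, coeff_beta hc, coeff_beta hc, frame_coord hc hD i (by omega)]
  rcases le_or_gt (i + 1) s with h | h
  · congr 1; omega
  · rw [hc.neg _ (by omega), hc.neg _ (by omega)]

/-- The difference quotient `(β_s(x) - β_s(y))/(x - y)` equals `∑ x^i β_{s-1-i}(y)`; this is its
diagonal value. Consequently `∑ X^i 𝔟_i` acts on the `β_s` as `d/dX`. -/
theorem sum_X_pow_mul_beta (hc : IsCoord n c) {s N : ℕ} (hs : s ≤ N + 1) :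
    ∑ i ∈ Finset.range N, X ^ i * beta c (s - 1 - i) = derivative (beta c s) := by
  induction s generalizing N with
  | zero => simp
  | succ s ih =>
    cases N with
    | zero => have : s = 0 := by omega
              subst this; simp [beta_one hc]
    | succ N =>
      rw [Finset.sum_range_succ', beta_succ]
      have : ∀ i ∈ Finset.range N, X ^ (i + 1) * beta c (s + 1 - 1 - (i + 1))
          = X * (X ^ i * beta c (s - 1 - i)) := by
        intro i _
        rw [show s + 1 - 1 - (i + 1) = s - 1 - i by omega]; ring
      rw [Finset.sum_congr rfl this, ← Finset.mul_sum, ih (by omega)]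
      simp; ring

section

variable [Nontrivial R]

/-- The coordinate divergence of the vector fields with components `res (β_k G)`. -/
theorem sum_partial_res_beta_mul (hc : IsCoord n c) (hD : IsPartials c D) (hn : 0 < n) (G : R[X]) :
    ∑ k : Fin n, D k (res (beta c (n + 1)) (beta c (k + 1) * G))
      = res (beta c (n + 1)) (∑ i ∈ Finset.range n, X ^ i * coeffD (frame c D i) G
          - derivative G) := by
  have ha := beta_monic hc n
  have hn' := charpoly_natDegree_pos hc hn
  -- `β_{k+1}` contains only coordinates of index at most `k`, whereas `D k` differentiates with
  -- respect to `c_{k+1}`.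
  have e1 : ∀ k : Fin n, D k (res (beta c (n + 1)) (beta c (k + 1) * G))
      = ∑ i ∈ Finset.range n, c (k - i) * D k (res (beta c (n + 1)) (X ^ i * G)) := by
    intro k
    rw [beta_eq_sum hc (Nat.succ_le_of_lt k.2), Finset.sum_mul, map_sum, map_sum]
    refine Finset.sum_congr rfl fun i _ => ?_
    rw [mul_assoc, res_C_mul, Derivation.leibniz, hD.coord, if_neg (by push_cast; omega)]
    simp
  have e2 : ∀ i : ℕ, ∑ k : Fin n, c (k - i) * D k (res (beta c (n + 1)) (X ^ i * G))
      = res (beta c (n + 1)) (X ^ i * coeffD (frame c D i) G)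
        - res (beta c (n + 1) ^ 2) (X ^ i * beta c (n - i) * G) := by
    intro i
    rw [← frame_apply, derivation_res _ ha hn', coeffD_frame_beta hc hD i le_rfl,
      coeffD_X_pow_mul]
    congr 2
    rw [show n + 1 - 1 - i = n - i by omega]; ring
  rw [Finset.sum_congr rfl fun k _ => e1 k, Finset.sum_comm, Finset.sum_congr rfl fun i _ => e2 i,
    Finset.sum_sub_distrib, ← map_sum, ← map_sum, ← Finset.sum_mul]
  have e3 := sum_X_pow_mul_beta hc (le_refl (n + 1))
  rw [show n + 1 - 1 = n by omega] at e3
  rw [e3, ← res_sq_parts ha hn', res_sq_self_mul ha hn', map_sub]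

end

/-- The constituents of the separated Laplace operators. -/
def sepOp (n : ℕ) (c : ℤ → R) (D : Fin n → Derivation ℤ R R) (v : R) : Fin n ⊕ Fin n × Fin n → R →ₗ[ℤ] R
  | .inl l => -(((l : ℕ) + v) • (frame c D l : R →ₗ[ℤ] R))
  | .inr (i, l) => (frame c D i : R →ₗ[ℤ] R) ∘ₗ (frame c D l : R →ₗ[ℤ] R)

/-- The exponents of the constituents of the separated Laplace operators. -/
def sepExp (n m : ℕ) : Fin n ⊕ Fin n × Fin n → ℕ
  | .inl l => m + l - 1
  | .inr (i, l) => m + i + l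

/-- The polynomial whose residues are the separated Laplacians of `ψ`. -/
def sepPoly (n m : ℕ) (c : ℤ → R) (D : Fin n → Derivation ℤ R R) (v : R) (ψ : R) : R[X] := ∑ x, C (sepOp n c D v x ψ) * X ^ sepExp n m x

/-- The Laplace operator of the tensor `A_r`. -/
def lap (n m : ℕ) (c : ℤ → R) (D : Fin n → Derivation ℤ R R) (v : R) (r : ℕ) (ψ : R) : R := res (beta c (n + 1)) (beta c r * sepPoly n m c D v ψ)

/-- The Laplace operator of the tensor `A_r` applied to coefficients. -/
def lapPoly (n m : ℕ) (c : ℤ → R) (D : Fin n → Derivation ℤ R R) (v : R) (r : ℕ) (F : R[X]) : R[X] :=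
  ∑ x, C (res (beta c (n + 1)) (beta c r * X ^ sepExp n m x)) * coeffMap (sepOp n c D v x) F

variable {m : ℕ} {v : R}

theorem lap_eq_sum (r : ℕ) (ψ : R) :
    lap n m c D v r ψ = ∑ x, res (beta c (n + 1)) (beta c r * X ^ sepExp n m x)
      * sepOp n c D v x ψ := by
  rw [lap, sepPoly, Finset.mul_sum, map_sum]
  refine Finset.sum_congr rfl fun x _ => ?_
  rw [mul_left_comm, res_C_mul, mul_comm]

theorem lap_zero (r : ℕ) : lap n m c D v r 0 = 0 := by simp [lap_eq_sum]

theorem coeff_lapPoly (r : ℕ) (F : R[X]) (N : ℕ) :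
    (lapPoly n m c D v r F).coeff N = lap n m c D v r (F.coeff N) := by
  rw [lapPoly, lap_eq_sum, finsetSum_coeff]
  exact Finset.sum_congr rfl fun x _ => by rw [coeff_C_mul, coeff_coeffMap]

theorem lapPoly_sub (r : ℕ) (F G : R[X]) :
    lapPoly n m c D v r (F - G) = lapPoly n m c D v r F - lapPoly n m c D v r G := by
  simp only [lapPoly, map_sub, mul_sub, Finset.sum_sub_distrib]

theorem sepOp_comm (hc : IsCoord n c) (hD : IsPartials c D) (hv : ∀ k, D k v = 0)
    (x y : Fin n ⊕ Fin n × Fin n) (ψ : R) :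
    sepOp n c D v x (sepOp n c D v y ψ) = sepOp n c D v y (sepOp n c D v x ψ) := by
  have h : ∀ i (l : ℕ) x, frame c D i ((l + v) * x) = (l + v) * frame c D i x := by
    intro i l x
    have : frame c D i (l + v) = 0 := by
      rw [frame_apply]
      simp [hv]
    rw [Derivation.leibniz, this]; simp
  have hcomm := frame_comm hc hD
  rcases x with l | ⟨i, l⟩ <;> rcases y with l' | ⟨i', l'⟩ <;>
    simp only [sepOp, LinearMap.neg_apply, LinearMap.smul_apply, smul_eq_mul, map_neg,
      Derivation.coeFn_coe, LinearMap.comp_apply, h]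
  · rw [hcomm l l']; ring
  · rw [hcomm l i', hcomm l l']
  · rw [hcomm l l', hcomm i l']
  · rw [hcomm l i', hcomm i i', hcomm l l', hcomm i l']

/-- The symbol of the separated Laplace operators modulo the characteristic polynomial. -/
def sepSymbol (n m : ℕ) (c : ℤ → R) (D : Fin n → Derivation ℤ R R) (w : R) (g : R[X]) : R[X] :=
  2 * X ^ m * ∑ i ∈ Finset.range n, X ^ i * coeffD (frame c D i) g - C w * X ^ (m - 1) * g

/-- Since `𝔟_i a = β_{n-i}`, derivatives falling on `a` recombine into remainders of `β_r X^N` by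
`mod_eq_sum_res_X_pow`. The point is that modulo `a` the index `r` enters only through the factor
`β_r`, in front of an operator that does not depend on `r`. -/
theorem dvd_lapPoly_charpoly_mul [Nontrivial R] (hc : IsCoord n c) (hD : IsPartials c D)
    (hw0 : m = 0 → v = 0) (r : ℕ) (g : R[X]) :
    beta c (n + 1) ∣ lapPoly n m c D v r (beta c (n + 1) * g)
      - beta c r * sepSymbol n m c D v g := by
  have ha := beta_monic hc n
  set a := beta c (n + 1) with hadef
  set T : ℕ → R[X] := fun N => C (res a (beta c r * X ^ N)) with hT
  have hda : ∀ i, coeffD (frame c D i) a = beta c (n - i) := by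
    intro i
    rw [hadef, coeffD_frame_beta hc hD i le_rfl]; rfl
  have hdb : ∀ i l, coeffD (frame c D i) (beta c (n - l)) = beta c (n - 1 - (i + l)) := by
    intro i l
    rw [coeffD_frame_beta hc hD i (by omega)]; congr 1; omega
  have e : lapPoly n m c D v r (a * g)
      = ∑ i ∈ Finset.range n, ∑ l ∈ Finset.range n, T (m + i + l)
          * coeffD (frame c D i) (coeffD (frame c D l) (a * g))
        - ∑ l ∈ Finset.range n, ((l : R[X]) + C v) * T (m + l - 1)
          * coeffD (frame c D l) (a * g) := by
    rw [lapPoly, Fintype.sum_sum_type, Fintype.sum_prod_type, add_comm, sub_eq_add_neg]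
    congr 1
    · simp only [sepExp, Finset.sum_range]
      refine Finset.sum_congr rfl fun i _ => Finset.sum_congr rfl fun l _ => ?_
      congr 1
      ext N
      rw [coeff_coeffMap, coeff_coeffD, coeff_coeffD]; rfl
    · simp only [sepExp, Finset.sum_range, ← Finset.sum_neg_distrib]
      refine Finset.sum_congr rfl fun l _ => ?_
      have : coeffMap (sepOp n c D v (Sum.inl l)) (a * g)
          = -(((l : ℕ) : R[X]) + C v) * coeffD (frame c D l) (a * g) := by
        rw [show ((l : ℕ) : R[X]) + C v = C ((l : ℕ) + v) by simp]
        ext N; simp only [coeff_coeffMap, sepOp, neg_mul, coeff_neg, coeff_C_mul, coeff_coeffD]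
        simp
      rw [this]; simp only [hT, hadef]; ring
  have hmod : ∀ N, ∑ i ∈ Finset.range n, T (N + i) * beta c (n - i) = (beta c r * X ^ N) %ₘ a := by
    intro N
    rw [mod_eq_sum_res_X_pow hc]
    refine Finset.sum_congr rfl fun i _ => ?_
    rw [hT]; simp only [pow_add, hadef]; congr 3; ring_nf
  have hexp : ∀ i l, coeffD (frame c D i) (coeffD (frame c D l) (a * g))
      = a * coeffD (frame c D i) (coeffD (frame c D l) g)
        + beta c (n - i) * coeffD (frame c D l) g + beta c (n - l) * coeffD (frame c D i) g
        + beta c (n - 1 - (i + l)) * g := by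
    intro i l
    rw [coeffD_mul, map_add, coeffD_mul, coeffD_mul, hda, hda, hdb]; ring
  have h1 : ∑ i ∈ Finset.range n, ∑ l ∈ Finset.range n, T (m + i + l)
      * (beta c (n - i) * coeffD (frame c D l) g)
      = ∑ l ∈ Finset.range n, ((beta c r * X ^ (m + l)) %ₘ a) * coeffD (frame c D l) g := by
    rw [Finset.sum_comm]
    refine Finset.sum_congr rfl fun l _ => ?_
    rw [← hmod, Finset.sum_mul]
    refine Finset.sum_congr rfl fun i _ => ?_
    rw [show m + i + l = m + l + i by ring]; ring
  have h2 : ∑ i ∈ Finset.range n, ∑ l ∈ Finset.range n, T (m + i + l)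
      * (beta c (n - l) * coeffD (frame c D i) g)
      = ∑ l ∈ Finset.range n, ((beta c r * X ^ (m + l)) %ₘ a) * coeffD (frame c D l) g := by
    refine Finset.sum_congr rfl fun l _ => ?_
    rw [← hmod, Finset.sum_mul]
    refine Finset.sum_congr rfl fun i _ => ?_
    ring
  -- These terms, with both derivatives on `a`, are cancelled by the `l`-part of the first-order
  -- operators.
  have h3 : ∑ i ∈ Finset.range n, ∑ l ∈ Finset.range n, T (m + i + l)
      * beta c (n - 1 - (i + l))
      = ∑ l ∈ Finset.range n, (l : R[X]) * (T (m + l - 1) * beta c (n - l)) := by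
    have := sum_range_sum_range_add (n := n) (fun t => T (m + t) * beta c (n - 1 - t)) (by
      intro t ht; rw [show n - 1 - t = 0 by omega]; simp)
    simp only [← add_assoc] at this ⊢
    rw [this]
    refine Finset.sum_congr rfl fun l hl => ?_
    rw [nsmul_eq_mul]
    rcases Nat.eq_zero_or_pos l with rfl | hl'
    · simp
    · rw [show m + (l - 1) = m + l - 1 by omega]
      rw [Finset.mem_range] at hl
      rw [show n - 1 - (l - 1) = n - l by omega]
  -- For `m = 0` the truncated exponent `m + l - 1` would be wrong at `l = 0`, but then `v = 0`.
  have h4 : C v * ∑ l ∈ Finset.range n, T (m + l - 1) * beta c (n - l)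
      = C v * ((beta c r * X ^ (m - 1)) %ₘ a) := by
    by_cases h : m = 0
    · rw [hw0 h]; simp
    · rw [← hmod]
      congr 1
      refine Finset.sum_congr rfl fun i _ => ?_
      rw [show m + i - 1 = m - 1 + i by omega]
  obtain ⟨E1, hE1⟩ : ∃ E, ∑ l ∈ Finset.range n, ((beta c r * X ^ (m + l)) %ₘ a)
      * coeffD (frame c D l) g
      = beta c r * X ^ m * ∑ i ∈ Finset.range n, X ^ i * coeffD (frame c D i) g + a * E := by
    refine ⟨-∑ l ∈ Finset.range n, ((beta c r * X ^ (m + l)) /ₘ a) * coeffD (frame c D l) g, ?_⟩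
    rw [Finset.mul_sum, mul_neg, Finset.mul_sum, ← sub_eq_add_neg, ← Finset.sum_sub_distrib]
    refine Finset.sum_congr rfl fun l _ => ?_
    linear_combination coeffD (frame c D l) g * modByMonic_add_div (beta c r * X ^ (m + l)) a
  have hmd := modByMonic_add_div (beta c r * X ^ (m - 1)) a
  refine ⟨∑ i ∈ Finset.range n, ∑ l ∈ Finset.range n, T (m + i + l)
      * coeffD (frame c D i) (coeffD (frame c D l) g)
      - ∑ l ∈ Finset.range n, ((l : R[X]) + C v) * T (m + l - 1) * coeffD (frame c D l) g
      + 2 * E1 + C v * ((beta c r * X ^ (m - 1)) /ₘ a) * g, ?_⟩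
  rw [e]
  have s1 : ∑ i ∈ Finset.range n, ∑ l ∈ Finset.range n, T (m + i + l)
          * coeffD (frame c D i) (coeffD (frame c D l) (a * g))
      = a * ∑ i ∈ Finset.range n, ∑ l ∈ Finset.range n, T (m + i + l)
          * coeffD (frame c D i) (coeffD (frame c D l) g)
        + 2 * (beta c r * X ^ m * ∑ i ∈ Finset.range n, X ^ i * coeffD (frame c D i) g + a * E1)
        + (∑ l ∈ Finset.range n, (l : R[X]) * (T (m + l - 1) * beta c (n - l))) * g := by
    rw [← hE1, two_mul]
    nth_rewrite 1 [← h1]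
    rw [← h2, ← h3]
    simp only [Finset.mul_sum, Finset.sum_mul, ← Finset.sum_add_distrib, hexp]
    refine Finset.sum_congr rfl fun i _ => Finset.sum_congr rfl fun l _ => ?_
    ring
  have s2 : ∑ l ∈ Finset.range n, ((l : R[X]) + C v) * T (m + l - 1)
          * coeffD (frame c D l) (a * g)
      = a * ∑ l ∈ Finset.range n, ((l : R[X]) + C v) * T (m + l - 1) * coeffD (frame c D l) g
        + (∑ l ∈ Finset.range n, (l : R[X]) * (T (m + l - 1) * beta c (n - l))) * g
        + C v * ((beta c r * X ^ (m - 1)) %ₘ a) * g := by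
    rw [← h4]
    simp only [Finset.mul_sum, Finset.sum_mul, ← Finset.sum_add_distrib, coeffD_mul, hda]
    refine Finset.sum_congr rfl fun l _ => ?_
    ring
  rw [s1, s2, sepSymbol]
  linear_combination (- C v * g) * hmd

end Frame

/-! ### Commutation of the Laplace operators and their action on divergences -/

section Laplace

variable {R : Type*} [CommRing R] [Nontrivial R] {n m : ℕ} {c : ℤ → R}
  {D : Fin n → Derivation ℤ R R} {v ν : R}

/-- The residues `res (β_{s+1} F)` are the coefficients of `F - a (F /ₘ a)`, and the operator acts
on coefficients. The correction caused by the quotient contains `β_{s+1} β_r` and is therefore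
symmetric once the outer operator is also taken with index `r + 1`; commutation is decided by the
first term. -/
theorem lap_res_beta_mul (hc : IsCoord n c) (hD : IsPartials c D) (hw0 : m = 0 → v = 0)
    (r : ℕ) {s : ℕ} (hs : s < n) (F : R[X]) :
    lap n m c D v r (res (beta c (n + 1)) (beta c (s + 1) * F))
      = res (beta c (n + 1)) (beta c (s + 1) * lapPoly n m c D v r F)
        - res (beta c (n + 1)) (beta c (s + 1) * beta c r
          * sepSymbol n m c D v (F /ₘ beta c (n + 1))) := by
  have ha := beta_monic hc n
  obtain ⟨E, hE⟩ := dvd_lapPoly_charpoly_mul hc hD hw0 r (F /ₘ beta c (n + 1))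
  have hd := degree_modByMonic_lt F ha
  have e1 : F %ₘ beta c (n + 1) = F - beta c (n + 1) * (F /ₘ beta c (n + 1)) := by
    linear_combination modByMonic_add_div F (beta c (n + 1))
  rw [← coeff_mod_eq_res hc s hs, ← coeff_lapPoly]
  have hd2 : (lapPoly n m c D v r (F %ₘ beta c (n + 1))).degree < (beta c (n + 1)).degree := by
    rw [degree_charpoly hc] at hd ⊢
    rw [degree_lt_iff_coeff_zero] at hd ⊢
    intro N hN
    rw [coeff_lapPoly, hd N hN, lap_zero]
  rw [← (modByMonic_eq_self_iff ha).2 hd2, coeff_mod_eq_res hc s hs, ← map_sub]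
  apply res_congr ha
  rw [e1, lapPoly_sub]
  exact ⟨-(beta c (s + 1) * E), by linear_combination (- beta c (s + 1)) * hE⟩

theorem res_beta_lapPoly_sepPoly (r s : ℕ) (ψ : R) :
    res (beta c (n + 1)) (beta c s * lapPoly n m c D v r (sepPoly n m c D v ψ))
      = ∑ x, ∑ y, res (beta c (n + 1)) (beta c r * X ^ sepExp n m x)
          * res (beta c (n + 1)) (beta c s * X ^ sepExp n m y)
          * sepOp n c D v x (sepOp n c D v y ψ) := by
  simp only [lapPoly, sepPoly, map_sum, coeffMap_C_mul_X_pow, Finset.mul_sum]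
  refine Finset.sum_congr rfl fun x _ => Finset.sum_congr rfl fun y _ => ?_
  rw [mul_left_comm, res_C_mul, mul_left_comm, res_C_mul]; ring

/-- The separated Laplace operators commute. -/
theorem lap_comm (hc : IsCoord n c) (hD : IsPartials c D) (hw0 : m = 0 → v = 0)
    (hv : ∀ k, D k v = 0) {r s : ℕ} (hr : r < n) (hs : s < n) (ψ : R) :
    lap n m c D v (r + 1) (lap n m c D v (s + 1) ψ)
      = lap n m c D v (s + 1) (lap n m c D v (r + 1) ψ) := by
  -- Each composition is a double sum over pairwise commuting operators minus a correction symmetric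
  -- in the two indices.
  rw [lap.eq_1 n m c D v (s + 1) ψ, lap.eq_1 n m c D v (r + 1) ψ, lap_res_beta_mul hc hD hw0 _ hs,
    lap_res_beta_mul hc hD hw0 _ hr, res_beta_lapPoly_sepPoly, res_beta_lapPoly_sepPoly,
    Finset.sum_comm, mul_comm (beta c (s + 1)) (beta c (r + 1))]
  congr 1
  refine Finset.sum_congr rfl fun x _ => Finset.sum_congr rfl fun y _ => ?_
  rw [sepOp_comm hc hD hv]; ring

theorem lapPoly_of_constant {F : R[X]} (hF : ∀ k, coeffD (D k) F = 0) (r : ℕ) :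
    lapPoly n m c D v r F = 0 := by
  have h : ∀ i N, frame c D i (F.coeff N) = 0 := by
    intro i N
    rw [frame_apply]
    refine Finset.sum_eq_zero fun k _ => ?_
    rw [← coeff_coeffD, hF, coeff_zero, mul_zero]
  rw [lapPoly]
  refine Finset.sum_eq_zero fun x _ => ?_
  have : coeffMap (sepOp n c D v x) F = 0 := by
    ext N
    rcases x with l | ⟨i, l⟩ <;> simp [sepOp, h]
  rw [this, mul_zero]

/-- No derivative acts on `F`, so only the symmetric correction of `lap_res_beta_mul` remains. -/
theorem lap_res_constant_symm (hc : IsCoord n c) (hD : IsPartials c D) (hw0 : m = 0 → v = 0)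
    {F : R[X]} (hF : ∀ k, coeffD (D k) F = 0) {r s : ℕ} (hr : r < n) (hs : s < n) :
    lap n m c D v (r + 1) (res (beta c (n + 1)) (beta c (s + 1) * F))
      = lap n m c D v (s + 1) (res (beta c (n + 1)) (beta c (r + 1) * F)) := by
  rw [lap_res_beta_mul hc hD hw0 _ hs, lap_res_beta_mul hc hD hw0 _ hr,
    lapPoly_of_constant hF, lapPoly_of_constant hF,
    mul_comm (beta c (r + 1)) (beta c (s + 1))]
  simp only [mul_zero, map_zero]

theorem charpoly_eq_X_mul_beta (c : ℤ → R) (n : ℕ) :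
    beta c (n + 1) = X * beta c n + C (c n) := beta_succ c n

/-- Modulo `a` the polynomial `ν β_n` is `-X⁻¹`. Coefficientwise operators commute with
multiplication by `X`, so their value on it follows from their value on `ν a`, known by
`dvd_lapPoly_charpoly_mul`, and contains `r` only in the factor `β_r`. -/
theorem lap_res_inverse_symm (hc : IsCoord n c) (hD : IsPartials c D)
    (hw0 : m = 0 → v = 0) (hν : ν * c n = 1) {r s : ℕ} (hr : r < n) (hs : s < n) :
    lap n m c D v (r + 1) (res (beta c (n + 1)) (beta c (s + 1) * (C ν * beta c n)))
      = lap n m c D v (s + 1) (res (beta c (n + 1)) (beta c (r + 1) * (C ν * beta c n))) := by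
  have ha := beta_monic hc n
  set F : R[X] := C ν * beta c n with hFdef
  have hX : X * F = beta c (n + 1) * C ν - 1 := by
    have : C ν * C (c n) = (1 : R[X]) := by rw [← C_mul, hν, C_1]
    rw [charpoly_eq_X_mul_beta, hFdef]; linear_combination -this
  have hF0 : F /ₘ beta c (n + 1) = 0 := by
    rw [divByMonic_eq_zero_iff ha, degree_charpoly hc, hFdef, ← smul_eq_C_mul]
    exact lt_of_le_of_lt (degree_smul_le _ _) (degree_beta_lt hc n)
  have key : ∀ r, beta c (n + 1) ∣ lapPoly n m c D v r F
      + F * beta c r * sepSymbol n m c D v (C ν) := by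
    intro r
    obtain ⟨E, hE⟩ := dvd_lapPoly_charpoly_mul (D := D) hc hD hw0 r (C ν)
    have hmulX : X * lapPoly n m c D v r F = lapPoly n m c D v r (X * F) := by
      ext N
      cases N with
      | zero => simp [coeff_lapPoly, lap_zero]
      | succ N => rw [coeff_X_mul, coeff_lapPoly, coeff_lapPoly, coeff_X_mul]
    rw [hX, lapPoly_sub, lapPoly_of_constant (F := (1 : R[X])) (fun k => Derivation.map_one_eq_zero _),
      sub_zero] at hmulX
    refine ⟨C ν * lapPoly n m c D v r F - F * E, ?_⟩
    linear_combination (lapPoly n m c D v r F) * hX - F * hmulX - F * hE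
  obtain ⟨E1, hE1⟩ := key (r + 1)
  obtain ⟨E2, hE2⟩ := key (s + 1)
  have h0 : sepSymbol n m c D v (0 : R[X]) = 0 := by simp [sepSymbol]
  rw [lap_res_beta_mul hc hD hw0 _ hs, lap_res_beta_mul hc hD hw0 _ hr, hF0, h0, mul_zero, mul_zero,
    map_zero, sub_zero, sub_zero]
  apply res_congr ha
  exact ⟨beta c (s + 1) * E1 - beta c (r + 1) * E2, by
    linear_combination beta c (s + 1) * hE1 - beta c (r + 1) * hE2⟩

/-- The divergence of a vector field with respect to the density `c_n ^ (-w)`, where `ν`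
is the inverse of `c_n`. -/
def weightedDiv (D : Fin n → Derivation ℤ R R) (w ν : R) (Y : Fin n → R) : R :=
  ∑ k, D k (Y k) - w * ν * ∑ k : Fin n, if (k : ℕ) + 1 = n then Y k else 0

theorem weightedDiv_res_beta_mul (hc : IsCoord n c) (hD : IsPartials c D) (hn : 0 < n)
    (w : R) (G : R[X]) :
    weightedDiv D w ν (fun k => res (beta c (n + 1)) (beta c (k + 1) * G))
      = res (beta c (n + 1)) (∑ i ∈ Finset.range n, X ^ i * coeffD (frame c D i) G
          - derivative G - C (w * ν) * beta c n * G) := by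
  rw [weightedDiv, sum_partial_res_beta_mul hc hD hn, map_sub (res _) (_ - derivative G)]
  congr 1
  rw [mul_assoc (C (w * ν)), res_C_mul]
  congr 1
  rw [Finset.sum_eq_single (⟨n - 1, by omega⟩ : Fin n)]
  · rw [if_pos (by simp only; omega)]; simp only; rw [Nat.sub_add_cancel hn]
  · intro k _ hk
    rw [if_neg]
    intro h; apply hk; ext; simp only; omega
  · simp

/-- The relation `a = X β_n + c_n` makes `ν β_n` the negative inverse of `X` modulo `a`. The
derivative of the density, which contains `1/q_n`, thereby lowers exponents of `X`. -/
theorem res_beta_mul_X_pow_succ (hc : IsCoord n c) (hν : ν * c n = 1) (F : R[X]) (k : ℕ) :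
    res (beta c (n + 1)) (C ν * beta c n * (F * X ^ (k + 1))) =
      - res (beta c (n + 1)) (F * X ^ k) := by
  rw [← map_neg]
  apply res_congr (beta_monic hc n)
  have : C ν * C (c n) = (1 : R[X]) := by rw [← C_mul, hν, C_1]
  refine ⟨C ν * F * X ^ k, ?_⟩
  rw [charpoly_eq_X_mul_beta]
  linear_combination (-F * X ^ k) * this

/-- The Laplace operators in divergence form. -/
theorem lap_eq_weightedDiv (hc : IsCoord n c) (hD : IsPartials c D) (hn : 0 < n) {w : R}
    (hw : v + w = m) (hw0 : m = 0 → v = 0) (hν : m ≠ 0 → ν * c n = 1)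
    {r : ℕ} (hr : r < n) (ψ : R) :
    lap n m c D v (r + 1) ψ = weightedDiv D w ν (fun k => ∑ j : Fin n,
      res (beta c (n + 1)) (beta c (k + 1) * (beta c (r + 1) * beta c (j + 1) * X ^ m)) * D j ψ) := by
  have ha := beta_monic hc n
  set a := beta c (n + 1) with hadef
  -- `B` is the analogue of `b` with `D j ψ` in place of the momenta, written in the frame.
  set B : R[X] := ∑ l ∈ Finset.range n, C (frame c D l ψ) * X ^ l with hB
  set G := beta c (r + 1) * X ^ m * B with hG
  have e1 : ∀ k : Fin n, ∑ j : Fin n,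
      res a (beta c (k + 1) * (beta c (r + 1) * beta c (j + 1) * X ^ m)) * D j ψ
      = res a (beta c (k + 1) * G) := by
    intro k
    have hB' : B = ∑ j : Fin n, C (D j ψ) * beta c (j + 1) := by
      rw [hB]
      have : ∀ j : Fin n, C (D j ψ) * beta c (j + 1)
          = ∑ l ∈ Finset.range n, C (c (j - l) * D j ψ) * X ^ l := by
        intro j
        rw [beta_eq_sum hc (Nat.succ_le_of_lt j.2), Finset.mul_sum]
        refine Finset.sum_congr rfl fun l _ => ?_
        rw [show (((j + 1 : ℕ) : ℤ) - 1 - l) = (j : ℤ) - l by push_cast; ring, C_mul]; ring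
      simp only [this]
      rw [Finset.sum_comm]
      refine Finset.sum_congr rfl fun l _ => ?_
      rw [frame_apply, map_sum, Finset.sum_mul]
    rw [hG, hB', Finset.mul_sum, Finset.mul_sum, map_sum]
    refine Finset.sum_congr rfl fun j _ => ?_
    rw [mul_comm, ← res_C_mul]; exact congrArg (res a) (by ring)
  simp only [e1]
  rw [weightedDiv_res_beta_mul hc hD hn]
  have hw' : res a (C (w * ν) * beta c n * G)
      = - res a (beta c (r + 1) * C w * X ^ (m - 1) * B) := by
    by_cases h0 : m = 0
    · have : w = 0 := by rw [hw0 h0, h0] at hw; simpa using hw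
      simp [this]
    · obtain ⟨k, rfl⟩ := Nat.exists_eq_succ_of_ne_zero h0
      have := res_beta_mul_X_pow_succ hc (hν h0) (C w * beta c (r + 1) * B) k
      rw [← hadef] at this
      rw [show C (w * ν) * beta c n * G = C ν * beta c n * (C w * beta c (r + 1) * B * X ^ (k + 1)) by
        rw [hG, C_mul, Nat.succ_eq_add_one]; ring, this, Nat.succ_sub_one]
      refine congrArg (fun F => - res a F) ?_
      ring
  rw [map_sub, hw', sub_neg_eq_add, ← map_add]
  have e2 : ∑ i ∈ Finset.range n, X ^ i * coeffD (frame c D i) G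
      = derivative (beta c (r + 1)) * X ^ m * B
        + beta c (r + 1) * X ^ m * ∑ i ∈ Finset.range n, X ^ i * coeffD (frame c D i) B := by
    rw [← sum_X_pow_mul_beta hc (by omega : r + 1 ≤ n + 1), Finset.sum_mul, Finset.sum_mul,
      Finset.mul_sum, ← Finset.sum_add_distrib]
    refine Finset.sum_congr rfl fun i _ => ?_
    rw [hG, coeffD_mul, coeffD_mul, coeffD_X_pow, coeffD_frame_beta hc hD i (by omega)]; ring
  have e3 : derivative G = derivative (beta c (r + 1)) * X ^ m * B
      + beta c (r + 1) * ((m : R[X]) * X ^ (m - 1)) * B + beta c (r + 1) * X ^ m * derivative B := by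
    rw [hG, derivative_mul, derivative_mul, derivative_X_pow]
    simp only [map_natCast]; ring
  rw [lap, e2, e3]
  congr 1
  have e4 : sepPoly n m c D v ψ = X ^ m * ∑ i ∈ Finset.range n, X ^ i * coeffD (frame c D i) B
      - X ^ m * derivative B - C v * X ^ (m - 1) * B := by
    rw [sepPoly, Fintype.sum_sum_type, Fintype.sum_prod_type, add_comm]
    have f1 : X ^ m * ∑ i ∈ Finset.range n, X ^ i * coeffD (frame c D i) B
        = ∑ i : Fin n, ∑ l : Fin n, C (sepOp n c D v (Sum.inr (i, l)) ψ)
          * X ^ sepExp n m (Sum.inr (i, l)) := by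
      rw [Finset.mul_sum, Finset.sum_range]
      refine Finset.sum_congr rfl fun i _ => ?_
      rw [hB, map_sum, Finset.mul_sum, Finset.mul_sum, Finset.sum_range]
      refine Finset.sum_congr rfl fun l _ => ?_
      rw [coeffD_mul, coeffD_X_pow, coeffD_C]
      simp only [sepOp, sepExp, LinearMap.comp_apply, Derivation.coeFn_coe, pow_add]; ring
    rw [f1, sub_sub, sub_eq_add_neg]
    congr 1
    rw [hB, derivative_sum, Finset.mul_sum, Finset.mul_sum, ← Finset.sum_add_distrib,
      ← Finset.sum_neg_distrib, Finset.sum_range]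
    refine Finset.sum_congr rfl fun l _ => ?_
    rw [derivative_mul, derivative_C, derivative_X_pow]
    simp only [sepOp, sepExp, LinearMap.neg_apply, LinearMap.smul_apply, smul_eq_mul,
      Derivation.coeFn_coe, C_neg, C_mul, C_add, map_natCast]
    rcases Nat.eq_zero_or_pos (l : ℕ) with hl | hl
    · rw [hl]; simp
    · have p1 : (X : R[X]) ^ (m + l - 1) = X ^ m * X ^ ((l : ℕ) - 1) := by
        rw [← pow_add]; congr 1; omega
      have p2 : C v * X ^ (m - 1) * X ^ (l : ℕ) = C v * X ^ m * (X ^ ((l : ℕ) - 1) : R[X]) := by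
        by_cases h0 : m = 0
        · rw [hw0 h0]; simp
        · rw [mul_assoc, ← pow_add, mul_assoc, ← pow_add]; congr 2; omega
      rw [p1]
      linear_combination C ((frame c D ↑l) ψ) * p2
  -- Differentiating `X^m` produces the weight `m`; the density accounts for `w` of it, and `v` is
  -- the weight left in `sepPoly`.
  have hm : (m : R[X]) = C v + C w := by rw [← C_add, hw]; simp
  rw [e4, hm]; ring

/-- On `β_{r+1}` the operator `∑ X^i 𝔟_i` is `d/dX`, so this factor drops out of the divergence
formula. Only the derivative of `X^γ` and the density term remain. -/
theorem weightedDiv_potential (hc : IsCoord n c) (hD : IsPartials c D) (hn : 0 < n)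
    (w : R) {r : ℕ} (hr : r < n) (γ : ℕ) :
    weightedDiv D w ν (fun k => res (beta c (n + 1)) (beta c (k + 1) * (beta c (r + 1) * X ^ γ)))
      = - res (beta c (n + 1)) (beta c (r + 1)
          * ((γ : R[X]) * X ^ (γ - 1) + C (w * ν) * (beta c n * X ^ γ))) := by
  rw [weightedDiv_res_beta_mul hc hD hn, ← map_neg]
  congr 1
  have e2 : ∑ i ∈ Finset.range n, X ^ i * coeffD (frame c D i) (beta c (r + 1) * X ^ γ)
      = derivative (beta c (r + 1)) * X ^ γ := by
    rw [← sum_X_pow_mul_beta hc (by omega : r + 1 ≤ n + 1), Finset.sum_mul]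
    refine Finset.sum_congr rfl fun i _ => ?_
    rw [coeffD_mul, coeffD_X_pow, coeffD_frame_beta hc hD i (by omega)]; ring
  rw [e2, derivative_mul, derivative_X_pow]
  simp only [map_natCast]; ring

/-- The Laplacians of the divergences of the separable vector potentials are symmetric. -/
theorem lap_weightedDiv_potential_symm (hc : IsCoord n c) (hD : IsPartials c D) (hn : 0 < n)
    {w : R} (hw0 : m = 0 → w = 0) (hv0 : m = 0 → v = 0) (hw : ∀ k, D k w = 0)
    (hν : m ≠ 0 → ν * c n = 1) (γ : ℕ)
    {r s : ℕ} (hr : r < n) (hs : s < n) :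
    lap n m c D v (r + 1) (weightedDiv D w ν
        (fun k => res (beta c (n + 1)) (beta c (k + 1) * (beta c (s + 1) * X ^ γ))))
      = lap n m c D v (s + 1) (weightedDiv D w ν
        (fun k => res (beta c (n + 1)) (beta c (k + 1) * (beta c (r + 1) * X ^ γ)))) := by
  rw [weightedDiv_potential hc hD hn w hs, weightedDiv_potential hc hD hn w hr]
  have ha := beta_monic hc n
  have hw' : ∀ k N, coeffD (D k) (C w * X ^ N) = 0 := by
    intro k N; rw [coeffD_mul, coeffD_C, hw, coeffD_X_pow]; simp
  have hnat : ∀ (k : Fin n) (a N : ℕ), coeffD (D k) (-((a : R[X]) * X ^ N)) = 0 := by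
    intro k a N
    rw [map_neg, coeffD_mul, coeffD_X_pow, Derivation.map_natCast]; simp
  -- The divergences are `res (β_{s+1} F)`. For `m = 0`, and for positive exponent, `F` can be
  -- chosen with constant coefficients; for `m ≠ 0` and exponent zero it is `-w ν β_n`, that is `w
  -- X⁻¹` modulo `a`.
  by_cases h0 : m = 0
  · have e : ∀ s, - res (beta c (n + 1)) (beta c (s + 1)
          * ((γ : R[X]) * X ^ (γ - 1) + C (w * ν) * (beta c n * X ^ γ)))
          = res (beta c (n + 1)) (beta c (s + 1) * -((γ : R[X]) * X ^ (γ - 1))) := by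
      intro s
      rw [hw0 h0, zero_mul, C_0, zero_mul, add_zero, mul_neg, map_neg]
    rw [e, e]
    exact lap_res_constant_symm hc hD hv0 (fun k => hnat k _ _) hr hs
  · have hν' := hν h0
    rcases γ with _ | γ
    · have e : ∀ s, - res (beta c (n + 1)) (beta c (s + 1)
          * (((0 : ℕ) : R[X]) * X ^ (0 - 1) + C (w * ν) * (beta c n * X ^ 0)))
          = -w * res (beta c (n + 1)) (beta c (s + 1) * (C ν * beta c n)) := by
        intro s
        rw [neg_mul, ← res_C_mul, C_mul]
        refine congrArg (fun F => - res _ F) ?_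
        simp; ring
      rw [e, e]
      have h2 : ∀ r x, lap n m c D v r (-w * x) = -w * lap n m c D v r x := by
        intro r x
        have hf : ∀ i x, frame c D i (-w * x) = -w * frame c D i x := by
          intro i x
          have : frame c D i w = 0 := by rw [frame_apply]; simp [hw]
          rw [Derivation.leibniz, map_neg, this]; simp
        rw [lap_eq_sum, lap_eq_sum, Finset.mul_sum]
        refine Finset.sum_congr rfl fun y _ => ?_
        rcases y with l | ⟨i, l⟩ <;>
          simp only [sepOp, LinearMap.neg_apply, LinearMap.smul_apply, smul_eq_mul,
            Derivation.coeFn_coe, LinearMap.comp_apply, hf] <;> ring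
      rw [h2, h2, lap_res_inverse_symm hc hD hv0 hν' hr hs]
    · have e : ∀ s, - res (beta c (n + 1)) (beta c (s + 1)
          * (((γ + 1 : ℕ) : R[X]) * X ^ (γ + 1 - 1) + C (w * ν) * (beta c n * X ^ (γ + 1))))
          = res (beta c (n + 1)) (beta c (s + 1) * (C w * X ^ γ + -(((γ + 1 : ℕ) : R[X]) * X ^ γ))) := by
        intro s
        have := res_beta_mul_X_pow_succ hc hν' (C w * beta c (s + 1)) γ
        rw [Nat.add_sub_cancel, mul_add, map_add, show beta c (s + 1) * (C (w * ν) * (beta c n *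
          X ^ (γ + 1))) = C ν * beta c n * (C w * beta c (s + 1) * X ^ (γ + 1)) by rw [C_mul]; ring,
          this, mul_add, map_add, mul_neg, map_neg,
          show C w * beta c (s + 1) * X ^ γ = beta c (s + 1) * (C w * X ^ γ) by ring]
        ring
      rw [e, e]
      exact lap_res_constant_symm hc hD hv0 (fun k => by rw [map_add, hw', hnat, add_zero]) hr hs

end Laplace

/-! ### The matrices and vectors of the theorem as residues; determinants -/

section Matrices

variable {n m : ℕ} (q : Fin n → ℝ)

theorem coord_zero : coord q 0 = 1 := by simp [coord]

theorem isCoord_coord : IsCoord n (coord q) where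
  zero := coord_zero q
  neg k hk := by rw [coord, if_neg (by omega), dif_neg (by omega)]
  big k hk := by rw [coord, if_neg (by omega), dif_neg (by omega)]

theorem coord_succ (i : Fin n) : coord q ((i : ℕ) + 1) = q i := by
  rw [coord, if_neg (by omega), dif_pos (by omega)]
  congr 1; ext; simp

/-- The vector with the components `res (β_i F)`. -/
def resVec (F : ℝ[X]) (i : Fin n) : ℝ :=
  res (beta (coord q) (n + 1)) (beta (coord q) (i + 1) * F)

/-- In these coordinates on the remainders, `L` is multiplication by `X`: its rows encode the
recursion `β_{i+1} = X β_i + q_i`. All geometric objects become residues through this fact. -/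
theorem tensorL_mulVec_resVec (F : ℝ[X]) :
    (tensorL q).mulVec (resVec q F) = resVec q (X * F) := by
  have hc := isCoord_coord q
  ext i
  have e0 : ∀ j : Fin n, (j : ℕ) = 0 → resVec q F j = res (beta (coord q) (n + 1)) F := by
    intro j hj; rw [resVec, hj, zero_add, beta_one hc, one_mul]
  have e1 : (tensorL q).mulVec (resVec q F) i = -q i * res (beta (coord q) (n + 1)) F
      + res (beta (coord q) (n + 1)) (beta (coord q) (i + 2) * F) := by
    simp only [Matrix.mulVec, dotProduct, tensorL, Matrix.of_apply, add_mul, ite_mul, zero_mul,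
      one_mul, Finset.sum_add_distrib]
    congr 1
    · rw [Finset.sum_eq_single (⟨0, i.pos⟩ : Fin n)]
      · rw [if_pos rfl, e0 _ rfl]
      · intro j _ hj; rw [if_neg]; intro h; exact hj (Fin.ext h)
      · simp
    · by_cases hi : (i : ℕ) + 1 = n
      · rw [Finset.sum_eq_zero]
        · have : (i : ℕ) + 2 = n + 1 := by omega
          rw [this, res_self_mul (beta_monic hc n)]
        · intro j _; rw [if_neg]; have := j.2; omega
      · rw [Finset.sum_eq_single (⟨i + 1, by omega⟩ : Fin n)]
        · rw [if_pos rfl]; rfl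
        · intro j _ hj; rw [if_neg]; intro h; exact hj (Fin.ext h)
        · simp
  rw [e1, beta_succ _ (i + 1), add_mul, map_add, res_C_mul,
    show (((i : ℕ) + 1 : ℕ) : ℤ) = (i : ℕ) + 1 by push_cast; rfl, coord_succ, resVec,
    show beta (coord q) (i + 1) * (X * F) = X * beta (coord q) (i + 1) * F by ring]
  ring

theorem tensorL_pow_mulVec_resVec (k : ℕ) (F : ℝ[X]) :
    (tensorL q ^ k).mulVec (resVec q F) = resVec q (X ^ k * F) := by
  induction k with
  | zero => simp
  | succ k ih => rw [pow_succ', ← Matrix.mulVec_mulVec, ih, tensorL_mulVec_resVec, pow_succ', mul_assoc]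

theorem resVec_sum {ι : Type*} (s : Finset ι) (x : ι → ℝ) (F : ι → ℝ[X]) (i : Fin n) :
    resVec q (∑ k ∈ s, C (x k) * F k) i = ∑ k ∈ s, x k * resVec q (F k) i := by
  simp only [resVec, Finset.mul_sum, map_sum]
  refine Finset.sum_congr rfl fun k _ => ?_
  rw [mul_left_comm, res_C_mul]

theorem beta_eq_sum_reflect (c : ℤ → ℝ) (r : ℕ) :
    beta c (r + 1) = ∑ k ∈ Finset.range (r + 1), C (c k) * X ^ (r - k) := by
  induction r with
  | zero => simp [beta_succ]
  | succ r ih =>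
    rw [beta_succ, ih, Finset.sum_range_succ _ (r + 1), Finset.mul_sum]
    congr 1
    · refine Finset.sum_congr rfl fun k hk => ?_
      rw [Finset.mem_range] at hk
      rw [show r + 1 - k = r - k + 1 by omega, pow_succ]; ring
    · simp

theorem tensorK_mulVec_resVec (r : Fin n) (F : ℝ[X]) :
    (tensorK r q).mulVec (resVec q F) = resVec q (beta (coord q) (r + 1) * F) := by
  ext i
  rw [tensorK, Matrix.sum_mulVec, Finset.sum_apply, beta_eq_sum_reflect, Finset.sum_mul]
  simp only [mul_assoc]
  rw [resVec_sum]
  refine Finset.sum_congr rfl fun k _ => ?_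
  rw [Matrix.smul_mulVec, tensorL_pow_mulVec_resVec]; rfl

theorem resVec_apply (F : ℝ[X]) (i : Fin n) :
    resVec q F i = (F %ₘ beta (coord q) (n + 1)).coeff (n - 1 - i) :=
  (coeff_mod_eq_res (isCoord_coord q) i i.2 F).symm

theorem metricG0_col (j : Fin n) :
    (fun i => metricG0 q i j) = resVec q (beta (coord q) (j + 1)) := by
  have hc := isCoord_coord q
  ext i
  rw [resVec_apply, (modByMonic_eq_self_iff (beta_monic hc n)).2, coeff_beta hc, metricG0,
    Matrix.of_apply]
  · congr 1; have := i.2; have := j.2; omega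
  · rw [degree_charpoly hc]
    exact lt_of_lt_of_le (degree_beta_lt hc _) (by exact_mod_cast j.2)

theorem tensorA_eq_res (r i j : Fin n) :
    tensorA m r q i j = res (beta (coord q) (n + 1))
      (beta (coord q) (i + 1) * (beta (coord q) (r + 1) * beta (coord q) (j + 1) * X ^ m)) := by
  have e : tensorA m r q i j
      = (tensorK r q).mulVec ((tensorL q ^ m).mulVec (fun k => metricG0 q k j)) i := by
    rw [Matrix.mulVec_mulVec, tensorA, metricG, ← mul_assoc]; rfl
  rw [e, metricG0_col, tensorL_pow_mulVec_resVec, tensorK_mulVec_resVec, resVec]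
  congr 1; ring

theorem potentialV_eq (α : ℕ) : potentialV α q = -resVec q (X ^ α) := by
  have hc := isCoord_coord q
  have e : (fun i : Fin n => if (i : ℕ) + 1 = n then (-1 : ℝ) else 0) = -resVec q 1 := by
    ext i
    have h1 : (1 : ℝ[X]) %ₘ beta (coord q) (n + 1) = 1 := by
      rw [modByMonic_eq_self_iff (beta_monic hc n), degree_charpoly hc, degree_one]
      exact_mod_cast i.pos
    rw [Pi.neg_apply, resVec_apply, h1, coeff_one]
    have := i.2
    by_cases h : (i : ℕ) + 1 = n
    · rw [if_pos h, if_pos (by omega)]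
    · rw [if_neg h, if_neg (by omega), neg_zero]
  rw [potentialV, e, Matrix.mulVec_neg, tensorL_pow_mulVec_resVec, mul_one]

theorem potentialP_eq_res (r : Fin n) (γ : ℕ) (j : Fin n) :
    potentialP r γ q j = res (beta (coord q) (n + 1))
      (beta (coord q) (j + 1) * (beta (coord q) (r + 1) * X ^ γ)) := by
  rw [potentialP, ← Finset.sum_neg_distrib]
  change _ = resVec q (beta (coord q) (r + 1) * X ^ γ) j
  rw [beta_eq_sum_reflect, Finset.sum_mul]
  simp only [mul_assoc]
  rw [resVec_sum]
  refine Finset.sum_congr rfl fun k hk => ?_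
  rw [Finset.mem_range] at hk
  rw [potentialV_eq, Pi.neg_apply, mul_neg, neg_neg, ← pow_add]
  congr 3; omega

/-- At every index excluded by the explicit ranges, the truncated weight or the coordinate is zero.
The field `J_1 = 0` counts as one of the first kind for every `m`. -/
theorem killingJ_eq (r k : Fin n) :
    killingJ m r q k = killC n m (r + 1) (coord q) ((k : ℕ) + 1) := by
  have hc := isCoord_coord q
  have hk := k.2
  have hr := r.2
  have ec : ((k : ℕ) + 1 - (n + 2 - m - ((r : ℕ) + 1 : ℕ)) : ℤ)
      = (m + ((r : ℕ) + 1) - n - 2 + ((k : ℕ) + 1) : ℤ) := by push_cast; ring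
  have hneg : ∀ z : ℤ, z < 0 ∨ n < z → coord q z = 0 := fun z hz => hz.elim (hc.neg z) (hc.big z)
  rw [killingJ, killingJAux, killC, ec]
  by_cases h1 : (r : ℕ) = 0
  · rw [if_pos (by omega), if_pos (by left; omega)]
    by_cases h : (n + 1 - m - ((k : ℕ) + 1) : ℤ) ≤ 0
    · rw [max_eq_right h]; simp
    · rw [hneg _ (by omega), mul_zero]
  · rw [if_neg (by omega)]
    by_cases h2 : (r : ℕ) + 1 + m ≤ n + 1
    · have hl : lowIdx n m (r + 1) := Or.inr h2
      rw [if_pos (by omega), if_pos hl]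
      split_ifs with h
      · rw [max_eq_left (by omega)]
      · by_cases h3 : (n + 1 - m - ((k : ℕ) + 1) : ℤ) ≤ 0
        · rw [max_eq_right h3]; simp
        · rw [hneg _ (by omega), mul_zero]
    · have hl : ¬ lowIdx n m (r + 1) := by unfold lowIdx; omega
      rw [if_neg (by omega), if_neg hl]
      split_ifs with h
      · rw [max_eq_left (by omega)]; push_cast; ring
      · by_cases h3 : ((k : ℕ) + 1 - (n + 1 - m) : ℤ) ≤ 0
        · rw [max_eq_right h3]; simp
        · rw [hneg _ (by omega), mul_zero]

/-- In the expansion along the last row only `-q_n` survives, with an identity matrix as minor.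
Squaring disposes of the sign. -/
theorem det_tensorL_sq (hn : 0 < n) : (tensorL q).det ^ 2 = coord q n ^ 2 := by
  obtain ⟨k, rfl⟩ : ∃ k, n = k + 1 := ⟨n - 1, by omega⟩
  rw [Matrix.det_succ_row _ (Fin.last k), Finset.sum_eq_single 0]
  · have h1 : (tensorL q).submatrix (Fin.last k).succAbove (0 : Fin (k + 1)).succAbove = 1 := by
      ext i j
      rw [Matrix.submatrix_apply, tensorL, Matrix.of_apply, Matrix.one_apply]
      simp [Fin.ext_iff, eq_comm]
    have h2 : coord q ((k + 1 : ℕ) : ℤ) = q (Fin.last k) := by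
      rw [← coord_succ q (Fin.last k)]; simp
    rw [h1, h2, Matrix.det_one, tensorL, Matrix.of_apply]
    simp [mul_pow, ← pow_mul, mul_comm]
  · intro j _ hj
    have : (tensorL q) (Fin.last k) j = 0 := by
      rw [tensorL, Matrix.of_apply, if_neg (by intro h; exact hj (Fin.ext h)), if_neg, add_zero]
      have := j.2; simp; omega
    rw [this]; ring
  · simp

/-- Reversing the columns gives a unit lower triangular Toeplitz matrix. -/
theorem det_metricG0_sq : (metricG0 q).det ^ 2 = 1 := by
  have hc := isCoord_coord q
  have h : (metricG0 q).submatrix id (Fin.revPerm : Equiv.Perm (Fin n))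
      = Matrix.of fun i j : Fin n => coord q ((i : ℤ) - j) := by
    ext i j
    rw [Matrix.submatrix_apply, metricG0, Matrix.of_apply, Matrix.of_apply]
    congr 1
    have := j.2
    simp only [id, Fin.revPerm_apply, Fin.val_rev]
    omega
  have h1 : ((metricG0 q).submatrix id (Fin.revPerm : Equiv.Perm (Fin n))).det = 1 := by
    rw [h, Matrix.det_of_isLowerTriangular]
    · simp [coord_zero]
    · intro i j hij
      exact hc.neg _ (by have : i < j := hij; simpa using this)
  rw [Matrix.det_permute'] at h1
  have h2 := congrArg (· ^ 2) h1
  simp only [mul_pow, one_pow] at h2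
  rcases Int.units_eq_one_or (Equiv.Perm.sign (Fin.revPerm : Equiv.Perm (Fin n))) with h | h <;>
    simpa [h] using h2

theorem det_metricG_sq (hn : 0 < n) : (metricG m q).det ^ 2 = coord q n ^ (2 * m) := by
  rw [metricG, Matrix.det_mul, Matrix.det_pow, mul_pow, det_metricG0_sq, mul_one, ← pow_mul,
    mul_comm, pow_mul, det_tensorL_sq q hn, pow_mul]

theorem mem_configSpace_iff (hn : 0 < n) :
    q ∈ configSpace n m ↔ coord q n ^ (2 * m) ≠ 0 := by
  rw [← det_metricG_sq q hn]
  simp [configSpace]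

/-- The fourth power removes the root and the absolute value. The resulting algebraic relation can
be differentiated. -/
theorem density_pow_four (hn : 0 < n) (hq : q ∈ configSpace n m) :
    density m q ^ 4 * coord q n ^ (2 * m) = 1 := by
  have h := (mem_configSpace_iff q hn).1 hq
  rw [← det_metricG_sq q hn] at h ⊢
  have e : density m q ^ 4 = (density m q ^ 2) ^ 2 := by ring
  rw [e, density, Real.sq_sqrt (abs_nonneg _), sq_abs, Matrix.det_nonsing_inv,
    Ring.inverse_eq_inv', inv_pow, inv_mul_cancel₀ h]

end Matrices

/-! ### Divergence, Lie derivatives and the commutator of quantized Hamiltonians -/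

section VectorFields

variable {R : Type*} [CommRing R] {n : ℕ} (D : Fin n → Derivation ℤ R R) (κ : Fin n → R)

/-- The derivation `∑_k Y_k ∂_k`. -/
def vf (Y : Fin n → R) : Derivation ℤ R R := ∑ k, Y k • D k

theorem vf_apply (Y : Fin n → R) (x : R) : vf D Y x = ∑ k, Y k * D k x := by
  unfold vf
  rw [← Derivation.coeFnAddMonoidHom_apply, map_sum, Finset.sum_apply]
  rfl

/-- The divergence of `Y` with respect to a density with logarithmic differential `κ`. -/
def divg (Y : Fin n → R) : R := ∑ k, (D k (Y k) + κ k * Y k)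

/-- The gradient of `ψ` with respect to the contravariant tensor `A`. -/
def grad (A : Fin n → Fin n → R) (ψ : R) (k : Fin n) : R := ∑ j, A k j * D j ψ

/-- The operator `ψ ↦ div (A ∇ψ)`. -/
def lapOp (A : Fin n → Fin n → R) (ψ : R) : R := divg D κ (grad D A ψ)

/-- The commutator of vector fields. -/
def vfBracket (X Y : Fin n → R) (k : Fin n) : R := vf D X (Y k) - vf D Y (X k)

/-- The Lie derivative of a contravariant tensor along a vector field. -/
def lieD (Y : Fin n → R) (A : Fin n → Fin n → R) (k j : Fin n) : R :=
  vf D Y (A k j) - ∑ i, A i j * D i (Y k) - ∑ i, A k i * D i (Y j)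

/-- The operator `α Δ_A + β (2 Y + div Y)`. -/
def quantOp (α β : R) (A : Fin n → Fin n → R) (Y : Fin n → R) (ψ : R) : R :=
  α * lapOp D κ A ψ + β * (2 * vf D Y ψ + divg D κ Y * ψ)

variable {D κ}

theorem divg_add (X Y : Fin n → R) : divg D κ (X + Y) = divg D κ X + divg D κ Y := by
  simp only [divg, Pi.add_apply, map_add, ← Finset.sum_add_distrib]
  exact Finset.sum_congr rfl fun k _ => by ring

theorem divg_sub (X Y : Fin n → R) : divg D κ (X - Y) = divg D κ X - divg D κ Y := by
  simp only [divg, Pi.sub_apply, map_sub, ← Finset.sum_sub_distrib]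
  exact Finset.sum_congr rfl fun k _ => by ring

theorem divg_mul (f : R) (Y : Fin n → R) :
    divg D κ (fun k => f * Y k) = f * divg D κ Y + vf D Y f := by
  simp only [divg, vf_apply, Derivation.leibniz, smul_eq_mul, Finset.mul_sum,
    ← Finset.sum_add_distrib]
  exact Finset.sum_congr rfl fun k _ => by ring

/-- The divergence is a cocycle on the Lie algebra of vector fields. Closedness of `κ` is needed for
the terms in which `κ` is differentiated. -/
theorem vf_divg (hcomm : ∀ i j x, D i (D j x) = D j (D i x)) (hκ : ∀ i j, D i (κ j) = D j (κ i))
    (X Y : Fin n → R) :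
    vf D Y (divg D κ X) = divg D κ (vfBracket D Y X) + vf D X (divg D κ Y) := by
  have h : ∀ X Y : Fin n → R, vf D Y (divg D κ X) = ∑ k, ∑ i, (Y i * D i (D k (X k))
      + Y i * D i (κ k) * X k + κ k * (Y i * D i (X k))) := by
    intro X Y
    rw [vf_apply, Finset.sum_comm]
    refine Finset.sum_congr rfl fun i _ => ?_
    rw [divg, map_sum, Finset.mul_sum]
    refine Finset.sum_congr rfl fun k _ => ?_
    rw [map_add, Derivation.leibniz, smul_eq_mul, smul_eq_mul]; ring
  have h2 : divg D κ (vfBracket D Y X) = ∑ k, ∑ i, (D k (Y i) * D i (X k) + Y i * D k (D i (X k))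
      - D k (X i) * D i (Y k) - X i * D k (D i (Y k)) + κ k * (Y i * D i (X k))
      - κ k * (X i * D i (Y k))) := by
    rw [divg]
    refine Finset.sum_congr rfl fun k _ => ?_
    rw [vfBracket, vf_apply, vf_apply, ← Finset.sum_sub_distrib, map_sum, Finset.mul_sum,
      ← Finset.sum_add_distrib]
    refine Finset.sum_congr rfl fun i _ => ?_
    rw [map_sub, Derivation.leibniz, Derivation.leibniz]
    simp only [smul_eq_mul]; ring
  rw [h, h, h2, ← Finset.sum_add_distrib]
  simp only [← Finset.sum_add_distrib]
  have e1 : ∑ k, ∑ i, D k (Y i) * D i (X k) = ∑ k, ∑ i, D k (X i) * D i (Y k) := by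
    rw [Finset.sum_comm]
    exact Finset.sum_congr rfl fun k _ => Finset.sum_congr rfl fun i _ => by ring
  have e2 : ∑ k, ∑ i, Y i * D i (κ k) * X k = ∑ k, ∑ i, X i * D i (κ k) * Y k := by
    rw [Finset.sum_comm]
    exact Finset.sum_congr rfl fun k _ => Finset.sum_congr rfl fun i _ => by rw [hκ]; ring
  rw [← sub_eq_zero] at e1 e2 ⊢
  simp only [← Finset.sum_sub_distrib] at e1 e2 ⊢
  rw [← sub_eq_zero, ← sub_eq_zero] at e1
  simp only [sub_zero] at e1
  calc _ = ∑ k, ∑ i, ((Y i * D i (κ k) * X k - X i * D i (κ k) * Y k)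
        - (D k (Y i) * D i (X k) - D k (X i) * D i (Y k))) := by
        refine Finset.sum_congr rfl fun k _ => Finset.sum_congr rfl fun i _ => ?_
        rw [hcomm k i, hcomm k i]; ring
    _ = 0 := by
        simp only [Finset.sum_sub_distrib] at e1 e2 ⊢
        rw [e1, e2, sub_zero]

/-- This is the Leibniz rule for the Lie derivative along `Y`, applied to the contraction of `A`
with the differential of `ψ`. -/
theorem vfBracket_grad (hcomm : ∀ i j x, D i (D j x) = D j (D i x)) (Y : Fin n → R)
    (A : Fin n → Fin n → R) (ψ : R) :
    vfBracket D Y (grad D A ψ) = grad D (lieD D Y A) ψ + grad D A (vf D Y ψ) := by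
  funext k
  have e1 : vf D Y (grad D A ψ k)
      = ∑ j, (vf D Y (A k j) * D j ψ + A k j * vf D Y (D j ψ)) := by
    rw [grad, map_sum]
    exact Finset.sum_congr rfl fun j _ => by rw [Derivation.leibniz]; simp only [smul_eq_mul]; ring
  have e2 : vf D (grad D A ψ) (Y k) = ∑ j, (∑ i, A i j * D i (Y k)) * D j ψ := by
    rw [vf_apply]
    simp only [grad, Finset.sum_mul]
    rw [Finset.sum_comm]
    exact Finset.sum_congr rfl fun j _ => Finset.sum_congr rfl fun i _ => by ring
  have e3 : grad D A (vf D Y ψ) k = ∑ j, (∑ i, A k i * D i (Y j)) * D j ψ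
      + ∑ j, A k j * vf D Y (D j ψ) := by
    rw [grad]
    have : ∀ j, A k j * D j (vf D Y ψ) = ∑ i, A k j * D j (Y i) * D i ψ
        + A k j * vf D Y (D j ψ) := by
      intro j
      rw [vf_apply, vf_apply, map_sum, Finset.mul_sum, Finset.mul_sum, ← Finset.sum_add_distrib]
      refine Finset.sum_congr rfl fun i _ => ?_
      rw [Derivation.leibniz, hcomm j i]; simp only [smul_eq_mul]; ring
    simp only [this]
    rw [Finset.sum_add_distrib, Finset.sum_comm]
    simp only [Finset.sum_mul]
  rw [vfBracket, e1, e2, Pi.add_apply, e3, grad]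
  simp only [lieD, sub_mul, Finset.sum_sub_distrib, Finset.sum_add_distrib]
  ring

theorem grad_mul (A : Fin n → Fin n → R) (f ψ : R) :
    grad D A (f * ψ) = fun k => f * grad D A ψ k + ψ * grad D A f k := by
  funext k
  simp only [grad, Derivation.leibniz, smul_eq_mul, Finset.mul_sum, ← Finset.sum_add_distrib]
  exact Finset.sum_congr rfl fun j _ => by ring

theorem vf_grad_symm {A : Fin n → Fin n → R} (hA : ∀ k j, A k j = A j k) (f ψ : R) :
    vf D (grad D A ψ) f = vf D (grad D A f) ψ := by
  simp only [vf_apply, grad, Finset.sum_mul]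
  rw [Finset.sum_comm]
  exact Finset.sum_congr rfl fun k _ => Finset.sum_congr rfl fun i _ => by rw [hA]; ring

theorem lapOp_mul {A : Fin n → Fin n → R} (hA : ∀ k j, A k j = A j k) (f ψ : R) :
    lapOp D κ A (f * ψ) = f * lapOp D κ A ψ + ψ * lapOp D κ A f + 2 * vf D (grad D A f) ψ := by
  have := divg_add (D := D) (κ := κ) (fun k => f * grad D A ψ k) (fun k => ψ * grad D A f k)
  rw [lapOp, grad_mul]
  refine this.trans ?_
  rw [divg_mul, divg_mul, vf_grad_symm hA]
  simp only [lapOp]; ring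

theorem lapOp_sub_left (A B : Fin n → Fin n → R) (ψ : R) :
    lapOp D κ (A - B) ψ = lapOp D κ A ψ - lapOp D κ B ψ := by
  rw [lapOp, lapOp, lapOp, ← divg_sub]
  congr 1
  funext k
  simp only [grad, Pi.sub_apply, sub_mul, Finset.sum_sub_distrib]

theorem lapOp_add (A : Fin n → Fin n → R) (f ψ : R) :
    lapOp D κ A (f + ψ) = lapOp D κ A f + lapOp D κ A ψ := by
  rw [lapOp, lapOp, lapOp, ← divg_add]
  congr 1
  funext k
  simp only [grad, Pi.add_apply, map_add, mul_add, Finset.sum_add_distrib]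

theorem lapOp_const_mul (A : Fin n → Fin n → R) {α : R} (hα : ∀ k, D k α = 0) (ψ : R) :
    lapOp D κ A (α * ψ) = α * lapOp D κ A ψ := by
  have e : grad D A (α * ψ) = fun k => α * grad D A ψ k := by
    rw [grad_mul]; funext k
    simp [grad, hα]
  have e2 : vf D (grad D A ψ) α = 0 := by rw [vf_apply]; simp [hα]
  rw [lapOp, e, divg_mul, e2, add_zero]; rfl

/-- The commutator of a vector field and a Laplace operator. -/
theorem vf_lapOp_sub (hcomm : ∀ i j x, D i (D j x) = D j (D i x))
    (hκ : ∀ i j, D i (κ j) = D j (κ i)) {A : Fin n → Fin n → R} (hA : ∀ k j, A k j = A j k)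
    (Y : Fin n → R) (ψ : R) :
    2 * vf D Y (lapOp D κ A ψ) + divg D κ Y * lapOp D κ A ψ
      - lapOp D κ A (2 * vf D Y ψ + divg D κ Y * ψ)
      = 2 * lapOp D κ (lieD D Y A) ψ - lapOp D κ A (divg D κ Y) * ψ := by
  have h1 := vf_divg hcomm hκ (grad D A ψ) Y
  rw [vfBracket_grad hcomm, divg_add] at h1
  have h2 : lapOp D κ A (2 * vf D Y ψ) = 2 * lapOp D κ A (vf D Y ψ) :=
    lapOp_const_mul A (fun k => Derivation.map_natCast _ 2) _
  rw [lapOp_add, h2, lapOp_mul hA]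
  rw [vf_grad_symm hA] at h1
  simp only [lapOp] at *
  linear_combination 2 * h1

/-- The commutator of two quantized Hamiltonians whose Laplace operators commute. -/
theorem quantOp_commutator (hcomm : ∀ i j x, D i (D j x) = D j (D i x))
    (hκ : ∀ i j, D i (κ j) = D j (κ i)) {A B : Fin n → Fin n → R} (hA : ∀ k j, A k j = A j k)
    (hB : ∀ k j, B k j = B j k) {α β : R} (hα : ∀ k, D k α = 0) (hβ : ∀ k, D k β = 0)
    (X Y : Fin n → R) (hAB : ∀ ψ, lapOp D κ A (lapOp D κ B ψ) = lapOp D κ B (lapOp D κ A ψ))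
    (hdiv : lapOp D κ A (divg D κ Y) = lapOp D κ B (divg D κ X)) (ψ : R) :
    quantOp D κ α β A X (quantOp D κ α β B Y ψ) - quantOp D κ α β B Y (quantOp D κ α β A X ψ)
      = 2 * β * quantOp D κ α β (lieD D X B - lieD D Y A) (vfBracket D X Y) ψ := by
  have hc : ∀ (Z : Fin n → R) {γ : R}, (∀ k, D k γ = 0) → ∀ x, vf D Z (γ * x) = γ * vf D Z x := by
    intro Z γ hγ x
    have : vf D Z γ = 0 := by rw [vf_apply]; simp [hγ]
    rw [Derivation.leibniz, this]; simp
  have h1 := vf_lapOp_sub hcomm hκ hB X ψ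
  have h2 := vf_lapOp_sub hcomm hκ hA Y ψ
  have h3 := vf_divg hcomm hκ Y X
  have h2' : ∀ (Z : Fin n → R) x, vf D Z (2 * x) = 2 * vf D Z x :=
    fun Z x => hc Z (fun k => Derivation.map_natCast _ 2) x
  have h4 : vf D X (vf D Y ψ) - vf D Y (vf D X ψ) = vf D (vfBracket D X Y) ψ := by
    have e : ∀ X Y : Fin n → R, vf D X (vf D Y ψ)
        = ∑ k, vf D X (Y k) * D k ψ + ∑ k, ∑ i, Y k * X i * D i (D k ψ) := by
      intro X Y
      rw [vf_apply D Y, map_sum, ← Finset.sum_add_distrib]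
      refine Finset.sum_congr rfl fun k _ => ?_
      rw [Derivation.leibniz, smul_eq_mul, smul_eq_mul, vf_apply D X (D k ψ), Finset.mul_sum]
      rw [add_comm, mul_comm]
      congr 1
      exact Finset.sum_congr rfl fun i _ => by ring
    rw [e, e, vf_apply]
    have e2 : ∑ k, ∑ i, Y k * X i * D i (D k ψ) = ∑ k, ∑ i, X k * Y i * D i (D k ψ) := by
      rw [Finset.sum_comm]
      exact Finset.sum_congr rfl fun k _ => Finset.sum_congr rfl fun i _ => by
        rw [hcomm]; ring
    rw [e2]
    simp only [vfBracket, sub_mul, Finset.sum_sub_distrib]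
    ring
  have hAψ := hAB ψ
  simp only [quantOp, lapOp_add, lapOp_const_mul _ hα, lapOp_const_mul _ hβ, map_add, hc _ hα,
    hc _ hβ, lapOp_sub_left] at h1 h2 h3 h4 hAψ ⊢
  simp only [h2', Derivation.leibniz, smul_eq_mul] at h1 h2 h3 h4 hAψ ⊢
  -- `hAψ` removes the products of Laplace operators. `h1` and `h2` give the Lie derivatives
  -- together with scalar terms that cancel by `hdiv`; `h3` and `h4` give the bracket of the vector
  -- fields and its divergence.
  linear_combination (α * β) * h1 - (α * β) * h2 + α ^ 2 * hAψ + 4 * β ^ 2 * h4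
    + (α * β * ψ) * hdiv + 2 * β ^ 2 * ψ * h3

end VectorFields

/-! ### The tensors over arbitrary rings and their transport along homomorphisms -/

section Universal

variable {R S : Type*} [CommRing R] [CommRing S] {n m : ℕ}

/-- The sequence of Viète coordinates with given nontrivial entries. -/
def vieta (x : Fin n → R) (k : ℤ) : R :=
  if k = 0 then 1 else if h : 1 ≤ k ∧ k ≤ n then x ⟨(k - 1).toNat, by omega⟩ else 0

/-- The components of the tensors `A_r`. -/
def genA (m : ℕ) (x : Fin n → R) (r k j : Fin n) : R :=
  res (beta (vieta x) (n + 1))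
    (beta (vieta x) (k + 1) * (beta (vieta x) (r + 1) * beta (vieta x) (j + 1) * X ^ m))

/-- The components of the vector potentials `P_r^{(γ)}`. -/
def genP (x : Fin n → R) (r : Fin n) (γ : ℕ) (j : Fin n) : R :=
  res (beta (vieta x) (n + 1)) (beta (vieta x) (j + 1) * (beta (vieta x) (r + 1) * X ^ γ))

/-- The components of the vector fields `J_r`. -/
def genJ (m : ℕ) (x : Fin n → R) (r k : Fin n) : R :=
  killC n m (r + 1) (vieta x) ((k : ℕ) + 1)

theorem isCoord_vieta (x : Fin n → R) : IsCoord n (vieta x) where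
  zero := by simp [vieta]
  neg k hk := by rw [vieta, if_neg (by omega), dif_neg (by omega)]
  big k hk := by rw [vieta, if_neg (by omega), dif_neg (by omega)]

theorem map_vieta (f : R →+* S) (x : Fin n → R) (k : ℤ) :
    f (vieta x k) = vieta (fun i => f (x i)) k := by
  unfold vieta; split_ifs <;> simp

theorem derivation_vieta (δ : Derivation ℤ R R) (x : Fin n → R) (k : ℤ) :
    δ (vieta x k) = if h : 1 ≤ k ∧ k ≤ n then δ (x ⟨(k - 1).toNat, by omega⟩) else 0 := by
  unfold vieta
  by_cases h0 : k = 0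
  · rw [if_pos h0, dif_neg (by omega), δ.map_one_eq_zero]
  · rw [if_neg h0]; split_ifs <;> simp

theorem derivation_vieta_single {δ : Derivation ℤ R R} {x : Fin n → R} {i : Fin n}
    (h : ∀ j, δ (x j) = if j = i then 1 else 0) (k : ℤ) :
    δ (vieta x k) = if k = i + 1 then 1 else 0 := by
  rw [derivation_vieta]
  have := i.2
  split_ifs with h1 h2 h2
  · rw [h, if_pos (by ext; simp only; omega)]
  · rw [h, if_neg (by rintro rfl; simp only at h2; omega)]
  · omega
  · rfl

theorem map_res [Nontrivial S] (f : R →+* S) {a : R[X]} (ha : a.Monic) (F : R[X]) :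
    f (res a F) = res (a.map f) (F.map f) := by
  rw [res_apply, res_apply, ha.natDegree_map, ← map_modByMonic f ha, coeff_map]

theorem map_res_vieta [Nontrivial S] (f : R →+* S) (x : Fin n → R) (F : R[X]) :
    f (res (beta (vieta x) (n + 1)) F)
      = res (beta (vieta fun i => f (x i)) (n + 1)) (F.map f) := by
  rw [map_res f (beta_monic (isCoord_vieta x) n), map_beta]
  simp only [map_vieta]

theorem map_beta_vieta (f : R →+* S) (x : Fin n → R) (s : ℕ) :
    (beta (vieta x) s).map f = beta (vieta fun i => f (x i)) s := by
  rw [map_beta]; simp only [map_vieta]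

theorem map_genA [Nontrivial S] (f : R →+* S) (x : Fin n → R) (r k j : Fin n) :
    f (genA m x r k j) = genA m (fun i => f (x i)) r k j := by
  rw [genA, map_res_vieta, genA]
  simp only [Polynomial.map_mul, map_beta_vieta, Polynomial.map_pow, map_X]

theorem map_genP [Nontrivial S] (f : R →+* S) (x : Fin n → R) (r : Fin n) (γ : ℕ) (j : Fin n) :
    f (genP x r γ j) = genP (fun i => f (x i)) r γ j := by
  rw [genP, map_res_vieta, genP]
  simp only [Polynomial.map_mul, map_beta_vieta, Polynomial.map_pow, map_X]

theorem map_genJ (f : R →+* S) (x : Fin n → R) (r k : Fin n) :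
    f (genJ m x r k) = genJ m (fun i => f (x i)) r k := by
  unfold genJ killC
  split_ifs <;> rw [map_mul, map_intCast, map_vieta]

/-- The derivations of a ring. -/
abbrev IntDerivation (R : Type*) [CommRing R] : Type _ := Derivation ℤ R R

/-- A derivation of an algebra as a derivation over the integers. -/
def intDerivation {k : Type*} [CommRing k] [Algebra k R] (δ : Derivation k R R) :
    Derivation ℤ R R :=
  Derivation.mk' δ.toLinearMap.toAddMonoidHom.toIntLinearMap fun x y => δ.leibniz x y

theorem genA_symm (x : Fin n → R) (r k j : Fin n) : genA m x r k j = genA m x r j k := by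
  exact congrArg (res _) (by ring)

theorem tensorA_eq (q : Fin n → ℝ) (r k j : Fin n) : tensorA m r q k j = genA m q r k j := by
  rw [tensorA_eq_res]; rfl

theorem potentialP_eq (q : Fin n → ℝ) (r : Fin n) (γ : ℕ) (j : Fin n) :
    potentialP r γ q j = genP q r γ j := by
  rw [potentialP_eq_res]; rfl

theorem killingJ_eq_genJ (q : Fin n → ℝ) (r k : Fin n) : killingJ m r q k = genJ m q r k :=
  killingJ_eq q r k

end Universal

/-! ### Polynomial functions on phase space -/

section Evaluation

variable {n m : ℕ}

theorem hasFDerivAt_eval {σ : Type*} [Fintype σ] (F : MvPolynomial σ ℝ) (x : σ → ℝ) :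
    HasFDerivAt (fun x => MvPolynomial.eval x F)
      (∑ i, MvPolynomial.eval x (MvPolynomial.pderiv i F) • ContinuousLinearMap.proj (R := ℝ) i :
        (σ → ℝ) →L[ℝ] ℝ) x := by
  classical
  induction F using MvPolynomial.induction_on with
  | C a => simpa using hasFDerivAt_const a x
  | add F G hF hG =>
    have := hF.add hG
    simp only [map_add, add_smul, Finset.sum_add_distrib]
    exact this
  | mul_X F i hF =>
    have := hF.mul (hasFDerivAt_apply (𝕜 := ℝ) i x)
    simp only [map_mul, MvPolynomial.eval_X]
    convert! this using 1
    ext v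
    simp only [Derivation.leibniz, MvPolynomial.pderiv_X, map_add, smul_eq_mul, map_mul,
      MvPolynomial.eval_X, Pi.single_apply, apply_ite (MvPolynomial.eval x), map_zero,
      mul_ite, mul_one, mul_zero, add_smul, Finset.sum_add_distrib, ite_smul, zero_smul,
      add_apply, sum_apply, smul_apply, ContinuousLinearMap.proj_apply, Finset.mul_sum, mul_assoc]
    congr 1
    rw [Finset.sum_eq_single i]
    · simp
    · intro j _ hj; rw [if_neg hj.symm]; rfl
    · simp

theorem pderiv_eval (F : MvPolynomial (Fin n) ℝ) (k : Fin n) (q : Fin n → ℝ) :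
    pderiv k (fun x => MvPolynomial.eval x F) q
      = MvPolynomial.eval q (MvPolynomial.pderiv k F) := by
  rw [pderiv, (hasFDerivAt_eval F q).fderiv]
  simp [Pi.single_apply]

/-- Polynomials on phase space. -/
abbrev PhasePoly (n : ℕ) := MvPolynomial (Fin n ⊕ Fin n) ℝ

theorem pderiv_eval_inl (F : PhasePoly n) (k : Fin n) (q p : Fin n → ℝ) :
    pderiv k (fun x => MvPolynomial.eval (Sum.elim x p) F) q
      = MvPolynomial.eval (Sum.elim q p) (MvPolynomial.pderiv (Sum.inl k) F) := by
  have h : HasFDerivAt (fun x : Fin n → ℝ => (Sum.elim x p : Fin n ⊕ Fin n → ℝ))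
      (ContinuousLinearMap.pi (Sum.elim (fun i => ContinuousLinearMap.proj (R := ℝ) i)
        fun _ => 0)) q := by
    rw [hasFDerivAt_pi']
    rintro (i | i)
    · exact hasFDerivAt_apply i q
    · exact hasFDerivAt_const (p i) q
  have h2 := (hasFDerivAt_eval F (Sum.elim q p)).comp q h
  rw [pderiv]
  erw [h2.fderiv]
  simp [Pi.single_apply]

theorem pderiv_eval_inr (F : PhasePoly n) (k : Fin n) (q p : Fin n → ℝ) :
    pderiv k (fun y => MvPolynomial.eval (Sum.elim q y) F) p
      = MvPolynomial.eval (Sum.elim q p) (MvPolynomial.pderiv (Sum.inr k) F) := by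
  have h : HasFDerivAt (fun x : Fin n → ℝ => (Sum.elim q x : Fin n ⊕ Fin n → ℝ))
      (ContinuousLinearMap.pi (Sum.elim (fun _ => 0)
        (fun i => ContinuousLinearMap.proj (R := ℝ) i))) p := by
    rw [hasFDerivAt_pi']
    rintro (i | i)
    · exact hasFDerivAt_const (q i) p
    · exact hasFDerivAt_apply i p
  have h2 := (hasFDerivAt_eval F (Sum.elim q p)).comp p h
  rw [pderiv]
  erw [h2.fderiv]
  simp [Pi.single_apply]

/-- The derivations `∂/∂q_i` of the polynomials on phase space. -/
def dqS (i : Fin n) : IntDerivation (PhasePoly n) :=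
  intDerivation (MvPolynomial.pderiv (Sum.inl i))

/-- The derivations `∂/∂p_i` of the polynomials on phase space. -/
def dpS (i : Fin n) : IntDerivation (PhasePoly n) :=
  intDerivation (MvPolynomial.pderiv (Sum.inr i))

theorem dqS_apply (i : Fin n) (F : PhasePoly n) :
    dqS i F = MvPolynomial.pderiv (Sum.inl i) F := rfl

theorem dpS_apply (i : Fin n) (F : PhasePoly n) :
    dpS i F = MvPolynomial.pderiv (Sum.inr i) F := rfl

/-- The Poisson bracket of polynomial functions. -/
theorem poisson_eval (F G : PhasePoly n) (q p : Fin n → ℝ) :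
    poisson (fun q p => MvPolynomial.eval (Sum.elim q p) F)
      (fun q p => MvPolynomial.eval (Sum.elim q p) G) q p
      = MvPolynomial.eval (Sum.elim q p) (ham dqS dpS G F) := by
  rw [poisson, ham_apply, map_sum]
  refine Finset.sum_congr rfl fun i _ => ?_
  simp only [pderiv_eval_inl, pderiv_eval_inr, map_sub, map_mul, dqS_apply, dpS_apply]

/-- The phase space polynomial `½ pᵀ A p + Yᵀ p`. -/
def quadH (A : Fin n → Fin n → MvPolynomial (Fin n) ℝ) (Y : Fin n → MvPolynomial (Fin n) ℝ) :
    PhasePoly n :=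
  MvPolynomial.C (1 / 2) * ∑ i, ∑ j, MvPolynomial.rename Sum.inl (A i j)
      * MvPolynomial.X (Sum.inr i) * MvPolynomial.X (Sum.inr j)
    + ∑ j, MvPolynomial.rename Sum.inl (Y j) * MvPolynomial.X (Sum.inr j)

theorem eval_rename_inl (F : MvPolynomial (Fin n) ℝ) (q p : Fin n → ℝ) :
    MvPolynomial.eval (Sum.elim q p) (MvPolynomial.rename Sum.inl F) = MvPolynomial.eval q F := by
  rw [MvPolynomial.eval_rename]; rfl

theorem eval_quadH (A : Fin n → Fin n → MvPolynomial (Fin n) ℝ)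
    (Y : Fin n → MvPolynomial (Fin n) ℝ) (q p : Fin n → ℝ) :
    MvPolynomial.eval (Sum.elim q p) (quadH A Y)
      = 1 / 2 * ∑ i, ∑ j, MvPolynomial.eval q (A i j) * p i * p j
        + ∑ j, MvPolynomial.eval q (Y j) * p j := by
  simp only [quadH, map_add, map_mul, map_sum, eval_rename_inl, MvPolynomial.eval_C,
    MvPolynomial.eval_X, Sum.elim_inr]

theorem pderiv_inr_rename_inl (F : MvPolynomial (Fin n) ℝ) (i : Fin n) :
    MvPolynomial.pderiv (Sum.inr i) (MvPolynomial.rename Sum.inl F : PhasePoly n) = 0 := by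
  induction F using MvPolynomial.induction_on with
  | C a => simp
  | add F G hF hG => simp [hF, hG]
  | mul_X F j hF =>
    rw [map_mul, Derivation.leibniz, hF, MvPolynomial.rename_X, MvPolynomial.pderiv_X_of_ne]
    · simp
    · simp

theorem dqS_quadH (A : Fin n → Fin n → MvPolynomial (Fin n) ℝ)
    (Y : Fin n → MvPolynomial (Fin n) ℝ) (i : Fin n) :
    dqS i (quadH A Y) = quadH (fun k j => MvPolynomial.pderiv i (A k j))
      (fun j => MvPolynomial.pderiv i (Y j)) := by
  have hX : ∀ j : Fin n, MvPolynomial.pderiv (Sum.inl i)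
      (MvPolynomial.X (Sum.inr j) : PhasePoly n) = 0 :=
    fun j => MvPolynomial.pderiv_X_of_ne (by simp)
  have hr : ∀ F : MvPolynomial (Fin n) ℝ, MvPolynomial.pderiv (Sum.inl i)
      (MvPolynomial.rename Sum.inl F : PhasePoly n)
      = MvPolynomial.rename Sum.inl (MvPolynomial.pderiv i F) :=
    fun F => MvPolynomial.pderiv_rename Sum.inl_injective _ _
  rw [dqS_apply, quadH, quadH, map_add, Derivation.leibniz, MvPolynomial.pderiv_C, smul_zero,
    add_zero, map_sum, map_sum]
  simp only [map_sum, Derivation.leibniz, hX, hr, zero_add, smul_eq_mul, mul_zero]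
  congr 2
  · refine Finset.sum_congr rfl fun k _ => Finset.sum_congr rfl fun j _ => by ring
  · funext j; ring

theorem eval_dpS_quadH {A : Fin n → Fin n → MvPolynomial (Fin n) ℝ}
    (hA : ∀ i j, A i j = A j i)
    (Y : Fin n → MvPolynomial (Fin n) ℝ) (i : Fin n) (q p : Fin n → ℝ) :
    MvPolynomial.eval (Sum.elim q p) (dpS i (quadH A Y))
      = ∑ j, MvPolynomial.eval q (A i j) * p j + MvPolynomial.eval q (Y i) := by
  classical
  have hX : ∀ j : Fin n, MvPolynomial.pderiv (Sum.inr i)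
      (MvPolynomial.X (Sum.inr j) : PhasePoly n) = if j = i then 1 else 0 := by
    intro j
    rw [MvPolynomial.pderiv_X, Pi.single_apply]
    simp
  rw [dpS_apply, quadH, map_add, Derivation.leibniz, MvPolynomial.pderiv_C, smul_zero,
    add_zero, map_sum, map_sum]
  simp only [map_sum, Derivation.leibniz, hX, pderiv_inr_rename_inl, smul_eq_mul,
    add_zero, map_add, map_mul, mul_ite, mul_one, mul_zero, apply_ite
    (MvPolynomial.eval (Sum.elim q p)), map_zero, eval_rename_inl, MvPolynomial.eval_C,
    MvPolynomial.eval_X, Sum.elim_inr, Finset.sum_add_distrib, Finset.sum_ite_eq',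
    Finset.mem_univ, if_true]
  rw [Finset.sum_comm]
  simp only [Finset.sum_ite_eq', Finset.mem_univ, if_true]
  congr 1
  have : ∑ j, p j * MvPolynomial.eval q (A j i) = ∑ j, MvPolynomial.eval q (A i j) * p j :=
    Finset.sum_congr rfl fun j _ => by rw [hA, mul_comm]
  have h2 : ∑ j, p j * MvPolynomial.eval q (A i j) = ∑ j, MvPolynomial.eval q (A i j) * p j :=
    Finset.sum_congr rfl fun j _ => by rw [mul_comm]
  simp only [mul_comm (p _)] at *
  linarith

end Evaluation

/-! ### Separation of the powers of the momenta -/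

section Extraction

variable {n : ℕ}

/-- The partial derivatives of polynomials in the coordinates. -/
def dP (k : Fin n) : IntDerivation (MvPolynomial (Fin n) ℝ) :=
  intDerivation (MvPolynomial.pderiv k)

theorem dP_apply (k : Fin n) (F : MvPolynomial (Fin n) ℝ) : dP k F = MvPolynomial.pderiv k F := rfl

theorem half_sum_lieD {A : Fin n → Fin n → MvPolynomial (Fin n) ℝ}
    (hA : ∀ i j, A i j = A j i) (Y : Fin n → MvPolynomial (Fin n) ℝ) (q p : Fin n → ℝ) :
    1 / 2 * ∑ k, ∑ j, MvPolynomial.eval q (lieD dP Y A k j) * p k * p j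
      = ∑ i, (MvPolynomial.eval q (Y i)
          * (1 / 2 * ∑ k, ∑ j, MvPolynomial.eval q (dP i (A k j)) * p k * p j)
        - (∑ j, MvPolynomial.eval q (A i j) * p j)
          * ∑ k, MvPolynomial.eval q (dP i (Y k)) * p k) := by
  have e1 : ∑ k, ∑ j, MvPolynomial.eval q (vf dP Y (A k j)) * p k * p j
      = ∑ i, MvPolynomial.eval q (Y i)
          * ∑ k, ∑ j, MvPolynomial.eval q (dP i (A k j)) * p k * p j := by
    simp only [vf_apply, map_sum, map_mul, Finset.sum_mul, Finset.mul_sum]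
    rw [Finset.sum_comm_cycle]
    refine Finset.sum_congr rfl fun i _ => Finset.sum_congr rfl fun k _ =>
      Finset.sum_congr rfl fun j _ => by ring
  have e2 : ∑ k, ∑ j, MvPolynomial.eval q (∑ i, A i j * dP i (Y k)) * p k * p j
      = ∑ i, (∑ j, MvPolynomial.eval q (A i j) * p j)
          * ∑ k, MvPolynomial.eval q (dP i (Y k)) * p k := by
    simp only [map_sum, map_mul, Finset.sum_mul, Finset.mul_sum]
    rw [Finset.sum_comm_cycle]
    refine Finset.sum_congr rfl fun i _ => Finset.sum_congr rfl fun k _ =>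
      Finset.sum_congr rfl fun j _ => by ring
  have e3 : ∑ k, ∑ j, MvPolynomial.eval q (∑ i, A k i * dP i (Y j)) * p k * p j
      = ∑ k, ∑ j, MvPolynomial.eval q (∑ i, A i j * dP i (Y k)) * p k * p j := by
    rw [Finset.sum_comm]
    refine Finset.sum_congr rfl fun k _ => Finset.sum_congr rfl fun j _ => ?_
    simp only [hA j]; ring
  simp only [lieD, map_sub, sub_mul, Finset.sum_sub_distrib]
  rw [e3, e1, e2]
  simp only [mul_left_comm (MvPolynomial.eval q (Y _)) (1 / 2 : ℝ), ← Finset.mul_sum]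
  ring

/-- The bracket of two inhomogeneous quadratic Hamiltonians. -/
theorem eval_ham_quadH {A B : Fin n → Fin n → MvPolynomial (Fin n) ℝ}
    (hA : ∀ i j, A i j = A j i) (hB : ∀ i j, B i j = B j i)
    (Y Z : Fin n → MvPolynomial (Fin n) ℝ) (q : Fin n → ℝ) :
    ∃ κ : (Fin n → ℝ) → ℝ, (∀ (t : ℝ) p, κ (t • p) = t ^ 3 * κ p) ∧
      ∀ p, MvPolynomial.eval (Sum.elim q p) (ham dqS dpS (quadH B Z) (quadH A Y))
        = κ p + 1 / 2 * ∑ k, ∑ j, MvPolynomial.eval q (lieD dP Z A k j - lieD dP Y B k j) * p k * p j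
          + ∑ k, MvPolynomial.eval q (vfBracket dP Z Y k) * p k := by
  -- The cubic part is the bracket of the two quadratic forms. Only its scaling behaviour is
  -- recorded, which suffices to separate it from the lower degrees.
  refine ⟨fun p => ∑ i, ((1 / 2 * ∑ k, ∑ j, MvPolynomial.eval q (dP i (A k j)) * p k * p j)
      * (∑ j, MvPolynomial.eval q (B i j) * p j)
      - (∑ j, MvPolynomial.eval q (A i j) * p j)
      * (1 / 2 * ∑ k, ∑ j, MvPolynomial.eval q (dP i (B k j)) * p k * p j)), ?_, ?_⟩
  · intro t p
    have h1 : ∀ a : Fin n → Fin n → ℝ, ∑ k, ∑ j, a k j * (t • p) k * (t • p) j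
        = t ^ 2 * ∑ k, ∑ j, a k j * p k * p j := by
      intro a
      simp only [Finset.mul_sum, Pi.smul_apply, smul_eq_mul]
      exact Finset.sum_congr rfl fun k _ => Finset.sum_congr rfl fun j _ => by ring
    have h2 : ∀ a : Fin n → ℝ, ∑ j, a j * (t • p) j = t * ∑ j, a j * p j := by
      intro a
      simp only [Finset.mul_sum, Pi.smul_apply, smul_eq_mul]
      exact Finset.sum_congr rfl fun k _ => by ring
    simp only [h1]
    simp only [h2]
    rw [Finset.mul_sum]
    exact Finset.sum_congr rfl fun i _ => by ring
  · intro p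
    have hl : ∑ k, MvPolynomial.eval q (vfBracket dP Z Y k) * p k
        = ∑ i, (MvPolynomial.eval q (Z i) * (∑ k, MvPolynomial.eval q (dP i (Y k)) * p k)
          - MvPolynomial.eval q (Y i) * ∑ k, MvPolynomial.eval q (dP i (Z k)) * p k) := by
      simp only [vfBracket, vf_apply, map_sub, map_sum, map_mul, sub_mul, Finset.sum_mul,
        Finset.sum_sub_distrib, Finset.mul_sum]
      congr 1 <;>
      · rw [Finset.sum_comm]
        exact Finset.sum_congr rfl fun k _ => Finset.sum_congr rfl fun j _ => by ring
    have hs : 1 / 2 * ∑ k, ∑ j, MvPolynomial.eval q (lieD dP Z A k j - lieD dP Y B k j) * p k * p j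
        = 1 / 2 * ∑ k, ∑ j, MvPolynomial.eval q (lieD dP Z A k j) * p k * p j
          - 1 / 2 * ∑ k, ∑ j, MvPolynomial.eval q (lieD dP Y B k j) * p k * p j := by
      simp only [map_sub, sub_mul, Finset.sum_sub_distrib, mul_sub]
    rw [hl, hs, half_sum_lieD hA, half_sum_lieD hB, ham_apply, map_sum, ← Finset.sum_sub_distrib,
      ← Finset.sum_add_distrib, ← Finset.sum_add_distrib]
    refine Finset.sum_congr rfl fun i _ => ?_
    rw [map_sub, map_mul, map_mul, eval_dpS_quadH hA, eval_dpS_quadH hB, dqS_quadH, dqS_quadH,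
      eval_quadH, eval_quadH]
    simp only [dP_apply]
    ring

theorem eq_zero_of_cubic {B : Fin n → Fin n → ℝ} (hB : ∀ i j, B i j = B j i) {z : Fin n → ℝ}
    {κ : (Fin n → ℝ) → ℝ} (hκ : ∀ (t : ℝ) p, κ (t • p) = t ^ 3 * κ p) {f : ℝ}
    (h : ∀ p : Fin n → ℝ, κ p + 1 / 2 * ∑ k, ∑ j, B k j * p k * p j + ∑ k, z k * p k = f) :
    (∀ i j, B i j = 0) ∧ ∀ i, z i = 0 := by
  have h1 : ∀ (t : ℝ) (p : Fin n → ℝ), ∑ k, ∑ j, B k j * (t • p) k * (t • p) j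
      = t ^ 2 * ∑ k, ∑ j, B k j * p k * p j := by
    intro t p
    simp only [Finset.mul_sum, Pi.smul_apply, smul_eq_mul]
    exact Finset.sum_congr rfl fun k _ => Finset.sum_congr rfl fun j _ => by ring
  have h2 : ∀ (t : ℝ) (p : Fin n → ℝ), ∑ j, z j * (t • p) j = t * ∑ j, z j * p j := by
    intro t p
    simp only [Finset.mul_sum, Pi.smul_apply, smul_eq_mul]
    exact Finset.sum_congr rfl fun k _ => by ring
  have h3 : ∀ (p : Fin n → ℝ), ∑ k, ∑ j, B k j * p k * p j = 0 ∧ ∑ k, z k * p k = 0 := by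
    intro p
    -- The factor `0` gives `f = 0`, the factors `1` and `-1` isolate the even part, and `2`
    -- separates degree one from degree three.
    have a0 := h ((0 : ℝ) • p)
    have a1 := h ((1 : ℝ) • p)
    have a2 := h ((-1 : ℝ) • p)
    have a3 := h ((2 : ℝ) • p)
    rw [hκ, h1, h2] at a0 a1 a2 a3
    constructor <;> linarith
  classical
  constructor
  · have hd : ∀ i j, ∑ k, ∑ l, B k l * (Pi.single i (1 : ℝ) + Pi.single j (1 : ℝ) : Fin n → ℝ) k
        * (Pi.single i (1 : ℝ) + Pi.single j (1 : ℝ) : Fin n → ℝ) l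
        = B i i + B i j + B j i + B j j := by
      intro i j
      simp only [Pi.add_apply, Pi.single_apply, mul_add, mul_ite, mul_one, mul_zero,
        Finset.sum_add_distrib, Finset.sum_ite_eq', Finset.mem_univ, if_true]
      ring
    intro i j
    have b1 := (h3 (Pi.single i 1 + Pi.single j 1)).1
    have b2 := (h3 (Pi.single i 1 + Pi.single i 1)).1
    have b3 := (h3 (Pi.single j 1 + Pi.single j 1)).1
    rw [hd] at b1 b2 b3
    have := hB i j
    linarith
  · intro i
    have := (h3 (Pi.single i 1)).2
    simpa [Pi.single_apply] using this

end Extraction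

/-! ### Smooth functions on an open set as a differential ring -/

section SmoothFunctions

variable {n : ℕ} {Q : Set (Fin n → ℝ)}

open Classical in
/-- Extension of a function on a set by zero. -/
def extendZero (f : Q → ℂ) (x : Fin n → ℝ) : ℂ := if h : x ∈ Q then f ⟨x, h⟩ else 0

theorem extendZero_apply (f : Q → ℂ) (x : Q) : extendZero f x = f x := by
  rw [extendZero, dif_pos x.2]

theorem eqOn_extendZero {f : Q → ℂ} {g : (Fin n → ℝ) → ℂ} (h : ∀ x : Q, g x = f x) :
    Set.EqOn (extendZero f) g Q := fun x hx => by
  rw [h ⟨x, hx⟩]; exact extendZero_apply f ⟨x, hx⟩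

variable (Q) in
/-- The ring of smooth complex functions on a subset of `ℝⁿ`. -/
def SmoothFun : Subring (Q → ℂ) where
  carrier := {f | ContDiffOn ℝ ∞ (extendZero f) Q}
  mul_mem' {f g} hf hg := (ContDiffOn.mul hf hg).congr
    (eqOn_extendZero fun x => by simp [extendZero_apply])
  one_mem' := (contDiffOn_const (c := (1 : ℂ))).congr (eqOn_extendZero fun x => by simp)
  add_mem' {f g} hf hg := (ContDiffOn.add hf hg).congr
    (eqOn_extendZero fun x => by simp [extendZero_apply])
  zero_mem' := (contDiffOn_const (c := (0 : ℂ))).congr (eqOn_extendZero fun x => by simp)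
  neg_mem' {f} hf := (ContDiffOn.neg hf).congr
    (eqOn_extendZero fun x => by simp [extendZero_apply])

/-- The restriction of a smooth function. -/
def mkSmooth (g : (Fin n → ℝ) → ℂ) (hg : ContDiffOn ℝ ∞ g Q) : SmoothFun Q :=
  ⟨fun x => g x, hg.congr (eqOn_extendZero fun _ => rfl)⟩

@[simp] theorem mkSmooth_apply (g : (Fin n → ℝ) → ℂ) (hg : ContDiffOn ℝ ∞ g Q) (x : Q) :
    (mkSmooth g hg).1 x = g x := rfl

theorem SmoothFun.ext' {f g : SmoothFun Q} (h : ∀ x, f.1 x = g.1 x) : f = g :=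
  Subtype.ext (funext h)

theorem SmoothFun.differentiableAt (hQ : IsOpen Q) (f : SmoothFun Q) (x : Q) :
    DifferentiableAt ℝ (extendZero f.1) x :=
  (f.2.contDiffAt (hQ.mem_nhds x.2)).differentiableAt (by simp)

theorem contDiffOn_pderiv (hQ : IsOpen Q) {g : (Fin n → ℝ) → ℂ} (hg : ContDiffOn ℝ ∞ g Q)
    (k : Fin n) : ContDiffOn ℝ ∞ (pderiv k g) Q :=
  (hg.fderiv_of_isOpen hQ (m := ∞) (by simp)).clm_apply contDiffOn_const

/-- Partial derivatives of smooth functions. -/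
def partialD (hQ : IsOpen Q) (k : Fin n) : IntDerivation (SmoothFun Q) :=
  Derivation.mk'
    (AddMonoidHom.toIntLinearMap
      { toFun := fun f => mkSmooth (pderiv k (extendZero f.1)) (contDiffOn_pderiv hQ f.2 k)
        map_zero' := SmoothFun.ext' fun x => by
          have : extendZero (0 : Q → ℂ) = fun _ => 0 := by funext x; simp [extendZero]
          simp [pderiv, this]
        map_add' := fun f g => SmoothFun.ext' fun x => by
          have : extendZero (f + g).1 = fun x => extendZero f.1 x + extendZero g.1 x := by
            funext x; simp only [extendZero]; split_ifs <;> simp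
          change pderiv k (extendZero (f + g).1) x
            = pderiv k (extendZero f.1) x + pderiv k (extendZero g.1) x
          simp only [pderiv, this]
          rw [fderiv_fun_add (SmoothFun.differentiableAt hQ f x)
            (SmoothFun.differentiableAt hQ g x)]
          rfl })
    (fun f g => SmoothFun.ext' fun x => by
      have : extendZero (f * g).1 = fun x => extendZero f.1 x * extendZero g.1 x := by
        funext x; simp only [extendZero]; split_ifs <;> simp
      change pderiv k (extendZero (f * g).1) x
        = f.1 x * pderiv k (extendZero g.1) x + g.1 x * pderiv k (extendZero f.1) x
      simp only [pderiv, this]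
      rw [fderiv_fun_mul (SmoothFun.differentiableAt hQ f x)
            (SmoothFun.differentiableAt hQ g x)]
      simp [extendZero_apply])

/-- On an open set derivatives ignore the values outside. The extension by zero, which need not be
smooth, is therefore harmless. -/
theorem pderiv_congr_of_eqOn (hQ : IsOpen Q) {f g : (Fin n → ℝ) → ℂ} (h : Set.EqOn f g Q)
    {x : Fin n → ℝ} (hx : x ∈ Q) (k : Fin n) : pderiv k f x = pderiv k g x := by
  have : f =ᶠ[nhds x] g := Filter.eventuallyEq_of_mem (hQ.mem_nhds hx) h
  rw [pderiv, pderiv, this.fderiv_eq]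

theorem pderiv_eq_partialD (hQ : IsOpen Q) (k : Fin n) {f : SmoothFun Q} {g : (Fin n → ℝ) → ℂ}
    (h : ∀ x : Q, g x = f.1 x) (x : Q) : pderiv k g x = (partialD hQ k f).1 x :=
  (pderiv_congr_of_eqOn hQ (eqOn_extendZero h) x.2 k).symm

theorem partialD_comm (hQ : IsOpen Q) (i j : Fin n) (f : SmoothFun Q) :
    partialD hQ i (partialD hQ j f) = partialD hQ j (partialD hQ i f) := by
  refine SmoothFun.ext' fun x => ?_
  have hf := f.2.contDiffAt (hQ.mem_nhds x.2)
  have hd : DifferentiableAt ℝ (fderiv ℝ (extendZero f.1)) x :=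
    (hf.fderiv_right (m := 1) (by norm_cast)).differentiableAt (by simp)
  have key : ∀ i j : Fin n, (partialD hQ i (partialD hQ j f)).1 x
      = fderiv ℝ (fderiv ℝ (extendZero f.1)) x (Pi.single i 1) (Pi.single j 1) := by
    intro i j
    rw [← pderiv_eq_partialD hQ i (g := pderiv j (extendZero f.1)) (fun _ => rfl)]
    change fderiv ℝ (fun x => fderiv ℝ (extendZero f.1) x (Pi.single j 1)) x _ = _
    rw [fderiv_clm_apply hd (differentiableAt_const _)]
    simp
  rw [key, key]
  refine (hf.isSymmSndFDerivAt ?_).eq _ _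
  rw [minSmoothness_of_isRCLikeNormedField]
  norm_cast

theorem contDiff_eval (F : MvPolynomial (Fin n) ℝ) :
    ContDiff ℝ ∞ (fun x => ((MvPolynomial.eval x F : ℝ) : ℂ)) := by
  induction F using MvPolynomial.induction_on with
  | C a => simpa using contDiff_const
  | add F G hF hG => simpa using hF.add hG
  | mul_X F i hF =>
    simp only [map_mul, MvPolynomial.eval_X, Complex.ofReal_mul]
    exact hF.mul (Complex.ofRealCLM.contDiff.comp (contDiff_apply ℝ ℝ i))

/-- Polynomials as smooth functions. -/
def polyFun : MvPolynomial (Fin n) ℝ →+* SmoothFun Q where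
  toFun F := mkSmooth (fun x => ((MvPolynomial.eval x F : ℝ) : ℂ)) (contDiff_eval F).contDiffOn
  map_one' := SmoothFun.ext' fun x => by simp
  map_mul' F G := SmoothFun.ext' fun x => by simp
  map_zero' := SmoothFun.ext' fun x => by simp
  map_add' F G := SmoothFun.ext' fun x => by simp

@[simp] theorem polyFun_apply (F : MvPolynomial (Fin n) ℝ) (x : Q) :
    (polyFun F : SmoothFun Q).1 x = ((MvPolynomial.eval (x : Fin n → ℝ) F : ℝ) : ℂ) := rfl

theorem partialD_polyFun (hQ : IsOpen Q) (k : Fin n) (F : MvPolynomial (Fin n) ℝ) :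
    partialD hQ k (polyFun F) = polyFun (dP k F) := by
  refine SmoothFun.ext' fun x => ?_
  rw [← pderiv_eq_partialD hQ k (g := fun x => ((MvPolynomial.eval x F : ℝ) : ℂ)) (fun _ => rfl),
    polyFun_apply, dP_apply, ← pderiv_eval, pderiv, pderiv]
  have h := (hasFDerivAt_eval F x.1)
  have h2 := (Complex.ofRealCLM.hasFDerivAt (x := MvPolynomial.eval x.1 F)).comp x.1 h
  rw [h.fderiv]
  erw [h2.fderiv]
  rfl

theorem map_vf {R S : Type*} [CommRing R] [CommRing S] (f : R →+* S)
    {D : Fin n → IntDerivation R} {E : Fin n → IntDerivation S} (h : ∀ k x, E k (f x) = f (D k x))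
    (Y : Fin n → R) (x : R) : f (vf D Y x) = vf E (fun k => f (Y k)) (f x) := by
  simp only [vf_apply, map_sum, map_mul, h]

theorem map_lieD {R S : Type*} [CommRing R] [CommRing S] (f : R →+* S)
    {D : Fin n → IntDerivation R} {E : Fin n → IntDerivation S} (h : ∀ k x, E k (f x) = f (D k x))
    (Y : Fin n → R) (A : Fin n → Fin n → R) (k j : Fin n) :
    f (lieD D Y A k j) = lieD E (fun k => f (Y k)) (fun k j => f (A k j)) k j := by
  simp only [lieD, map_sub, map_sum, map_mul, map_vf f h, h]

theorem map_vfBracket {R S : Type*} [CommRing R] [CommRing S] (f : R →+* S)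
    {D : Fin n → IntDerivation R} {E : Fin n → IntDerivation S} (h : ∀ k x, E k (f x) = f (D k x))
    (X Y : Fin n → R) (k : Fin n) :
    f (vfBracket D X Y k) = vfBracket E (fun k => f (X k)) (fun k => f (Y k)) k := by
  simp only [vfBracket, map_sub, map_vf f h]

end SmoothFunctions

/-! ### Coordinates and density on the configuration space -/

section Configuration

variable {n m : ℕ}

theorem isOpen_configSpace (hn : 0 < n) : IsOpen (configSpace n m) := by
  have : configSpace n m = (fun q : Fin n → ℝ => coord q n ^ (2 * m)) ⁻¹' {0}ᶜ := by
    ext q; rw [mem_configSpace_iff q hn]; rfl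
  rw [this]
  refine isOpen_compl_singleton.preimage ?_
  obtain ⟨k, rfl⟩ : ∃ k, n = k + 1 := ⟨n - 1, by omega⟩
  have e : ∀ q : Fin (k + 1) → ℝ, coord q ((k + 1 : ℕ) : ℤ) = q (Fin.last k) := by
    intro q; rw [← coord_succ q (Fin.last k)]; simp
  simp only [e]
  fun_prop

/-- The coordinates as elements of the ring of smooth functions. -/
def coordFun (i : Fin n) : SmoothFun (configSpace n m) := polyFun (MvPolynomial.X i)

theorem vieta_coordFun (k : ℤ) :
    vieta (coordFun (m := m)) k = (polyFun (vieta MvPolynomial.X k) : SmoothFun (configSpace n m)) := by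
  rw [map_vieta]; rfl

theorem vieta_coordFun_apply (k : ℤ) (x : configSpace n m) :
    (vieta (coordFun (m := m)) k).1 x = (coord x.1 k : ℂ) := by
  rw [vieta_coordFun, polyFun_apply, map_vieta (MvPolynomial.eval x.1)]
  simp only [MvPolynomial.eval_X]; rfl

theorem isPartials_coordFun (hQ : IsOpen (configSpace n m)) :
    IsPartials (vieta coordFun) (partialD hQ) where
  comm := partialD_comm hQ
  coord i k := by
    refine derivation_vieta_single (fun j => ?_) k
    rw [coordFun, partialD_polyFun, dP_apply, MvPolynomial.pderiv_X, Pi.single_apply]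
    split_ifs <;> simp

theorem coord_ne_zero (hn : 0 < n) (hm : m ≠ 0) (x : configSpace n m) : coord x.1 n ≠ 0 := by
  have h := (mem_configSpace_iff x.1 hn).1 x.2
  exact fun h0 => h (by rw [h0, zero_pow (by omega)])

/-- The function `1 / q_n`, replaced by zero if `m = 0`. -/
def invCoord (hn : 0 < n) : SmoothFun (configSpace n m) :=
  mkSmooth (fun x => if m = 0 then 0 else
      ((MvPolynomial.eval x (vieta MvPolynomial.X n : MvPolynomial (Fin n) ℝ) : ℝ) : ℂ)⁻¹) <| by
    by_cases h : m = 0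
    · simp only [if_pos h]; exact contDiffOn_const
    · simp only [if_neg h]
      refine (contDiff_eval _).contDiffOn.inv fun x hx => ?_
      rw [map_vieta]
      simp only [MvPolynomial.eval_X]
      exact Complex.ofReal_ne_zero.2 (coord_ne_zero hn h ⟨x, hx⟩)

theorem invCoord_mul (hn : 0 < n) (hm : m ≠ 0) :
    invCoord hn * vieta (coordFun (m := m)) n = 1 := by
  refine SmoothFun.ext' fun x => ?_
  have h := coord_ne_zero hn hm x
  change (invCoord hn).1 x * (vieta (coordFun (m := m)) n).1 x = 1
  rw [vieta_coordFun_apply, invCoord, mkSmooth_apply, if_neg hm, map_vieta]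
  simp only [MvPolynomial.eval_X]
  exact inv_mul_cancel₀ (Complex.ofReal_ne_zero.2 h)

/-- As a real power of the function `q_n^(2m)`, which does not vanish on the configuration space,
the density is seen to be smooth. -/
theorem density_eq (hn : 0 < n) {q : Fin n → ℝ} (hq : q ∈ configSpace n m) :
    density m q = (coord q n ^ (2 * m)) ^ (-(1 / 4) : ℝ) := by
  have h := density_pow_four q hn hq
  have h0 : 0 ≤ density m q := Real.sqrt_nonneg _
  have h1 : (coord q n ^ (2 * m)) = (density m q ^ 4)⁻¹ := eq_inv_of_mul_eq_one_right h
  rw [h1, Real.inv_rpow (by positivity), ← Real.rpow_neg (by positivity), neg_neg,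
    ← Real.rpow_natCast, ← Real.rpow_mul h0]
  norm_num

/-- The density as an element of the ring of smooth functions. -/
def densityFun (hn : 0 < n) : SmoothFun (configSpace n m) :=
  mkSmooth (fun x => (density m x : ℂ)) <| by
    refine Complex.ofRealCLM.contDiff.comp_contDiffOn ?_
    have : ContDiffOn ℝ ∞ (fun q : Fin n → ℝ => (coord q n ^ (2 * m)) ^ (-(1 / 4) : ℝ))
        (configSpace n m) := by
      refine ContDiffOn.rpow_const_of_ne ?_ fun x hx => (mem_configSpace_iff x hn).1 hx
      obtain ⟨k, rfl⟩ : ∃ k, n = k + 1 := ⟨n - 1, by omega⟩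
      have e : ∀ q : Fin (k + 1) → ℝ, coord q ((k + 1 : ℕ) : ℤ) = q (Fin.last k) := by
        intro q; rw [← coord_succ q (Fin.last k)]; simp
      simp only [e]
      fun_prop
    exact this.congr fun x hx => density_eq hn hx

theorem densityFun_apply (hn : 0 < n) (x : configSpace n m) :
    (densityFun hn).1 x = (density m x.1 : ℂ) := rfl

theorem density_ne_zero (hn : 0 < n) (x : configSpace n m) : density m x.1 ≠ 0 := by
  intro h
  have := density_pow_four x.1 hn x.2
  rw [h] at this; simp at this

/-- The logarithmic differential of the density. -/
def densityForm (hn : 0 < n) (k : Fin n) : SmoothFun (configSpace n m) :=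
  if (k : ℕ) + 1 = n then -(polyFun (MvPolynomial.C ((m : ℝ) / 2)) * invCoord hn) else 0

/-- Differentiating `μ⁴ q_n^(2m) = 1` and multiplying by `μ` gives `4 ∂μ = -2m μ/q_n` in the last
direction and zero in the others. The case `m = 0` is separate because `invCoord` is then zero. -/
theorem partialD_densityFun (hn : 0 < n) (hQ : IsOpen (configSpace n m)) (k : Fin n) :
    partialD hQ k (densityFun hn) = densityForm hn k * densityFun hn := by
  have h4 : densityFun hn ^ 4 * vieta (coordFun (m := m)) n ^ (2 * m) = 1 := by
    refine SmoothFun.ext' fun x => ?_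
    change (densityFun hn).1 x ^ 4 * (vieta (coordFun (m := m)) n).1 x ^ (2 * m) = 1
    rw [vieta_coordFun_apply, densityFun_apply]
    exact_mod_cast density_pow_four x.1 hn x.2
  have hD := (isPartials_coordFun hQ).coord k n
  have h5 := congrArg (partialD hQ k) h4
  rw [Derivation.leibniz, Derivation.leibniz_pow, Derivation.leibniz_pow,
    Derivation.map_one_eq_zero, hD] at h5
  simp only [smul_eq_mul, nsmul_eq_mul] at h5
  set μ := densityFun (m := m) hn
  set y := vieta (coordFun (m := m)) n
  have h6 : 4 * partialD hQ k μ = 4 * (densityForm hn k * μ) := by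
    by_cases hm : m = 0
    · have e : densityForm (m := m) hn k = 0 := by
        rw [densityForm, hm]; simp
      rw [e, zero_mul, mul_zero]
      have h2m : 2 * m = 0 := by omega
      have : y ^ (2 * m) = 1 := by rw [h2m, pow_zero]
      rw [this, mul_one] at h4
      have hm' : ((2 * m : ℕ) : SmoothFun (configSpace n m)) = 0 := by rw [h2m]; simp
      rw [hm', this] at h5
      linear_combination (μ : SmoothFun (configSpace n m)) * h5 - 4 * (partialD hQ k μ) * h4
    · have hν := invCoord_mul (m := m) hn hm
      have hy : y ^ (2 * m - 1) = invCoord hn * y ^ (2 * m) := by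
        have : y ^ (2 * m) = y ^ (2 * m - 1) * y := by rw [← pow_succ]; congr 1; omega
        rw [this]; linear_combination (-y ^ (2 * m - 1)) * hν
      rw [hy] at h5
      have hw : (polyFun (MvPolynomial.C ((m : ℝ) / 2)) : SmoothFun (configSpace n m)) * 2
          = (m : ℕ) := by
        refine SmoothFun.ext' fun x => ?_
        change (polyFun (MvPolynomial.C ((m : ℝ) / 2)) : SmoothFun (configSpace n m)).1 x * 2 = _
        rw [polyFun_apply, MvPolynomial.eval_C]; push_cast; simp
      by_cases hk : (k : ℕ) + 1 = n
      · rw [if_pos (by exact_mod_cast hk.symm)] at h5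
        rw [densityForm, if_pos hk]
        push_cast at h5
        linear_combination (μ : SmoothFun (configSpace n m)) * h5
          - (4 * partialD hQ k μ + 2 * (m : SmoothFun (configSpace n m)) * invCoord hn * μ) * h4
          + 2 * invCoord hn * μ * hw
      · rw [if_neg (by intro h; exact hk (by exact_mod_cast h.symm))] at h5
        rw [densityForm, if_neg hk]
        linear_combination (μ : SmoothFun (configSpace n m)) * h5
          - (4 * partialD hQ k μ) * h4
  refine SmoothFun.ext' fun x => ?_
  have h7 := congrArg (fun f : SmoothFun (configSpace n m) => f.1 x) h6
  have h8 : (4 : ℂ) * (partialD hQ k μ).1 x = 4 * (densityForm hn k * μ).1 x := h7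
  linear_combination h8 / 4

theorem weightedDiv_eq_divg (hn : 0 < n) (hQ : IsOpen (configSpace n m))
    (Y : Fin n → SmoothFun (configSpace n m)) :
    weightedDiv (partialD hQ) (polyFun (MvPolynomial.C ((m : ℝ) / 2))) (invCoord hn) Y
      = divg (partialD hQ) (densityForm hn) Y := by
  rw [weightedDiv, divg, Finset.sum_add_distrib, sub_eq_add_neg, Finset.mul_sum,
    ← Finset.sum_neg_distrib]
  congr 1
  refine Finset.sum_congr rfl fun k _ => ?_
  rw [densityForm]
  split_ifs <;> ring

theorem densityForm_closed (hn : 0 < n) (hQ : IsOpen (configSpace n m)) (i j : Fin n) :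
    partialD hQ i (densityForm hn j) = partialD hQ j (densityForm hn i) := by
  have hc : ∀ k a, partialD hQ k (polyFun (MvPolynomial.C a)) = 0 := by
    intro k a; rw [partialD_polyFun, dP_apply, MvPolynomial.pderiv_C, map_zero]
  have h : ∀ k : Fin n, (k : ℕ) + 1 ≠ n →
      partialD hQ k (-(polyFun (MvPolynomial.C ((m : ℝ) / 2)) * invCoord (m := m) hn)) = 0 := by
    intro k hk
    rw [map_neg, Derivation.leibniz, hc, smul_zero, add_zero, neg_eq_zero]
    by_cases hm : m = 0
    · have : (m : ℝ) / 2 = 0 := by rw [hm]; simp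
      rw [this, MvPolynomial.C_0, map_zero, zero_smul]
    · have hν := invCoord_mul (m := m) hn hm
      have h5 := congrArg (partialD hQ k) hν
      rw [Derivation.leibniz, (isPartials_coordFun hQ).coord, Derivation.map_one_eq_zero,
        if_neg (by intro h; exact hk (by exact_mod_cast h.symm)), smul_zero, zero_add,
        smul_eq_mul] at h5
      have : partialD hQ k (invCoord (m := m) hn) = 0 := by
        linear_combination (invCoord (m := m) hn) * h5 - (partialD hQ k (invCoord (m := m) hn)) * hν
      rw [this, smul_zero]
  by_cases hi : (i : ℕ) + 1 = n <;> by_cases hj : (j : ℕ) + 1 = n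
  · have : i = j := by ext; omega
    rw [this]
  · rw [densityForm, densityForm, if_pos hi, if_neg hj, map_zero, h j hj]
  · rw [densityForm, densityForm, if_neg hi, if_pos hj, map_zero, h i hi]
  · rw [densityForm, densityForm, if_neg hi, if_neg hj, map_zero, map_zero]

end Configuration

/-! ### The Killing vector fields are divergence free -/

section DivergenceFree

variable {R : Type*} [CommRing R] {n m : ℕ} {c : ℤ → R} {D : Fin n → Derivation ℤ R R} {w ν : R}

theorem two_mul_sum_range_sub {a N : ℕ} (h : a ≤ N) :
    2 * ∑ k ∈ Finset.range N, (a - k) = a * (a + 1) := by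
  induction a generalizing N with
  | zero => simp
  | succ a ih =>
    obtain ⟨N, rfl⟩ : ∃ M, N = M + 1 := ⟨N - 1, by omega⟩
    rw [Finset.sum_range_succ']
    simp only [Nat.add_sub_add_right, mul_add]
    rw [ih (by omega)]; simp; ring

/-- The Killing vector fields are divergence free. -/
theorem weightedDiv_killC (hc : IsCoord n c) (hD : IsPartials c D) (hn : 0 < n) (hm : m ≤ n + 1)
    (h2 : ∀ x : R, 2 * x = 0 → x = 0) (hw : 2 * w = m) (hν : m ≠ 0 → ν * c n = 1) {s : ℕ}
    (hs : s ≤ n) : weightedDiv D w ν (fun k => killC n m s c ((k : ℕ) + 1)) = 0 := by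
  have hlast : ∑ k : Fin n, (if (k : ℕ) + 1 = n then killC n m s c ((k : ℕ) + 1) else 0)
      = killC n m s c n := by
    rw [Finset.sum_eq_single (⟨n - 1, by omega⟩ : Fin n)]
    · rw [if_pos (by simp only; omega)]; congr 1; simp only; omega
    · intro k _ hk
      rw [if_neg]; intro h; apply hk; ext; simp only; omega
    · simp
  rw [weightedDiv, hlast]
  by_cases hl : lowIdx n m s
  · have e1 : ∀ k : Fin n, D k (killC n m s c ((k : ℕ) + 1)) = 0 := by
      intro k
      rw [killC, if_pos hl, Derivation.map_intCast_mul, hD.coord]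
      split_ifs with h
      · rw [max_eq_right]
        · simp
        · unfold lowIdx at hl; omega
      · rw [mul_zero]
    have e2 : w * killC n m s c n = 0 := by
      rw [killC, if_pos hl]
      rcases Nat.eq_zero_or_pos m with h0 | h0
      · have : w = 0 := h2 w (by rw [hw, h0]; simp)
        rw [this, zero_mul]
      · rw [max_eq_right (by omega)]; simp
    rw [Finset.sum_eq_zero fun k _ => e1 k]
    linear_combination (-ν) * e2
  · have hl' := hl
    unfold lowIdx at hl'
    -- Among the fields of the second kind, only at this index does a component depend on its own
    -- coordinate. There the coordinate divergence is `1 + … + (m-1) = m(m-1)/2`, and the density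
    -- contributes `-(m/2)(m-1)`.
    by_cases hs' : s + m = n + 2
    · have hm0 : m ≠ 0 := by omega
      have e1 : ∑ k : Fin n, D k (killC n m s c ((k : ℕ) + 1))
          = ((∑ k ∈ Finset.range n, (m - 1 - k) : ℕ) : R) := by
        rw [← Finset.sum_range_reflect, Finset.sum_range, Nat.cast_sum]
        refine Finset.sum_congr rfl fun k _ => ?_
        have hk := k.2
        rw [killC, if_neg hl, Derivation.map_intCast_mul, hD.coord, if_pos (by omega), mul_one]
        have : max (((k : ℕ) : ℤ) + 1 - (n + 1 - m)) 0 = ((m - 1 - (n - 1 - k) : ℕ) : ℤ) := by omega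
        rw [this]; simp
      have e2 : killC n m s c n = (m - 1 : ℕ) * c n := by
        rw [killC, if_neg hl]
        have : max ((n : ℤ) - (n + 1 - m)) 0 = ((m - 1 : ℕ) : ℤ) := by omega
        rw [this, show ((n : ℤ) - (n + 2 - m - s)) = n by omega]; simp
      have e3 := two_mul_sum_range_sub (a := m - 1) (N := n) (by omega)
      have e4 := congrArg (Nat.cast : ℕ → R) e3
      rw [Nat.sub_add_cancel (by omega)] at e4
      push_cast at e4
      apply h2
      rw [e1, e2]
      push_cast
      linear_combination e4 - ((m - 1 : ℕ) : R) * hw - 2 * w * ((m - 1 : ℕ) : R) * hν hm0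
    · have e1 : ∀ k : Fin n, D k (killC n m s c ((k : ℕ) + 1)) = 0 := by
        intro k
        rw [killC, if_neg hl, Derivation.map_intCast_mul, hD.coord, if_neg (by omega), mul_zero]
      have e2 : killC n m s c n = 0 := by
        rw [killC, if_neg hl, hc.big _ (by omega), mul_zero]
      rw [Finset.sum_eq_zero fun k _ => e1 k, e2]; simp

end DivergenceFree

/-! ### Linear combinations with constant coefficients -/

section Linear

variable {R : Type*} [CommRing R] {n : ℕ} {D : Fin n → Derivation ℤ R R} {κ : Fin n → R}
  {ι : Type*} (s : Finset ι)

theorem divg_sum {x : ι → R} (hx : ∀ i k, D k (x i) = 0) (Y : ι → Fin n → R) :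
    divg D κ (fun k => ∑ i ∈ s, x i * Y i k) = ∑ i ∈ s, x i * divg D κ (Y i) := by
  simp only [divg, Finset.mul_sum, map_sum, Derivation.leibniz, hx,
    smul_eq_mul, mul_zero, add_zero, ← Finset.sum_add_distrib]
  rw [Finset.sum_comm]
  exact Finset.sum_congr rfl fun i _ => Finset.sum_congr rfl fun k _ => by ring

theorem lapOp_sum {x : ι → R} (hx : ∀ i k, D k (x i) = 0) (A : ι → Fin n → Fin n → R) (ψ : R) :
    lapOp D κ (fun k j => ∑ i ∈ s, x i * A i k j) ψ = ∑ i ∈ s, x i * lapOp D κ (A i) ψ := by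
  rw [lapOp]
  have : grad D (fun k j => ∑ i ∈ s, x i * A i k j) ψ = fun k => ∑ i ∈ s, x i * grad D (A i) ψ k := by
    funext k
    simp only [grad, Finset.sum_mul, Finset.mul_sum]
    rw [Finset.sum_comm]
    exact Finset.sum_congr rfl fun i _ => Finset.sum_congr rfl fun k _ => by ring
  rw [this, divg_sum s hx]; rfl

theorem lapOp_sum_right (A : Fin n → Fin n → R) {x : ι → R} (hx : ∀ i k, D k (x i) = 0) (f : ι → R) :
    lapOp D κ A (∑ i ∈ s, x i * f i) = ∑ i ∈ s, x i * lapOp D κ A (f i) := by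
  classical
  induction s using Finset.induction_on with
  | empty =>
    have := lapOp_const_mul (D := D) (κ := κ) A (α := 0) (fun k => map_zero _) 0
    simpa using this
  | insert i s hi ih =>
    rw [Finset.sum_insert hi, Finset.sum_insert hi, lapOp_add, lapOp_const_mul A (hx i), ih]

theorem quantOp_sum {x : ι → R} (hx : ∀ i k, D k (x i) = 0) (α β : R) (A : ι → Fin n → Fin n → R)
    (Y : ι → Fin n → R) (ψ : R) :
    quantOp D κ α β (fun k j => ∑ i ∈ s, x i * A i k j) (fun k => ∑ i ∈ s, x i * Y i k) ψ
      = ∑ i ∈ s, x i * quantOp D κ α β (A i) (Y i) ψ := by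
  have hv : vf D (fun k => ∑ i ∈ s, x i * Y i k) ψ = ∑ i ∈ s, x i * vf D (Y i) ψ := by
    simp only [vf_apply, Finset.sum_mul, Finset.mul_sum]
    rw [Finset.sum_comm]
    exact Finset.sum_congr rfl fun i _ => Finset.sum_congr rfl fun k _ => by ring
  simp only [quantOp, lapOp_sum s hx, divg_sum s hx, hv, Finset.mul_sum, Finset.sum_mul,
    ← Finset.sum_add_distrib]
  exact Finset.sum_congr rfl fun i _ => by ring

end Linear

/-! ### The combined operators and their commutators -/

section Operators

variable {n m : ℕ}

/-- The tensors whose combinations are the quadratic parts of the Hamiltonians. -/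
def baseT (m : ℕ) {R : Type*} [CommRing R] (x : Fin n → R) :
    Fin n × Option (Fin (n + 2)) → Fin n → Fin n → R
  | (j, none) => genA m x j
  | (_, some _) => 0

/-- The vector fields whose combinations are the linear parts of the Hamiltonians. -/
def baseV (m : ℕ) {R : Type*} [CommRing R] (x : Fin n → R) :
    Fin n × Option (Fin (n + 2)) → Fin n → R
  | (j, none) => genJ m x j
  | (j, some γ) => genP x j γ

theorem baseT_symm {R : Type*} [CommRing R] (x : Fin n → R) (i : Fin n × Option (Fin (n + 2)))
    (k j : Fin n) : baseT m x i k j = baseT m x i j k := by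
  rcases i with ⟨l, _ | γ⟩
  · exact genA_symm x l k j
  · rfl

theorem map_baseT {R S : Type*} [CommRing R] [CommRing S] [Nontrivial S] (f : R →+* S)
    (x : Fin n → R) (i : Fin n × Option (Fin (n + 2))) (k j : Fin n) :
    f (baseT m x i k j) = baseT m (fun i => f (x i)) i k j := by
  rcases i with ⟨l, _ | γ⟩
  · exact map_genA f x l k j
  · exact map_zero f

theorem map_baseV {R S : Type*} [CommRing R] [CommRing S] [Nontrivial S] (f : R →+* S)
    (x : Fin n → R) (i : Fin n × Option (Fin (n + 2))) (k : Fin n) :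
    f (baseV m x i k) = baseV m (fun i => f (x i)) i k := by
  rcases i with ⟨l, _ | γ⟩
  · exact map_genJ f x l k
  · exact map_genP f x l γ k

/-- Here `v = w = m/2`: the density `|q_n|^(-m/2)` absorbs half of the exponent `m`. -/
theorem lapOp_genA [Nontrivial (SmoothFun (configSpace n m))] (hn : 0 < n)
    (hQ : IsOpen (configSpace n m)) (r : Fin n) (ψ : SmoothFun (configSpace n m)) :
    lapOp (partialD hQ) (densityForm hn) (genA m coordFun r) ψ
      = lap n m (vieta coordFun) (partialD hQ) (polyFun (MvPolynomial.C ((m : ℝ) / 2))) (r + 1) ψ := by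
  rw [lap_eq_weightedDiv (ν := invCoord hn) (w := polyFun (MvPolynomial.C ((m : ℝ) / 2)))
    (isCoord_vieta _) (isPartials_coordFun hQ) hn ?_ ?_ (fun h => invCoord_mul hn h) r.2,
    weightedDiv_eq_divg hn hQ]
  · rfl
  · rw [← map_add, ← MvPolynomial.C_add, add_halves]; simp
  · intro h
    have : (m : ℝ) / 2 = 0 := by rw [h]; simp
    rw [this, MvPolynomial.C_0, map_zero]

theorem smoothFun_two_mul (x : SmoothFun (configSpace n m)) (h : 2 * x = 0) : x = 0 := by
  refine SmoothFun.ext' fun y => ?_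
  have h7 := congrArg (fun f : SmoothFun (configSpace n m) => f.1 y) h
  have h8 : (2 : ℂ) * x.1 y = 0 := h7
  simpa using h8

theorem partialD_const (hQ : IsOpen (configSpace n m)) (k : Fin n) (a : ℝ) :
    partialD hQ k (polyFun (MvPolynomial.C a)) = 0 := by
  rw [partialD_polyFun, dP_apply, MvPolynomial.pderiv_C, map_zero]

theorem two_mul_half : 2 * (polyFun (MvPolynomial.C ((m : ℝ) / 2)) : SmoothFun (configSpace n m))
    = m := by
  have : (2 : SmoothFun (configSpace n m)) = polyFun (MvPolynomial.C 2) := by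
    rw [map_ofNat MvPolynomial.C, map_ofNat]
  rw [this, ← map_mul, ← MvPolynomial.C_mul, mul_div_cancel₀ _ two_ne_zero]; simp

variable [Nontrivial (SmoothFun (configSpace n m))]

/-- The operators with coefficients `x`. -/
def combOp (hn : 0 < n) (hQ : IsOpen (configSpace n m)) (α β : SmoothFun (configSpace n m))
    (x : Fin n × Option (Fin (n + 2)) → ℝ) (ψ : SmoothFun (configSpace n m)) :
    SmoothFun (configSpace n m) :=
  quantOp (partialD hQ) (densityForm hn) α β
    (fun k j => ∑ i, polyFun (MvPolynomial.C (x i)) * baseT m coordFun i k j)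
    (fun k => ∑ i, polyFun (MvPolynomial.C (x i)) * baseV m coordFun i k) ψ

/-- Both obstructions in `quantOp_commutator` vanish: the Laplace operators commute, the Killing
fields have no divergence, and the Laplacians of the divergences of the potentials are symmetric in
the two indices. The last point requires that both operators use the same parameters `d`, as `hx`
and `hy` provide. -/
theorem combOp_commutator (hn : 0 < n) (hm : m ≤ n + 1) (hQ : IsOpen (configSpace n m))
    {α β : SmoothFun (configSpace n m)} (hα : ∀ k, partialD hQ k α = 0)
    (hβ : ∀ k, partialD hQ k β = 0) {x y z : Fin n × Option (Fin (n + 2)) → ℝ}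
    {d : Fin (n + 2) → ℝ} (hx : ∀ j γ, x (j, some γ) = x (j, none) * d γ)
    (hy : ∀ j γ, y (j, some γ) = y (j, none) * d γ)
    (hT : ∀ k j, ∑ i, polyFun (MvPolynomial.C (z i)) * baseT m coordFun i k j
      = lieD (partialD hQ) (fun k => ∑ i, polyFun (MvPolynomial.C (x i)) * baseV m coordFun i k)
          (fun k j => ∑ i, polyFun (MvPolynomial.C (y i)) * baseT m coordFun i k j) k j
        - lieD (partialD hQ) (fun k => ∑ i, polyFun (MvPolynomial.C (y i)) * baseV m coordFun i k)
          (fun k j => ∑ i, polyFun (MvPolynomial.C (x i)) * baseT m coordFun i k j) k j)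
    (hV : ∀ k, ∑ i, polyFun (MvPolynomial.C (z i)) * baseV m coordFun i k
      = vfBracket (partialD hQ) (fun k => ∑ i, polyFun (MvPolynomial.C (x i)) * baseV m coordFun i k)
        (fun k => ∑ i, polyFun (MvPolynomial.C (y i)) * baseV m coordFun i k) k)
    (ψ : SmoothFun (configSpace n m)) :
    combOp hn hQ α β x (combOp hn hQ α β y ψ) - combOp hn hQ α β y (combOp hn hQ α β x ψ)
      = 2 * β * combOp hn hQ α β z ψ := by
  set Φ : ℝ → SmoothFun (configSpace n m) := fun a => polyFun (MvPolynomial.C a) with hΦ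
  have hconst : ∀ a k, partialD hQ k (Φ a) = 0 := fun a k => partialD_const hQ k a
  set Δ : Fin n → SmoothFun (configSpace n m) → SmoothFun (configSpace n m) :=
    fun r => lapOp (partialD hQ) (densityForm hn) (genA m coordFun r) with hΔ
  have hlap : ∀ (x : Fin n × Option (Fin (n + 2)) → ℝ) ψ,
      lapOp (partialD hQ) (densityForm hn) (fun k j => ∑ i, Φ (x i) * baseT m coordFun i k j) ψ
        = ∑ j, Φ (x (j, none)) * Δ j ψ := by
    intro x ψ
    rw [lapOp_sum Finset.univ (fun i k => hconst (x i) k), Fintype.sum_prod_type]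
    refine Finset.sum_congr rfl fun j _ => ?_
    rw [Fintype.sum_option]
    have h0 : ∀ γ, lapOp (partialD hQ) (densityForm hn)
        (baseT m (coordFun (m := m)) (j, some γ)) ψ = 0 := by
      intro γ
      have := lapOp_sub_left (D := partialD hQ) (κ := densityForm hn)
        (baseT m (coordFun (m := m)) (j, some γ)) (baseT m (coordFun (m := m)) (j, some γ)) ψ
      rw [sub_self, sub_self] at this
      exact this
    rw [Finset.sum_eq_zero fun γ _ => by rw [h0, mul_zero], add_zero]
    rfl
  have hw0 : m = 0 → (polyFun (MvPolynomial.C ((m : ℝ) / 2)) : SmoothFun (configSpace n m)) = 0 := by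
    intro h
    have : (m : ℝ) / 2 = 0 := by rw [h]; simp
    rw [this, MvPolynomial.C_0, map_zero]
  have hΔcomm : ∀ r s ψ, Δ r (Δ s ψ) = Δ s (Δ r ψ) := by
    intro r s ψ
    simp only [hΔ, lapOp_genA]
    exact lap_comm (isCoord_vieta _) (isPartials_coordFun hQ) hw0
      (fun k => partialD_const hQ k _) r.2 s.2 ψ
  have hdiv : ∀ (y : Fin n × Option (Fin (n + 2)) → ℝ),
      divg (partialD hQ) (densityForm hn) (fun k => ∑ i, Φ (y i) * baseV m coordFun i k)
        = ∑ j, ∑ γ : Fin (n + 2), Φ (y (j, some γ))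
          * divg (partialD hQ) (densityForm hn) (genP coordFun j γ) := by
    intro y
    rw [divg_sum Finset.univ (fun i k => hconst (y i) k), Fintype.sum_prod_type]
    refine Finset.sum_congr rfl fun j _ => ?_
    rw [Fintype.sum_option]
    have : divg (partialD hQ) (densityForm hn) (baseV m (coordFun (m := m)) (j, none)) = 0 := by
      rw [← weightedDiv_eq_divg hn hQ]
      exact weightedDiv_killC (isCoord_vieta _) (isPartials_coordFun hQ) hn hm smoothFun_two_mul
        two_mul_half (fun h => invCoord_mul hn h) (by have := j.2; omega)
    rw [this, mul_zero, zero_add]; rfl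
  have hP : ∀ (r s : Fin n) (γ : ℕ),
      Δ r (divg (partialD hQ) (densityForm hn) (genP coordFun s γ))
        = Δ s (divg (partialD hQ) (densityForm hn) (genP coordFun r γ)) := by
    intro r s γ
    simp only [hΔ, lapOp_genA]
    rw [← weightedDiv_eq_divg hn hQ, ← weightedDiv_eq_divg hn hQ]
    exact lap_weightedDiv_potential_symm (isCoord_vieta _) (isPartials_coordFun hQ) hn hw0 hw0
      (fun k => partialD_const hQ k _) (fun h => invCoord_mul hn h) γ r.2 s.2
  have hΔsum : ∀ {ι : Type} (s : Finset ι) (r : Fin n) (a : ι → ℝ)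
      (f : ι → SmoothFun (configSpace n m)),
      Δ r (∑ i ∈ s, Φ (a i) * f i) = ∑ i ∈ s, Φ (a i) * Δ r (f i) := by
    intro ι s r a f
    exact lapOp_sum_right s (genA m coordFun r) (x := fun i => Φ (a i))
      (fun i k => hconst (a i) k) f
  have hsymm : ∀ (x : Fin n × Option (Fin (n + 2)) → ℝ) (k j : Fin n),
      ∑ i, Φ (x i) * baseT m coordFun i k j = ∑ i, Φ (x i) * baseT m coordFun i j k :=
    fun x k j => Finset.sum_congr rfl fun i _ => by rw [baseT_symm]
  have hΦmul : ∀ a b, Φ (a * b) = Φ a * Φ b := by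
    intro a b; simp only [hΦ, map_mul]
  have hAB : ∀ ψ, ∑ j, Φ (x (j, none)) * Δ j (∑ l, Φ (y (l, none)) * Δ l ψ)
      = ∑ j, Φ (y (j, none)) * Δ j (∑ l, Φ (x (l, none)) * Δ l ψ) := by
    intro ψ
    simp only [hΔsum, Finset.mul_sum]
    rw [Finset.sum_comm]
    refine Finset.sum_congr rfl fun j _ => Finset.sum_congr rfl fun l _ => ?_
    rw [hΔcomm l j]; ring
  have hDD : ∀ (x y : Fin n × Option (Fin (n + 2)) → ℝ),
      ∑ j, Φ (x (j, none)) * Δ j (∑ l, ∑ γ : Fin (n + 2), Φ (y (l, some γ))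
          * divg (partialD hQ) (densityForm hn) (genP coordFun l γ))
      = ∑ j, ∑ l, ∑ γ : Fin (n + 2), Φ (x (j, none)) * (Φ (y (l, some γ))
          * Δ j (divg (partialD hQ) (densityForm hn) (genP coordFun l γ))) := by
    intro x y
    refine Finset.sum_congr rfl fun j _ => ?_
    rw [← Finset.sum_product', hΔsum, Finset.mul_sum, ← Finset.sum_product']
  have key := quantOp_commutator (D := partialD hQ) (κ := densityForm hn)
    (partialD_comm hQ) (densityForm_closed hn hQ) (hsymm x) (hsymm y) hα hβ
    (fun k => ∑ i, Φ (x i) * baseV m coordFun i k) (fun k => ∑ i, Φ (y i) * baseV m coordFun i k)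
    (fun ψ => by rw [hlap, hlap, hlap, hlap, hAB])
    (by
      rw [hdiv, hdiv, hlap, hlap, hDD, hDD, Finset.sum_comm]
      refine Finset.sum_congr rfl fun j _ => Finset.sum_congr rfl fun l _ =>
        Finset.sum_congr rfl fun γ _ => ?_
      rw [hP l j, hx, hy, hΦmul, hΦmul]; ring) ψ
  refine key.trans ?_
  rw [combOp]
  congr 2
  · funext k j; exact (hT k j).symm
  · funext k; exact (hV k).symm

end Operators

/-! ### Minimal quantization inside the ring of smooth functions -/

section Quantization

variable {n m : ℕ}

/-- Conjugation with the density replaces each `∂_k` by `∂_k` plus the logarithmic derivative of the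
density. Both quantization rules thus become expressions in `divg`. -/
theorem sum_partialD_densityFun_mul (hn : 0 < n) (hQ : IsOpen (configSpace n m))
    (Y : Fin n → SmoothFun (configSpace n m)) :
    ∑ k, partialD hQ k (densityFun hn * Y k)
      = densityFun hn * divg (partialD hQ) (densityForm hn) Y := by
  rw [divg, Finset.mul_sum]
  refine Finset.sum_congr rfl fun k _ => ?_
  rw [Derivation.leibniz, partialD_densityFun hn hQ, smul_eq_mul, smul_eq_mul]; ring

theorem SmoothFun.sum_apply {ι : Type*} {Q : Set (Fin n → ℝ)} (s : Finset ι) (f : ι → SmoothFun Q)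
    (x : Q) : (∑ i ∈ s, f i).1 x = ∑ i ∈ s, (f i).1 x := by
  have := map_sum ((Pi.evalRingHom (fun _ : Q => ℂ) x).comp (SmoothFun Q).subtype) f s
  exact this

theorem SmoothFun.mul_apply {Q : Set (Fin n → ℝ)} (f g : SmoothFun Q) (x : Q) :
    (f * g).1 x = f.1 x * g.1 x := rfl

theorem SmoothFun.add_apply {Q : Set (Fin n → ℝ)} (f g : SmoothFun Q) (x : Q) :
    (f + g).1 x = f.1 x + g.1 x := rfl

theorem quantQuad_eq (hn : 0 < n) (hQ : IsOpen (configSpace n m)) (ħ : ℝ)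
    {C : (Fin n → ℝ) → Matrix (Fin n) (Fin n) ℝ} {A : Fin n → Fin n → SmoothFun (configSpace n m)}
    (hC : ∀ k j (x : configSpace n m), (C x k j : ℂ) = (A k j).1 x)
    {ψ : (Fin n → ℝ) → ℂ} {Ψ : SmoothFun (configSpace n m)}
    (hψ : ∀ x : configSpace n m, ψ x = Ψ.1 x) (q : configSpace n m) :
    quantQuad m ħ C ψ q
      = -(1 / 2) * (ħ : ℂ) ^ 2 * (lapOp (partialD hQ) (densityForm hn) A Ψ).1 q := by
  have e : ∀ k, pderiv k (fun x => ∑ j, ((density m x * C x k j : ℝ) : ℂ) * pderiv j ψ x) q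
      = (partialD hQ k (densityFun hn * grad (partialD hQ) A Ψ k)).1 q := by
    intro k
    refine pderiv_eq_partialD hQ k (fun x => ?_) q
    rw [SmoothFun.mul_apply, grad, SmoothFun.sum_apply, Finset.mul_sum]
    refine Finset.sum_congr rfl fun j _ => ?_
    rw [SmoothFun.mul_apply, ← hC, ← pderiv_eq_partialD hQ j hψ, densityFun_apply]
    push_cast; ring
  rw [quantQuad, Finset.sum_congr rfl fun k _ => e k, ← SmoothFun.sum_apply,
    sum_partialD_densityFun_mul, SmoothFun.mul_apply, densityFun_apply, lapOp]
  have : (density m q.1 : ℂ) ≠ 0 := Complex.ofReal_ne_zero.2 (density_ne_zero hn q)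
  field_simp

theorem quantLin_eq (hn : 0 < n) (hQ : IsOpen (configSpace n m)) (ħ : ℝ)
    {Z : (Fin n → ℝ) → Fin n → ℝ} {Y : Fin n → SmoothFun (configSpace n m)}
    (hZ : ∀ k (x : configSpace n m), (Z x k : ℂ) = (Y k).1 x)
    {ψ : (Fin n → ℝ) → ℂ} {Ψ : SmoothFun (configSpace n m)}
    (hψ : ∀ x : configSpace n m, ψ x = Ψ.1 x) (q : configSpace n m) :
    quantLin m ħ Z ψ q = -(1 / 2) * Complex.I * (ħ : ℂ) *
      (2 * vf (partialD hQ) Y Ψ + divg (partialD hQ) (densityForm hn) Y * Ψ).1 q := by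
  have e : ∀ k, pderiv k (fun x => ((density m x * Z x k : ℝ) : ℂ) * ψ x) q
      = (partialD hQ k (densityFun hn * (Ψ * Y k))).1 q := by
    intro k
    refine pderiv_eq_partialD hQ k (fun x => ?_) q
    rw [SmoothFun.mul_apply, SmoothFun.mul_apply, hψ, ← hZ, densityFun_apply]
    push_cast; ring
  have e2 : ∑ j, ((Z q j : ℝ) : ℂ) * pderiv j ψ q = (vf (partialD hQ) Y Ψ).1 q := by
    rw [vf_apply, SmoothFun.sum_apply]
    refine Finset.sum_congr rfl fun j _ => ?_
    rw [SmoothFun.mul_apply, ← hZ, ← pderiv_eq_partialD hQ j hψ]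
  have h : (density m q.1 : ℂ) ≠ 0 := Complex.ofReal_ne_zero.2 (density_ne_zero hn q)
  have h2 : ∀ f : SmoothFun (configSpace n m), (2 * f).1 q = 2 * f.1 q := fun f => rfl
  rw [quantLin, Finset.sum_congr rfl fun k _ => e k, e2, ← SmoothFun.sum_apply,
    sum_partialD_densityFun_mul hn hQ (fun k => Ψ * Y k), SmoothFun.mul_apply, densityFun_apply,
    divg_mul, SmoothFun.add_apply, SmoothFun.add_apply, h2, SmoothFun.mul_apply,
    SmoothFun.mul_apply]
  field_simp
  ring

/-- The constant by which the quadratic part of a Hamiltonian is quantized. -/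
def quadConst (n m : ℕ) (ħ : ℝ) : SmoothFun (configSpace n m) :=
  mkSmooth (fun _ => -(1 / 2) * (ħ : ℂ) ^ 2) contDiffOn_const

/-- The constant by which the linear part of a Hamiltonian is quantized. -/
def linConst (n m : ℕ) (ħ : ℝ) : SmoothFun (configSpace n m) :=
  mkSmooth (fun _ => -(1 / 2) * Complex.I * (ħ : ℂ)) contDiffOn_const

theorem partialD_mkSmooth_const (hQ : IsOpen (configSpace n m)) (k : Fin n) (a : ℂ) :
    partialD hQ k (mkSmooth (fun _ => a) contDiffOn_const) = 0 := by
  refine SmoothFun.ext' fun x => ?_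
  rw [← pderiv_eq_partialD hQ k (g := fun _ => a) (fun _ => rfl)]
  simp [pderiv]

theorem genA_coordFun_apply [Nontrivial (SmoothFun (configSpace n m))] (r k j : Fin n)
    (x : configSpace n m) : ((tensorA m r x.1 k j : ℝ) : ℂ) = (genA m coordFun r k j).1 x := by
  have : genA m (coordFun (m := m)) r k j = polyFun (genA m MvPolynomial.X r k j) :=
    (map_genA polyFun _ r k j).symm
  rw [this, polyFun_apply, map_genA (MvPolynomial.eval x.1), tensorA_eq]
  simp only [MvPolynomial.eval_X]

theorem genP_coordFun_apply [Nontrivial (SmoothFun (configSpace n m))] (r : Fin n) (γ : ℕ)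
    (j : Fin n) (x : configSpace n m) :
    ((potentialP r γ x.1 j : ℝ) : ℂ) = (genP (coordFun (m := m)) r γ j).1 x := by
  have : genP (coordFun (m := m)) r γ j = polyFun (genP MvPolynomial.X r γ j) :=
    (map_genP polyFun _ r γ j).symm
  rw [this, polyFun_apply, map_genP (MvPolynomial.eval x.1), potentialP_eq]
  simp only [MvPolynomial.eval_X]

theorem genJ_coordFun_apply (r j : Fin n) (x : configSpace n m) :
    ((killingJ m r x.1 j : ℝ) : ℂ) = (genJ m (coordFun (m := m)) r j).1 x := by
  have : genJ m (coordFun (m := m)) r j = polyFun (genJ m MvPolynomial.X r j) :=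
    (map_genJ polyFun _ r j).symm
  rw [this, polyFun_apply, map_genJ (MvPolynomial.eval x.1), killingJ_eq_genJ]
  simp only [MvPolynomial.eval_X]

/-- The coefficients of the basic Hamiltonians in `H_r`. -/
def coeffH (m : ℕ) (ζ : Fin n → Fin n → (Fin n → ℝ) → ℝ) (d : Fin (n + 2) → (Fin n → ℝ) → ℝ)
    (r : Fin n) : Fin n × Option (Fin (n + 2)) → (Fin n → ℝ) → ℝ
  | (j, none) => mix m ζ r j
  | (j, some γ) => fun t => mix m ζ r j t * d γ t

/-- The operators of which the quantum Hamiltonians are combinations. -/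
def baseQ (m : ℕ) (ħ : ℝ) (ψ : (Fin n → ℝ) → ℂ) (q : Fin n → ℝ) :
    Fin n × Option (Fin (n + 2)) → ℂ
  | (j, none) => quantQuad m ħ (tensorA m j) ψ q + quantLin m ħ (killingJ m j) ψ q
  | (j, some γ) => quantLin m ħ (potentialP j (γ : ℕ)) ψ q

theorem QuantHB_eq_sum (ħ : ℝ) (ζ : Fin n → Fin n → (Fin n → ℝ) → ℝ)
    (d : Fin (n + 2) → (Fin n → ℝ) → ℝ) (r : Fin n) (t : Fin n → ℝ) (ψ : (Fin n → ℝ) → ℂ)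
    (q : Fin n → ℝ) :
    QuantHB m ħ ζ d r t ψ q = ∑ i, ((coeffH m ζ d r i t : ℝ) : ℂ) * baseQ m ħ ψ q i := by
  rw [QuantHB, Fintype.sum_prod_type]
  refine Finset.sum_congr rfl fun j _ => ?_
  rw [Fintype.sum_option, quantHB, mul_add, Finset.mul_sum]
  congr 1
  refine Finset.sum_congr rfl fun γ _ => ?_
  simp only [coeffH, baseQ]; push_cast; ring

theorem baseQ_eq [Nontrivial (SmoothFun (configSpace n m))] (hn : 0 < n)
    (hQ : IsOpen (configSpace n m)) (ħ : ℝ) {ψ : (Fin n → ℝ) → ℂ}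
    {Ψ : SmoothFun (configSpace n m)} (hψ : ∀ x : configSpace n m, ψ x = Ψ.1 x)
    (q : configSpace n m) (i : Fin n × Option (Fin (n + 2))) :
    baseQ m ħ ψ q i = (quantOp (partialD hQ) (densityForm hn) (quadConst n m ħ) (linConst n m ħ)
      (baseT m coordFun i) (baseV m coordFun i) Ψ).1 q := by
  rcases i with ⟨j, _ | γ⟩
  · rw [baseQ, quantQuad_eq hn hQ ħ (fun k l x => genA_coordFun_apply j k l x) hψ,
      quantLin_eq hn hQ ħ (fun k x => genJ_coordFun_apply j k x) hψ]
    rfl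
  · rw [baseQ, quantLin_eq hn hQ ħ (fun k x => genP_coordFun_apply j γ k x) hψ]
    have h0 : lapOp (partialD hQ) (densityForm hn)
        (baseT m (coordFun (m := m)) (j, some γ)) Ψ = 0 := by
      have := lapOp_sub_left (D := partialD hQ) (κ := densityForm hn)
        (baseT m (coordFun (m := m)) (j, some γ)) (baseT m (coordFun (m := m)) (j, some γ)) Ψ
      rw [sub_self, sub_self] at this
      exact this
    rw [quantOp, h0, mul_zero, zero_add]; rfl

theorem combOp_apply [Nontrivial (SmoothFun (configSpace n m))] (hn : 0 < n)
    (hQ : IsOpen (configSpace n m)) (ħ : ℝ) {ψ : (Fin n → ℝ) → ℂ}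
    {Ψ : SmoothFun (configSpace n m)} (hψ : ∀ x : configSpace n m, ψ x = Ψ.1 x)
    (q : configSpace n m) (x : Fin n × Option (Fin (n + 2)) → ℝ) :
    (combOp hn hQ (quadConst n m ħ) (linConst n m ħ) x Ψ).1 q
      = ∑ i, ((x i : ℝ) : ℂ) * baseQ m ħ ψ q i := by
  rw [combOp, quantOp_sum Finset.univ (fun i k => partialD_const hQ k (x i)), SmoothFun.sum_apply]
  refine Finset.sum_congr rfl fun i _ => ?_
  rw [SmoothFun.mul_apply, polyFun_apply, MvPolynomial.eval_C, baseQ_eq hn hQ ħ hψ]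

end Quantization

/-! ### From the classical to the quantum Frobenius condition -/

section Time

variable {n m : ℕ}

/-- The Hamiltonians of which the classical Hamiltonians are combinations. -/
def baseH (m : ℕ) (q p : Fin n → ℝ) : Fin n × Option (Fin (n + 2)) → ℝ
  | (j, none) => (1 / 2) * ∑ i, ∑ l, tensorA m j q i l * p i * p l + ∑ l, killingJ m j q l * p l
  | (j, some γ) => ∑ l, potentialP j (γ : ℕ) q l * p l

theorem HB_eq_sum (ζ : Fin n → Fin n → (Fin n → ℝ) → ℝ)
    (d : Fin (n + 2) → (Fin n → ℝ) → ℝ) (r : Fin n) (t q p : Fin n → ℝ) :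
    HB m ζ d r t q p = ∑ i, coeffH m ζ d r i t * baseH m q p i := by
  rw [HB, Fintype.sum_prod_type]
  refine Finset.sum_congr rfl fun j _ => ?_
  rw [Fintype.sum_option, hB, mul_add]
  refine congrArg₂ (· + ·) rfl ?_
  rw [Finset.mul_sum]
  refine Finset.sum_congr rfl fun γ _ => ?_
  simp only [coeffH, baseH]; ring

/-- The polynomial Hamiltonian with coefficients `x`. -/
def combH (m : ℕ) (x : Fin n × Option (Fin (n + 2)) → ℝ) : PhasePoly n :=
  quadH (fun k j => ∑ i, MvPolynomial.C (x i) * baseT m MvPolynomial.X i k j)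
    (fun k => ∑ i, MvPolynomial.C (x i) * baseV m MvPolynomial.X i k)

theorem eval_combH (x : Fin n × Option (Fin (n + 2)) → ℝ) (q p : Fin n → ℝ) :
    MvPolynomial.eval (Sum.elim q p) (combH m x) = ∑ i, x i * baseH m q p i := by
  have hb : ∀ i, baseH m q p i = 1 / 2 * ∑ k, ∑ j, baseT m q i k j * p k * p j
      + ∑ k, baseV m q i k * p k := by
    rintro ⟨j, _ | γ⟩
    · simp only [baseH, baseT, baseV, tensorA_eq, killingJ_eq_genJ]
    · simp only [baseH, baseT, baseV, potentialP_eq, Pi.zero_apply, zero_mul,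
        Finset.sum_const_zero, mul_zero, zero_add]
  rw [combH, eval_quadH]
  simp only [hb, map_sum, map_mul, MvPolynomial.eval_C, map_baseT, map_baseV, MvPolynomial.eval_X,
    mul_add, Finset.sum_add_distrib, Finset.mul_sum, Finset.sum_mul]
  congr 1
  · rw [Finset.sum_comm_cycle]
    exact Finset.sum_congr rfl fun i _ => Finset.sum_congr rfl fun k _ =>
      Finset.sum_congr rfl fun j _ => by ring
  · rw [Finset.sum_comm]
    exact Finset.sum_congr rfl fun i _ => Finset.sum_congr rfl fun k _ => by ring

theorem pderiv_sum_ofReal_mul {ι : Type*} (s : Finset ι) {x : ι → (Fin n → ℝ) → ℝ} {t : Fin n → ℝ}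
    (hx : ∀ i, DifferentiableAt ℝ (x i) t) (b : ι → ℂ) (k : Fin n) :
    pderiv k (fun τ => ∑ i ∈ s, ((x i τ : ℝ) : ℂ) * b i) t
      = ∑ i ∈ s, ((pderiv k (x i) t : ℝ) : ℂ) * b i := by
  have h : ∀ i, HasFDerivAt (fun τ => ((x i τ : ℝ) : ℂ) * b i)
      ((Complex.ofRealCLM.comp (fderiv ℝ (x i) t)).smulRight (b i)) t := fun i =>
    ((Complex.ofRealCLM.hasFDerivAt.comp t (hx i).hasFDerivAt).mul_const (b i)).congr_fderiv (by
      ext; simp [mul_comm])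
  rw [pderiv, (HasFDerivAt.fun_sum fun i _ => h i).fderiv]
  simp [pderiv]

theorem pderiv_sum_mul {ι : Type*} (s : Finset ι) {x : ι → (Fin n → ℝ) → ℝ} {t : Fin n → ℝ}
    (hx : ∀ i, DifferentiableAt ℝ (x i) t) (b : ι → ℝ) (k : Fin n) :
    pderiv k (fun τ => ∑ i ∈ s, x i τ * b i) t = ∑ i ∈ s, pderiv k (x i) t * b i := by
  rw [pderiv, (HasFDerivAt.fun_sum fun i _ => (hx i).hasFDerivAt.mul_const (b i)).fderiv]
  simp [pderiv, mul_comm]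

theorem differentiableAt_coeffH {U : Set (Fin n → ℝ)} (hU : IsOpen U)
    {ζ : Fin n → Fin n → (Fin n → ℝ) → ℝ} {d : Fin (n + 2) → (Fin n → ℝ) → ℝ}
    (hζ : AdmissibleZeta m U ζ) (hd : ∀ γ, ContDiffOn ℝ ∞ (d γ) U) {t : Fin n → ℝ} (ht : t ∈ U)
    (r : Fin n) (i : Fin n × Option (Fin (n + 2))) : DifferentiableAt ℝ (coeffH m ζ d r i) t := by
  have hmix : ∀ j, DifferentiableAt ℝ (mix m ζ r j) t := by
    intro j
    have hz := ((hζ.smooth r j).contDiffAt (hU.mem_nhds ht)).differentiableAt (by simp)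
    have e : mix m ζ r j = fun t => mix m ζ r j t := rfl
    rw [e]
    unfold mix
    split_ifs
    exacts [differentiableAt_const _, differentiableAt_const _, hz, differentiableAt_const _, hz,
      differentiableAt_const _]
  rcases i with ⟨j, _ | γ⟩
  · exact hmix j
  · exact (hmix j).mul (((hd γ).contDiffAt (hU.mem_nhds ht)).differentiableAt (by simp))

/-- The classical Frobenius condition implies the quantum Frobenius condition. -/
theorem quantumFrobenius_of_classicalFrobenius (hn : 0 < n) (hm : m ≤ n + 1) (ħ : ℝ)
    {U : Set (Fin n → ℝ)} (hU : IsOpen U) {ζ : Fin n → Fin n → (Fin n → ℝ) → ℝ}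
    {d : Fin (n + 2) → (Fin n → ℝ) → ℝ} (hζ : AdmissibleZeta m U ζ)
    (hd : ∀ γ, ContDiffOn ℝ ∞ (d γ) U) (h : ClassicalFrobenius m U ζ d) :
    QuantumFrobenius m ħ U ζ d := by
  intro r s t ht ψ hψ q hq
  have hQ := isOpen_configSpace (n := n) (m := m) hn
  have : Nonempty (configSpace n m) := ⟨⟨q, hq⟩⟩
  have : Nontrivial (SmoothFun (configSpace n m)) := inferInstance
  obtain ⟨f, hf⟩ := h r s
  have hdiff := fun r i => differentiableAt_coeffH hU hζ hd ht r i
  set x : Fin n × Option (Fin (n + 2)) → ℝ := fun i => coeffH m ζ d r i t with hx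
  set y : Fin n × Option (Fin (n + 2)) → ℝ := fun i => coeffH m ζ d s i t with hy
  -- These are the coefficients of the time derivative term. The classical condition equates them
  -- with the brackets of the combinations `x` and `y`, up to sign.
  set z : Fin n × Option (Fin (n + 2)) → ℝ :=
    fun i => pderiv s (coeffH m ζ d r i) t - pderiv r (coeffH m ζ d s i) t with hz
  set Tx : Fin n → Fin n → MvPolynomial (Fin n) ℝ :=
    fun k j => ∑ i, MvPolynomial.C (x i) * baseT m MvPolynomial.X i k j with hTx
  set Ty : Fin n → Fin n → MvPolynomial (Fin n) ℝ :=
    fun k j => ∑ i, MvPolynomial.C (y i) * baseT m MvPolynomial.X i k j with hTy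
  set Vx : Fin n → MvPolynomial (Fin n) ℝ :=
    fun k => ∑ i, MvPolynomial.C (x i) * baseV m MvPolynomial.X i k with hVx
  set Vy : Fin n → MvPolynomial (Fin n) ℝ :=
    fun k => ∑ i, MvPolynomial.C (y i) * baseV m MvPolynomial.X i k with hVy
  have hTsymm : ∀ (x : Fin n × Option (Fin (n + 2)) → ℝ) (k j : Fin n),
      ∑ i, MvPolynomial.C (x i) * baseT m (MvPolynomial.X (R := ℝ)) i k j
        = ∑ i, MvPolynomial.C (x i) * baseT m MvPolynomial.X i j k :=
    fun x k j => Finset.sum_congr rfl fun i _ => by rw [baseT_symm]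
  have hlsymm : ∀ (Y : Fin n → MvPolynomial (Fin n) ℝ) (A : Fin n → Fin n → MvPolynomial (Fin n) ℝ),
      (∀ k j, A k j = A j k) → ∀ k j, lieD dP Y A k j = lieD dP Y A j k := by
    intro Y A hA k j
    have : ∀ k j, ∑ i, A i j * dP i (Y k) = ∑ i, A j i * dP i (Y k) :=
      fun k j => Finset.sum_congr rfl fun i _ => by rw [hA]
    rw [lieD, lieD, hA k j, this k j, this j k]; ring
  -- the tensor identities that follow from the classical condition
  have hcl : ∀ q ∈ configSpace n m,
      (∀ k j, MvPolynomial.eval q (∑ i, MvPolynomial.C (z i) * baseT m MvPolynomial.X i k j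
        + (lieD dP Vy Tx k j - lieD dP Vx Ty k j)) = 0)
      ∧ ∀ k, MvPolynomial.eval q (∑ i, MvPolynomial.C (z i) * baseV m MvPolynomial.X i k
        + vfBracket dP Vy Vx k) = 0 := by
    intro q hq
    obtain ⟨κ, hκ, hκ'⟩ := eval_ham_quadH (hTsymm x) (hTsymm y) Vx Vy q
    refine eq_zero_of_cubic (κ := κ) (f := f t) ?_ hκ ?_
    · intro k j
      rw [hTsymm z k j, hlsymm Vy Tx (hTsymm x) k j, hlsymm Vx Ty (hTsymm y) k j]
    · intro p
      have h1 := hf t ht q hq p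
      simp only [HB_eq_sum] at h1
      rw [pderiv_sum_mul _ (hdiff r), pderiv_sum_mul _ (hdiff s), ← Finset.sum_sub_distrib] at h1
      simp only [← sub_mul] at h1
      have e1 := eval_combH (m := m) z q p
      have e2 : poisson (HB m ζ d r t) (HB m ζ d s t) q p
          = MvPolynomial.eval (Sum.elim q p) (ham dqS dpS (combH m y) (combH m x)) := by
        rw [← poisson_eval]
        congr 1 <;> funext q p <;> rw [HB_eq_sum, eval_combH]
      have e3 := hκ' p
      rw [e2] at h1
      change MvPolynomial.eval (Sum.elim q p) (ham dqS dpS (combH m y) (combH m x)) = _ at e3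
      rw [e3] at h1
      rw [combH, eval_quadH] at e1
      change ∑ i, z i * baseH m q p i + _ = _ at h1
      rw [← e1] at h1
      simp only [map_add, add_mul, Finset.sum_add_distrib, mul_add] at h1 ⊢
      linear_combination h1
  have hpoly : ∀ k a, partialD hQ k (polyFun a) = polyFun (dP k a) := partialD_polyFun hQ
  -- The identities are available on the configuration space, so they are passed to its smooth
  -- functions rather than kept as polynomial identities.
  have hzero : ∀ F : MvPolynomial (Fin n) ℝ, (∀ q ∈ configSpace n m, MvPolynomial.eval q F = 0) →
      (polyFun F : SmoothFun (configSpace n m)) = 0 := by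
    intro F hF
    refine SmoothFun.ext' fun x => ?_
    rw [polyFun_apply, hF x.1 x.2]; simp
  have hmapT : ∀ (x : Fin n × Option (Fin (n + 2)) → ℝ) k j,
      (polyFun (∑ i, MvPolynomial.C (x i) * baseT m MvPolynomial.X i k j) :
        SmoothFun (configSpace n m))
        = ∑ i, polyFun (MvPolynomial.C (x i)) * baseT m coordFun i k j := by
    intro x k j
    rw [map_sum]
    exact Finset.sum_congr rfl fun i _ => by rw [map_mul, map_baseT]; rfl
  have hmapV : ∀ (x : Fin n × Option (Fin (n + 2)) → ℝ) k,
      (polyFun (∑ i, MvPolynomial.C (x i) * baseV m MvPolynomial.X i k) :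
        SmoothFun (configSpace n m))
        = ∑ i, polyFun (MvPolynomial.C (x i)) * baseV m coordFun i k := by
    intro x k
    rw [map_sum]
    exact Finset.sum_congr rfl fun i _ => by rw [map_mul, map_baseV]; rfl
  -- Twice `linConst` is `-iħ`, so the commutator cancels the time derivatives.
  have key := combOp_commutator hn hm hQ (α := quadConst n m ħ) (β := linConst n m ħ)
    (fun k => partialD_mkSmooth_const hQ k _) (fun k => partialD_mkSmooth_const hQ k _)
    (x := x) (y := y) (z := z) (d := fun γ => d γ t) (fun _ _ => rfl) (fun _ _ => rfl)
    (fun k j => by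
      have := hzero _ fun q hq => (hcl q hq).1 k j
      rw [map_add, map_sub, hmapT, map_lieD polyFun hpoly, map_lieD polyFun hpoly] at this
      simp only [hTx, hTy, hVx, hVy, hmapT, hmapV] at this
      linear_combination this)
    (fun k => by
      have := hzero _ fun q hq => (hcl q hq).2 k
      rw [map_add, hmapV, map_vfBracket polyFun hpoly] at this
      simp only [hVx, hVy, hmapV] at this
      simp only [vfBracket] at this ⊢
      linear_combination this)
    (mkSmooth ψ hψ)
  have hop : ∀ r (φ : (Fin n → ℝ) → ℂ) (Φ : SmoothFun (configSpace n m)),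
      (∀ x : configSpace n m, φ x = Φ.1 x) → ∀ q : configSpace n m, QuantHB m ħ ζ d r t φ q
        = (combOp hn hQ (quadConst n m ħ) (linConst n m ħ) (fun i => coeffH m ζ d r i t) Φ).1 q := by
    intro r φ Φ hφ q
    rw [QuantHB_eq_sum, combOp_apply hn hQ ħ hφ]
  have hψ' : ∀ x : configSpace n m, ψ x = (mkSmooth ψ hψ).1 x := fun _ => rfl
  have k1 := hop r _ _ (hop s ψ _ hψ') ⟨q, hq⟩
  have k2 := hop s _ _ (hop r ψ _ hψ') ⟨q, hq⟩
  have k3 := congrArg (fun f : SmoothFun (configSpace n m) => f.1 ⟨q, hq⟩) key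
  have k4 := combOp_apply hn hQ ħ hψ' ⟨q, hq⟩ z
  have k5 : (combOp hn hQ (quadConst n m ħ) (linConst n m ħ) x
        (combOp hn hQ (quadConst n m ħ) (linConst n m ħ) y (mkSmooth ψ hψ))).1 ⟨q, hq⟩
      - (combOp hn hQ (quadConst n m ħ) (linConst n m ħ) y
        (combOp hn hQ (quadConst n m ħ) (linConst n m ħ) x (mkSmooth ψ hψ))).1 ⟨q, hq⟩
      = 2 * (-(1 / 2) * Complex.I * (ħ : ℂ))
        * (combOp hn hQ (quadConst n m ħ) (linConst n m ħ) z (mkSmooth ψ hψ)).1 ⟨q, hq⟩ := k3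
  rw [k1, k2, k5, k4]
  simp only [QuantHB_eq_sum]
  rw [pderiv_sum_ofReal_mul _ (hdiff r), pderiv_sum_ofReal_mul _ (hdiff s)]
  simp only [hz, Complex.ofReal_sub, sub_mul, Finset.sum_sub_distrib]
  ring

end Time

/-! ### The Hamiltonians as residues of expressions in `b` -/

section Momenta

variable {R : Type*} [CommRing R] {n m : ℕ}

/-- The momenta as a sequence. -/
def dualSeq (y : Fin n → R) (k : ℤ) : R :=
  if h : 1 ≤ k ∧ k ≤ n then y ⟨(k - 1).toNat, by omega⟩ else 0

theorem dualSeq_succ (y : Fin n → R) (i : Fin n) : dualSeq y ((i : ℕ) + 1) = y i := by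
  rw [dualSeq, dif_pos (by omega)]
  congr 1; ext; simp

theorem dualSeq_big (y : Fin n → R) (k : ℤ) (hk : (n : ℤ) < k) : dualSeq y k = 0 := by
  rw [dualSeq, dif_neg (by omega)]

theorem sum_range_succ_dualSeq {M : Type*} [AddCommMonoid M] (n : ℕ) {f : ℕ → M} (h0 : f 0 = 0) :
    ∑ k ∈ Finset.range (n + 1), f k = ∑ k : Fin n, f (k + 1) := by
  rw [Finset.sum_range_succ', h0, add_zero, Finset.sum_range]

theorem polyB_eq_sum (c p : ℤ → R) :
    polyB n c p = ∑ k : Fin n, C (p (k + 1)) * beta c (k + 1) := by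
  rw [polyB, sum_range_succ_dualSeq n (f := fun k => C (p k) * beta c k) (by simp)]
  rfl

/-- Twice the kinetic energies. -/
def polyE (n m : ℕ) (c p : ℤ → R) (r : ℕ) : R :=
  res (beta c (n + 1)) (beta c r * (X ^ m * polyB n c p ^ 2))

/-- The Hamiltonians of the Killing vector fields. -/
def polyW (n m : ℕ) (c p : ℤ → R) (r : ℕ) : R :=
  ∑ k : Fin n, killC n m r c (k + 1) * p (k + 1)

/-- The Hamiltonians of the basic vector potentials. -/
def polyM (n : ℕ) (c p : ℤ → R) (r γ : ℕ) : R :=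
  res (beta c (n + 1)) (beta c r * (X ^ γ * polyB n c p))

theorem polyE_succ (x : Fin n → R) (p : ℤ → R) (r : Fin n) :
    polyE n m (vieta x) p (r + 1)
      = ∑ k : Fin n, ∑ j : Fin n, genA m x r k j * p (k + 1) * p (j + 1) := by
  have : beta (vieta x) (r + 1) * (X ^ m * polyB n (vieta x) p ^ 2)
      = ∑ k : Fin n, ∑ j : Fin n, C (p (k + 1) * p (j + 1)) * (beta (vieta x) (k + 1)
        * (beta (vieta x) (r + 1) * beta (vieta x) (j + 1) * X ^ m)) := by
    rw [polyB_eq_sum, pow_two, Finset.sum_mul_sum]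
    simp only [Finset.mul_sum]
    exact Finset.sum_congr rfl fun k _ => Finset.sum_congr rfl fun j _ => by rw [C_mul]; ring
  rw [polyE, this]
  simp only [map_sum, res_C_mul]
  exact Finset.sum_congr rfl fun k _ => Finset.sum_congr rfl fun j _ => by rw [genA]; ring

theorem polyM_succ (x : Fin n → R) (p : ℤ → R) (r : Fin n) (γ : ℕ) :
    polyM n (vieta x) p (r + 1) γ = ∑ k : Fin n, genP x r γ k * p (k + 1) := by
  have : beta (vieta x) (r + 1) * (X ^ γ * polyB n (vieta x) p)
      = ∑ k : Fin n, C (p (k + 1)) * (beta (vieta x) (k + 1)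
        * (beta (vieta x) (r + 1) * X ^ γ)) := by
    rw [polyB_eq_sum]
    simp only [Finset.mul_sum]
    exact Finset.sum_congr rfl fun k _ => by ring
  rw [polyM, this]
  simp only [map_sum, res_C_mul]
  exact Finset.sum_congr rfl fun k _ => by rw [genP]; ring

end Momenta

/-! ### The flows of the Killing Hamiltonians -/

section Flows

variable {R : Type*} [CommRing R] {n m : ℕ} {c p : ℤ → R} {dq dp : Fin n → Derivation ℤ R R}

theorem IsCanonical.dp_killC (h : IsCanonical c p dq dp) (i : Fin n) (s : ℕ) (k : ℤ) :
    dp i (killC n m s c k) = 0 := by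
  unfold killC
  split_ifs <;> rw [Derivation.map_intCast_mul, h.pc, mul_zero]

theorem IsCanonical.dp_polyW (h : IsCanonical c p dq dp) (i : Fin n) (s : ℕ) :
    dp i (polyW n m c p s) = killC n m s c (i + 1) := by
  rw [polyW, map_sum, Finset.sum_eq_single i]
  · rw [Derivation.leibniz, h.dp_killC, h.pp, if_pos rfl]; simp
  · intro k _ hk
    rw [Derivation.leibniz, h.dp_killC, h.pp, if_neg (by intro h'; apply hk; ext; omega)]; simp
  · simp

theorem IsCanonical.dq_polyW (h : IsCanonical c p dq dp) (i : Fin n) (s : ℕ) :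
    dq i (polyW n m c p s) = ∑ k : Fin n, dq i (killC n m s c (k + 1)) * p (k + 1) := by
  rw [polyW, map_sum]
  refine Finset.sum_congr rfl fun k _ => ?_
  rw [Derivation.leibniz, h.qp]; simp [mul_comm]

theorem IsCanonical.flowsAlong (h : IsCanonical c p dq dp) (hc : IsCoord n c) (hm : m ≤ n + 1)
    (s : ℕ) : FlowsAlong n m s c (ham dq dp (polyW n m c p s)) := by
  intro k
  rcases lt_or_ge 0 k with hk | hk
  · obtain ⟨k, rfl⟩ := Int.eq_ofNat_of_zero_le hk.le
    rw [ham_coord h]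
    split_ifs with h1
    · rw [h.dp_polyW]
      congr 1
      simp only; omega
    · rw [killC_big hc]; omega
  · rw [killC_zero hc hm _ _ hk]
    rcases hk.lt_or_eq with hk | rfl
    · rw [hc.neg _ hk, map_zero]
    · rw [hc.zero, Derivation.map_one_eq_zero]

theorem ham_killC (h : IsCanonical c p dq dp) (s r : ℕ) (k : ℤ) :
    ham dq dp (polyW n m c p r) (killC n m s c k)
      = ∑ i : Fin n, dq i (killC n m s c k) * killC n m r c (i + 1) := by
  rw [ham_apply]
  exact Finset.sum_congr rfl fun i _ => by rw [h.dp_killC, h.dp_polyW]; ring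

theorem ham_polyW_polyW (h : IsCanonical c p dq dp) (hc : IsCoord n c) (hm : m ≤ n + 1) {r s : ℕ}
    (hr : 1 ≤ r) (hs : 1 ≤ s) :
    ham dq dp (polyW n m c p s) (polyW n m c p r)
      = structC n m r s * polyW n m c p (r + s + m - (n + 2)) := by
  have key : ham dq dp (polyW n m c p s) (polyW n m c p r)
      = ∑ k : Fin n, (ham dq dp (polyW n m c p s) (killC n m r c (k + 1))
        - ham dq dp (polyW n m c p r) (killC n m s c (k + 1))) * p (k + 1) := by
    simp only [ham_killC h, sub_mul, Finset.sum_sub_distrib]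
    rw [ham_apply]
    simp only [h.dq_polyW, h.dp_polyW, Finset.sum_sub_distrib, Finset.sum_mul, Finset.mul_sum]
    congr 1
    · rw [Finset.sum_comm]
      exact Finset.sum_congr rfl fun i _ => Finset.sum_congr rfl fun k _ => by ring
    · rw [Finset.sum_comm]
      exact Finset.sum_congr rfl fun i _ => Finset.sum_congr rfl fun k _ => by ring
  rw [key, polyW.eq_1 n m c p (r + s + m - (n + 2)), Finset.mul_sum]
  refine Finset.sum_congr rfl fun k _ => ?_
  rw [flow_killC_sub hc hm hr hs (h.flowsAlong hc hm r) (h.flowsAlong hc hm s), mul_assoc]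

theorem IsCanonical.dq_coord_shift (h : IsCanonical c p dq dp) (i k : Fin n) (s : ℕ) :
    dq i (killC n m s c (k + 1)) =
      if (k : ℤ) + 1 - (n + 2 - m - s) = i + 1 then
        (if lowIdx n m s then ((max (n + 1 - m - (k + 1)) 0 : ℤ) : R)
          else ((max (k + 1 - (n + 1 - m)) 0 : ℤ) : R)) else 0 := by
  unfold killC
  split_ifs <;> rw [Derivation.map_intCast_mul, h.qc] <;> simp_all

/-- The momentum `p_k` moves by `-∑_j (∂J_s^j/∂q_k) p_j`, and at most one component of `J_s` depends
on `q_k`. -/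
theorem IsCanonical.flowsAlongDual (h : IsCanonical c p dq dp) (hm : m ≤ n + 1)
    (hp : ∀ k : ℤ, (n : ℤ) < k → p k = 0) {s : ℕ} :
    FlowsAlongDual n m s p (ham dq dp (polyW n m c p s)) := by
  intro k h1 h2
  obtain ⟨k, rfl⟩ := Int.eq_ofNat_of_zero_le (by omega : 0 ≤ k)
  rw [ham_momentum h, dif_pos (by omega), h.dq_polyW, neg_mul]
  congr 1
  simp only [h.dq_coord_shift]
  rcases lt_or_ge (n : ℤ) (k + (n + 2 - m - s)) with hk | hk
  · rw [hp _ hk, mul_zero]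
    refine Finset.sum_eq_zero fun j _ => ?_
    rw [if_neg (by have := j.2; omega), zero_mul]
  by_cases hk1 : 1 ≤ (k : ℤ) + (n + 2 - m - s)
  · rw [Finset.sum_eq_single ⟨((k : ℤ) + (n + 2 - m - s) - 1).toNat, by omega⟩]
    · have e : ((((k : ℤ) + (n + 2 - m - s) - 1).toNat : ℕ) : ℤ) = (k : ℤ) + (n + 2 - m - s) - 1 :=
        Int.toNat_of_nonneg (by omega)
      simp only [e]
      rw [if_pos (by omega), show (k : ℤ) + (n + 2 - m - s) - 1 + 1 = k + (n + 2 - m - s) by ring,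
        show (n + 1 - m - (k + (n + 2 - m - s)) : ℤ) = s - 1 - k by ring,
        show (k + (n + 2 - m - s) - (n + 1 - m) : ℤ) = k - (s - 1) by ring]
    · intro j _ hj
      rw [if_neg, zero_mul]
      intro h'; apply hj; ext; simp only; omega
    · simp
  · have : (if lowIdx n m s then ((max (s - 1 - k) 0 : ℤ) : R)
        else ((max (k - (s - 1)) 0 : ℤ) : R)) = 0 := by
      split_ifs with hl
      · unfold lowIdx at hl; rw [max_eq_right (by omega)]; simp
      · unfold lowIdx at hl; rw [max_eq_right (by omega)]; simp
    rw [this, zero_mul]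
    refine Finset.sum_eq_zero fun j _ => ?_
    rw [if_neg (by have := j.2; omega), zero_mul]

end Flows

/-! ### The action of the Killing fields on the basic vector potentials -/

section Shift

variable {R : Type*} [CommRing R] [Nontrivial R] {n m : ℕ} {c p : ℤ → R}

/-- `X^(n+1-s) β_s` agrees with `a` in its upper coefficients, so the quotient is a power of `X` up
to a constant, which the derivative removes. This works because `γ ≤ n + 1`; larger exponents would
bring coordinates into the derivative. -/
theorem derivative_X_pow_mul_beta_div (hc : IsCoord n c) {s γ : ℕ} (hs : s ≤ n)
    (hγ : γ ≤ n + 1) :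
    derivative ((X ^ γ * beta c s) /ₘ beta c (n + 1))
      = ((γ + s - (n + 1) : ℕ) : R[X]) * X ^ (γ + s - (n + 2)) := by
  have ha := beta_monic hc n
  have hdeg := natDegree_beta hc n
  have hsmall : ∀ F : R[X], F.natDegree ≤ n → derivative (F /ₘ beta c (n + 1)) = 0 := by
    intro F hF
    refine derivative_of_natDegree_zero ?_
    rw [natDegree_divByMonic _ ha, hdeg]; omega
  rcases Nat.lt_or_ge (γ + s) (n + 1) with h | h
  · rw [hsmall]
    · rw [show γ + s - (n + 1) = 0 by omega]; simp
    · refine natDegree_mul_le.trans ?_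
      rw [natDegree_X_pow]
      rcases s with _ | s
      · simp; omega
      · rw [natDegree_beta hc]; omega
  · obtain ⟨j, rfl⟩ : ∃ j, γ = n + 1 - s + j := ⟨γ + s - (n + 1), by omega⟩
    set T := beta c (n + 1) - X ^ (n + 1 - s) * beta c s with hT
    have hTdeg : T.natDegree ≤ n - s := by
      rw [natDegree_le_iff_coeff_eq_zero]
      intro N hN
      rw [hT, coeff_sub, coeff_beta hc, coeff_X_pow_mul', coeff_beta hc, if_pos (by omega),
        sub_eq_zero]
      congr 1; omega
    have e : X ^ (n + 1 - s + j) * beta c s = X ^ j * beta c (n + 1) - X ^ j * T := by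
      rw [hT, pow_add]; ring
    have h2 : (X ^ j * T).natDegree ≤ n := by
      refine natDegree_mul_le.trans ?_
      rw [natDegree_X_pow]; omega
    rw [e, sub_divByMonic' ha, mul_comm (X ^ j) (beta c (n + 1)),
      mul_divByMonic_cancel_left _ ha, derivative_sub, hsmall _ h2, sub_zero, derivative_X_pow,
      show n + 1 - s + j + s - (n + 1) = j by omega,
      show n + 1 - s + j + s - (n + 2) = j - 1 by omega]
    simp

/-- The weights of the action of the Killing vector fields on the basic vector potentials. -/
def shiftW (n m s γ : ℕ) : ℕ :=
  if lowIdx n m s then γ + s - (n + 1) else n + 1 - (s + γ)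

/-- The result is free of the coordinates, so the action descends to the magnetic parameters. For
the second kind the positive part of `γ+s-n-1` minus that number itself leaves the positive part of
`n+1-s-γ`. -/
theorem polyD_X_pow (hc : IsCoord n c) {s γ : ℕ} (hs' : s ≤ n)
    (hγ : γ ≤ n + 1) :
    polyD n m s c (X ^ γ) = (shiftW n m s γ : R[X]) * X ^ (γ + m + s - (n + 2)) := by
  rw [polyD, derivative_X_pow_mul_beta_div hc hs' hγ, polyZ, polyY, shiftW]
  have e1 : X ^ m * (((γ + s - (n + 1) : ℕ) : R[X]) * X ^ (γ + s - (n + 2)))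
      = ((γ + s - (n + 1) : ℕ) : R[X]) * X ^ (γ + m + s - (n + 2)) := by
    rcases Nat.eq_zero_or_pos (γ + s - (n + 1)) with h | h
    · rw [h]; simp
    · rw [show γ + m + s - (n + 2) = m + (γ + s - (n + 2)) by omega, pow_add]; ring
  rw [e1]
  by_cases hl : lowIdx n m s
  · simp only [if_pos hl]; ring
  · simp only [if_neg hl]
    have hl' : n + 2 ≤ m + s := by unfold lowIdx at hl; omega
    have e2 : X ^ (m + s - 1 - n) * derivative (X ^ γ : R[X])
        = (γ : R[X]) * X ^ (γ + m + s - (n + 2)) := by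
      rw [derivative_X_pow]
      rcases γ with _ | γ
      · simp
      · rw [show γ + 1 + m + s - (n + 2) = (m + s - 1 - n) + γ by omega, pow_add]; simp; ring
    have e3 : ((s : R[X]) - 1 - (n : R[X])) * X ^ (m + s - 2 - n) * X ^ γ
        = ((s : R[X]) - 1 - (n : R[X])) * X ^ (γ + m + s - (n + 2)) := by
      rw [show γ + m + s - (n + 2) = (m + s - 2 - n) + γ by omega, pow_add]; ring
    rw [e2, e3]
    have e4 : ((γ + s - (n + 1) : ℕ) : R[X]) = ((n + 1 - (s + γ) : ℕ) : R[X]) + (γ : R[X]) + ((s : R[X]) - 1 - (n : R[X])) := by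
      rcases le_total (n + 1) (γ + s) with h | h
      · rw [show n + 1 - (s + γ) = 0 by omega, Nat.cast_sub h]; push_cast; ring
      · rw [show γ + s - (n + 1) = 0 by omega, Nat.cast_sub (by omega)]; push_cast; ring
    rw [e4]; ring

/-- `X` is prime and does not divide the characteristic polynomial, whose constant coefficient is `c
n`. -/
theorem charpoly_dvd_of_dvd_X_pow_mul {R : Type*} [CommRing R] [IsDomain R] {c : ℤ → R}
    (hc : IsCoord n c) (h0 : c n ≠ 0) (G : R[X])
    (h : beta c (n + 1) ∣ X ^ m * G) : beta c (n + 1) ∣ G := by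
  induction m with
  | zero => simpa using h
  | succ m ih =>
    apply ih
    obtain ⟨K, hK⟩ := h
    have h1 : X ∣ beta c (n + 1) * K := ⟨X ^ m * G, by rw [← hK]; ring⟩
    rcases prime_X.dvd_or_dvd h1 with h2 | ⟨K', rfl⟩
    · rw [X_dvd_iff, coeff_beta hc] at h2
      refine absurd ?_ h0
      rw [← h2]; congr 1; push_cast; ring
    · refine ⟨K', mul_left_cancel₀ (X_ne_zero (R := R)) ?_⟩
      linear_combination hK

end Shift

/-! ### The bracket relations of the magnetic Hamiltonians -/

section Brackets

variable {R : Type*} [CommRing R] [IsDomain R] {n m : ℕ} {c p : ℤ → R}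
  {dq dp : Fin n → Derivation ℤ R R}

theorem flow_polyM_sub (hc : IsCoord n c) (hn : 0 < n) (hm : m ≤ n + 1) (h0 : c n ≠ 0) {r s : ℕ}
    (hr : 1 ≤ r) (hr' : r ≤ n) (hs : 1 ≤ s) (hs' : s ≤ n) {δr δs : Derivation ℤ R R}
    (hδr : FlowsAlong n m r c δr) (hδrp : FlowsAlongDual n m r p δr)
    (hδs : FlowsAlong n m s c δs) (hδsp : FlowsAlongDual n m s p δs) {γ : ℕ} (hγ : γ ≤ n + 1) :
    δs (polyM n c p r γ) - δr (polyM n c p s γ)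
      = structC n m r s * polyM n c p (r + s + m - (n + 2)) γ
        + shiftW n m r γ * polyM n c p s (γ + m + r - (n + 2))
        - shiftW n m s γ * polyM n c p r (γ + m + s - (n + 2)) := by
  have hM : ∀ (k l w i : ℕ), res (beta c (n + 1)) (beta c k * ((w : R[X]) * X ^ i * polyB n c p))
      = w * polyM n c p k i := by
    intro k l w i
    rw [polyM, ← res_C_mul]
    refine congrArg (res _) ?_
    rw [C_eq_natCast]; ring
  have := flow_magnetic_sub hc hn hm (fun G => charpoly_dvd_of_dvd_X_pow_mul hc h0 G) hr hr' hs hs'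
    hδr hδrp hδs hδsp (X ^ γ) (coeffD_X_pow _ _) (coeffD_X_pow _ _)
  rw [polyD_X_pow hc hr' hγ, polyD_X_pow hc hs' hγ, hM s 0, hM r 0] at this
  exact this

/-- The Hamiltonians, with parameters `x`. -/
def polyH (n m : ℕ) (c p : ℤ → R) (ι : R) (x : Fin (n + 2) → R) (r : ℕ) : R :=
  ι * polyE n m c p r + polyW n m c p r + ∑ γ : Fin (n + 2), x γ * polyM n c p r γ

/-- The brackets of the Hamiltonians. -/
theorem ham_polyH_polyH (h : IsCanonical c p dq dp) (hc : IsCoord n c) (hn : 0 < n)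
    (hm : m ≤ n + 1) (h0 : c n ≠ 0) (hp : ∀ k : ℤ, (n : ℤ) < k → p k = 0) {ι : R} (hι : 2 * ι = 1)
    {x : Fin (n + 2) → R} (hιq : ∀ i, dq i ι = 0) (hιp : ∀ i, dp i ι = 0)
    (hxq : ∀ i γ, dq i (x γ) = 0) (hxp : ∀ i γ, dp i (x γ) = 0) {r s : ℕ} (hr : 1 ≤ r)
    (hr' : r ≤ n) (hs : 1 ≤ s) (hs' : s ≤ n) :
    ham dq dp (polyH n m c p ι x s) (polyH n m c p ι x r)
      = structC n m r s * polyH n m c p ι x (r + s + m - (n + 2))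
        + ∑ γ : Fin (n + 2), x γ * (shiftW n m r γ * polyM n c p s (γ + m + r - (n + 2))
          - shiftW n m s γ * polyM n c p r (γ + m + s - (n + 2))) := by
  -- The kinetic and magnetic terms together form a Stäckel system in involution. Only brackets that
  -- involve the Killing Hamiltonians contribute.
  set K : ℕ → R := fun r => ι * polyE n m c p r + ∑ γ : Fin (n + 2), x γ * polyM n c p r γ with hK
  have hH : ∀ r, polyH n m c p ι x r = K r + polyW n m c p r := by
    intro r; rw [polyH, hK]; ring
  have hK0 : ∀ r, K r = res (beta c (n + 1)) (beta c r * ((C ι * X ^ m) * polyB n c p ^ 2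
      + 2 * ((∑ γ : Fin (n + 2), C (ι * x γ) * X ^ (γ : ℕ)) * polyB n c p))) := by
    intro r
    simp only [hK, polyE, polyM, ← res_C_mul, ← map_sum, ← map_add]
    refine congrArg (res _) ?_
    have e : ∀ γ, C (x γ) = 2 * C (ι * x γ) := by
      intro γ
      have : (2 : R[X]) = C 2 := (map_ofNat C 2).symm
      rw [this, ← C_mul, ← mul_assoc, hι, one_mul]
    have e5 : ∑ γ : Fin (n + 2), C (x γ) * (beta c r * (X ^ (γ : ℕ) * polyB n c p))
        = 2 * (∑ γ : Fin (n + 2), C (ι * x γ) * X ^ (γ : ℕ)) * (beta c r * polyB n c p) := by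
      rw [Finset.mul_sum, Finset.sum_mul]
      exact Finset.sum_congr rfl fun γ _ => by rw [e]; ring
    rw [e5]
    ring
  have hconst : ∀ (g y : R), (∀ i, dq i y = 0) → (∀ i, dp i y = 0) → ham dq dp g y = 0 := by
    intro g y h1 h2
    rw [ham_apply]
    exact Finset.sum_eq_zero fun i _ => by rw [h1, h2]; ring
  have hCD : ∀ (δ : Derivation ℤ R R), δ ι = 0 → (∀ γ, δ (x γ) = 0) →
      coeffD δ (C ι * X ^ m) = 0 ∧
      coeffD δ (∑ γ : Fin (n + 2), C (ι * x γ) * X ^ (γ : ℕ)) = 0 := by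
    intro δ h1 h2
    constructor
    · rw [coeffD_mul, coeffD_X_pow, coeffD_C, h1]; simp
    · rw [map_sum]
      refine Finset.sum_eq_zero fun γ _ => ?_
      rw [coeffD_mul, coeffD_X_pow, coeffD_C, δ.leibniz, h1, h2]; simp
  have hKK : ham dq dp (K s) (K r) = 0 := by
    obtain ⟨s, rfl⟩ : ∃ s', s = s' + 1 := ⟨s - 1, by omega⟩
    obtain ⟨r, rfl⟩ : ∃ r', r = r' + 1 := ⟨r - 1, by omega⟩
    rw [hK0, hK0]
    exact ham_stackel_stackel h hc hn hp _ _ (fun i => (hCD _ (hιq i) (hxq i)).1)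
      (fun i => (hCD _ (hιp i) (hxp i)).1) (fun i => (hCD _ (hιq i) (hxq i)).2)
      (fun i => (hCD _ (hιp i) (hxp i)).2) (by omega) (by omega)
  have fr := h.flowsAlong hc hm r
  have fs := h.flowsAlong hc hm s
  have fr' := h.flowsAlongDual hm hp (s := r)
  have fs' := h.flowsAlongDual hm hp (s := s)
  have hKW : ham dq dp (polyW n m c p s) (K r) - ham dq dp (polyW n m c p r) (K s)
      = structC n m r s * K (r + s + m - (n + 2))
        + ∑ γ : Fin (n + 2), x γ * (shiftW n m r γ * polyM n c p s (γ + m + r - (n + 2))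
          - shiftW n m s γ * polyM n c p r (γ + m + s - (n + 2))) := by
    have eK : ∀ g r, ham dq dp g (K r) = ι * ham dq dp g (polyE n m c p r)
        + ∑ γ : Fin (n + 2), x γ * ham dq dp g (polyM n c p r γ) := by
      intro g r
      simp only [hK]
      rw [map_add, map_sum, Derivation.leibniz, hconst g ι hιq hιp]
      simp only [Derivation.leibniz, hconst g _ (fun i => hxq i _) (fun i => hxp i _), smul_eq_mul,
        mul_zero, add_zero]
    have e1 := flow_geodesic_sub hc hn hm hr hr' hs hs' fr fr' fs fs'
    rw [eK, eK]
    have e2 : ∀ γ : Fin (n + 2), x γ * ham dq dp (polyW n m c p s) (polyM n c p r γ)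
        - x γ * ham dq dp (polyW n m c p r) (polyM n c p s γ)
        = structC n m r s * (x γ * polyM n c p (r + s + m - (n + 2)) γ)
          + x γ * (shiftW n m r γ * polyM n c p s (γ + m + r - (n + 2))
          - shiftW n m s γ * polyM n c p r (γ + m + s - (n + 2))) := by
      intro γ
      have := flow_polyM_sub hc hn hm h0 hr hr' hs hs' fr fr' fs fs' (γ := γ) (by omega)
      linear_combination x γ * this
    have e3 := Finset.sum_congr (rfl : (Finset.univ : Finset (Fin (n + 2))) = _) fun γ _ => e2 γ
    rw [Finset.sum_sub_distrib, Finset.sum_add_distrib, ← Finset.mul_sum] at e3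
    simp only [hK]
    unfold polyE
    linear_combination ι * e1 + e3
  have hadd : ∀ g₁ g₂ f, ham dq dp (g₁ + g₂) f = ham dq dp g₁ f + ham dq dp g₂ f := by
    intro g₁ g₂ f
    simp only [ham_apply, ← Finset.sum_add_distrib, map_add]
    exact Finset.sum_congr rfl fun i _ => by ring
  clear_value K
  rw [hH, hH, hH, hadd, map_add, map_add, hKK, ham_symm dq dp (polyW n m c p r) (K s),
    ham_polyW_polyW h hc hm hr hs]
  linear_combination hKW

end Brackets

/-! ### The bracket relations for polynomials on phase space -/

section Phase

variable {n m : ℕ}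

/-- The coordinates on phase space as a sequence of polynomials. -/
def phaseCoord (n : ℕ) : ℤ → PhasePoly n := vieta fun i => MvPolynomial.X (Sum.inl i)

/-- The momenta on phase space as a sequence of polynomials. -/
def phaseMom (n : ℕ) : ℤ → PhasePoly n := dualSeq fun i => MvPolynomial.X (Sum.inr i)

theorem isCanonical_phase : IsCanonical (phaseCoord n) (phaseMom n) dqS dpS where
  qc i k := derivation_vieta_single (fun j => by
    rw [dqS_apply, MvPolynomial.pderiv_X, Pi.single_apply]; simp [eq_comm]) k
  pc i k := by
    rw [phaseCoord, derivation_vieta]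
    split_ifs
    · rw [dpS_apply, MvPolynomial.pderiv_X_of_ne (by simp)]
    · rfl
  qp i k := by
    rw [phaseMom, dualSeq]
    split_ifs
    · rw [dqS_apply, MvPolynomial.pderiv_X_of_ne (by simp)]
    · rw [map_zero]
  pp i k := by
    have := i.2
    rw [phaseMom, dualSeq]
    split_ifs with h1 h2 h2
    · rw [dpS_apply, MvPolynomial.pderiv_X, Pi.single_apply, if_pos]
      congr 1; ext; simp only; omega
    · rw [dpS_apply, MvPolynomial.pderiv_X, Pi.single_apply, if_neg]
      intro h3
      have h4 := congrArg Fin.val (Sum.inr_injective h3)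
      simp only at h4; omega
    · omega
    · rw [map_zero]

theorem phaseCoord_ne_zero (hn : 0 < n) : phaseCoord n n ≠ 0 := by
  rw [phaseCoord, vieta, if_neg (by omega), dif_pos (by omega)]
  exact MvPolynomial.X_ne_zero _

theorem eval_phaseMom (q p : Fin n → ℝ) (k : Fin n) :
    MvPolynomial.eval (Sum.elim q p) (phaseMom n (k + 1)) = p k := by
  rw [phaseMom, dualSeq_succ, MvPolynomial.eval_X, Sum.elim_inr]

theorem eval_polyM (q p : Fin n → ℝ) (r : Fin n) (γ : ℕ) :
    MvPolynomial.eval (Sum.elim q p) (polyM n (phaseCoord n) (phaseMom n) (r + 1) γ)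
      = ∑ j, potentialP r γ q j * p j := by
  rw [phaseCoord, polyM_succ, map_sum]
  refine Finset.sum_congr rfl fun k _ => ?_
  rw [map_mul, eval_phaseMom, map_genP, potentialP_eq]
  simp only [MvPolynomial.eval_X, Sum.elim_inl]

theorem eval_polyH (d : Fin (n + 2) → ℝ) (q p : Fin n → ℝ) (r : Fin n) :
    MvPolynomial.eval (Sum.elim q p) (polyH n m (phaseCoord n) (phaseMom n)
        (MvPolynomial.C (1 / 2)) (fun γ => MvPolynomial.C (d γ)) (r + 1))
      = (1 / 2) * ∑ i, ∑ j, tensorA m r q i j * p i * p j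
        + ∑ j, killingJ m r q j * p j
        + ∑ γ : Fin (n + 2), d γ * ∑ j, potentialP r (γ : ℕ) q j * p j := by
  rw [polyH, map_add, map_add, map_mul, MvPolynomial.eval_C, map_sum]
  congr 1
  · congr 1
    · rw [phaseCoord, polyE_succ]
      simp only [map_sum, map_mul, eval_phaseMom, map_genA, tensorA_eq, MvPolynomial.eval_X,
        Sum.elim_inl]
    · rw [polyW, map_sum]
      refine Finset.sum_congr rfl fun k _ => ?_
      rw [map_mul, eval_phaseMom, killingJ_eq_genJ]
      congr 1
      have := map_genJ (m := m) (MvPolynomial.eval (Sum.elim q p))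
        (fun i => (MvPolynomial.X (Sum.inl i) : PhasePoly n)) r k
      simp only [MvPolynomial.eval_X, Sum.elim_inl] at this
      exact this
  · refine Finset.sum_congr rfl fun γ _ => ?_
    rw [map_mul, MvPolynomial.eval_C, eval_polyM]

/-- The Hamiltonians with parameters `x`, as functions of the index. -/
def phaseH (n m : ℕ) (x : Fin (n + 2) → ℝ) (r : ℕ) : PhasePoly n :=
  polyH n m (phaseCoord n) (phaseMom n) (MvPolynomial.C (1 / 2)) (fun γ => MvPolynomial.C (x γ)) r

/-- The magnetic Hamiltonians as polynomials. -/
def phaseM (n : ℕ) (r γ : ℕ) : PhasePoly n := polyM n (phaseCoord n) (phaseMom n) r γ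

theorem ham_phaseH (hn : 0 < n) (hm : m ≤ n + 1) (x : Fin (n + 2) → ℝ) (r s : Fin n) :
    ham dqS dpS (phaseH n m x (s + 1)) (phaseH n m x (r + 1))
      = (structC n m (r + 1) (s + 1) : PhasePoly n) * phaseH n m x ((r + 1) + (s + 1) + m - (n + 2))
        + ∑ γ : Fin (n + 2), MvPolynomial.C (x γ)
          * ((shiftW n m (r + 1) γ : PhasePoly n) * phaseM n (s + 1) (γ + m + (r + 1) - (n + 2))
            - (shiftW n m (s + 1) γ : PhasePoly n) * phaseM n (r + 1) (γ + m + (s + 1) - (n + 2))) := by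
  refine ham_polyH_polyH isCanonical_phase (isCoord_vieta _) hn hm (phaseCoord_ne_zero hn)
    (fun k hk => dualSeq_big _ k hk) ?_ (fun i => ?_) (fun i => ?_) (fun i γ => ?_) (fun i γ => ?_)
    (by omega) r.2 (by omega) s.2
  · rw [← map_ofNat MvPolynomial.C, ← MvPolynomial.C_mul]; norm_num
  all_goals first | rw [dqS_apply, MvPolynomial.pderiv_C] | rw [dpS_apply, MvPolynomial.pderiv_C]

/-- The index zero is what natural subtraction yields for `r + s + m ≤ n + 2`. -/
theorem phaseH_zero (x : Fin (n + 2) → ℝ) (hm : m ≤ n + 1) : phaseH n m x 0 = 0 := by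
  have hc : IsCoord n (phaseCoord n) := isCoord_vieta _
  have hW : polyW n m (phaseCoord n) (phaseMom n) 0 = 0 := by
    refine Finset.sum_eq_zero fun k _ => ?_
    have : killC n m 0 (phaseCoord n) (k + 1) = 0 := by
      rw [killC, if_pos (by right; omega)]
      rcases le_or_gt (n + 1 - m - ((k : ℤ) + 1)) 0 with h | h
      · rw [max_eq_right h]; simp
      · rw [hc.neg _ (by push_cast; omega), mul_zero]
    rw [this, zero_mul]
  rw [phaseH, polyH, hW, polyE]
  simp [polyM]

/-- Brackets of two Hamiltonians of the second kind can have an index beyond `n`. -/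
theorem phaseH_big (x : Fin (n + 2) → ℝ) (hn : 0 < n) {r : ℕ} (hr : n < r)
    (hr' : n + 2 ≤ m + r) : phaseH n m x r = 0 := by
  have hc : IsCoord n (phaseCoord n) := isCoord_vieta _
  have hW : polyW n m (phaseCoord n) (phaseMom n) r = 0 := by
    refine Finset.sum_eq_zero fun k _ => ?_
    have : killC n m r (phaseCoord n) (k + 1) = 0 := by
      rw [killC, if_neg (by unfold lowIdx; omega)]
      rcases le_or_gt ((k : ℤ) + 1 - (n + 1 - m)) 0 with h | h
      · rw [max_eq_right h]; simp
      · rw [hc.big _ (by omega), mul_zero]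
    rw [this, zero_mul]
  have hres : ∀ F, res (beta (phaseCoord n) (n + 1)) (beta (phaseCoord n) r * F) = 0 := by
    intro F
    obtain ⟨j, rfl⟩ : ∃ j, r = n + 1 + j := ⟨r - (n + 1), by omega⟩
    rw [beta_big hc, mul_comm (Polynomial.X ^ j), mul_assoc]
    exact res_self_mul (beta_monic hc n) _
  rw [phaseH, polyH, hW, polyE, hres]
  simp only [polyM, hres]
  simp

theorem HB_eq_eval (ζ : Fin n → Fin n → (Fin n → ℝ) → ℝ) (d : Fin (n + 2) → (Fin n → ℝ) → ℝ)
    (r : Fin n) (t q p : Fin n → ℝ) :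
    HB m ζ d r t q p = MvPolynomial.eval (Sum.elim q p)
      (∑ j : Fin n, MvPolynomial.C (mix m ζ r j t) * phaseH n m (fun γ => d γ t) (j + 1)) := by
  rw [HB, map_sum]
  refine Finset.sum_congr rfl fun j _ => ?_
  rw [map_mul, MvPolynomial.eval_C, phaseH, eval_polyH, hB]

theorem ham_sum_phaseH (x : Fin (n + 2) → ℝ) (y z : Fin n → ℝ) :
    ham dqS dpS (∑ j : Fin n, MvPolynomial.C (z j) * phaseH n m x (j + 1))
      (∑ j : Fin n, MvPolynomial.C (y j) * phaseH n m x (j + 1))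
      = ∑ j : Fin n, ∑ k : Fin n, MvPolynomial.C (y j * z k)
        * ham dqS dpS (phaseH n m x (k + 1)) (phaseH n m x (j + 1)) := by
  have h1 : ∀ (g : PhasePoly n) (y : Fin n → ℝ),
      ham dqS dpS g (∑ j : Fin n, MvPolynomial.C (y j) * phaseH n m x (j + 1))
        = ∑ j : Fin n, MvPolynomial.C (y j) * ham dqS dpS g (phaseH n m x (j + 1)) := by
    intro g y
    rw [map_sum]
    refine Finset.sum_congr rfl fun j _ => ?_
    have h0 : ham dqS dpS g (MvPolynomial.C (y j)) = 0 := by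
      rw [ham_apply]
      exact Finset.sum_eq_zero fun i _ => by
        simp only [dqS_apply, dpS_apply, MvPolynomial.pderiv_C, zero_mul, sub_zero]
    rw [Derivation.leibniz, h0, smul_eq_mul, smul_zero, add_zero]
  rw [h1]
  refine Finset.sum_congr rfl fun j _ => ?_
  rw [ham_symm, h1, mul_neg, Finset.mul_sum, ← Finset.sum_neg_distrib]
  refine Finset.sum_congr rfl fun k _ => ?_
  rw [ham_symm dqS dpS (phaseH n m x (j + 1)), MvPolynomial.C_mul]; ring

end Phase

/-! ### Exponential flows of linear maps -/

section Flow

variable {F : Type*} [NormedAddCommGroup F] [NormedSpace ℝ F] {n : ℕ}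

/-- The flow of a linear vector field. -/
def linFlow (A : F →L[ℝ] F) (s : ℝ) : F →L[ℝ] F := NormedSpace.exp (s • A)

theorem linFlow_zero (A : F →L[ℝ] F) : linFlow A 0 = 1 := by
  rw [linFlow, zero_smul, NormedSpace.exp_zero]

variable [CompleteSpace F]

theorem hasDerivAt_linFlow (A : F →L[ℝ] F) (s : ℝ) :
    HasDerivAt (linFlow A) (A * linFlow A s) s :=
  hasDerivAt_exp_smul_const' A s

theorem contDiff_linFlow (A : F →L[ℝ] F) : ContDiff ℝ ∞ (linFlow A) := by
  have h : ContDiff ℝ ∞ (NormedSpace.exp : (F →L[ℝ] F) → (F →L[ℝ] F)) :=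
    contDiff_iff_contDiffAt.2 fun x => (NormedSpace.exp_analytic (𝕂 := ℝ) x).contDiffAt
  exact h.comp (contDiff_id.smul contDiff_const)

theorem contDiff_linFlow_apply (A : F →L[ℝ] F) (k : Fin n) {g : (Fin n → ℝ) → F}
    (hg : ContDiff ℝ ∞ g) : ContDiff ℝ ∞ fun t => linFlow A (t k) (g t) :=
  ((contDiff_linFlow A).comp (contDiff_apply ℝ ℝ k)).clm_apply hg

theorem pderiv_linFlow_apply (A : F →L[ℝ] F) (k s : Fin n) {g : (Fin n → ℝ) → F}
    (hg : ContDiff ℝ ∞ g) (t : Fin n → ℝ) :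
    pderiv s (fun t => linFlow A (t k) (g t)) t
      = linFlow A (t k) (pderiv s g t) + if s = k then A (linFlow A (t k) (g t)) else 0 := by
  have h0 : HasFDerivAt (fun t : Fin n → ℝ => t k)
      (ContinuousLinearMap.proj (R := ℝ) (φ := fun _ : Fin n => ℝ) k) t :=
    (ContinuousLinearMap.proj (R := ℝ) (φ := fun _ : Fin n => ℝ) k).hasFDerivAt
  have h1 := HasFDerivAt.comp (g := linFlow A) (f := fun t : Fin n → ℝ => t k) t
    (hasDerivAt_linFlow A (t k)).hasFDerivAt h0
  have h2 : HasFDerivAt g (fderiv ℝ g t) t := (hg.differentiable (by simp) t).hasFDerivAt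
  have h3 : HasFDerivAt (fun t => linFlow A (t k) (g t)) _ t := h1.clm_apply h2
  rw [pderiv, h3.fderiv]
  by_cases h : s = k
  · subst h; simp [pderiv]
  · simp [pderiv, h, Ne.symm h]

/-- The flow maps a subspace to itself modulo a smaller subspace. -/
theorem linFlow_sub_mem [FiniteDimensional ℝ F] {A : F →L[ℝ] F} {P W : Submodule ℝ F} (hW : W ≤ P)
    (h : ∀ v ∈ P, A v ∈ W) (s : ℝ) {v : F} (hv : v ∈ P) : linFlow A s v - v ∈ W := by
  have h1 : HasSum (fun i : ℕ => ((i.factorial : ℝ)⁻¹ • (s • A) ^ i) v) (linFlow A s v) :=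
    (NormedSpace.exp_series_hasSum_exp' (𝕂 := ℝ) (s • A)).mapL
      (ContinuousLinearMap.apply ℝ F v)
  -- Without its constant term the exponential series lies term by term in `W`, which is closed in
  -- finite dimension.
  have h2 := (hasSum_nat_add_iff' 1).2 h1
  simp only [Finset.range_one, Finset.sum_singleton, Nat.factorial_zero, Nat.cast_one, inv_one,
    pow_zero, one_smul, one_apply_eq_self] at h2
  have hpow : ∀ i, ((s • A) ^ (i + 1)) v ∈ W := by
    intro i
    induction i with
    | zero => simpa using W.smul_mem s (h v hv)
    | succ i ih =>
      rw [pow_succ', mul_apply_eq_comp]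
      exact W.smul_mem s (h _ (hW ih))
  have hclosed : IsClosed (W : Set F) := W.closed_of_finiteDimensional
  refine hclosed.mem_of_tendsto h2 (Filter.Eventually.of_forall fun S => ?_)
  exact W.sum_mem fun i _ => W.smul_mem _ (hpow i)

theorem linFlow_eq_self [FiniteDimensional ℝ F] {A : F →L[ℝ] F} {v : F} (h : A v = 0) (s : ℝ) :
    linFlow A s v = v := by
  have := linFlow_sub_mem (A := A) (P := ℝ ∙ v) (W := ⊥) bot_le (fun w hw => by
    obtain ⟨a, rfl⟩ := Submodule.mem_span_singleton.1 hw
    simp [h]) s (Submodule.mem_span_singleton_self v)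
  rw [Submodule.mem_bot] at this
  exact sub_eq_zero.1 this

theorem linFlow_neg_apply (A : F →L[ℝ] F) (s : ℝ) (v : F) :
    linFlow A s (linFlow (-A) s v) = v := by
  have h : linFlow A s * linFlow (-A) s = 1 := by
    let _ : NormedAlgebra ℚ (F →L[ℝ] F) := NormedAlgebra.restrictScalars ℚ ℝ _
    have e : s • (-A) = -(s • A) := smul_neg s A
    rw [linFlow, linFlow, e, ← NormedSpace.exp_add_of_commute (Commute.neg_right (Commute.refl _)),
      add_neg_cancel, NormedSpace.exp_zero]
  exact congrArg (fun B : F →L[ℝ] F => B v) h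

/-- A bilinear map that is invariant infinitesimally is invariant under the flows. -/
theorem linFlow_bilinear {E₁ E₂ : Type*} [NormedAddCommGroup E₁] [NormedSpace ℝ E₁]
    [CompleteSpace E₁] [NormedAddCommGroup E₂] [NormedSpace ℝ E₂] [CompleteSpace E₂]
    {B : E₁ →L[ℝ] E₂ →L[ℝ] F} {A₁ : E₁ →L[ℝ] E₁} {A₂ : E₂ →L[ℝ] E₂} {A : F →L[ℝ] F}
    (h : ∀ x y, A (B x y) = B (A₁ x) y + B x (A₂ y)) (s : ℝ) (x : E₁) (y : E₂) :
    linFlow A s (B x y) = B (linFlow A₁ s x) (linFlow A₂ s y) := by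
  -- Transported back by the flow of `-A`, the right-hand side has zero derivative.
  have key : ∀ s, HasDerivAt (fun s => linFlow (-A) s (B (linFlow A₁ s x) (linFlow A₂ s y))) 0 s := by
    intro s
    have d1 := (hasDerivAt_linFlow A₁ s).clm_apply (hasDerivAt_const s x)
    have d2 := (hasDerivAt_linFlow A₂ s).clm_apply (hasDerivAt_const s y)
    have d3 := (B.hasFDerivAt.comp_hasDerivAt s d1).clm_apply d2
    have d4 := (hasDerivAt_linFlow (-A) s).clm_apply d3
    refine d4.congr_deriv ?_
    have hc : Commute (-A) (linFlow (-A) s) :=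
      ((Commute.refl (-A)).smul_right s).exp_right
    rw [hc.eq]
    simp only [mul_apply_eq_comp, _root_.neg_apply, map_zero, add_zero, Function.comp_apply, h,
      map_add, map_neg]
    abel
  have hconst := is_const_of_deriv_eq_zero (fun s => (key s).differentiableAt)
    (fun s => (key s).deriv) s 0
  simp only [linFlow_zero, one_apply_eq_self] at hconst
  rw [← hconst, linFlow_neg_apply]

end Flow

/-! ### Zero curvature frames from products of exponentials -/

section Frames

variable {E V : Type*} [NormedAddCommGroup E] [NormedSpace ℝ E] [FiniteDimensional ℝ E]
  [CompleteSpace E] [NormedAddCommGroup V] [NormedSpace ℝ V] [CompleteSpace V] {n : ℕ}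

/-- The frame obtained from the vectors `x` by the successive adjoint flows. -/
def adjFrame (br : E →L[ℝ] E →L[ℝ] E) (x : Fin n → E) : List (Fin n) → Fin n → (Fin n → ℝ) → E
  | [], _, _ => 0
  | k :: σ, r, t => if r = k then x k else linFlow (br (x k)) (t k) (adjFrame br x σ r t)

/-- The orbit of a vector under the successive flows. -/
def orbit (N : E →L[ℝ] V →L[ℝ] V) (x : Fin n → E) (b : V) : List (Fin n) → (Fin n → ℝ) → V
  | [], _ => b
  | k :: σ, t => linFlow (N (x k)) (t k) (orbit N x b σ t)

variable {br : E →L[ℝ] E →L[ℝ] E} {N : E →L[ℝ] V →L[ℝ] V} {x : Fin n → E}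

theorem contDiff_adjFrame (σ : List (Fin n)) (r : Fin n) : ContDiff ℝ ∞ (adjFrame br x σ r) := by
  induction σ with
  | nil => exact contDiff_const
  | cons k σ ih =>
    by_cases h : r = k
    · have : adjFrame br x (k :: σ) r = fun _ => x k := by funext t; rw [adjFrame, if_pos h]
      rw [this]; exact contDiff_const
    · have : adjFrame br x (k :: σ) r = fun t => linFlow (br (x k)) (t k) (adjFrame br x σ r t) := by
        funext t; rw [adjFrame, if_neg h]
      rw [this]; exact contDiff_linFlow_apply _ _ ih

theorem contDiff_orbit (b : V) (σ : List (Fin n)) : ContDiff ℝ ∞ (orbit N x b σ) := by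
  induction σ with
  | nil => exact contDiff_const
  | cons k σ ih => exact contDiff_linFlow_apply _ _ ih

theorem orbit_zero (b : V) (σ : List (Fin n)) : orbit N x b σ 0 = b := by
  induction σ with
  | nil => rfl
  | cons k σ ih => rw [orbit, ih, Pi.zero_apply, linFlow_zero]; rfl

theorem adjFrame_cons_self (k : Fin n) (σ : List (Fin n)) : adjFrame br x (k :: σ) k = fun _ => x k := by
  funext t; rw [adjFrame, if_pos rfl]

theorem adjFrame_cons_of_ne {k r : Fin n} (h : r ≠ k) (σ : List (Fin n)) :
    adjFrame br x (k :: σ) r = fun t => linFlow (br (x k)) (t k) (adjFrame br x σ r t) := by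
  funext t; rw [adjFrame, if_neg h]

theorem pderiv_adjFrame_of_notMem {σ : List (Fin n)} {s : Fin n} (hs : s ∉ σ) (r : Fin n)
    (t : Fin n → ℝ) : pderiv s (adjFrame br x σ r) t = 0 := by
  induction σ with
  | nil => simp [pderiv, show adjFrame br x [] r = fun _ => 0 from rfl]
  | cons k σ ih =>
    rw [List.mem_cons, not_or] at hs
    by_cases h : r = k
    · subst h; rw [adjFrame_cons_self]; simp [pderiv]
    · rw [adjFrame_cons_of_ne h, pderiv_linFlow_apply _ _ _ (contDiff_adjFrame _ _), ih hs.2,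
        if_neg hs.1]; simp

theorem pderiv_orbit_of_notMem {σ : List (Fin n)} {s : Fin n} (hs : s ∉ σ) (b : V)
    (t : Fin n → ℝ) : pderiv s (orbit N x b σ) t = 0 := by
  induction σ with
  | nil => simp [pderiv, show orbit N x b [] = fun _ => b from rfl]
  | cons k σ ih =>
    rw [List.mem_cons, not_or] at hs
    rw [show orbit N x b (k :: σ) = fun t => linFlow (N (x k)) (t k) (orbit N x b σ t) from rfl,
      pderiv_linFlow_apply _ _ _ (contDiff_orbit _ _), ih hs.2, if_neg hs.1]; simp

/-- The derivatives of the orbit are given by the frame. -/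
theorem pderiv_orbit (hN : ∀ x y v, N (br x y) v = N x (N y v) - N y (N x v)) {σ : List (Fin n)}
    (hσ : σ.Nodup) {r : Fin n} (hr : r ∈ σ) (b : V) (t : Fin n → ℝ) :
    pderiv r (orbit N x b σ) t = N (adjFrame br x σ r t) (orbit N x b σ t) := by
  induction σ with
  | nil => simp at hr
  | cons k σ ih =>
    rw [List.nodup_cons] at hσ
    rw [show orbit N x b (k :: σ) = fun t => linFlow (N (x k)) (t k) (orbit N x b σ t) from rfl,
      pderiv_linFlow_apply _ _ _ (contDiff_orbit _ _)]
    by_cases h : r = k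
    · subst h
      rw [pderiv_orbit_of_notMem hσ.1, adjFrame_cons_self, if_pos rfl]; simp
    · rw [ih hσ.2 ((List.mem_cons.1 hr).resolve_left h), adjFrame_cons_of_ne h, if_neg h, add_zero]
      -- The representation intertwines the adjoint flow of `x k` with the flow of `N (x k)`.
      refine linFlow_bilinear (fun y v => ?_) _ _ _
      rw [hN]; abel

/-- A faithful representation by commutators forces the Lie algebra axioms, so they need no separate
check on structure constants. -/
theorem bracket_jacobi (hN : ∀ x y v, N (br x y) v = N x (N y v) - N y (N x v))
    (hinj : Function.Injective N) (z x y : E) :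
    br z (br x y) = br (br z x) y + br x (br z y) := by
  apply hinj
  ext v
  simp only [map_add, add_apply, hN, map_sub]
  abel

theorem bracket_symm (hN : ∀ x y v, N (br x y) v = N x (N y v) - N y (N x v))
    (hinj : Function.Injective N) (x y : E) : br x y = - br y x := by
  apply hinj
  ext v
  simp only [map_neg, neg_apply, hN]
  abel

/-- The frame satisfies the zero curvature equations. -/
theorem adjFrame_flat (hN : ∀ x y v, N (br x y) v = N x (N y v) - N y (N x v))
    (hinj : Function.Injective N) {σ : List (Fin n)} (hσ : σ.Nodup) {r s : Fin n} (hr : r ∈ σ)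
    (hs : s ∈ σ) (t : Fin n → ℝ) :
    pderiv s (adjFrame br x σ r) t - pderiv r (adjFrame br x σ s) t
      + br (adjFrame br x σ r t) (adjFrame br x σ s t) = 0 := by
  have hself : ∀ y, br y y = 0 := by
    intro y
    apply hinj
    ext v
    simp only [hN, sub_self, map_zero, zero_apply]
  induction σ with
  | nil => simp at hr
  | cons k σ ih =>
    rw [List.nodup_cons] at hσ
    by_cases h : r = k <;> by_cases h' : s = k
    · subst h; subst h'; rw [hself]; simp
    -- The head vector is constant, and the derivative of the other vector along its time is the
    -- bracket with it.
    · subst h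
      rw [adjFrame_cons_self, adjFrame_cons_of_ne h', pderiv_linFlow_apply _ _ _ (contDiff_adjFrame _ _),
        pderiv_adjFrame_of_notMem hσ.1, if_pos rfl]
      simp [pderiv]
    · subst h'
      rw [adjFrame_cons_self, adjFrame_cons_of_ne h, pderiv_linFlow_apply _ _ _ (contDiff_adjFrame _ _),
        pderiv_adjFrame_of_notMem hσ.1, if_pos rfl, bracket_symm hN hinj _ (x s)]
      simp [pderiv]
    -- The outer adjoint flow preserves the bracket, so it carries the whole equation for the
    -- shorter list along.
    · rw [adjFrame_cons_of_ne h, adjFrame_cons_of_ne h',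
        pderiv_linFlow_apply _ _ _ (contDiff_adjFrame _ _),
        pderiv_linFlow_apply _ _ _ (contDiff_adjFrame _ _), if_neg h, if_neg h', add_zero, add_zero,
        ← linFlow_bilinear (bracket_jacobi hN hinj (x k)), ← map_sub, ← map_add,
        ih hσ.2 ((List.mem_cons.1 hr).resolve_left h) ((List.mem_cons.1 hs).resolve_left h'),
        map_zero]

/-- The frame is triangular. -/
theorem adjFrame_sub_mem {ρ : Fin n → Fin n → Prop} {P W : Submodule ℝ E} (hW : W ≤ P)
    {σ : List (Fin n)} (hσ : σ.Pairwise ρ) {r : Fin n} (hr : r ∈ σ) (hx : x r ∈ P)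
    (h : ∀ k, ρ k r → ∀ v ∈ P, br (x k) v ∈ W) (t : Fin n → ℝ) :
    adjFrame br x σ r t - x r ∈ W := by
  induction σ with
  | nil => simp at hr
  | cons k σ ih =>
    rw [List.pairwise_cons] at hσ
    by_cases h' : r = k
    · subst h'; rw [adjFrame_cons_self]; simp
    · have hr' := (List.mem_cons.1 hr).resolve_left h'
      have h1 := ih hσ.2 hr'
      have h2 : adjFrame br x σ r t ∈ P := by simpa using P.add_mem (hW h1) hx
      rw [adjFrame_cons_of_ne h']
      have h3 := linFlow_sub_mem hW (h k (hσ.1 r hr')) (t k) h2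
      simpa using W.add_mem h3 h1

/-- The frame depends only on the times that act on it. -/
theorem adjFrame_congr {ρ : Fin n → Fin n → Prop} {P : Submodule ℝ E}
    {σ : List (Fin n)} (hσ : σ.Pairwise ρ) {r : Fin n} (hr : r ∈ σ) (hx : x r ∈ P)
    (h : ∀ k, ρ k r → ∀ v ∈ P, br (x k) v ∈ P) {t t' : Fin n → ℝ}
    (ht : ∀ k, ρ k r → t k = t' k ∨ ∀ v ∈ P, br (x k) v = 0) :
    adjFrame br x σ r t = adjFrame br x σ r t' := by
  induction σ with
  | nil => rfl
  | cons k σ ih =>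
    have hσ' := List.pairwise_cons.1 hσ
    by_cases h' : r = k
    · subst h'; rw [adjFrame_cons_self]
    · have hr' := (List.mem_cons.1 hr).resolve_left h'
      rw [adjFrame_cons_of_ne h']
      simp only [ih hσ'.2 hr']
      rcases ht k (hσ'.1 r hr') with h1 | h1
      · rw [h1]
      · have h2 : adjFrame br x σ r t' ∈ P := by
          simpa using P.add_mem (adjFrame_sub_mem le_rfl hσ'.2 hr' hx h t') hx
        rw [linFlow_eq_self (h1 _ h2), linFlow_eq_self (h1 _ h2)]

end Frames

/-! ### The Lie algebra and its representation on the magnetic parameters -/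

section LieAlgebra

variable {n m : ℕ}

/-- The unit vectors; they are zero outside the range of the index. -/
def unitE (n l : ℕ) : Fin n → ℝ := fun i => if (i : ℕ) + 1 = l then 1 else 0

/-- The unit vectors of the space of magnetic parameters. -/
def unitV (n a : ℕ) : Fin (n + 2) → ℝ := fun i => if (i : ℕ) = a then 1 else 0

theorem unitE_succ (i : Fin n) : unitE n (i + 1) = Pi.single i 1 := by
  ext j
  simp [unitE, Pi.single_apply, Fin.ext_iff]

theorem unitV_coe (i : Fin (n + 2)) : unitV n i = Pi.single i 1 := by
  ext j
  simp [unitV, Pi.single_apply, Fin.ext_iff]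

theorem unitE_zero : unitE n 0 = 0 := by ext; simp [unitE]

theorem unitE_big {l : ℕ} (h : n < l) : unitE n l = 0 := by
  ext i
  rw [unitE, if_neg (by have := i.2; omega)]; rfl

theorem ext_unitE {M : Type*} [AddCommGroup M] [Module ℝ M] {f g : (Fin n → ℝ) →ₗ[ℝ] M}
    (h : ∀ l, 1 ≤ l → l ≤ n → f (unitE n l) = g (unitE n l)) : f = g := by
  refine (Pi.basisFun ℝ (Fin n)).ext fun i => ?_
  rw [Pi.basisFun_apply, ← unitE_succ]
  exact h _ (by omega) i.2

theorem ext_unitV {M : Type*} [AddCommGroup M] [Module ℝ M] {f g : (Fin (n + 2) → ℝ) →ₗ[ℝ] M}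
    (h : ∀ a, a ≤ n + 1 → f (unitV n a) = g (unitV n a)) : f = g := by
  refine (Pi.basisFun ℝ (Fin (n + 2))).ext fun i => ?_
  rw [Pi.basisFun_apply, ← unitV_coe]
  exact h _ (by omega)

/-- The bilinear map with given values on the unit vectors. -/
def bilinOfBasis {ι κ M : Type*} [Fintype ι] [Fintype κ] [AddCommGroup M] [Module ℝ M]
    (f : ι → κ → M) : (ι → ℝ) →ₗ[ℝ] (κ → ℝ) →ₗ[ℝ] M :=
  LinearMap.mk₂ ℝ (fun x y => ∑ j, ∑ k, (x j * y k) • f j k)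
    (fun x x' y => by simp only [Pi.add_apply, add_mul, add_smul, Finset.sum_add_distrib])
    (fun a x y => by simp only [Pi.smul_apply, smul_eq_mul, mul_assoc, mul_smul, Finset.smul_sum])
    (fun x y y' => by simp only [Pi.add_apply, mul_add, add_smul, Finset.sum_add_distrib])
    (fun a x y => by
      simp only [Pi.smul_apply, smul_eq_mul, mul_left_comm, mul_smul _ (_ * _), Finset.smul_sum])

theorem bilinOfBasis_apply {ι κ M : Type*} [Fintype ι] [Fintype κ] [AddCommGroup M] [Module ℝ M]
    (f : ι → κ → M) (x : ι → ℝ) (y : κ → ℝ) :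
    bilinOfBasis f x y = ∑ j, ∑ k, (x j * y k) • f j k := rfl

theorem bilinOfBasis_single {ι κ M : Type*} [Fintype ι] [Fintype κ] [AddCommGroup M] [Module ℝ M]
    [DecidableEq ι] [DecidableEq κ] (f : ι → κ → M) (j : ι) (k : κ) :
    bilinOfBasis f (Pi.single j 1) (Pi.single k 1) = f j k := by
  rw [bilinOfBasis_apply, Finset.sum_eq_single j, Finset.sum_eq_single k]
  · simp
  · intro b _ hb; simp [hb]
  · simp
  · intro b _ hb; simp [hb]
  · simp

/-- The Lie bracket. -/
def lieBr (n m : ℕ) : (Fin n → ℝ) →ₗ[ℝ] (Fin n → ℝ) →ₗ[ℝ] (Fin n → ℝ) :=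
  bilinOfBasis fun j k => (structC n m (j + 1) (k + 1) : ℝ)
    • unitE n ((j + 1) + (k + 1) + m - (n + 2))

/-- The action of the Lie algebra on the magnetic parameters. -/
def lieRep (n m : ℕ) : (Fin n → ℝ) →ₗ[ℝ] (Fin (n + 2) → ℝ) →ₗ[ℝ] (Fin (n + 2) → ℝ) :=
  bilinOfBasis fun j γ => (shiftW n m (j + 1) γ : ℝ) • unitV n (γ + m + (j + 1) - (n + 2))

theorem lieBr_unit {j k : ℕ} (hj : 1 ≤ j) (hj' : j ≤ n) (hk : 1 ≤ k) (hk' : k ≤ n) :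
    lieBr n m (unitE n j) (unitE n k)
      = (structC n m j k : ℝ) • unitE n (j + k + m - (n + 2)) := by
  obtain ⟨j, rfl⟩ : ∃ j', j = j' + 1 := ⟨j - 1, by omega⟩
  obtain ⟨k, rfl⟩ : ∃ k', k = k' + 1 := ⟨k - 1, by omega⟩
  have := bilinOfBasis_single (fun j k : Fin n => (structC n m (j + 1) (k + 1) : ℝ)
    • unitE n ((j + 1) + (k + 1) + m - (n + 2))) ⟨j, hj'⟩ ⟨k, hk'⟩
  rw [← unitE_succ, ← unitE_succ] at this
  exact this

/-- Indices outside the range are admitted because brackets produce them; both the unit vector and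
the weight are zero there. -/
theorem lieRep_unit {l a : ℕ} (hl : l ≤ n ∨ ¬ lowIdx n m l) (hm : m ≤ n + 1) (ha : a ≤ n + 1) :
    lieRep n m (unitE n l) (unitV n a)
      = (shiftW n m l a : ℝ) • unitV n (a + m + l - (n + 2)) := by
  by_cases h : 1 ≤ l ∧ l ≤ n
  · obtain ⟨l, rfl⟩ : ∃ l', l = l' + 1 := ⟨l - 1, by omega⟩
    have := bilinOfBasis_single (fun (j : Fin n) (γ : Fin (n + 2)) => (shiftW n m (j + 1) γ : ℝ)
      • unitV n (γ + m + (j + 1) - (n + 2))) ⟨l, h.2⟩ ⟨a, by omega⟩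
    rw [← unitE_succ, ← unitV_coe] at this
    exact this
  · have h0 : unitE n l = 0 := by
      rcases Nat.eq_zero_or_pos l with rfl | h1
      · exact unitE_zero
      · exact unitE_big (by omega)
    have h1 : shiftW n m l a = 0 := by
      unfold shiftW
      by_cases hl' : lowIdx n m l
      · rw [if_pos hl']; unfold lowIdx at hl hl'; omega
      · rw [if_neg hl']; unfold lowIdx at hl'; omega
    rw [h0, h1]; simp

/-- A nonzero weight guarantees that the new exponent is a genuine difference and stays between `0`
and `n + 1`, so `n + 2` parameters suffice. -/
theorem shiftW_le {s a : ℕ} (hs : s ≤ n) (ha : a ≤ n + 1) (hm : m ≤ n + 1)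
    (h : shiftW n m s a ≠ 0) :
    n + 2 ≤ a + m + s ∧ a + m + s - (n + 2) ≤ n + 1 := by
  unfold shiftW at h
  split_ifs at h with hl <;> unfold lowIdx at hl <;> omega

theorem lieRep_comp_unit {j k a : ℕ} (hj : j ≤ n) (hk : k ≤ n) (hm : m ≤ n + 1) (ha : a ≤ n + 1) :
    lieRep n m (unitE n j) (lieRep n m (unitE n k) (unitV n a))
      = ((shiftW n m k a * shiftW n m j (a + m + k - (n + 2)) : ℕ) : ℝ)
        • unitV n (a + m + k - (n + 2) + m + j - (n + 2)) := by
  rw [lieRep_unit (Or.inl hk) hm ha, map_smul]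
  by_cases h : shiftW n m k a = 0
  · rw [h]; simp
  · rw [lieRep_unit (Or.inl hj) hm (shiftW_le hk ha hm h).2, smul_smul]; push_cast; rfl

/-- Apart from truncation, an element of either kind multiplies `X^a` by a weight affine in `a` and
shifts the exponent, as in the Witt algebra. The cases check that truncation does not spoil the
commutators and that elements of different kinds commute. -/
theorem lieRep_bracket (hm : m ≤ n + 1) (x y : Fin n → ℝ) (v : Fin (n + 2) → ℝ) :
    lieRep n m (lieBr n m x y) v
      = lieRep n m x (lieRep n m y v) - lieRep n m y (lieRep n m x v) := by
  have key : ∀ j k a, 1 ≤ j → j ≤ n → 1 ≤ k → k ≤ n → a ≤ n + 1 →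
      lieRep n m (lieBr n m (unitE n j) (unitE n k)) (unitV n a)
        = lieRep n m (unitE n j) (lieRep n m (unitE n k) (unitV n a))
          - lieRep n m (unitE n k) (lieRep n m (unitE n j) (unitV n a)) := by
    intro j k a hj hj' hk hk' ha
    rw [lieBr_unit hj hj' hk hk', map_smul, LinearMap.smul_apply, lieRep_comp_unit hj' hk' hm ha,
      lieRep_comp_unit hk' hj' hm ha]
    -- Either every term vanishes, or both second weights equal the weight of the bracket and the
    -- first weights differ by the structure constant.
    have fin : ∀ (z : ℤ) (l w p q p' q' : ℕ),
        (p * p' = 0 ∧ q * q' = 0 ∧ z * w = 0) ∨ (p' = w ∧ q' = w ∧ z = p - q ∧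
          a + m + k - (n + 2) + m + j - (n + 2) = l ∧
          a + m + j - (n + 2) + m + k - (n + 2) = l) →
        (z : ℝ) • (w : ℝ) • unitV n l = ((p * p' : ℕ) : ℝ)
          • unitV n (a + m + k - (n + 2) + m + j - (n + 2)) - ((q * q' : ℕ) : ℝ)
          • unitV n (a + m + j - (n + 2) + m + k - (n + 2)) := by
      rintro z l w p q p' q' (⟨h1, h2, h3⟩ | ⟨rfl, rfl, rfl, h4, h5⟩)
      · have h3' : (z : ℝ) * (w : ℝ) = 0 := by exact_mod_cast h3
        rw [h1, h2, smul_smul, h3']; simp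
      · rw [h4, h5, smul_smul, ← sub_smul]
        congr 1; push_cast; ring
    by_cases hlj : lowIdx n m j <;> by_cases hlk : lowIdx n m k
    · have hl : lowIdx n m (j + k + m - (n + 2)) := by unfold lowIdx at *; omega
      rw [lieRep_unit (Or.inl (by unfold lowIdx at *; omega)) hm ha]
      simp only [structC, shiftW, if_pos hlj, if_pos hlk, if_pos hl]
      unfold lowIdx at *
      apply fin
      by_cases h : n + 2 ≤ a + (j + k + m - (n + 2)) ∧ n + 2 ≤ j + k + m
      · right
        refine ⟨?_, ?_, ?_, ?_, ?_⟩ <;> omega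
      · left
        refine ⟨Nat.mul_eq_zero.2 ?_, Nat.mul_eq_zero.2 ?_, mul_eq_zero.2 (Or.inr ?_)⟩ <;> omega
    · simp only [structC, shiftW, if_pos hlj, if_neg hlk]
      have := fin 0 0 0 (n + 1 - (k + a)) (a + j - (n + 1)) (a + m + k - (n + 2) + j - (n + 1))
        (n + 1 - (k + (a + m + j - (n + 2)))) (Or.inl ⟨Nat.mul_eq_zero.2 ?_, Nat.mul_eq_zero.2 ?_,
          mul_zero _⟩)
      · rw [← this]; simp
      · unfold lowIdx at *; omega
      · unfold lowIdx at *; omega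
    · simp only [structC, shiftW, if_neg hlj, if_pos hlk]
      have := fin 0 0 0 (a + k - (n + 1)) (n + 1 - (j + a)) (n + 1 - (j + (a + m + k - (n + 2))))
        (a + m + j - (n + 2) + k - (n + 1)) (Or.inl ⟨Nat.mul_eq_zero.2 ?_, Nat.mul_eq_zero.2 ?_,
          mul_zero _⟩)
      · rw [← this]; simp
      · unfold lowIdx at *; omega
      · unfold lowIdx at *; omega
    · have hl : ¬ lowIdx n m (j + k + m - (n + 2)) := by unfold lowIdx at *; omega
      rw [lieRep_unit (Or.inr hl) hm ha]
      simp only [structC, shiftW, if_neg hlj, if_neg hlk, if_neg hl]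
      unfold lowIdx at *
      apply fin
      by_cases h : (j + k + m - (n + 2)) + a ≤ n
      · right
        refine ⟨?_, ?_, ?_, ?_, ?_⟩ <;> omega
      · left
        refine ⟨Nat.mul_eq_zero.2 ?_, Nat.mul_eq_zero.2 ?_, mul_eq_zero.2 (Or.inr ?_)⟩ <;> omega
  have h1 : ∀ j k, 1 ≤ j → j ≤ n → 1 ≤ k → k ≤ n →
      lieRep n m (lieBr n m (unitE n j) (unitE n k))
        = (lieRep n m (unitE n j)).comp (lieRep n m (unitE n k))
          - (lieRep n m (unitE n k)).comp (lieRep n m (unitE n j)) :=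
    fun j k hj hj' hk hk' => ext_unitV fun a ha => key j k a hj hj' hk hk' ha
  let ρ : (Fin n → ℝ) →ₗ[ℝ] Module.End ℝ (Fin (n + 2) → ℝ) := lieRep n m
  have h2 : ∀ j, 1 ≤ j → j ≤ n → ρ.comp (lieBr n m (unitE n j))
      = (LinearMap.mulLeft ℝ (ρ (unitE n j)) - LinearMap.mulRight ℝ (ρ (unitE n j))).comp ρ :=
    fun j hj hj' => ext_unitE fun k hk hk' => h1 j k hj hj' hk hk'
  have h3 : ρ.comp ((lieBr n m).flip y)
      = (LinearMap.mulRight ℝ (ρ y) - LinearMap.mulLeft ℝ (ρ y)).comp ρ :=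
    ext_unitE fun j hj hj' => LinearMap.congr_fun (h2 j hj hj') y
  exact LinearMap.congr_fun (LinearMap.congr_fun h3 x) v

/-- Distinct elements send the extreme parameter vectors to multiples of distinct unit vectors.
Components of the first kind are read off at exponent `n + 1`, those of the second kind at exponent
`0`, where their weights are nonzero. -/
theorem lieRep_injective (hm : m ≤ n + 1) : Function.Injective (lieRep n m) := by
  refine (injective_iff_map_eq_zero _).2 fun x hx => ?_
  ext i
  have hi := i.2
  have hsum : ∀ a b : Fin (n + 2), lieRep n m x (unitV n a) b
      = ∑ j : Fin n, x j * (shiftW n m (j + 1) a * unitV n (a + m + (j + 1) - (n + 2)) b) := by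
    intro a b
    rw [lieRep, bilinOfBasis_apply, Finset.sum_apply]
    refine Finset.sum_congr rfl fun j _ => ?_
    rw [unitV_coe, Finset.sum_apply, Finset.sum_eq_single a]
    · simp
    · intro c _ hc; simp [hc]
    · simp
  have hzero : ∀ a b, lieRep n m x (unitV n a) b = 0 := by intro a b; rw [hx]; rfl
  by_cases hl : lowIdx n m (i + 1)
  · have h := hzero (n + 1) ⟨m + i, by unfold lowIdx at hl; omega⟩
    have h' := hsum ⟨n + 1, by omega⟩ ⟨m + i, by unfold lowIdx at hl; omega⟩
    rw [h, Finset.sum_eq_single i] at h'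
    · simp only [shiftW, if_pos hl, unitV] at h'
      rw [if_pos (by omega)] at h'
      have : ((n + 1 + (i + 1) - (n + 1) : ℕ) : ℝ) ≠ 0 := by
        exact_mod_cast (by omega : n + 1 + ((i : ℕ) + 1) - (n + 1) ≠ 0)
      rw [mul_one] at h'
      exact (mul_eq_zero.1 h'.symm).resolve_right this
    · intro j _ hj
      have hj' : (j : ℕ) ≠ i := fun h => hj (Fin.ext h)
      rw [unitV, if_neg (by unfold lowIdx at hl; simp only; omega)]; simp
    · simp
  · have h := hzero 0 ⟨m + (i + 1) - (n + 2), by omega⟩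
    have h' := hsum ⟨0, by omega⟩ ⟨m + (i + 1) - (n + 2), by omega⟩
    rw [h, Finset.sum_eq_single i] at h'
    · simp only [shiftW, if_neg hl, unitV] at h'
      rw [if_pos (by omega)] at h'
      have : ((n + 1 - (i + 1 + 0) : ℕ) : ℝ) ≠ 0 := by
        exact_mod_cast (by omega : n + 1 - ((i : ℕ) + 1 + 0) ≠ 0)
      rw [mul_one] at h'
      exact (mul_eq_zero.1 h'.symm).resolve_right this
    · intro j _ hj
      have hj' : (j : ℕ) ≠ i := fun h => hj (Fin.ext h)
      by_cases hw : shiftW n m (j + 1) 0 = 0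
      · simp only [hw]; simp
      · have := shiftW_le (by omega) (by omega) hm hw
        rw [unitV, if_neg (by unfold lowIdx at hl; simp only; omega)]; simp
    · simp

end LieAlgebra

/-! ### Brackets of arbitrary combinations of the Hamiltonians -/

section Classical

variable {n m : ℕ}

/-- The combinations of the Hamiltonians. -/
def phaseComb (n m : ℕ) (v : Fin (n + 2) → ℝ) : (Fin n → ℝ) →ₗ[ℝ] PhasePoly n :=
  Fintype.linearCombination ℝ fun j : Fin n => phaseH n m v (j + 1)

/-- The combinations of the magnetic Hamiltonians. -/
def phaseMag (n : ℕ) : (Fin n → ℝ) →ₗ[ℝ] (Fin (n + 2) → ℝ) →ₗ[ℝ] PhasePoly n :=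
  bilinOfBasis fun j γ => phaseM n (j + 1) γ

theorem phaseComb_unit (v : Fin (n + 2) → ℝ) (hn : 0 < n) (hm : m ≤ n + 1) {l : ℕ}
    (hl : l ≤ n ∨ n + 2 ≤ m + l) : phaseComb n m v (unitE n l) = phaseH n m v l := by
  by_cases h : 1 ≤ l ∧ l ≤ n
  · obtain ⟨l, rfl⟩ : ∃ l', l = l' + 1 := ⟨l - 1, by omega⟩
    have := unitE_succ (⟨l, h.2⟩ : Fin n)
    rw [show unitE n (l + 1) = _ from this, phaseComb, Fintype.linearCombination_apply_single,
      one_smul]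
  · rcases Nat.eq_zero_or_pos l with rfl | h1
    · rw [unitE_zero, map_zero, phaseH_zero _ hm]
    · rw [unitE_big (by omega), map_zero, phaseH_big _ hn (by omega) (by omega)]

theorem phaseMag_unit {l a : ℕ} (hl : 1 ≤ l) (hl' : l ≤ n) (ha : a ≤ n + 1) :
    phaseMag n (unitE n l) (unitV n a) = phaseM n l a := by
  obtain ⟨l, rfl⟩ : ∃ l', l = l' + 1 := ⟨l - 1, by omega⟩
  have := bilinOfBasis_single (fun (j : Fin n) (γ : Fin (n + 2)) => phaseM n (j + 1) γ)
    ⟨l, hl'⟩ ⟨a, by omega⟩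
  rw [← unitE_succ, ← unitV_coe] at this
  exact this

theorem phaseMag_lieRep_unit (hm : m ≤ n + 1) {r s : ℕ} (hr' : r ≤ n)
    (hs : 1 ≤ s) (hs' : s ≤ n) (v : Fin (n + 2) → ℝ) :
    phaseMag n (unitE n s) (lieRep n m (unitE n r) v)
      = ∑ γ : Fin (n + 2), v γ • ((shiftW n m r γ : ℝ) • phaseM n s (γ + m + r - (n + 2))) := by
  have : (phaseMag n (unitE n s)).comp (lieRep n m (unitE n r))
      = Fintype.linearCombination ℝ fun γ : Fin (n + 2) =>
        (shiftW n m r γ : ℝ) • phaseM n s (γ + m + r - (n + 2)) := by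
    refine ext_unitV fun a ha => ?_
    have e := unitV_coe (⟨a, by omega⟩ : Fin (n + 2))
    rw [LinearMap.comp_apply, lieRep_unit (Or.inl hr') hm ha, map_smul]
    rw [show unitV n a = _ from e, Fintype.linearCombination_apply_single, one_smul]
    by_cases h : shiftW n m r a = 0
    · simp [h]
    · rw [phaseMag_unit hs hs' (shiftW_le hr' ha hm h).2]
  exact LinearMap.congr_fun this v

/-- The brackets of the Hamiltonians in terms of the Lie algebra. -/
theorem ham_phaseComb (hn : 0 < n) (hm : m ≤ n + 1) (v : Fin (n + 2) → ℝ) (y z : Fin n → ℝ) :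
    ham dqS dpS (phaseComb n m v z) (phaseComb n m v y)
      = phaseComb n m v (lieBr n m y z) + phaseMag n z (lieRep n m y v)
        - phaseMag n y (lieRep n m z v) := by
  have hsum : ∀ y, phaseComb n m v y
      = ∑ j : Fin n, MvPolynomial.C (y j) * phaseH n m v (j + 1) := by
    intro y
    rw [phaseComb, Fintype.linearCombination_apply]
    exact Finset.sum_congr rfl fun j _ => MvPolynomial.smul_eq_C_mul _ _
  have hbase : ∀ j k : Fin n, ham dqS dpS (phaseH n m v (k + 1)) (phaseH n m v (j + 1))
      = phaseComb n m v (lieBr n m (unitE n (j + 1)) (unitE n (k + 1)))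
        + phaseMag n (unitE n (k + 1)) (lieRep n m (unitE n (j + 1)) v)
        - phaseMag n (unitE n (j + 1)) (lieRep n m (unitE n (k + 1)) v) := by
    intro j k
    have hj := j.2
    have hk := k.2
    rw [ham_phaseH hn hm, lieBr_unit (by omega) (by omega) (by omega) (by omega), map_smul,
      phaseMag_lieRep_unit hm (by omega) (by omega) (by omega),
      phaseMag_lieRep_unit hm (by omega) (by omega) (by omega), add_sub_assoc,
      ← Finset.sum_sub_distrib]
    congr 1
    · by_cases h0 : structC n m (j + 1) (k + 1) = 0
      · rw [h0]; simp
      · rw [phaseComb_unit v hn hm, MvPolynomial.smul_eq_C_mul]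
        · simp
        · unfold structC lowIdx at h0
          split_ifs at h0 <;> omega
    · refine Finset.sum_congr rfl fun γ _ => ?_
      simp only [MvPolynomial.smul_eq_C_mul, map_natCast]
      ring
  have hy : ∀ y : Fin n → ℝ, y = ∑ j : Fin n, y j • unitE n (j + 1) := by
    intro y
    simp only [unitE_succ]
    exact pi_eq_sum_univ' y
  rw [hsum, hsum, ham_sum_phaseH]
  conv_rhs => rw [hy y, hy z]
  simp only [map_sum, map_smul, LinearMap.sum_apply, LinearMap.smul_apply, Finset.smul_sum]
  have comm : ∀ f : Fin n → Fin n → PhasePoly n, ∑ k, ∑ j, z k • y j • f k j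
      = ∑ j, ∑ k, z k • y j • f k j := fun f => Finset.sum_comm
  rw [comm, comm]
  simp only [← Finset.sum_add_distrib, ← Finset.sum_sub_distrib]
  refine Finset.sum_congr rfl fun j _ => Finset.sum_congr rfl fun k _ => ?_
  rw [hbase]
  simp only [MvPolynomial.smul_eq_C_mul, MvPolynomial.C_mul]
  ring

end Classical

/-! ### Zero curvature, the Frobenius condition and the order of the flows -/

section Existence

variable {n m : ℕ}

theorem phaseComb_eq_add (v : Fin (n + 2) → ℝ) (y : Fin n → ℝ) :
    phaseComb n m v y = phaseComb n m 0 y + phaseMag n y v := by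
  rw [phaseComb, phaseComb, Fintype.linearCombination_apply, Fintype.linearCombination_apply,
    phaseMag, bilinOfBasis_apply, ← Finset.sum_add_distrib]
  refine Finset.sum_congr rfl fun j _ => ?_
  rw [phaseH, phaseH, polyH, polyH]
  simp only [MvPolynomial.smul_eq_C_mul, Pi.zero_apply, MvPolynomial.C_0, zero_mul,
    Finset.sum_const_zero, add_zero, mul_add, Finset.mul_sum, phaseM, MvPolynomial.C_mul]
  congr 1
  exact Finset.sum_congr rfl fun γ _ => by ring

theorem pderiv_eval_phaseComb {Z : (Fin n → ℝ) → Fin n → ℝ} {D : (Fin n → ℝ) → Fin (n + 2) → ℝ}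
    (hZ : ContDiff ℝ ∞ Z) (hD : ContDiff ℝ ∞ D) (x : Fin n ⊕ Fin n → ℝ) (s : Fin n)
    (t : Fin n → ℝ) :
    pderiv s (fun τ => MvPolynomial.eval x (phaseComb n m (D τ) (Z τ))) t
      = MvPolynomial.eval x (phaseComb n m (D t) (pderiv s Z t))
        + MvPolynomial.eval x (phaseMag n (Z t) (pderiv s D t)) := by
  let ev : PhasePoly n →ₗ[ℝ] ℝ := (MvPolynomial.aeval x).toLinearMap
  have hev : ∀ F, ev F = MvPolynomial.eval x F := fun F =>
    RingHom.congr_fun (MvPolynomial.coe_aeval_eq_eval x) F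
  let B₀ : (Fin n → ℝ) →L[ℝ] ℝ := (ev.comp (phaseComb n m 0)).toContinuousLinearMap
  let B₁ : (Fin n → ℝ) →L[ℝ] (Fin (n + 2) → ℝ) →L[ℝ] ℝ :=
    ((phaseMag n).compr₂ ev).toContinuousBilinearMap
  have h0 : ∀ y, B₀ y = MvPolynomial.eval x (phaseComb n m 0 y) := fun y => hev _
  have h1 : ∀ y v, B₁ y v = MvPolynomial.eval x (phaseMag n y v) := fun y v => hev _
  have dZ : HasFDerivAt Z (fderiv ℝ Z t) t := (hZ.differentiable (by simp) t).hasFDerivAt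
  have dD : HasFDerivAt D (fderiv ℝ D t) t := (hD.differentiable (by simp) t).hasFDerivAt
  have d1 : HasFDerivAt (fun τ => B₀ (Z τ) + B₁ (Z τ) (D τ)) _ t :=
    (B₀.hasFDerivAt.comp t dZ).add ((B₁.hasFDerivAt.comp t dZ).clm_apply dD)
  have e : (fun τ => MvPolynomial.eval x (phaseComb n m (D τ) (Z τ)))
      = fun τ => B₀ (Z τ) + B₁ (Z τ) (D τ) := by
    funext τ; rw [phaseComb_eq_add, map_add, h0, h1]
  rw [e, pderiv, d1.fderiv, phaseComb_eq_add, map_add, ← h0, ← h1, ← h1]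
  simp [pderiv]
  ring

/-- Solutions of the zero curvature equations yield the classical Frobenius condition. -/
theorem classicalFrobenius_of_flat (hn : 0 < n) (hm : m ≤ n + 1) (U : Set (Fin n → ℝ))
    {ζ : Fin n → Fin n → (Fin n → ℝ) → ℝ} {d : Fin (n + 2) → (Fin n → ℝ) → ℝ}
    {Z : Fin n → (Fin n → ℝ) → Fin n → ℝ} {D : (Fin n → ℝ) → Fin (n + 2) → ℝ}
    (hZ : ∀ r, ContDiff ℝ ∞ (Z r)) (hD : ContDiff ℝ ∞ D)
    (hmix : ∀ r j t, mix m ζ r j t = Z r t j) (hd : ∀ γ t, d γ t = D t γ)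
    (hDZ : ∀ r t, pderiv r D t = lieRep n m (Z r t) (D t))
    (hflat : ∀ r s t, pderiv s (Z r) t - pderiv r (Z s) t + lieBr n m (Z r t) (Z s t) = 0) :
    ClassicalFrobenius m U ζ d := by
  intro r s
  refine ⟨0, fun t _ q _ p => ?_⟩
  have hH : ∀ r t q p, HB m ζ d r t q p
      = MvPolynomial.eval (Sum.elim q p) (phaseComb n m (D t) (Z r t)) := by
    intro r t q p
    rw [HB_eq_eval, phaseComb, Fintype.linearCombination_apply]
    congr 1
    refine Finset.sum_congr rfl fun j _ => ?_
    rw [hmix, MvPolynomial.smul_eq_C_mul]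
    simp only [hd]
  have hP : poisson (HB m ζ d r t) (HB m ζ d s t) q p
      = MvPolynomial.eval (Sum.elim q p)
        (ham dqS dpS (phaseComb n m (D t) (Z s t)) (phaseComb n m (D t) (Z r t))) := by
    rw [← poisson_eval]
    congr 1 <;> funext q p <;> rw [hH]
  simp only [hP, hH]
  rw [pderiv_eval_phaseComb (hZ r) hD, pderiv_eval_phaseComb (hZ s) hD, ham_phaseComb hn hm,
    hDZ, hDZ]
  have := congrArg (fun y => MvPolynomial.eval (Sum.elim q p) (phaseComb n m (D t) y))
    (hflat r s t)
  simp only [map_add, map_sub, map_zero] at this ⊢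
  simp only [Pi.zero_apply]
  -- The time derivatives of the parameters cancel the two magnetic terms of the bracket. What
  -- remains is the zero curvature equation.
  linear_combination this

/-- The order in which the flows are composed. -/
def flowBefore (n m : ℕ) (k r : Fin n) : Prop :=
  (lowIdx n m (k + 1) ∧ lowIdx n m (r + 1) ∧ k < r) ∨
  (lowIdx n m (k + 1) ∧ ¬ lowIdx n m (r + 1)) ∨
  (¬ lowIdx n m (k + 1) ∧ ¬ lowIdx n m (r + 1) ∧ r < k)

/-- The frame vector of `r` is acted on only by the flows listed before `r`. Indices of the first
kind in increasing order, followed by those of the second kind in decreasing order, therefore make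
`ζ_{r,j}` depend on `t_1, …, t_{r-1}` or on `t_{r+1}, …, t_n`; the flows of the first kind do not
affect the second. -/
theorem exists_flow_list (n m : ℕ) :
    ∃ σ : List (Fin n), σ.Nodup ∧ (∀ r, r ∈ σ) ∧ σ.Pairwise (flowBefore n m) := by
  have hlt : (List.finRange n).Pairwise (· < ·) := List.pairwise_lt_finRange n
  have hmem : ∀ r, r ∈ (List.finRange n).filter (fun r : Fin n => decide (lowIdx n m (r + 1)))
      ++ ((List.finRange n).filter (fun r : Fin n => decide (¬ lowIdx n m (r + 1)))).reverse := by
    intro r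
    simp only [List.mem_append, List.mem_filter, List.mem_finRange, List.mem_reverse, true_and,
      decide_eq_true_eq]
    exact em _
  have hpw : ((List.finRange n).filter (fun r : Fin n => decide (lowIdx n m (r + 1)))
      ++ ((List.finRange n).filter (fun r : Fin n => decide (¬ lowIdx n m (r + 1)))).reverse).Pairwise
        (flowBefore n m) := by
    rw [List.pairwise_append]
    refine ⟨?_, ?_, ?_⟩
    · refine (List.pairwise_filter.2 (hlt.imp ?_))
      intro a b h ha hb
      rw [decide_eq_true_eq] at ha hb
      exact Or.inl ⟨ha, hb, h⟩
    · rw [List.pairwise_reverse]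
      refine (List.pairwise_filter.2 (hlt.imp ?_))
      intro a b h ha hb
      rw [decide_eq_true_eq] at ha hb
      exact Or.inr (Or.inr ⟨hb, ha, h⟩)
    · intro a ha b hb
      rw [List.mem_filter, decide_eq_true_eq] at ha
      rw [List.mem_reverse, List.mem_filter, decide_eq_true_eq] at hb
      exact Or.inr (Or.inl ⟨ha.2, hb.2⟩)
  refine ⟨_, ?_, hmem, hpw⟩
  refine hpw.imp ?_
  rintro a b h rfl
  rcases h with ⟨_, _, h⟩ | ⟨h, h'⟩ | ⟨_, _, h⟩
  exacts [lt_irrefl _ h, h' h, lt_irrefl _ h]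

/-- The vectors supported on a set of indices. -/
def supportedOn (S : Fin n → Prop) : Submodule ℝ (Fin n → ℝ) where
  carrier := {v | ∀ j, ¬ S j → v j = 0}
  add_mem' ha hb j hj := by rw [Pi.add_apply, ha j hj, hb j hj, add_zero]
  zero_mem' _ _ := rfl
  smul_mem' a v hv j hj := by rw [Pi.smul_apply, hv j hj, smul_zero]

theorem supportedOn_mono {S T : Fin n → Prop} (h : ∀ j, S j → T j) :
    supportedOn S ≤ supportedOn T := fun _ hv j hj => hv j fun h' => hj (h j h')

theorem lieBr_mem {S : Fin n → Prop} {W : Submodule ℝ (Fin n → ℝ)} {k : Fin n}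
    (h : ∀ j, S j → structC n m (k + 1) (j + 1) ≠ 0 →
      unitE n ((k + 1) + (j + 1) + m - (n + 2)) ∈ W) {v : Fin n → ℝ} (hv : v ∈ supportedOn S) :
    lieBr n m (unitE n (k + 1)) v ∈ W := by
  have hy : v = ∑ j : Fin n, v j • unitE n (j + 1) := by
    simp only [unitE_succ]; exact pi_eq_sum_univ' v
  rw [hy, map_sum]
  refine W.sum_mem fun j _ => ?_
  by_cases hj : S j
  · rw [map_smul, lieBr_unit (by omega) (by omega) (by omega) (by omega)]
    by_cases h0 : structC n m (k + 1) (j + 1) = 0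
    · rw [h0]; simp
    · exact W.smul_mem _ (W.smul_mem _ (h j hj h0))
  · rw [hv j hj, zero_smul, map_zero]; exact W.zero_mem

theorem unitE_mem_supportedOn {S : Fin n → Prop} {l : ℕ}
    (h : ∀ j : Fin n, (j : ℕ) + 1 = l → S j) : unitE n l ∈ supportedOn S := by
  intro j hj
  rw [unitE, if_neg fun h' => hj (h j h')]

end Existence

/-! ### Triangularity of the frame and the solution of the classical problem -/

section Solution

variable {n m : ℕ}

/-- The coefficient vectors of the Hamiltonians for a given order of the flows. -/
def mixFrame (m : ℕ) (σ : List (Fin n)) (r : Fin n) : (Fin n → ℝ) → Fin n → ℝ :=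
  adjFrame (lieBr n m).toContinuousBilinearMap (fun k : Fin n => unitE n (k + 1)) σ r

variable {σ : List (Fin n)}

/-- The bracket with index `k + 1` shifts indices by `k + 1 + m - (n + 2)`, which is negative for
the first kind. -/
theorem lieBr_low {k r : Fin n} (hk : lowIdx n m (k + 1)) (hkr : k < r) {v : Fin n → ℝ}
    (hv : v ∈ supportedOn fun j : Fin n => j ≤ r ∧ lowIdx n m (j + 1)) :
    lieBr n m (unitE n (k + 1)) v ∈ supportedOn fun j : Fin n => j < r ∧ lowIdx n m (j + 1) := by
  refine lieBr_mem (fun j hj h0 => unitE_mem_supportedOn fun i hi => ?_) hv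
  have h1 := Fin.le_def.1 hj.1
  have h2 := Fin.lt_def.1 hkr
  rw [Fin.lt_def]
  unfold structC at h0
  rw [if_pos hk, if_pos hj.2] at h0
  have h3 := hj.2
  unfold lowIdx at *
  omega

/-- For the second kind the shift is nonnegative, and `r < k` with `r` also of the second kind makes
it positive. -/
theorem lieBr_high {k r : Fin n} (hk : ¬ lowIdx n m (k + 1)) (hkr : r < k) {v : Fin n → ℝ}
    (hv : v ∈ supportedOn fun j : Fin n => r ≤ j ∧ ¬ lowIdx n m (j + 1)) :
    lieBr n m (unitE n (k + 1)) v ∈ supportedOn fun j : Fin n => r < j ∧ ¬ lowIdx n m (j + 1) := by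
  refine lieBr_mem (fun j hj h0 => unitE_mem_supportedOn fun i hi => ?_) hv
  have h1 := Fin.le_def.1 hj.1
  have h2 := Fin.lt_def.1 hkr
  rw [Fin.lt_def]
  have h3 := hj.2
  unfold lowIdx at *
  omega

theorem lieBr_low_high {k r : Fin n} (hk : lowIdx n m (k + 1)) {v : Fin n → ℝ}
    (hv : v ∈ supportedOn fun j : Fin n => r ≤ j ∧ ¬ lowIdx n m (j + 1)) :
    lieBr n m (unitE n (k + 1)) v = 0 := by
  refine (Submodule.mem_bot ℝ).1 (lieBr_mem (fun j hj h0 => ?_) hv)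
  refine absurd ?_ h0
  rw [structC, if_pos hk, if_neg hj.2]

theorem mixFrame_low (hσ : σ.Pairwise (flowBefore n m)) {r : Fin n} (hr : r ∈ σ)
    (hl : lowIdx n m (r + 1)) (t : Fin n → ℝ) :
    mixFrame m σ r t - unitE n (r + 1)
      ∈ supportedOn fun j : Fin n => j < r ∧ lowIdx n m (j + 1) := by
  refine adjFrame_sub_mem (P := supportedOn fun j : Fin n => j ≤ r ∧ lowIdx n m (j + 1))
    (supportedOn_mono fun j hj => ⟨hj.1.le, hj.2⟩) hσ hr
    (unitE_mem_supportedOn fun j hj => ?_) (fun k hk v hv => ?_) t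
  · obtain rfl : j = r := Fin.ext (by omega)
    exact ⟨le_rfl, hl⟩
  · rcases hk with ⟨h1, _, h2⟩ | ⟨_, h⟩ | ⟨_, h, _⟩
    · exact lieBr_low h1 h2 hv
    · exact absurd hl h
    · exact absurd hl h

theorem mixFrame_high (hσ : σ.Pairwise (flowBefore n m)) {r : Fin n} (hr : r ∈ σ)
    (hl : ¬ lowIdx n m (r + 1)) (t : Fin n → ℝ) :
    mixFrame m σ r t - unitE n (r + 1)
      ∈ supportedOn fun j : Fin n => r < j ∧ ¬ lowIdx n m (j + 1) := by
  refine adjFrame_sub_mem (P := supportedOn fun j : Fin n => r ≤ j ∧ ¬ lowIdx n m (j + 1))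
    (supportedOn_mono fun j hj => ⟨hj.1.le, hj.2⟩) hσ hr
    (unitE_mem_supportedOn fun j hj => ?_) (fun k hk v hv => ?_) t
  · obtain rfl : j = r := Fin.ext (by omega)
    exact ⟨le_rfl, hl⟩
  · rcases hk with ⟨_, h, _⟩ | ⟨h1, _⟩ | ⟨h1, _, h2⟩
    · exact absurd h hl
    · have := lieBr_low_high h1 hv
      change lieBr n m (unitE n (k + 1)) v ∈ _
      rw [this]; exact Submodule.zero_mem _
    · exact lieBr_high h1 h2 hv

theorem mixFrame_congr_low (hσ : σ.Pairwise (flowBefore n m)) {r : Fin n} (hr : r ∈ σ)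
    (hl : lowIdx n m (r + 1)) {t t' : Fin n → ℝ} (ht : ∀ k < r, t k = t' k) :
    mixFrame m σ r t = mixFrame m σ r t' := by
  refine adjFrame_congr (P := supportedOn fun j : Fin n => j ≤ r ∧ lowIdx n m (j + 1)) hσ hr
    (unitE_mem_supportedOn fun j hj => ?_) (fun k hk v hv => ?_) (fun k hk => ?_)
  · obtain rfl : j = r := Fin.ext (by omega)
    exact ⟨le_rfl, hl⟩
  · rcases hk with ⟨h1, _, h2⟩ | ⟨_, h⟩ | ⟨_, h, _⟩
    · exact supportedOn_mono (fun j hj => ⟨hj.1.le, hj.2⟩) (lieBr_low h1 h2 hv)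
    · exact absurd hl h
    · exact absurd hl h
  · rcases hk with ⟨_, _, h⟩ | ⟨_, h⟩ | ⟨_, h, _⟩
    · exact Or.inl (ht k h)
    · exact absurd hl h
    · exact absurd hl h

theorem mixFrame_congr_high (hσ : σ.Pairwise (flowBefore n m)) {r : Fin n} (hr : r ∈ σ)
    (hl : ¬ lowIdx n m (r + 1)) {t t' : Fin n → ℝ} (ht : ∀ k, r < k → t k = t' k) :
    mixFrame m σ r t = mixFrame m σ r t' := by
  refine adjFrame_congr (P := supportedOn fun j : Fin n => r ≤ j ∧ ¬ lowIdx n m (j + 1)) hσ hr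
    (unitE_mem_supportedOn fun j hj => ?_) (fun k hk v hv => ?_) (fun k hk => ?_)
  · obtain rfl : j = r := Fin.ext (by omega)
    exact ⟨le_rfl, hl⟩
  · rcases hk with ⟨_, h, _⟩ | ⟨h1, _⟩ | ⟨h1, _, h2⟩
    · exact absurd h hl
    · have := lieBr_low_high h1 hv
      change lieBr n m (unitE n (k + 1)) v ∈ _
      rw [this]; exact Submodule.zero_mem _
    · exact supportedOn_mono (fun j hj => ⟨hj.1.le, hj.2⟩) (lieBr_high h1 h2 hv)
  · rcases hk with ⟨_, h, _⟩ | ⟨h1, _⟩ | ⟨_, _, h⟩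
    · exact absurd h hl
    · exact Or.inr fun v hv => lieBr_low_high h1 hv
    · exact Or.inl (ht k h)

/-- The Hamiltonians with extreme indices need not be modified. -/
theorem mixFrame_extreme (hm : m ≤ n + 1) (hσ : σ.Pairwise (flowBefore n m)) {r : Fin n}
    (hr : r ∈ σ) (h : (r : ℕ) + 1 ≤ kappa1 n m ∨ n - kappa2 m < (r : ℕ) + 1) (t : Fin n → ℝ) :
    mixFrame m σ r t = unitE n (r + 1) := by
  have hr' := r.2
  refine sub_eq_zero.1 ((Submodule.mem_bot ℝ).1 (adjFrame_sub_mem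
    (P := ℝ ∙ unitE n (r + 1)) (W := ⊥) bot_le hσ hr (Submodule.mem_span_singleton_self _)
    (fun k hk v hv => ?_) t))
  have hk' := k.2
  obtain ⟨a, rfl⟩ := Submodule.mem_span_singleton.1 hv
  have h0 : lieBr n m (unitE n (k + 1)) (unitE n (r + 1)) = 0 := by
    rw [lieBr_unit (by omega) (by omega) (by omega) (by omega)]
    -- For `k < r` of the first kind, the bound by `κ₁` truncates the index of the bracket to zero.
    -- For `k > r` of the second kind, the bound by `κ₂` pushes it beyond `n`.
    unfold kappa1 kappa2 at h
    rcases hk with ⟨h1, h2, h3⟩ | ⟨h1, h2⟩ | ⟨h1, h2, h3⟩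
    · have h3' := Fin.lt_def.1 h3
      have : (k : ℕ) + 1 + (r + 1) + m - (n + 2) = 0 := by unfold lowIdx at h1 h2; omega
      rw [this, unitE_zero, smul_zero]
    · rw [structC, if_pos h1, if_neg h2]; simp
    · have h3' := Fin.lt_def.1 h3
      rw [unitE_big (by unfold lowIdx at h1 h2; omega), smul_zero]
  change lieBr n m (unitE n (k + 1)) (a • unitE n (r + 1)) ∈ _
  rw [map_smul, h0, smul_zero]
  exact Submodule.zero_mem _

theorem unitE_apply (r j : Fin n) : unitE n (r + 1) j = if j = r then 1 else 0 := by
  rw [unitE]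
  exact if_congr ⟨fun h => Fin.ext (by omega), fun h => by rw [h]⟩ rfl rfl

theorem mixFrame_apply_low (hσ : σ.Pairwise (flowBefore n m)) {r : Fin n} (hr : r ∈ σ)
    (hl : lowIdx n m (r + 1)) (t : Fin n → ℝ) {j : Fin n} (hj : r ≤ j) :
    mixFrame m σ r t j = if j = r then 1 else 0 := by
  have := mixFrame_low hσ hr hl t j fun h => absurd h.1 (not_lt.2 hj)
  rw [← unitE_apply]
  exact sub_eq_zero.1 this

theorem mixFrame_apply_high (hσ : σ.Pairwise (flowBefore n m)) {r : Fin n} (hr : r ∈ σ)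
    (hl : ¬ lowIdx n m (r + 1)) (t : Fin n → ℝ) {j : Fin n} (hj : j ≤ r) :
    mixFrame m σ r t j = if j = r then 1 else 0 := by
  have := mixFrame_high hσ hr hl t j fun h => absurd h.1 (not_lt.2 hj)
  rw [← unitE_apply]
  exact sub_eq_zero.1 this

theorem mix_mixFrame (hm : m ≤ n + 1) (hσ : σ.Pairwise (flowBefore n m)) {r : Fin n} (hr : r ∈ σ)
    (j : Fin n) (t : Fin n → ℝ) :
    mix m (fun r j t => mixFrame m σ r t j) r j t = mixFrame m σ r t j := by
  have hr' := r.2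
  rw [mix]
  split_ifs with h1 h2 h3 h4 h5
  · rw [mixFrame_extreme hm hσ hr h1, unitE_apply, if_pos h2]
  · rw [mixFrame_extreme hm hσ hr h1, unitE_apply, if_neg h2]
  · rfl
  · rw [mixFrame_apply_low hσ hr (Or.inr (by omega)) t (not_le.1 h4).le,
      if_neg (not_le.1 h4).ne']
  · rfl
  -- Since `κ₁ ≥ 1`, the first index never reaches this branch.
  · have hl : ¬ lowIdx n m (r + 1) := by
      unfold kappa1 kappa2 at h1; unfold lowIdx; omega
    rw [mixFrame_apply_high hσ hr hl t (not_le.1 h5).le, if_neg (not_le.1 h5).ne]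

/-- The coefficients are admissible. -/
theorem admissibleZeta_mixFrame (hm : m ≤ n + 1) (hσ : σ.Pairwise (flowBefore n m))
    (hr : ∀ r, r ∈ σ) (U : Set (Fin n → ℝ)) :
    AdmissibleZeta m U fun r j t => mixFrame m σ r t j where
  smooth r j := ((contDiff_apply ℝ ℝ j).comp (contDiff_adjFrame σ r)).contDiffOn
  diag r t _ := by
    by_cases hl : lowIdx n m (r + 1)
    · rw [mixFrame_apply_low hσ (hr r) hl t le_rfl, if_pos rfl]
    · rw [mixFrame_apply_high hσ (hr r) hl t le_rfl, if_pos rfl]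
  lower r j h _ t _ t' _ ht :=
    congrFun (mixFrame_congr_low hσ (hr r) (Or.inr (by omega)) ht) j
  upper r j h _ t _ t' _ ht := by
    -- For `m = n + 1` the first index exceeds `n + 1 - m` and still counts as being of the first
    -- kind. It has no predecessors, so its frame vector is constant.
    by_cases hl : lowIdx n m (r + 1)
    · refine congrFun (mixFrame_congr_low hσ (hr r) hl fun k hk => ?_) j
      have := Fin.lt_def.1 hk
      unfold lowIdx at hl; omega
    · exact congrFun (mixFrame_congr_high hσ (hr r) hl ht) j

/-- There are coefficients for which all initial values of the parameters extend to solutions of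
the classical Frobenius condition. -/
theorem exists_classicalFrobenius (hn : 0 < n) (hm : m ≤ n + 1) :
    ∃ ζ : Fin n → Fin n → (Fin n → ℝ) → ℝ, AdmissibleZeta m Set.univ ζ ∧
      ∀ b : Fin (n + 2) → ℝ, ∃ d : Fin (n + 2) → (Fin n → ℝ) → ℝ,
        (∀ γ, ContDiff ℝ ∞ (d γ)) ∧ (∀ γ, d γ 0 = b γ) ∧ ClassicalFrobenius m Set.univ ζ d := by
  obtain ⟨σ, hσ, hmem, hpw⟩ := exists_flow_list n m
  refine ⟨fun r j t => mixFrame m σ r t j, admissibleZeta_mixFrame hm hpw hmem _, fun b => ?_⟩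
  let N := (lieRep n m).toContinuousBilinearMap
  have hN : ∀ x y v, N ((lieBr n m).toContinuousBilinearMap x y) v
      = N x (N y v) - N y (N x v) := lieRep_bracket hm
  have hinj : Function.Injective N := fun x y h => lieRep_injective hm
    (LinearMap.ext fun v => congrArg (fun B => B v) h)
  -- All flows are the identity at time zero, so the orbit starts at `b`. The frame is built without
  -- `b` and serves all initial values.
  let D := orbit N (fun k : Fin n => unitE n (k + 1)) b σ
  have hD : ContDiff ℝ ∞ D := contDiff_orbit b σ
  refine ⟨fun γ t => D t γ, fun γ => (contDiff_apply ℝ ℝ γ).comp hD,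
    fun γ => congrFun (orbit_zero b σ) γ, ?_⟩
  exact classicalFrobenius_of_flat hn hm _ (Z := mixFrame m σ) (D := D)
    (fun r => contDiff_adjFrame σ r) hD (fun r j t => mix_mixFrame hm hpw (hmem r) j t)
    (fun _ _ => rfl) (fun r t => pderiv_orbit hN hσ (hmem r) b t)
    (fun r s t => adjFrame_flat hN hinj hσ (hmem r) (hmem s) t)

end Solution

end QuasiStackel

end

theorem theorem3 (n m : ℕ) (hn : 0 < n) (hm : m ≤ n + 1) (ħ : ℝ) (hħ : 0 < ħ) :
    (∃ ζ : Fin n → Fin n → (Fin n → ℝ) → ℝ,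
      QuasiStackel.AdmissibleZeta m Set.univ ζ ∧
      ∀ b : Fin (n + 2) → ℝ, ∃ d : Fin (n + 2) → (Fin n → ℝ) → ℝ,
        (∀ γ, ContDiff ℝ ∞ (d γ)) ∧ (∀ γ, d γ 0 = b γ) ∧
        QuasiStackel.ClassicalFrobenius m Set.univ ζ d) ∧
    (∀ (U : Set (Fin n → ℝ)), IsOpen U →
      ∀ (ζ : Fin n → Fin n → (Fin n → ℝ) → ℝ) (d : Fin (n + 2) → (Fin n → ℝ) → ℝ),
        QuasiStackel.AdmissibleZeta m U ζ →
        (∀ γ, ContDiffOn ℝ ∞ (d γ) U) →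
        QuasiStackel.ClassicalFrobenius m U ζ d →
        QuasiStackel.QuantumFrobenius m ħ U ζ d) :=
  ⟨QuasiStackel.exists_classicalFrobenius hn hm, fun _ hU _ _ hζ hd h =>
    QuasiStackel.quantumFrobenius_of_classicalFrobenius hn hm ħ hU hζ hd h⟩
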